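/- **Setting.** Let $d\ge 1$, let $\langle\nabla\rangle^s=(1-\Delta)^{s/2}$, and for $1\le r\le\infty$ let $W^{s,r}=W^{s,r}(\mathbb R^d)$ be the space of tempered distributions $u$ with $\|u\|_{W^{s,r}}=\|\langle\nabla\rangle^s u\|_{L^r}<\infty$; $H^s=W^{s,2}$. Let $S(t)=e^{-it\Delta}$, let $(e_n)_{n\in\mathbb N}$ be an orthonormal basis of $L^2(\mathbb R^d)$ and let $(\beta_n)_{n\in\mathbb N}$ be mutually independent complex-valued Brownian motions on a probability space $\Omega$ (each $\beta_n=(B_n^1+iB_n^2)/\sqrt2$ with independent standard real Brownian motions $B_n^1,B_n^2$). For $s\in\mathbb R$ and a Hilbert–Schmidt operator $\phi\in HS(L^2;H^s)$, with norm $\|\phi\|_{HS(L^2;H^s)}=(\sum_n\|\phi(e_n)\|_{H^s}^2)^{1/2}$, the stochastic convolution is $$\Psi(t)=-i\sum_{n\in\mathbb N}\int_0^t S(t-t')\,\phi(e_n)\,d\beta_n(t'),\qquad t\ge0,$$ where the integrals are Wiener integrals and, for each $t$, the series converges in $L^2(\Omega;H^s)$; thus $\Psi(t)$ is determined almost surely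 for each $t$. **Lemma 2.1.** Let $s\in\mathbb R$ and $\phi\in HS(L^2;H^s)$. Then the stochastic convolution $\Psi$ exists, and: (i) $\Psi$ has a modification whose paths almost surely lie in $C(\mathbb R_+;H^s(\mathbb R^d))$. (ii) Let $\Psi$ denote any version of the stochastic convolution with almost surely continuous paths in $H^s$. Almost surely, $\Psi\in L^q([0,T];W^{s,r}(\mathbb R^d))$ for all $T>0$, all $1\le q<\infty$ and all finite $r\ge2$ such that $r\le\frac{2d}{d-2}$ when $d\ge3$. Moreover, for all such $q$ and $r$ there is $\theta=\theta(d,q,r)>0$, and for every $1\le\rho<\infty$ there is a constant $C=C(d,q,r,\rho)$, such that for all $T>0$, all $s\in\mathbb R$ and all $\phi\in HS(L^2;H^s)$ the quantity $\|\Psi\|_{L^q([0,T];W^{s,r})}$ is a random variable and $$\Big\|\,\|\Psi\|_{L^q([0,T];W^{s,r})}\Big\|_{L^\rho(\Omega)}\le C\,T^{\theta}\,\|\phi\|_{HS(L^2;H^s)}.$$ -/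

import Mathlib

open MeasureTheory ProbabilityTheory Filter Topology
open scoped NNReal ENNReal SchwartzMap FourierTransform

namespace SNLS

noncomputable section

/-- The space `ℝ^d` with its Euclidean norm. -/
abbrev Rd (d : ℕ) : Type := EuclideanSpace ℝ (Fin d)

/-- The complex Lebesgue space `L^p(ℝ^d)`. -/
abbrev LpRd (d : ℕ) (p : ℝ≥0∞) : Type := ↥(Lp ℂ p (volume : Measure (Rd d)))

/-! ### Fourier multipliers: Bessel potentials and the Schrödinger group

Mathlib's Fourier transform is `𝓕 f ξ = ∫ e^{-2πi x·ξ} f(x) dx`, so that `-Δ` is the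
Fourier multiplier with symbol `|2πξ|²`. -/

/-- The symbol `(1 + |2πξ|²)^{s/2}` of `⟨∇⟩^s = (1 - Δ)^{s/2}`. -/
def besselSymbol (d : ℕ) (s : ℝ) (ξ : Rd d) : ℂ :=
  (((1 + ‖(2 * Real.pi) • ξ‖ ^ 2) ^ (s / 2) : ℝ) : ℂ)

/-- The symbol `e^{i t |2πξ|²}` of `S(t) = e^{-itΔ}`. -/
def schrodingerSymbol (d : ℕ) (t : ℝ) (ξ : Rd d) : ℂ :=
  Complex.exp (((t * ‖(2 * Real.pi) • ξ‖ ^ 2 : ℝ) : ℂ) * Complex.I)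

theorem besselSymbol_hasTemperateGrowth (d : ℕ) (s : ℝ) :
    (besselSymbol d s).HasTemperateGrowth := by
  have h1 : (fun x : Rd d => ((1 + ‖x‖ ^ 2) ^ (s / 2) : ℝ)).HasTemperateGrowth :=
    Function.hasTemperateGrowth_one_add_norm_sq_rpow (Rd d) (s / 2)
  have h2 : (fun ξ : Rd d => (2 * Real.pi) • ξ).HasTemperateGrowth := by fun_prop
  exact Function.Complex.hasTemperateGrowth_ofReal.comp (h1.comp h2)

theorem cexp_hasTemperateGrowth :
    (fun x : ℝ => Complex.exp ((x : ℂ) * Complex.I)).HasTemperateGrowth := by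
  have hd : ∀ (n : ℕ), iteratedDeriv n (fun x : ℝ => Complex.exp ((x : ℂ) * Complex.I)) =
      fun x : ℝ => Complex.I ^ n * Complex.exp ((x : ℂ) * Complex.I) := by
    intro n
    induction n with
    | zero => simp
    | succ n ih =>
      rw [iteratedDeriv_succ, ih]
      funext x
      have h0 : HasDerivAt (fun x : ℝ => (x : ℂ) * Complex.I) (1 * Complex.I) x :=
        (Complex.ofRealCLM.hasDerivAt (x := x)).mul_const Complex.I
      have h := (h0.cexp).const_mul (Complex.I ^ n)
      rw [h.deriv]
      ring
  refine ⟨?_, fun n => ⟨0, 1, fun x => ?_⟩⟩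
  · exact (Complex.ofRealCLM.contDiff.mul contDiff_const).cexp
  · rw [norm_iteratedFDeriv_eq_norm_iteratedDeriv, hd n]
    simp [Complex.norm_exp_ofReal_mul_I]

theorem schrodingerSymbol_hasTemperateGrowth (d : ℕ) (t : ℝ) :
    (schrodingerSymbol d t).HasTemperateGrowth := by
  have h2 : (fun ξ : Rd d => (2 * Real.pi) • ξ).HasTemperateGrowth := by fun_prop
  have h3 : (fun ξ : Rd d => ‖(2 * Real.pi) • ξ‖ ^ 2).HasTemperateGrowth :=
    (Function.hasTemperateGrowth_norm_sq (H := Rd d)).comp h2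
  have h4 : (fun ξ : Rd d => t * ‖(2 * Real.pi) • ξ‖ ^ 2).HasTemperateGrowth := by fun_prop
  exact cexp_hasTemperateGrowth.comp h4

theorem norm_schrodingerSymbol (d : ℕ) (t : ℝ) (ξ : Rd d) : ‖schrodingerSymbol d t ξ‖ = 1 :=
  Complex.norm_exp_ofReal_mul_I _

/-- The operator `⟨∇⟩^s = (1 - Δ)^{s/2}` on tempered distributions. -/
def bessel (d : ℕ) (s : ℝ) : 𝓢'(Rd d, ℂ) →L[ℂ] 𝓢'(Rd d, ℂ) :=
  TemperedDistribution.fourierMultiplierCLM ℂ (besselSymbol d s)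

/-- The Schrödinger propagator `S(t) = e^{-itΔ}` on tempered distributions. -/
def schrodingerDist (d : ℕ) (t : ℝ) : 𝓢'(Rd d, ℂ) →L[ℂ] 𝓢'(Rd d, ℂ) :=
  TemperedDistribution.fourierMultiplierCLM ℂ (schrodingerSymbol d t)

theorem bessel_bessel (d : ℕ) (s s' : ℝ) (u : 𝓢'(Rd d, ℂ)) :
    bessel d s' (bessel d s u) = bessel d (s + s') u := by
  simp only [bessel]
  rw [TemperedDistribution.fourierMultiplierCLM_fourierMultiplierCLM_apply
    (besselSymbol_hasTemperateGrowth d s) (besselSymbol_hasTemperateGrowth d s')]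
  congr 2
  ext ξ
  simp only [Pi.mul_apply, besselSymbol]
  rw [← Complex.ofReal_mul, ← Real.rpow_add (by positivity), add_div]

theorem bessel_zero (d : ℕ) (u : 𝓢'(Rd d, ℂ)) : bessel d 0 u = u := by
  have : besselSymbol d 0 = fun _ => (1 : ℂ) := by
    ext ξ; simp [besselSymbol]
  simp [bessel, this]

theorem bessel_injective (d : ℕ) (s : ℝ) : Function.Injective (bessel d s) := by
  intro u v h
  have h' := congrArg (bessel d (-s)) h
  rwa [bessel_bessel, bessel_bessel, add_neg_cancel, bessel_zero, bessel_zero] at h'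

theorem bessel_schrodingerDist (d : ℕ) (s t : ℝ) (u : 𝓢'(Rd d, ℂ)) :
    bessel d s (schrodingerDist d t u) = schrodingerDist d t (bessel d s u) := by
  simp only [bessel, schrodingerDist]
  rw [TemperedDistribution.fourierMultiplierCLM_fourierMultiplierCLM_apply
    (besselSymbol_hasTemperateGrowth d s) (schrodingerSymbol_hasTemperateGrowth d t),
    TemperedDistribution.fourierMultiplierCLM_fourierMultiplierCLM_apply
    (schrodingerSymbol_hasTemperateGrowth d t) (besselSymbol_hasTemperateGrowth d s), mul_comm]

/-! ### The Bessel potential spaces `W^{s,p}(ℝ^d)` -/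

/-- The tempered distributions `u` with `⟨∇⟩^s u ∈ L^p`. -/
def sobolevSubmodule (d : ℕ) (s : ℝ) (p : ℝ≥0∞) [Fact (1 ≤ p)] :
    Submodule ℂ 𝓢'(Rd d, ℂ) where
  carrier := {u | ∃ f : LpRd d p, bessel d s u = (f : 𝓢'(Rd d, ℂ))}
  add_mem' := by
    rintro u v ⟨f, hf⟩ ⟨g, hg⟩
    refine ⟨f + g, ?_⟩
    rw [← Lp.toTemperedDistributionCLM_apply, map_add, map_add, hf, hg]
    rfl
  zero_mem' := by
    refine ⟨0, ?_⟩
    rw [← Lp.toTemperedDistributionCLM_apply, map_zero, map_zero]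
  smul_mem' := by
    rintro c u ⟨f, hf⟩
    refine ⟨c • f, ?_⟩
    rw [← Lp.toTemperedDistributionCLM_apply, map_smul, map_smul, hf]
    rfl

/-- The Sobolev space `W^{s,p}(ℝ^d)` of the tempered distributions `u` with `⟨∇⟩^s u ∈ L^p`; it is
a type of its own, so that it carries the Sobolev norm and not the topology of `𝓢'`. -/
def WSob (d : ℕ) (s : ℝ) (p : ℝ≥0∞) [Fact (1 ≤ p)] : Type := ↥(sobolevSubmodule d s p)

/-- The Sobolev space `H^s(ℝ^d) = W^{s,2}(ℝ^d)`. -/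
abbrev HSob (d : ℕ) (s : ℝ) : Type := WSob d s 2

namespace WSob

variable {d : ℕ} {s : ℝ} {p : ℝ≥0∞} [Fact (1 ≤ p)]

instance : AddCommGroup (WSob d s p) := inferInstanceAs (AddCommGroup (sobolevSubmodule d s p))

instance : Module ℂ (WSob d s p) := inferInstanceAs (Module ℂ (sobolevSubmodule d s p))

/-- The tempered distribution underlying an element of `W^{s,p}`. -/
def toDist : WSob d s p →ₗ[ℂ] 𝓢'(Rd d, ℂ) := (sobolevSubmodule d s p).subtype

theorem toDist_injective : Function.Injective (toDist : WSob d s p → 𝓢'(Rd d, ℂ)) :=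
  Subtype.val_injective

theorem exists_toLp (u : WSob d s p) :
    ∃ f : LpRd d p, bessel d s (toDist u) = (f : 𝓢'(Rd d, ℂ)) := u.2

theorem coe_Lp_injective :
    Function.Injective (fun f : LpRd d p => (f : 𝓢'(Rd d, ℂ))) := by
  have h := Lp.ker_toTemperedDistributionCLM_eq_bot (E := Rd d) (F := ℂ) (μ := volume) (p := p)
  exact LinearMap.ker_eq_bot.1 h

/-- The function `⟨∇⟩^s u ∈ L^p` of an element `u` of `W^{s,p}`. -/
def toLp : WSob d s p →ₗ[ℂ] LpRd d p where
  toFun u := (exists_toLp u).choose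
  map_add' u v := by
    apply coe_Lp_injective
    have h : bessel d s (toDist (u + v)) = bessel d s (toDist u) + bessel d s (toDist v) := by
      rw [map_add, map_add]
    rw [(exists_toLp (u + v)).choose_spec, (exists_toLp u).choose_spec,
      (exists_toLp v).choose_spec] at h
    simp only
    rw [h, ← Lp.toTemperedDistributionCLM_apply, ← Lp.toTemperedDistributionCLM_apply,
      ← Lp.toTemperedDistributionCLM_apply, map_add]
  map_smul' c u := by
    apply coe_Lp_injective
    have h : bessel d s (toDist (c • u)) = c • bessel d s (toDist u) := by
      rw [map_smul, map_smul]
    rw [(exists_toLp (c • u)).choose_spec, (exists_toLp u).choose_spec] at h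
    simp only [RingHom.id_apply]
    rw [h, ← Lp.toTemperedDistributionCLM_apply, ← Lp.toTemperedDistributionCLM_apply, map_smul]

theorem toLp_spec (u : WSob d s p) :
    bessel d s (toDist u) = ((toLp u : LpRd d p) : 𝓢'(Rd d, ℂ)) := (exists_toLp u).choose_spec

theorem toLp_injective : Function.Injective (toLp : WSob d s p → LpRd d p) := by
  intro u v h
  apply toDist_injective
  apply bessel_injective d s
  rw [toLp_spec, toLp_spec, h]

/-- The norm `‖u‖_{W^{s,p}} = ‖⟨∇⟩^s u‖_{L^p}`. -/
instance : NormedAddCommGroup (WSob d s p) :=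
  NormedAddCommGroup.induced (WSob d s p) (LpRd d p) toLp toLp_injective

instance : NormedSpace ℂ (WSob d s p) := NormedSpace.induced ℂ (WSob d s p) (LpRd d p) toLp

theorem norm_eq (u : WSob d s p) : ‖u‖ = ‖toLp u‖ := rfl

end WSob

/-- `S(t)` preserves `H^s`. -/
theorem schrodingerDist_mem (d : ℕ) (s t : ℝ) (u : HSob d s) :
    schrodingerDist d t (WSob.toDist u) ∈ sobolevSubmodule d s 2 := by
  change ∃ f : LpRd d 2, _
  rw [bessel_schrodingerDist, WSob.toLp_spec]
  set f : LpRd d 2 := WSob.toLp u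
  have h0 : TemperedDistribution.MemSobolev 0 2 (f : 𝓢'(Rd d, ℂ)) :=
    TemperedDistribution.memSobolev_zero_iff.2 ⟨f, rfl⟩
  have h1 := h0.fourierMultiplierCLM_of_bounded (schrodingerSymbol_hasTemperateGrowth d t)
    ⟨1, fun ξ => (norm_schrodingerSymbol d t ξ).le⟩
  exact TemperedDistribution.memSobolev_zero_iff.1 h1

/-- The Schrödinger propagator `S(t) = e^{-itΔ}` on `H^s(ℝ^d)`. -/
def schrodinger (d : ℕ) (s t : ℝ) : HSob d s →ₗ[ℂ] HSob d s :=
  LinearMap.codRestrict (sobolevSubmodule d s 2)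
    ((schrodingerDist d t : 𝓢'(Rd d, ℂ) →ₗ[ℂ] 𝓢'(Rd d, ℂ)) ∘ₗ WSob.toDist)
    (schrodingerDist_mem d s t)

theorem toDist_schrodinger (d : ℕ) (s t : ℝ) (u : HSob d s) :
    WSob.toDist (schrodinger d s t u) = schrodingerDist d t (WSob.toDist u) := rfl

/-! ### Hilbert-Schmidt norms -/

/-- The Hilbert-Schmidt norm `(∑ₙ ‖T eₙ‖²)^{1/2} ∈ [0, ∞]` of an operator `T`, computed in an
orthonormal basis `e` of its domain; `T` is a Hilbert-Schmidt operator iff it is finite (the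
value does not depend on the basis when the target is a Hilbert space). -/
def hsNorm {H K : Type*} [NormedAddCommGroup H] [InnerProductSpace ℂ H]
    [NormedAddCommGroup K] [NormedSpace ℂ K] (e : HilbertBasis ℕ ℂ H) (T : H →L[ℂ] K) : ℝ≥0∞ :=
  (∑' n, ‖T (e n)‖ₑ ^ 2) ^ (1 / 2 : ℝ)

/-! ### Complex Brownian motions and Wiener integrals -/

/-- `β` is a standard complex Brownian motion: `β = (B₁ + i B₂) / √2` with two independent
standard real Brownian motions, so that `𝔼 |β(t)|² = t`. -/
structure IsComplexBrownian {Ω : Type*} [MeasurableSpace Ω] (P : Measure Ω)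
    (β : ℝ≥0 → Ω → ℂ) : Prop where
  re : IsBrownianReal (fun t ω => √2 * (β t ω).re) P
  im : IsBrownianReal (fun t ω => √2 * (β t ω).im) P
  indep : IndepFun (fun ω (t : ℝ≥0) => (β t ω).re) (fun ω (t : ℝ≥0) => (β t ω).im) P

/-- The coefficients of a cylindrical Wiener process `W(t) = ∑ₙ βₙ(t) eₙ`: a family of mutually
independent complex Brownian motions. -/
structure IsBrownianFamily {Ω : Type*} [MeasurableSpace Ω] (P : Measure Ω)
    (β : ℕ → ℝ≥0 → Ω → ℂ) : Prop where
  brownian : ∀ n, IsComplexBrownian P (β n)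
  indep : iIndepFun (fun n ω (t : ℝ≥0) => β n t ω) P

/-- The step function `∑_{j<m} 1_{(τⱼ, τⱼ₊₁]} hⱼ`. -/
def stepFun {H : Type*} [AddCommGroup H] (m : ℕ) (τ : ℕ → ℝ≥0) (h : ℕ → H) (x : ℝ≥0) : H :=
  ∑ j ∈ Finset.range m, (Set.Ioc (τ j) (τ (j + 1))).indicator (fun _ => h j) x

/-- The Wiener integral `∑_{j<m} (β(τⱼ₊₁) - β(τⱼ)) hⱼ` of a step function. -/
def stepIntegral {Ω H : Type*} [AddCommGroup H] [Module ℂ H] (β : ℝ≥0 → Ω → ℂ)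
    (m : ℕ) (τ : ℕ → ℝ≥0) (h : ℕ → H) (ω : Ω) : H :=
  ∑ j ∈ Finset.range m, (β (τ (j + 1)) ω - β (τ j) ω) • h j

/-- Lebesgue measure on the time interval `[0,T] ⊆ ℝ_+`. -/
def leb (T : ℝ≥0) : Measure ℝ≥0 :=
  (Measure.comap ((↑) : ℝ≥0 → ℝ) volume).restrict (Set.Icc 0 T)

/-- `I` is (a version of) the Wiener integral `∫_0^t f(t') dβ(t')` of `f ∈ L²([0,t]; H)`: it is the
limit in `L²(Ω; H)` of the integrals of step functions on `[0,t]` that converge to `f` in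
`L²([0,t]; H)`. -/
def IsWienerIntegral {Ω H : Type*} [MeasurableSpace Ω] [NormedAddCommGroup H] [NormedSpace ℂ H]
    (P : Measure Ω) (β : ℝ≥0 → Ω → ℂ) (f : ℝ≥0 → H) (t : ℝ≥0) (I : Ω → H) : Prop :=
  MemLp f 2 (leb t) ∧ MemLp I 2 P ∧
  ∃ (m : ℕ → ℕ) (τ : ℕ → ℕ → ℝ≥0) (h : ℕ → ℕ → H),
    (∀ k, Monotone (τ k)) ∧ (∀ k j, τ k j ≤ t) ∧
    Tendsto (fun k => eLpNorm (fun x => f x - stepFun (m k) (τ k) (h k) x) 2 (leb t)) atTop (𝓝 0) ∧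
    Tendsto (fun k => eLpNorm (fun ω => I ω - stepIntegral β (m k) (τ k) (h k) ω) 2 P)
      atTop (𝓝 0)

/-- The process `Ψ` is (a version of) the stochastic convolution
`Ψ(t) = -i ∑ₙ ∫_0^t S(t - t') φ(eₙ) dβₙ(t')`, with the series converging in `L²(Ω; H^s)` for every
`t ≥ 0`. -/
def IsStochasticConvolution {Ω : Type*} [MeasurableSpace Ω] {d : ℕ} {s : ℝ}
    (P : Measure Ω) (e : HilbertBasis ℕ ℂ (LpRd d 2)) (β : ℕ → ℝ≥0 → Ω → ℂ)
    (φ : LpRd d 2 →L[ℂ] HSob d s) (Ψ : ℝ≥0 → Ω → HSob d s) : Prop :=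
  ∃ I : ℕ → ℝ≥0 → Ω → HSob d s,
    (∀ (n : ℕ) (t : ℝ≥0), IsWienerIntegral P (β n)
      (fun t' => schrodinger d s ((t : ℝ) - (t' : ℝ)) (φ (e n))) t (I n t)) ∧
    ∀ t : ℝ≥0, MemLp (Ψ t) 2 P ∧
      Tendsto (fun N => eLpNorm
        (fun ω => Ψ t ω - ∑ n ∈ Finset.range N, (-Complex.I) • I n t ω) 2 P) atTop (𝓝 0)

/-! ### The spaces `L^q([0,T]; W^{s,r})` -/

/-- The norm `‖u‖_{W^{s,r}} ∈ [0, ∞]` of a tempered distribution, infinite outside `W^{s,r}`. -/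
def sobolevENorm {d : ℕ} (s : ℝ) (r : ℝ≥0∞) [Fact (1 ≤ r)] (u : 𝓢'(Rd d, ℂ)) : ℝ≥0∞ :=
  ⨅ (v : WSob d s r) (_ : WSob.toDist v = u), ‖v‖ₑ

/-- The norm `‖u‖_{L^q([0,T]; W^{s,r})} ∈ [0, ∞]` of a function of time. -/
def LqWNorm {d : ℕ} (s : ℝ) (q r : ℝ≥0∞) [Fact (1 ≤ r)] (T : ℝ≥0)
    (u : ℝ≥0 → 𝓢'(Rd d, ℂ)) : ℝ≥0∞ :=
  eLpNorm (fun t => sobolevENorm s r (u t)) q (leb T)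

/-- `u ∈ L^q([0,T]; W^{s,r})`: for almost every `t ∈ [0,T]`, `u(t)` agrees with `v(t)`, where
`v : [0,T] → W^{s,r}` is strongly measurable with `q`-integrable norm. -/
def MemLqW {d : ℕ} (s : ℝ) (q r : ℝ≥0∞) [Fact (1 ≤ r)] (T : ℝ≥0)
    (u : ℝ≥0 → 𝓢'(Rd d, ℂ)) : Prop :=
  ∃ v : ℝ≥0 → WSob d s r, MemLp v q (leb T) ∧
    ∀ᵐ t ∂(leb T), WSob.toDist (v t) = u t

/-- The range of spatial integrability exponents: finite `r ≥ 2` with `r ≤ 2d/(d-2)` if `d ≥ 3`. -/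
def AdmissibleExponent (d : ℕ) (r : ℝ≥0) : Prop :=
  2 ≤ r ∧ (3 ≤ d → (r : ℝ) ≤ 2 * d / ((d : ℝ) - 2))

end

end SNLS

/-!
The mode sum and the time integral of a stochastic convolution are treated as one Wiener integral
over `ℕ × ℝ_+`: integrands `F ∈ L²(ℕ × ℝ_+; H)` and their integrals `Y ∈ L²(Ω; H)` form the closed
graph generated by the pairs `(1_{n} × 1_{(0,b]} h, βₙ(b) h)`. Independence and the covariance of
Brownian motion make this graph isometric (`itoGraph_norm_eq`), so Cauchy sequences of integrands
have integrals (`IsItoPair.exists_limit`), which gives the existence of `Ψ`. The scalar elements of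
the graph are limits of Gaussian variables, so all their moments are bounded by the second one
(`IsItoPair.eLpNorm_le`). The isometry `⟨∇⟩^s : W^{s,r} → L^r` commutes with `S(t)`, and reduces
everything to `s = 0`; the `W^{s,r}` norm of `Ψ(t)` is then the `L^r` norm of an element of `L²`,
`+∞` allowed.

*Continuity.* `S(-t)Ψ(t)` has increments of size `|t - s|^{1/2}` in `L²(Ω)`
(`eLpNorm_sub_convIntegrand`), hence in `L⁴(Ω)`, and Kolmogorov's criterion
(`exists_continuous_modification`) applies to it; `S` is strongly continuous.

*Integrability.* At a fixed time, Minkowski's inequality and the Gaussian moments reduce the moments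
of `‖Ψ(t)‖_{L^r}` to the `L^{r/2}` norm in `x` of the variance
`D(x) = ∑ₙ ∫_0^t |S(τ) fₙ(x)|² dτ` (`IsItoPair.eLpNorm_eLpNorm_le`). Point values make sense after
a cutoff to bounded frequencies, which is removed at the end by Fatou's lemma and the lower
semicontinuity of `L^r` norms. By duality, `‖D‖_{L^{r/2}}` is bounded once
`∫_0^t ∫ u^θ |S(τ)f|² dx dτ ≤ C t^{1-dθ/2} (∫ u)^θ ‖f‖²` for weights `u ≥ 0`, with `θ = 1 - 2/r`
(`exists_weighted_strichartz`); the condition `r ≤ 2d/(d-2)` is `dθ ≤ 2`.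

The endpoint `dθ = 2` is included, and the estimate is proved for all `θ` at once, by the `TT*`
argument and complex interpolation. The form
`∬ κ(t - s) ⟨S(t - s) u^{θ/2} F(s), u^{θ/2} F(t)⟩ ds dt` with `κ = 1` on `(ε, T]` is embedded
in an analytic family with kernel `τ^{-dθ/2 + ζd/2}` and weights `u^{ζ/2}`. For `Re ζ = 0` it is
bounded on the frequency side by Plancherel's theorem in time; for `Re ζ = 1` the factor
`τ^{d/2}` cancels the decay of the kernel of `S(τ)`, and it is bounded on the physical side in
the same way for each pair of points. Both bounds rest on the uniform estimate
`|∫_ε^T τ^{-1+δ+iη} e^{i(ατ + γ/τ)} dτ| ≤ C T^δ (1 + |η| + 1/|η|)`, `δ = 1 - dθ/2`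
(`exists_norm_integral_powFactor_le`), which at `δ = 0` is a van der Corput estimate in the variable
`log τ`; the three lines theorem tolerates the singularity at `η = 0`
(`norm_le_of_three_lines_singular`).
-/

namespace SNLS

noncomputable section

/-! ### A uniform bound for oscillatory integrals -/

/-- The phase factor `e^{i(ηu + αe^u + γe^{-u})}`. -/
def oscFactor (η α γ u : ℝ) : ℂ :=
  Complex.exp (((η * u + α * Real.exp u + γ * Real.exp (-u) : ℝ) : ℂ) * Complex.I)

theorem norm_oscFactor (η α γ u : ℝ) : ‖oscFactor η α γ u‖ = 1 :=
  Complex.norm_exp_ofReal_mul_I _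

theorem continuous_oscFactor (η α γ : ℝ) : Continuous (oscFactor η α γ) := by
  unfold oscFactor; fun_prop

theorem norm_integral_oscFactor_le_length (η α γ : ℝ) {c d : ℝ} (h : c ≤ d) :
    ‖∫ u in c..d, oscFactor η α γ u‖ ≤ d - c := by
  have := intervalIntegral.norm_integral_le_of_norm_le_const (a := c) (b := d) (C := 1)
    (f := oscFactor η α γ) (fun u _ => (norm_oscFactor η α γ u).le)
  rwa [one_mul, abs_of_nonneg (by linarith)] at this

/-- The derivative `αe^u - γe^{-u}` of the phase is at least `|α|e^u / 2` in size here, and the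
bound comes from an integration by parts, with `e^{iηu}` as part of the amplitude. -/
theorem norm_integral_oscFactor_le_of_dominant (η α γ : ℝ) {c d : ℝ} (hcd : c ≤ d)
    (h1 : 1 ≤ |α| * Real.exp c) (h2 : 4 * (|γ| * Real.exp (-c)) ≤ |α| * Real.exp c) :
    ‖∫ u in c..d, oscFactor η α γ u‖ ≤ 12 + 2 * |η| := by
  set x : ℝ → ℝ := fun u => |α| * Real.exp u with hx
  have hxlow : ∀ u, c ≤ u → Real.exp (u - c) ≤ x u := by
    intro u hu
    have : x u = (|α| * Real.exp c) * Real.exp (u - c) := by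
      simp only [hx]; rw [mul_assoc, ← Real.exp_add]; ring_nf
    rw [this]
    nlinarith [Real.exp_pos (u - c)]
  have hxpos : ∀ u, c ≤ u → 0 < x u := fun u hu => (Real.exp_pos _).trans_le (hxlow u hu)
  have hg : ∀ u, c ≤ u → 4 * (|γ| * Real.exp (-u)) ≤ x u := by
    intro u hu
    have e1 : Real.exp (-u) ≤ Real.exp (-c) := Real.exp_le_exp.2 (by linarith)
    have e2 : Real.exp c ≤ Real.exp u := Real.exp_le_exp.2 hu
    calc 4 * (|γ| * Real.exp (-u)) ≤ 4 * (|γ| * Real.exp (-c)) := by gcongr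
      _ ≤ |α| * Real.exp c := h2
      _ ≤ x u := by simp only [hx]; gcongr
  set p : ℝ → ℝ := fun u => α * Real.exp u - γ * Real.exp (-u) with hp
  set p' : ℝ → ℝ := fun u => α * Real.exp u + γ * Real.exp (-u) with hp'
  have hae : ∀ u, |α * Real.exp u| = x u := fun u => by
    simp only [hx]; rw [abs_mul, abs_of_pos (Real.exp_pos u)]
  have hge : ∀ u, |γ * Real.exp (-u)| = |γ| * Real.exp (-u) := fun u => by
    rw [abs_mul, abs_of_pos (Real.exp_pos (-u))]
  have hplow : ∀ u, c ≤ u → x u / 2 ≤ |p u| := by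
    intro u hu
    have : |α * Real.exp u| - |γ * Real.exp (-u)| ≤ |p u| := abs_sub_abs_le_abs_sub _ _
    rw [hae, hge] at this
    have h3 := hg u hu
    have h4 := hxpos u hu
    linarith
  have hp'up : ∀ u, c ≤ u → |p' u| ≤ 2 * x u := by
    intro u hu
    have : |p' u| ≤ |α * Real.exp u| + |γ * Real.exp (-u)| := abs_add_le _ _
    rw [hae, hge] at this
    have h3 := hg u hu
    have h4 := hxpos u hu
    linarith
  have hpne : ∀ u, c ≤ u → p u ≠ 0 := by
    intro u hu h0
    have := hplow u hu
    rw [h0, abs_zero] at this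
    linarith [hxpos u hu]
  have hpd : ∀ u, HasDerivAt p (p' u) u := by
    intro u
    have e1 := (Real.hasDerivAt_exp u).const_mul α
    have e2 := ((Real.hasDerivAt_exp (-u)).comp u (hasDerivAt_neg u)).const_mul γ
    refine (e1.sub e2).congr_deriv ?_
    change _ = α * Real.exp u + γ * Real.exp (-u)
    ring
  have hp'c : Continuous p' := by simp only [hp']; fun_prop
  have hpc : Continuous p := by simp only [hp]; fun_prop
  set v : ℝ → ℂ := fun u =>
    Complex.exp (((α * Real.exp u + γ * Real.exp (-u) : ℝ) : ℂ) * Complex.I) with hv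
  have hvn : ∀ u, ‖v u‖ = 1 := fun u => Complex.norm_exp_ofReal_mul_I _
  have hvd : ∀ u, HasDerivAt v (((p u : ℝ) : ℂ) * Complex.I * v u) u := by
    intro u
    have e1 := (Real.hasDerivAt_exp u).const_mul α
    have e2 := ((Real.hasDerivAt_exp (-u)).comp u (hasDerivAt_neg u)).const_mul γ
    have e3 := ((e1.add e2).ofReal_comp.mul_const Complex.I).cexp
    refine e3.congr_deriv ?_
    change Complex.exp (((α * Real.exp u + γ * Real.exp (-u) : ℝ) : ℂ) * Complex.I) * _ =
      ((α * Real.exp u - γ * Real.exp (-u) : ℝ) : ℂ) * Complex.I *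
        Complex.exp (((α * Real.exp u + γ * Real.exp (-u) : ℝ) : ℂ) * Complex.I)
    push_cast; ring
  set E : ℝ → ℂ := fun u => Complex.exp (((η * u : ℝ) : ℂ) * Complex.I) with hE
  have hEn : ∀ u, ‖E u‖ = 1 := fun u => Complex.norm_exp_ofReal_mul_I _
  have hEd : ∀ u, HasDerivAt E (((η : ℝ) : ℂ) * Complex.I * E u) u := by
    intro u
    have e1 := (hasDerivAt_id u).const_mul η
    have e3 := (e1.ofReal_comp.mul_const Complex.I).cexp
    refine e3.congr_deriv ?_
    change Complex.exp (((η * u : ℝ) : ℂ) * Complex.I) * _ =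
      (η : ℂ) * Complex.I * Complex.exp (((η * u : ℝ) : ℂ) * Complex.I)
    push_cast; ring
  set w : ℝ → ℂ := fun u => E u / (((p u : ℝ) : ℂ) * Complex.I) with hw
  set w' : ℝ → ℂ := fun u =>
    (((η : ℝ) : ℂ) * Complex.I * E u * (((p u : ℝ) : ℂ) * Complex.I)
      - E u * (((p' u : ℝ) : ℂ) * Complex.I)) / (((p u : ℝ) : ℂ) * Complex.I) ^ 2 with hw'
  have hpI : ∀ u, c ≤ u → ((p u : ℝ) : ℂ) * Complex.I ≠ 0 := fun u hu =>
    mul_ne_zero (Complex.ofReal_ne_zero.2 (hpne u hu)) Complex.I_ne_zero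
  have hwd : ∀ u, c ≤ u → HasDerivAt w (w' u) u := fun u hu =>
    (hEd u).div ((hpd u).ofReal_comp.mul_const Complex.I) (hpI u hu)
  have hpw : ∀ u, c ≤ u → ‖w u‖ ≤ 2 / x u := by
    intro u hu
    simp only [hw, norm_div, hEn, norm_mul, Complex.norm_I, mul_one, Complex.norm_real,
      Real.norm_eq_abs]
    rw [div_le_div_iff₀ (abs_pos.2 (hpne u hu)) (hxpos u hu)]
    linarith [hplow u hu]
  have hpw' : ∀ u, c ≤ u → ‖w' u‖ ≤ (2 * |η| + 8) / x u := by
    intro u hu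
    have ha := abs_pos.2 (hpne u hu)
    have hx0 := hxpos u hu
    have e1 : ‖w' u‖ ≤ (|η| * |p u| + |p' u|) / |p u| ^ 2 := by
      simp only [hw', norm_div, norm_pow, norm_mul, Complex.norm_I, mul_one, Complex.norm_real,
        Real.norm_eq_abs]
      gcongr
      refine (norm_sub_le _ _).trans ?_
      simp [hEn]
    refine e1.trans ?_
    rw [div_le_div_iff₀ (by positivity) hx0]
    have l1 := hplow u hu
    have l2 := hp'up u hu
    have l3 : |η| * |p u| * x u ≤ 2 * |η| * |p u| ^ 2 := by
      have : |η| * |p u| * x u ≤ |η| * |p u| * (2 * |p u|) := by gcongr; linarith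
      linarith
    have l4 : |p' u| * x u ≤ 8 * |p u| ^ 2 := by
      have : |p' u| * x u ≤ (2 * x u) * x u := by gcongr
      nlinarith
    nlinarith
  have hinv : ∀ u, c ≤ u → (x u)⁻¹ ≤ Real.exp (c - u) := by
    intro u hu
    rw [show c - u = -(u - c) by ring, Real.exp_neg]
    exact inv_anti₀ (Real.exp_pos _) (hxlow u hu)
  have hvc : Continuous v := by simp only [hv]; fun_prop
  have hEc : Continuous E := by simp only [hE]; fun_prop
  have hosc : ∀ u, oscFactor η α γ u = E u * v u := by
    intro u
    simp only [oscFactor, hE, hv]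
    rw [← Complex.exp_add]
    congr 1
    push_cast; ring
  have hw'c : ContinuousOn w' (Set.uIcc c d) := by
    rw [Set.uIcc_of_le hcd]
    refine ContinuousOn.div (by fun_prop) (by fun_prop) ?_
    intro u hu
    exact pow_ne_zero _ (hpI u hu.1)
  have ibp := intervalIntegral.integral_mul_deriv_eq_deriv_mul (a := c) (b := d)
    (u := w) (v := v) (u' := w') (v' := fun u => ((p u : ℝ) : ℂ) * Complex.I * v u)
    (fun u hu => hwd u (by rw [Set.uIcc_of_le hcd] at hu; exact hu.1)) (fun u _ => hvd u)
    hw'c.intervalIntegrable ((by fun_prop : Continuous _).intervalIntegrable _ _)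
  have hcongr : ∫ u in c..d, oscFactor η α γ u =
      ∫ u in c..d, w u * (((p u : ℝ) : ℂ) * Complex.I * v u) := by
    apply intervalIntegral.integral_congr
    intro u hu
    rw [Set.uIcc_of_le hcd] at hu
    simp only [hosc, hw]
    have := hpI u hu.1
    rw [div_mul_eq_mul_div, eq_div_iff this]
    ring
  rw [hcongr, ibp]
  have b1 : ‖w d * v d‖ ≤ 2 := by
    rw [norm_mul, hvn, mul_one]
    refine (hpw d hcd).trans ?_
    rw [div_eq_mul_inv]
    have := (hinv d hcd).trans (Real.exp_le_one_iff.2 (by linarith : c - d ≤ 0))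
    linarith
  have b2 : ‖w c * v c‖ ≤ 2 := by
    rw [norm_mul, hvn, mul_one]
    refine (hpw c le_rfl).trans ?_
    rw [div_eq_mul_inv]
    have := (hinv c le_rfl).trans (Real.exp_le_one_iff.2 (by linarith : c - c ≤ 0))
    linarith
  have b3 : ‖∫ u in c..d, w' u * v u‖ ≤ 2 * |η| + 8 := by
    have i1 : ‖∫ u in c..d, w' u * v u‖ ≤ ∫ u in c..d, (2 * |η| + 8) * Real.exp (c - u) := by
      apply intervalIntegral.norm_integral_le_of_norm_le hcd
      · filter_upwards with u hu
        rw [norm_mul, hvn, mul_one]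
        refine (hpw' u hu.1.le).trans ?_
        rw [div_eq_mul_inv]
        have := hinv u hu.1.le
        gcongr
      · exact (by fun_prop : Continuous _).intervalIntegrable _ _
    refine i1.trans ?_
    rw [intervalIntegral.integral_const_mul, intervalIntegral.integral_comp_sub_left
      (fun y => Real.exp y), integral_exp]
    have : Real.exp (c - c) - Real.exp (c - d) ≤ 1 := by
      rw [sub_self, Real.exp_zero]; linarith [Real.exp_pos (c - d)]
    have h0 : 0 ≤ 2 * |η| + 8 := by positivity
    nlinarith
  calc ‖w d * v d - w c * v c - ∫ u in c..d, w' u * v u‖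
      ≤ ‖w d * v d‖ + ‖w c * v c‖ + ‖∫ u in c..d, w' u * v u‖ := by
        refine (norm_sub_le _ _).trans ?_
        gcongr
        exact norm_sub_le _ _
    _ ≤ 12 + 2 * |η| := by linarith

/-- To the right of a point where `|α|e^u ≥ max(1, |γ|e^{-u})`: after a length at most `1`, the
first phase dominates the second by a factor `4`. -/
theorem norm_integral_oscFactor_le_right (η α γ : ℝ) {c d : ℝ} (hcd : c ≤ d)
    (h1 : 1 ≤ |α| * Real.exp c) (h2 : |γ| * Real.exp (-c) ≤ |α| * Real.exp c) :
    ‖∫ u in c..d, oscFactor η α γ u‖ ≤ 13 + 2 * |η| := by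
  have h0 := abs_nonneg η
  rcases le_total d (c + 1) with h | h
  · exact (norm_integral_oscFactor_le_length η α γ hcd).trans (by linarith)
  · rw [← intervalIntegral.integral_add_adjacent_intervals (b := c + 1)
      ((continuous_oscFactor η α γ).intervalIntegrable _ _)
      ((continuous_oscFactor η α γ).intervalIntegrable _ _)]
    have e1 : (2 : ℝ) ≤ Real.exp 1 := by linarith [Real.add_one_le_exp (1 : ℝ)]
    have e3 : Real.exp (-1) * Real.exp 1 = 1 := by rw [← Real.exp_add]; simp
    have e2 : Real.exp (-1) ≤ 1 / 2 := by
      nlinarith [Real.exp_pos (-1)]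
    have hp : 0 ≤ |γ| * Real.exp (-c) := by positivity
    have k1 := norm_integral_oscFactor_le_length η α γ (show c ≤ c + 1 by linarith)
    have k2 := norm_integral_oscFactor_le_of_dominant η α γ h
      (by rw [Real.exp_add]; nlinarith)
      (by rw [neg_add, Real.exp_add, Real.exp_add]; nlinarith [Real.exp_pos (-1)])
    refine (norm_add_le _ _).trans ?_
    linarith

/-- The reflection `u ↦ -u` of `norm_integral_oscFactor_le_right`, which exchanges the two phases.
-/
theorem norm_integral_oscFactor_le_left (η α γ : ℝ) {c d : ℝ} (hcd : c ≤ d)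
    (h1 : 1 ≤ |γ| * Real.exp (-d)) (h2 : |α| * Real.exp d ≤ |γ| * Real.exp (-d)) :
    ‖∫ u in c..d, oscFactor η α γ u‖ ≤ 13 + 2 * |η| := by
  have key := norm_integral_oscFactor_le_right (-η) γ α (c := -d) (d := -c) (by linarith) h1
    (by rwa [neg_neg])
  rw [abs_neg, ← intervalIntegral.integral_comp_neg] at key
  convert key using 4 with u
  simp only [oscFactor, neg_neg]
  congr 3
  ring

/-- Where both phases are at most `1`, only the oscillation of `e^{iηu}` is available. -/
theorem norm_integral_oscFactor_le_middle {η : ℝ} (hη : η ≠ 0) (α γ : ℝ) {c d : ℝ} (hcd : c ≤ d)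
    (h1 : |α| * Real.exp d ≤ 1) (h2 : |γ| * Real.exp (-c) ≤ 1) :
    ‖∫ u in c..d, oscFactor η α γ u‖ ≤ 2 + 2 / |η| := by
  set E : ℝ → ℂ := fun u => Complex.exp (((η : ℂ) * Complex.I) * u) with hE
  have hηI : (η : ℂ) * Complex.I ≠ 0 :=
    mul_ne_zero (Complex.ofReal_ne_zero.2 hη) Complex.I_ne_zero
  have hEn : ∀ u : ℝ, ‖E u‖ = 1 := by
    intro u
    have : ((η : ℂ) * Complex.I) * u = ((η * u : ℝ) : ℂ) * Complex.I := by push_cast; ring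
    simp only [hE]
    rw [this]
    exact Complex.norm_exp_ofReal_mul_I _
  have i1 : ‖∫ u in c..d, E u‖ ≤ 2 / |η| := by
    simp only [hE]
    rw [integral_exp_mul_complex hηI, norm_div, norm_mul, Complex.norm_I, mul_one,
      Complex.norm_real, Real.norm_eq_abs]
    gcongr
    refine (norm_sub_le _ _).trans ?_
    rw [hEn, hEn]; norm_num
  have hEc : Continuous E := by simp only [hE]; fun_prop
  have i2 : ‖∫ u in c..d, (oscFactor η α γ u - E u)‖ ≤ 2 := by
    have : ‖∫ u in c..d, (oscFactor η α γ u - E u)‖ ≤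
        ∫ u in c..d, (|α| * Real.exp u + |γ| * Real.exp (-u)) := by
      apply intervalIntegral.norm_integral_le_of_norm_le hcd
      · filter_upwards with u hu
        have : oscFactor η α γ u - E u = E u *
            (Complex.exp (Complex.I * ((α * Real.exp u + γ * Real.exp (-u) : ℝ) : ℂ)) - 1) := by
          rw [mul_sub, mul_one]
          congr 1
          simp only [oscFactor, hE]
          rw [← Complex.exp_add]
          congr 1
          push_cast; ring
        rw [this, norm_mul, hEn, one_mul]
        refine (Real.norm_exp_I_mul_ofReal_sub_one_le).trans ?_
        refine (norm_add_le _ _).trans ?_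
        simp [abs_of_pos (Real.exp_pos _)]
      · exact (by fun_prop : Continuous _).intervalIntegrable _ _
    refine this.trans ?_
    rw [intervalIntegral.integral_add ((by fun_prop : Continuous _).intervalIntegrable _ _)
      ((by fun_prop : Continuous _).intervalIntegrable _ _), intervalIntegral.integral_const_mul,
      intervalIntegral.integral_const_mul, integral_exp,
      intervalIntegral.integral_comp_neg (fun y => Real.exp y), integral_exp]
    have a1 : 0 ≤ |α| * Real.exp c := by positivity
    have a2 : 0 ≤ |γ| * Real.exp (-d) := by positivity
    linarith
  have : ∫ u in c..d, oscFactor η α γ u =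
      (∫ u in c..d, (oscFactor η α γ u - E u)) + ∫ u in c..d, E u := by
    rw [← intervalIntegral.integral_add]
    · simp
    · exact ((continuous_oscFactor η α γ).sub hEc).intervalIntegrable _ _
    · exact hEc.intervalIntegrable _ _
  rw [this]
  exact (norm_add_le _ _).trans (add_le_add i2 i1)

/-- The first point of the closed set `R` in `[a, b]`, or `b` if there is none. -/
theorem exists_split_of_isClosed {R : Set ℝ} (hR : IsClosed R) {a b : ℝ} (hab : a ≤ b) :
    ∃ c ∈ Set.Icc a b, (∀ u ∈ Set.Ico a c, u ∉ R) ∧ (c ∈ R ∨ c = b) := by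
  by_cases h : (R ∩ Set.Icc a b).Nonempty
  · have hcl : IsClosed (R ∩ Set.Icc a b) := hR.inter isClosed_Icc
    have hbd : BddBelow (R ∩ Set.Icc a b) := ⟨a, fun x hx => hx.2.1⟩
    have hm := hcl.csInf_mem h hbd
    refine ⟨sInf (R ∩ Set.Icc a b), hm.2, ?_, Or.inl hm.1⟩
    intro u hu huR
    have := csInf_le hbd ⟨huR, hu.1, hu.2.le.trans hm.2.2⟩
    exact absurd hu.2 (not_lt.2 this)
  · refine ⟨b, ⟨hab, le_rfl⟩, ?_, Or.inr rfl⟩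
    intro u hu huR
    exact h ⟨u, huR, hu.1, hu.2.le⟩

/-- The van der Corput estimate that drives the endpoint case: the bound is uniform in the
phases `α`, `γ` and in the interval, at the price of a singularity at `η = 0`. -/
theorem norm_integral_oscFactor_le {η : ℝ} (hη : η ≠ 0) (α γ : ℝ) {a b : ℝ} (hab : a ≤ b) :
    ‖∫ u in a..b, oscFactor η α γ u‖ ≤ 28 * (1 + |η| + 1 / |η|) := by
  have hRc : IsClosed ({u : ℝ | 1 ≤ |α| * Real.exp u} ∩
      {u : ℝ | |γ| * Real.exp (-u) ≤ |α| * Real.exp u}) :=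
    (isClosed_le (by fun_prop) (by fun_prop)).inter (isClosed_le (by fun_prop) (by fun_prop))
  have hLc : IsClosed ({u : ℝ | 1 ≤ |γ| * Real.exp u} ∩
      {u : ℝ | |α| * Real.exp (-u) ≤ |γ| * Real.exp u}) :=
    (isClosed_le (by fun_prop) (by fun_prop)).inter (isClosed_le (by fun_prop) (by fun_prop))
  -- the phase `αe^u` is large on the right, `γe^{-u}` on the left, and both are small in between
  obtain ⟨c, hc, hc1, hc2⟩ := exists_split_of_isClosed hRc hab
  obtain ⟨c', hc', hc'1, hc'2⟩ := exists_split_of_isClosed hLc (show -c ≤ -a by linarith [hc.1])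
  have hint : ∀ x y, IntervalIntegrable (oscFactor η α γ) volume x y := fun x y =>
    (continuous_oscFactor η α γ).intervalIntegrable x y
  have hη0 : 0 < |η| := abs_pos.2 hη
  have I3 : ‖∫ u in c..b, oscFactor η α γ u‖ ≤ 13 + 2 * |η| := by
    rcases hc2 with h | h
    · exact norm_integral_oscFactor_le_right η α γ hc.2 h.1 h.2
    · rw [h]; simp; positivity
  have I1 : ‖∫ u in a..(-c'), oscFactor η α γ u‖ ≤ 13 + 2 * |η| := by
    rcases hc'2 with h | h
    · refine norm_integral_oscFactor_le_left η α γ (by linarith [hc'.2]) ?_ ?_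
      · rw [neg_neg]; exact h.1
      · rw [neg_neg]; exact h.2
    · rw [h]; simp; positivity
  have hcc' : -c' ≤ c := by linarith [hc'.1]
  have I2 : ‖∫ u in (-c')..c, oscFactor η α γ u‖ ≤ 2 + 2 / |η| := by
    rcases hcc'.eq_or_lt with heq | hlt
    · rw [heq]; simp; positivity
    have hmid : ∀ u ∈ Set.Ioo (-c') c, |α| * Real.exp u ≤ 1 ∧ |γ| * Real.exp (-u) ≤ 1 := by
      intro u hu
      have r := hc1 u ⟨by linarith [hu.1, hc'.2], hu.2⟩
      have l := hc'1 (-u) ⟨by linarith [hu.2], by linarith [hu.1]⟩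
      simp only [Set.mem_inter_iff, Set.mem_ofPred_eq, not_and_or, not_le, neg_neg] at r l
      rcases r with r | r <;> rcases l with l | l
      · exact ⟨r.le, l.le⟩
      · exact ⟨r.le, by linarith⟩
      · exact ⟨by linarith, l.le⟩
      · linarith
    have hcl : ∀ u ∈ Set.Icc (-c') c, |α| * Real.exp u ≤ 1 ∧ |γ| * Real.exp (-u) ≤ 1 := by
      intro u hu
      rw [← closure_Ioo hlt.ne] at hu
      have hS : IsClosed ({u : ℝ | |α| * Real.exp u ≤ 1} ∩
          {u : ℝ | |γ| * Real.exp (-u) ≤ 1}) :=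
        (isClosed_le (by fun_prop) (by fun_prop)).inter (isClosed_le (by fun_prop) (by fun_prop))
      exact closure_minimal hmid hS hu
    exact norm_integral_oscFactor_le_middle hη α γ hcc'
      (hcl c ⟨hcc', le_rfl⟩).1 (hcl (-c') ⟨le_rfl, hcc'⟩).2
  have hsum : ∫ u in a..b, oscFactor η α γ u = (∫ u in a..(-c'), oscFactor η α γ u) +
      (∫ u in (-c')..c, oscFactor η α γ u) + ∫ u in c..b, oscFactor η α γ u := by
    rw [intervalIntegral.integral_add_adjacent_intervals (hint _ _) (hint _ _),
      intervalIntegral.integral_add_adjacent_intervals (hint _ _) (hint _ _)]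
  rw [hsum]
  refine (norm_add₃_le).trans ?_
  have h1 : 0 ≤ 1 / |η| := by positivity
  have h2 : 2 / |η| = 2 * (1 / |η|) := by ring
  linarith

/-- The factor `t^{-1+δ+iη}` of the interpolating family of kernels. -/
def powFactor (δ η t : ℝ) : ℂ :=
  ((t ^ (-1 + δ) : ℝ) : ℂ) * Complex.exp (((η * Real.log t : ℝ) : ℂ) * Complex.I)

theorem norm_powFactor (δ η : ℝ) {t : ℝ} (ht : 0 < t) : ‖powFactor δ η t‖ = t ^ (-1 + δ) := by
  rw [powFactor, norm_mul, Complex.norm_exp_ofReal_mul_I, mul_one, Complex.norm_real,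
    Real.norm_of_nonneg (by positivity)]

/-- The case `δ = 0`, by the substitution `t = e^u`. -/
theorem norm_integral_powFactor_zero_le {η : ℝ} (hη : η ≠ 0) (α γ : ℝ) {ε T : ℝ} (hε : 0 < ε)
    (hT : ε ≤ T) :
    ‖∫ t in ε..T, powFactor 0 η t * Complex.exp (((α * t + γ / t : ℝ) : ℂ) * Complex.I)‖ ≤
      28 * (1 + |η| + 1 / |η|) := by
  have hT0 : 0 < T := hε.trans_le hT
  set G : ℝ → ℂ := fun t =>
    powFactor 0 η t * Complex.exp (((α * t + γ / t : ℝ) : ℂ) * Complex.I) with hG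
  have himg : ∀ t ∈ Real.exp '' (Set.uIcc (Real.log ε) (Real.log T)), t ≠ 0 := by
    rintro t ⟨u, -, rfl⟩
    exact (Real.exp_pos u).ne'
  have hsub := intervalIntegral.integral_deriv_smul_comp' (a := Real.log ε) (b := Real.log T)
    (f := Real.exp) (f' := Real.exp) (g := G) (fun u _ => Real.hasDerivAt_exp u)
    (by fun_prop) (by
      simp only [hG, powFactor]
      refine ContinuousOn.mul (ContinuousOn.mul ?_ ?_) ?_
      · exact Complex.continuous_ofReal.comp_continuousOn
          (continuousOn_id.rpow_const fun t ht => Or.inl (himg t ht))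
      · refine Complex.continuous_exp.comp_continuousOn (ContinuousOn.mul ?_ continuousOn_const)
        exact Complex.continuous_ofReal.comp_continuousOn
          (continuousOn_const.mul (Real.continuousOn_log.mono himg))
      · refine Complex.continuous_exp.comp_continuousOn (ContinuousOn.mul ?_ continuousOn_const)
        refine Complex.continuous_ofReal.comp_continuousOn (ContinuousOn.add (by fun_prop) ?_)
        exact continuousOn_const.div continuousOn_id himg)
  rw [Real.exp_log hε, Real.exp_log hT0] at hsub
  rw [← hsub]
  have : ∀ u, Real.exp u • (G ∘ Real.exp) u = oscFactor η α γ u := by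
    intro u
    have h1 : (Real.exp u) ^ (-1 + 0 : ℝ) = Real.exp (-u) := by
      rw [← Real.exp_mul]; congr 1; ring
    simp only [hG, Function.comp, powFactor, h1, Real.log_exp, oscFactor, Complex.real_smul]
    rw [mul_assoc, ← mul_assoc, ← Complex.ofReal_mul, ← Real.exp_add, add_neg_cancel,
      Real.exp_zero, Complex.ofReal_one, one_mul, ← Complex.exp_add, Real.exp_neg]
    congr 1
    push_cast
    ring
  simp_rw [this]
  exact norm_integral_oscFactor_le hη α γ (Real.log_le_log hε hT)

/-- The Fourier transform in time of the truncated kernels `t^{-1+δ+iη}e^{iγ/t}`, bounded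
uniformly in the frequency `α`, in `γ` and in the truncation `ε`. For `δ > 0` the kernel is
absolutely integrable; for `δ = 0` its oscillation has to be used. -/
theorem exists_norm_integral_powFactor_le {δ : ℝ} (hδ : 0 ≤ δ) :
    ∃ C : ℝ, 0 < C ∧ ∀ (η : ℝ), η ≠ 0 → ∀ (α γ ε T : ℝ), 0 < ε → ε ≤ T →
      ‖∫ t in ε..T, powFactor δ η t * Complex.exp (((α * t + γ / t : ℝ) : ℂ) * Complex.I)‖ ≤
        C * T ^ δ * (1 + |η| + 1 / |η|) := by
  rcases hδ.eq_or_lt with h0 | hpos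
  · refine ⟨28, by norm_num, fun η hη α γ ε T hε hT => ?_⟩
    rw [← h0, Real.rpow_zero, mul_one]
    exact norm_integral_powFactor_zero_le hη α γ hε hT
  · refine ⟨1 / δ, by positivity, fun η hη α γ ε T hε hT => ?_⟩
    have hT0 : 0 < T := hε.trans_le hT
    have h1 : ‖∫ t in ε..T, powFactor δ η t *
        Complex.exp (((α * t + γ / t : ℝ) : ℂ) * Complex.I)‖ ≤ ∫ t in ε..T, t ^ (-1 + δ) := by
      apply intervalIntegral.norm_integral_le_of_norm_le hT
      · filter_upwards with t ht
        rw [norm_mul, Complex.norm_exp_ofReal_mul_I, mul_one, norm_powFactor δ η (hε.trans ht.1)]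
      · exact intervalIntegral.intervalIntegrable_rpow' (by linarith)
    have h2 : ∫ t in ε..T, t ^ (-1 + δ) ≤ 1 / δ * T ^ δ := by
      rw [integral_rpow (Or.inl (by linarith)), neg_add_cancel_comm, one_div_mul_eq_div]
      gcongr
      have : 0 < ε ^ δ := by positivity
      linarith
    refine h1.trans (h2.trans ?_)
    have h3 : 0 ≤ 1 / |η| := by positivity
    have h4 : 0 < 1 / δ * T ^ δ := by positivity
    nlinarith [abs_nonneg η]

/-! ### The Plancherel theorem on `L¹ ∩ L²` -/

section Plancherel

variable {V : Type*} [NormedAddCommGroup V] [InnerProductSpace ℝ V] [FiniteDimensional ℝ V]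
  [MeasurableSpace V] [BorelSpace V]

theorem continuous_fourier_of_integrable {f : V → ℂ} (hf : Integrable f) : Continuous (𝓕 f) :=
  VectorFourier.fourierIntegral_continuous Real.continuous_fourierChar
    (by exact continuous_inner) hf

/-- On `L¹ ∩ L²` the Fourier transform of `L²` is given by the Fourier integral. -/
theorem coeFn_fourier_of_integrable (f : Lp ℂ 2 (volume : Measure V)) (hf : Integrable f) :
    ((𝓕 f : Lp ℂ 2 (volume : Measure V)) : V → ℂ) =ᵐ[volume] 𝓕 (f : V → ℂ) := by
  apply ae_eq_of_integral_contDiff_smul_eq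
  · exact (Lp.memLp (𝓕 f)).locallyIntegrable (by norm_num)
  · exact (continuous_fourier_of_integrable hf).locallyIntegrable
  intro g g_smooth g_cpt
  have hg₁ : HasCompactSupport (Complex.ofRealCLM ∘ g) := g_cpt.comp_left rfl
  have hg₂ : ContDiff ℝ (⊤ : ℕ∞) (Complex.ofRealCLM ∘ g) := by fun_prop
  set G : 𝓢(V, ℂ) := hg₁.toSchwartzMap hg₂
  have h1 : ∫ x, g x • (𝓕 f : Lp ℂ 2 (volume : Measure V)) x = 𝓕 (f : 𝓢'(V, ℂ)) G := by
    rw [Lp.fourier_toTemperedDistribution_eq, Lp.toTemperedDistribution_apply]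
    simp [G]
  rw [h1, TemperedDistribution.fourier_apply, Lp.toTemperedDistribution_apply]
  have h2 := VectorFourier.integral_fourierIntegral_smul_eq_flip (L := innerₗ V) (μ := volume)
    (ν := volume) (f := (G : V → ℂ)) (g := (f : V → ℂ)) Real.continuous_fourierChar
    (by exact continuous_inner) G.integrable hf
  have h3 : (innerₗ V).flip = innerₗ V := by
    ext x y; simp
  rw [h3] at h2
  have h4 : ∀ x, g x • 𝓕 (f : V → ℂ) x = G x • 𝓕 (f : V → ℂ) x := fun x => by simp [G]
  simp_rw [h4, SchwartzMap.fourier_coe]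
  exact h2

theorem coeFn_fourierInv_of_integrable (f : Lp ℂ 2 (volume : Measure V)) (hf : Integrable f) :
    ((𝓕⁻ f : Lp ℂ 2 (volume : Measure V)) : V → ℂ) =ᵐ[volume] 𝓕⁻ (f : V → ℂ) := by
  have hcont : Continuous (𝓕⁻ (f : V → ℂ)) :=
    VectorFourier.fourierIntegral_continuous (L := -innerₗ V) Real.continuous_fourierChar
      (by exact continuous_inner.neg) hf
  apply ae_eq_of_integral_contDiff_smul_eq
  · exact (Lp.memLp (𝓕⁻ f)).locallyIntegrable (by norm_num)
  · exact hcont.locallyIntegrable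
  intro g g_smooth g_cpt
  have hg₁ : HasCompactSupport (Complex.ofRealCLM ∘ g) := g_cpt.comp_left rfl
  have hg₂ : ContDiff ℝ (⊤ : ℕ∞) (Complex.ofRealCLM ∘ g) := by fun_prop
  set G : 𝓢(V, ℂ) := hg₁.toSchwartzMap hg₂
  have h1 : ∫ x, g x • (𝓕⁻ f : Lp ℂ 2 (volume : Measure V)) x = 𝓕⁻ (f : 𝓢'(V, ℂ)) G := by
    rw [Lp.fourierInv_toTemperedDistribution_eq, Lp.toTemperedDistribution_apply]
    simp [G]
  rw [h1, TemperedDistribution.fourierInv_apply, Lp.toTemperedDistribution_apply]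
  have h2 := VectorFourier.integral_fourierIntegral_smul_eq_flip (L := -innerₗ V) (μ := volume)
    (ν := volume) (f := (G : V → ℂ)) (g := (f : V → ℂ)) Real.continuous_fourierChar
    (by exact continuous_inner.neg) G.integrable hf
  have h3 : (-innerₗ V).flip = -innerₗ V := by
    ext x y; simp [real_inner_comm]
  rw [h3] at h2
  have h4 : ∀ x, g x • 𝓕⁻ (f : V → ℂ) x = G x • 𝓕⁻ (f : V → ℂ) x := fun x => by simp [G]
  simp_rw [h4, SchwartzMap.fourierInv_coe]
  exact h2

theorem integral_norm_sq_toLp {X : Type*} [MeasurableSpace X] {μ : Measure X} {f : X → ℂ}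
    (hf : MemLp f 2 μ) : ∫ x, ‖f x‖ ^ 2 ∂μ = ‖hf.toLp f‖ ^ 2 := by
  have h := L2.inner_def (𝕜 := ℂ) (hf.toLp f) (hf.toLp f)
  rw [inner_self_eq_norm_sq_to_K] at h
  have h2 : ∫ x, inner ℂ (hf.toLp f x) (hf.toLp f x) ∂μ = ((∫ x, ‖f x‖ ^ 2 ∂μ : ℝ) : ℂ) := by
    rw [← integral_complex_ofReal]
    apply integral_congr_ae
    filter_upwards [hf.coeFn_toLp] with x hx
    rw [hx, inner_self_eq_norm_sq_to_K]
    push_cast; rfl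
  rw [h2] at h
  exact Complex.ofReal_injective (h.symm.trans (by push_cast; rfl))

theorem memLp_fourier {f : V → ℂ} (hf : Integrable f) (hf2 : MemLp f 2 volume) :
    MemLp (𝓕 f) 2 volume := by
  have h1 := coeFn_fourier_of_integrable (hf2.toLp f) (hf.congr hf2.coeFn_toLp.symm)
  have h2 : 𝓕 (hf2.toLp f : V → ℂ) = 𝓕 f := by
    ext ξ
    rw [Real.fourier_eq, Real.fourier_eq]
    apply integral_congr_ae
    filter_upwards [hf2.coeFn_toLp] with x hx
    rw [hx]
  rw [h2] at h1
  exact (memLp_congr_ae h1).1 (Lp.memLp _)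

theorem toLp_fourier {f : V → ℂ} (hf : Integrable f) (hf2 : MemLp f 2 volume) :
    (memLp_fourier hf hf2).toLp (𝓕 f) = 𝓕 (hf2.toLp f) := by
  have h1 := coeFn_fourier_of_integrable (hf2.toLp f) (hf.congr hf2.coeFn_toLp.symm)
  have h2 : 𝓕 (hf2.toLp f : V → ℂ) = 𝓕 f := by
    ext ξ
    rw [Real.fourier_eq, Real.fourier_eq]
    apply integral_congr_ae
    filter_upwards [hf2.coeFn_toLp] with x hx
    rw [hx]
  rw [h2] at h1
  apply Lp.ext
  exact (MemLp.coeFn_toLp _).trans h1.symm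

theorem integral_norm_sq_fourier {f : V → ℂ} (hf : Integrable f) (hf2 : MemLp f 2 volume) :
    ∫ ξ, ‖𝓕 f ξ‖ ^ 2 = ∫ x, ‖f x‖ ^ 2 := by
  rw [integral_norm_sq_toLp (memLp_fourier hf hf2), integral_norm_sq_toLp hf2, toLp_fourier hf hf2,
    Lp.norm_fourier_eq]

theorem integral_mul_conj_toLp {X : Type*} [MeasurableSpace X] {μ : Measure X} {f g : X → ℂ}
    (hf : MemLp f 2 μ) (hg : MemLp g 2 μ) :
    ∫ x, f x * (starRingEnd ℂ) (g x) ∂μ = inner ℂ (hg.toLp g) (hf.toLp f) := by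
  rw [L2.inner_def]
  apply integral_congr_ae
  filter_upwards [hf.coeFn_toLp, hg.coeFn_toLp] with x hx hy
  rw [hx, hy]
  rfl

theorem integral_fourier_mul_conj {f g : V → ℂ} (hf : Integrable f) (hf2 : MemLp f 2 volume)
    (hg : Integrable g) (hg2 : MemLp g 2 volume) :
    ∫ ξ, 𝓕 f ξ * (starRingEnd ℂ) (𝓕 g ξ) = ∫ x, f x * (starRingEnd ℂ) (g x) := by
  rw [integral_mul_conj_toLp (memLp_fourier hf hf2) (memLp_fourier hg hg2),
    integral_mul_conj_toLp hf2 hg2, toLp_fourier hf hf2, toLp_fourier hg hg2]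
  exact Lp.inner_fourier_eq _ _

theorem norm_integral_mul_conj_le {X : Type*} [MeasurableSpace X] {μ : Measure X} {f g : X → ℂ}
    (hf : MemLp f 2 μ) (hg : MemLp g 2 μ) :
    ‖∫ x, f x * (starRingEnd ℂ) (g x) ∂μ‖ ≤
      √(∫ x, ‖f x‖ ^ 2 ∂μ) * √(∫ x, ‖g x‖ ^ 2 ∂μ) := by
  rw [integral_mul_conj_toLp hf hg, integral_norm_sq_toLp hf, integral_norm_sq_toLp hg,
    Real.sqrt_sq (norm_nonneg _), Real.sqrt_sq (norm_nonneg _), mul_comm]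
  exact norm_inner_le_norm _ _

end Plancherel

/-- The convolution with an integrable kernel `k` is bounded on `L²` by the supremum of `|k̂|`. -/
theorem norm_integral_convolution_mul_conj_le {k a b : ℝ → ℂ} (hk : Integrable k) {B : ℝ}
    (hB : ∀ t, ‖k t‖ ≤ B) {M : ℝ} (hM : ∀ τ, ‖𝓕 k τ‖ ≤ M)
    (ha : Integrable a) (ha2 : MemLp a 2 volume) (hb : Integrable b) (hb2 : MemLp b 2 volume) :
    ‖∫ t, (∫ s, a s * k (t - s)) * (starRingEnd ℂ) (b t)‖ ≤
      M * (√(∫ s, ‖a s‖ ^ 2) * √(∫ t, ‖b t‖ ^ 2)) := by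
  have hM0 : 0 ≤ M := (norm_nonneg _).trans (hM 0)
  set h : ℝ → ℂ := MeasureTheory.convolution a k (ContinuousLinearMap.mul ℂ ℂ) volume with hh
  have hh' : ∀ t, ∫ s, a s * k (t - s) = h t := fun t => rfl
  have hhi : Integrable h := ha.integrable_convolution _ hk
  have hhb : ∀ t, ‖h t‖ ≤ B * ∫ s, ‖a s‖ := by
    intro t
    rw [← hh', ← integral_const_mul]
    apply norm_integral_le_of_norm_le (ha.norm.const_mul B)
    filter_upwards with s
    rw [norm_mul, mul_comm]
    exact mul_le_mul_of_nonneg_right (hB _) (norm_nonneg _)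
  have hh2 : MemLp h 2 volume := by
    rw [memLp_two_iff_integrable_sq_norm hhi.aestronglyMeasurable]
    refine Integrable.mono' (hhi.norm.const_mul (B * ∫ s, ‖a s‖))
      (hhi.aestronglyMeasurable.norm.pow 2) ?_
    filter_upwards with t
    rw [Real.norm_of_nonneg (by positivity), sq]
    exact mul_le_mul_of_nonneg_right (hhb t) (norm_nonneg _)
  simp_rw [hh']
  rw [← integral_fourier_mul_conj hhi hh2 hb hb2]
  refine (norm_integral_mul_conj_le (memLp_fourier hhi hh2) (memLp_fourier hb hb2)).trans ?_
  rw [integral_norm_sq_fourier hb hb2, ← mul_assoc]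
  gcongr
  rw [← Real.sqrt_sq hM0, ← Real.sqrt_mul (sq_nonneg M), ← integral_norm_sq_fourier ha ha2,
    ← integral_const_mul]
  apply Real.sqrt_le_sqrt
  have hfa := (memLp_two_iff_integrable_sq_norm
    (continuous_fourier_of_integrable ha).aestronglyMeasurable).1 (memLp_fourier ha ha2)
  have hfh := (memLp_two_iff_integrable_sq_norm
    (continuous_fourier_of_integrable hhi).aestronglyMeasurable).1 (memLp_fourier hhi hh2)
  refine integral_mono hfh (hfa.const_mul _) ?_
  intro τ
  simp only
  rw [hh, Real.fourier_mul_convolution_eq ha hk τ, norm_mul, mul_pow, mul_comm]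
  gcongr
  exact hM τ

/-! ### The kernel of the Schrödinger group -/

section Kernel

variable {V : Type*} [NormedAddCommGroup V] [InnerProductSpace ℝ V]

/-- The kernel `(π/b)^{n/2} e^{-π²|z|²/b}` of the Fourier multiplier `e^{-b|ξ|²}`. -/
def gaussianKernel (V : Type*) [NormedAddCommGroup V] [InnerProductSpace ℝ V] (b : ℂ) (z : V) :
    ℂ :=
  (Real.pi / b) ^ (Module.finrank ℝ V / 2 : ℂ) * Complex.exp (-Real.pi ^ 2 * ‖z‖ ^ 2 / b)

theorem norm_gaussianKernel_le {b : ℂ} (hb : 0 ≤ b.re) (z : V) :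
    ‖gaussianKernel V b z‖ ≤ (Real.pi / ‖b‖) ^ ((Module.finrank ℝ V : ℝ) / 2) := by
  rw [gaussianKernel, norm_mul]
  have h1 : (Module.finrank ℝ V / 2 : ℂ) = (((Module.finrank ℝ V : ℝ) / 2 : ℝ) : ℂ) := by
    push_cast; rfl
  rw [h1, Complex.norm_cpow_real, norm_div, Complex.norm_real, Real.norm_of_nonneg Real.pi_pos.le]
  refine mul_le_of_le_one_right (by positivity) ?_
  rw [Complex.norm_exp, Real.exp_le_one_iff]
  have h2 : (-(Real.pi : ℂ) ^ 2 * (‖z‖ : ℂ) ^ 2 / b) = ((-Real.pi ^ 2 * ‖z‖ ^ 2 : ℝ) : ℂ) * b⁻¹ := by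
    push_cast; rfl
  rw [h2, Complex.re_ofReal_mul, Complex.inv_re]
  have h3 : 0 ≤ b.re / Complex.normSq b := div_nonneg hb (Complex.normSq_nonneg _)
  have h4 : 0 ≤ Real.pi ^ 2 * ‖z‖ ^ 2 := by positivity
  nlinarith

variable [FiniteDimensional ℝ V] [MeasurableSpace V] [BorelSpace V]

theorem integral_fourier_mul_eq {f g : V → ℂ} (hf : Integrable f) (hg : Integrable g) :
    ∫ ξ, 𝓕 f ξ * g ξ = ∫ x, f x * 𝓕 g x := by
  have h2 := VectorFourier.integral_fourierIntegral_smul_eq_flip (L := innerₗ V) (μ := volume)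
    (ν := volume) (f := f) (g := g) Real.continuous_fourierChar
    (by exact continuous_inner) hf hg
  have h3 : (innerₗ V).flip = innerₗ V := by
    ext x y; simp
  rw [h3] at h2
  exact h2

theorem integral_fourierInv_mul_eq {f g : V → ℂ} (hf : Integrable f) (hg : Integrable g) :
    ∫ ξ, 𝓕⁻ f ξ * g ξ = ∫ x, f x * 𝓕⁻ g x := by
  have h2 := VectorFourier.integral_fourierIntegral_smul_eq_flip (L := -innerₗ V) (μ := volume)
    (ν := volume) (f := f) (g := g) Real.continuous_fourierChar
    (by exact continuous_inner.neg) hf hg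
  have h3 : (-innerₗ V).flip = -innerₗ V := by
    ext x y; simp [real_inner_comm]
  rw [h3] at h2
  exact h2

theorem conj_fourier (f : V → ℂ) (ξ : V) :
    (starRingEnd ℂ) (𝓕 f ξ) = 𝓕⁻ (fun x => (starRingEnd ℂ) (f x)) ξ := by
  rw [Real.fourier_eq', Real.fourierInv_eq', ← integral_conj]
  congr 1
  ext x
  rw [smul_eq_mul, smul_eq_mul, map_mul, ← Complex.exp_conj, map_mul, Complex.conj_I,
    Complex.conj_ofReal]
  congr 2
  push_cast; ring

theorem norm_fourier_le (f : V → ℂ) (ξ : V) : ‖𝓕 f ξ‖ ≤ ∫ x, ‖f x‖ := by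
  rw [Real.fourier_eq]
  refine (norm_integral_le_integral_norm _).trans (le_of_eq ?_)
  congr 1; ext x; rw [Circle.norm_smul]

theorem integrable_gaussian_symbol {b : ℂ} (hb : 0 < b.re) :
    Integrable (fun ξ : V => Complex.exp (-b * ‖ξ‖ ^ 2)) := by
  have := GaussianFourier.integrable_cexp_neg_mul_sq_norm_add (V := V) hb 0 0
  simpa using this

theorem integral_gaussian_mul_fourier {b : ℂ} (hb : 0 < b.re) {g h : V → ℂ} (hg : Integrable g)
    (hh : Integrable h) :
    ∫ ξ, Complex.exp (-b * ‖ξ‖ ^ 2) * (𝓕 g ξ * (starRingEnd ℂ) (𝓕 h ξ)) =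
      ∫ y, g y * ∫ x, gaussianKernel V b (x - y) * (starRingEnd ℂ) (h x) := by
  have hh' : Integrable (fun x => (starRingEnd ℂ) (h x)) :=
    Complex.conjLIE.toContinuousLinearEquiv.toContinuousLinearMap.integrable_comp hh
  have hm := integrable_gaussian_symbol (V := V) hb
  have hbd : ∀ ξ, ‖(starRingEnd ℂ) (𝓕 h ξ)‖ ≤ ∫ x, ‖h x‖ := fun ξ => by
    rw [RCLike.norm_conj]; exact norm_fourier_le h ξ
  have hc : Continuous fun ξ => (starRingEnd ℂ) (𝓕 h ξ) :=
    Complex.continuous_conj.comp (continuous_fourier_of_integrable hh)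
  have hw : Integrable (fun ξ => Complex.exp (-b * ‖ξ‖ ^ 2) * (starRingEnd ℂ) (𝓕 h ξ)) := by
    have := hm.bdd_mul (c := ∫ x, ‖h x‖) hc.aestronglyMeasurable (ae_of_all _ hbd)
    simpa [mul_comm] using this
  have e1 : ∫ ξ, Complex.exp (-b * ‖ξ‖ ^ 2) * (𝓕 g ξ * (starRingEnd ℂ) (𝓕 h ξ)) =
      ∫ ξ, 𝓕 g ξ * (Complex.exp (-b * ‖ξ‖ ^ 2) * (starRingEnd ℂ) (𝓕 h ξ)) := by
    congr 1; ext ξ; ring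
  rw [e1, integral_fourier_mul_eq hg hw]
  congr 1
  ext y
  congr 1
  rw [Real.fourier_eq']
  set my : V → ℂ := fun ξ =>
    Complex.exp (((-2 * Real.pi * inner ℝ ξ y : ℝ) : ℂ) * Complex.I) * Complex.exp (-b * ‖ξ‖ ^ 2)
    with hmy
  have hmyi : Integrable my := by
    refine hm.bdd_mul (c := 1) ?_ (ae_of_all _ fun ξ => (Complex.norm_exp_ofReal_mul_I _).le)
    exact (by fun_prop : Continuous _).aestronglyMeasurable
  have e2 : ∀ ξ, Complex.exp (((-2 * Real.pi * inner ℝ ξ y : ℝ) : ℂ) * Complex.I) •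
      (Complex.exp (-b * ‖ξ‖ ^ 2) * (starRingEnd ℂ) (𝓕 h ξ)) =
      𝓕⁻ (fun x => (starRingEnd ℂ) (h x)) ξ * my ξ := by
    intro ξ
    rw [conj_fourier, smul_eq_mul]; simp only [hmy]; ring
  simp_rw [e2]
  rw [integral_fourierInv_mul_eq hh' hmyi]
  congr 1
  ext x
  rw [mul_comm]
  congr 1
  rw [Real.fourierInv_eq', gaussianKernel]
  have e3 : ∀ ξ, Complex.exp (((2 * Real.pi * inner ℝ ξ x : ℝ) : ℂ) * Complex.I) • my ξ =
      Complex.exp (-b * ‖ξ‖ ^ 2 + (2 * Real.pi * Complex.I) * inner ℝ (x - y) ξ) := by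
    intro ξ
    simp only [hmy]
    rw [smul_eq_mul, ← Complex.exp_add, ← Complex.exp_add, inner_sub_left, real_inner_comm x,
      real_inner_comm y]
    congr 1
    push_cast; ring
  simp_rw [e3]
  rw [GaussianFourier.integral_cexp_neg_mul_sq_norm_add hb]
  congr 2
  have hb0 : b ≠ 0 := by rintro rfl; simp at hb
  field_simp
  rw [Complex.I_sq]; ring

/-- The dispersive representation formula: the multiplier `e^{-b|ξ|²}` with `b` on the imaginary
axis, as the limit of the Gaussian multipliers with `Re b > 0`. -/
theorem integral_symbol_mul_fourier {β : ℝ} (hβ : β ≠ 0) {g h : V → ℂ} (hg : Integrable g)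
    (hg2 : MemLp g 2 volume) (hh : Integrable h) (hh2 : MemLp h 2 volume) :
    ∫ ξ, Complex.exp (-(β * Complex.I) * ‖ξ‖ ^ 2) * (𝓕 g ξ * (starRingEnd ℂ) (𝓕 h ξ)) =
      ∫ y, g y * ∫ x, gaussianKernel V (β * Complex.I) (x - y) * (starRingEnd ℂ) (h x) := by
  set b : ℝ → ℂ := fun κ => κ + β * Complex.I with hbdef
  have hbre : ∀ κ, (b κ).re = κ := fun κ => by simp [hbdef]
  have hbn : ∀ κ, |β| ≤ ‖b κ‖ := fun κ => by
    have := Complex.abs_im_le_norm (b κ)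
    simpa [hbdef] using this
  have hβ0 : 0 < |β| := abs_pos.2 hβ
  have hbne : ∀ κ, b κ ≠ 0 := fun κ h0 => by
    have := hbn κ
    rw [h0, norm_zero] at this; linarith
  have hbc : Continuous b := by simp only [hbdef]; fun_prop
  have hb0 : b 0 = β * Complex.I := by simp [hbdef]
  set A : ℝ := (Real.pi / |β|) ^ ((Module.finrank ℝ V : ℝ) / 2) with hA
  have hKb : ∀ κ, 0 ≤ κ → ∀ z : V, ‖gaussianKernel V (b κ) z‖ ≤ A := by
    intro κ hκ z
    refine (norm_gaussianKernel_le (by rw [hbre]; exact hκ) z).trans ?_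
    simp only [hA]
    have := hbn κ
    gcongr
  have hKc : ∀ z : V, Continuous fun κ => gaussianKernel V (b κ) z := by
    intro z
    simp only [gaussianKernel]
    refine Continuous.mul ?_ ?_
    · refine Continuous.cpow (continuous_const.div hbc hbne) continuous_const ?_
      intro κ
      right
      rw [Complex.div_im]
      have h1 : (b κ).im = β := by simp [hbdef]
      rw [h1]
      simp only [Complex.ofReal_im, Complex.ofReal_re, zero_mul, zero_div, zero_sub, neg_ne_zero]
      have : Complex.normSq (b κ) ≠ 0 := by simpa using hbne κ
      have := Real.pi_ne_zero
      positivity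
    · exact Complex.continuous_exp.comp (continuous_const.div hbc hbne)
  have hKz : ∀ κ, Continuous (gaussianKernel V (b κ)) := by
    intro κ
    unfold gaussianKernel; fun_prop
  have hh' : Integrable (fun x => (starRingEnd ℂ) (h x)) :=
    Complex.conjLIE.toContinuousLinearEquiv.toContinuousLinearMap.integrable_comp hh
  have hfc : Continuous fun ξ => 𝓕 g ξ * (starRingEnd ℂ) (𝓕 h ξ) :=
    (continuous_fourier_of_integrable hg).mul
      (Complex.continuous_conj.comp (continuous_fourier_of_integrable hh))
  have hgh : Integrable fun ξ => 𝓕 g ξ * (starRingEnd ℂ) (𝓕 h ξ) := by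
    have h1 := memLp_fourier hg hg2
    have h2 := memLp_fourier hh hh2
    have h3 := h1.norm.integrable_mul h2.norm
    refine h3.mono hfc.aestronglyMeasurable (ae_of_all _ fun ξ => ?_)
    simp
  have L1 : Tendsto (fun κ => ∫ ξ, Complex.exp (-(b κ) * ‖ξ‖ ^ 2) *
      (𝓕 g ξ * (starRingEnd ℂ) (𝓕 h ξ))) (𝓝[>] 0)
      (𝓝 (∫ ξ, Complex.exp (-(b 0) * ‖ξ‖ ^ 2) * (𝓕 g ξ * (starRingEnd ℂ) (𝓕 h ξ)))) := by
    refine tendsto_integral_filter_of_dominated_convergence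
      (fun ξ => ‖𝓕 g ξ * (starRingEnd ℂ) (𝓕 h ξ)‖) ?_ ?_ hgh.norm ?_
    · filter_upwards with κ
      exact (Continuous.mul (by fun_prop) hfc).aestronglyMeasurable
    · filter_upwards [self_mem_nhdsWithin] with κ hκ
      filter_upwards with ξ
      rw [norm_mul]
      refine mul_le_of_le_one_left (norm_nonneg _) ?_
      rw [Complex.norm_exp, Real.exp_le_one_iff]
      have : (-(b κ) * (‖ξ‖ : ℂ) ^ 2).re = -κ * ‖ξ‖ ^ 2 := by
        rw [← Complex.ofReal_pow, Complex.re_mul_ofReal, Complex.neg_re, hbre]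
      rw [this]
      have : (0 : ℝ) < κ := hκ
      nlinarith [sq_nonneg ‖ξ‖]
    · filter_upwards with ξ
      refine Tendsto.mul_const _ ?_
      have : Continuous fun κ => Complex.exp (-(b κ) * ‖ξ‖ ^ 2) := by fun_prop
      exact (this.tendsto 0).mono_left nhdsWithin_le_nhds
  have L2 : Tendsto (fun κ => ∫ y, g y * ∫ x, gaussianKernel V (b κ) (x - y) *
      (starRingEnd ℂ) (h x)) (𝓝[>] 0)
      (𝓝 (∫ y, g y * ∫ x, gaussianKernel V (b 0) (x - y) * (starRingEnd ℂ) (h x))) := by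
    have hinb : ∀ κ, 0 ≤ κ → ∀ y, ‖∫ x, gaussianKernel V (b κ) (x - y) * (starRingEnd ℂ) (h x)‖ ≤
        A * ∫ x, ‖h x‖ := by
      intro κ hκ y
      rw [← integral_const_mul]
      refine norm_integral_le_of_norm_le (hh.norm.const_mul A) (ae_of_all _ fun x => ?_)
      rw [norm_mul, RCLike.norm_conj]
      exact mul_le_mul_of_nonneg_right (hKb κ hκ _) (norm_nonneg _)
    refine tendsto_integral_filter_of_dominated_convergence
      (fun y => ‖g y‖ * (A * ∫ x, ‖h x‖)) ?_ ?_ (hg.norm.mul_const _) ?_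
    · filter_upwards with κ
      refine hg.aestronglyMeasurable.mul ?_
      have : AEStronglyMeasurable (fun p : V × V =>
          gaussianKernel V (b κ) (p.2 - p.1) * (starRingEnd ℂ) (h p.2))
          ((volume : Measure V).prod volume) := by
        refine AEStronglyMeasurable.mul ?_ ?_
        · exact ((hKz κ).comp (continuous_snd.sub continuous_fst)).aestronglyMeasurable
        · exact hh'.aestronglyMeasurable.comp_snd
      exact this.integral_prod_right'
    · filter_upwards [self_mem_nhdsWithin] with κ hκ
      filter_upwards with y
      rw [norm_mul]
      exact mul_le_mul_of_nonneg_left (hinb κ (le_of_lt hκ) y) (norm_nonneg _)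
    · filter_upwards with y
      refine Tendsto.const_mul _ ?_
      refine tendsto_integral_filter_of_dominated_convergence
        (fun x => A * ‖h x‖) ?_ ?_ (hh.norm.const_mul _) ?_
      · filter_upwards with κ
        exact (((hKz κ).comp (continuous_id.sub continuous_const)).aestronglyMeasurable).mul
          hh'.aestronglyMeasurable
      · filter_upwards [self_mem_nhdsWithin] with κ hκ
        filter_upwards with x
        rw [norm_mul, RCLike.norm_conj]
        exact mul_le_mul_of_nonneg_right (hKb κ (le_of_lt hκ) _) (norm_nonneg _)
      · filter_upwards with x
        refine Tendsto.mul_const _ ?_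
        exact ((hKc (x - y)).tendsto 0).mono_left nhdsWithin_le_nhds
  rw [hb0] at L1 L2
  refine tendsto_nhds_unique L1 (L2.congr' ?_)
  filter_upwards [self_mem_nhdsWithin] with κ hκ
  exact (integral_gaussian_mul_fourier (by rw [hbre]; exact hκ) hg hh).symm

end Kernel

/-- The constant `(i/4π)^{d/2}` of the Schrödinger kernel. -/
def kernelConst (d : ℕ) : ℂ := (Complex.I / (4 * Real.pi)) ^ ((d : ℂ) / 2)

theorem gaussianKernel_imaginary (d : ℕ) {τ : ℝ} (hτ : 0 < τ) (z : Rd d) :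
    gaussianKernel (Rd d) (((-(4 * Real.pi ^ 2 * τ) : ℝ) : ℂ) * Complex.I) z =
      kernelConst d * ((τ ^ (-((d : ℝ) / 2)) : ℝ) : ℂ) *
        Complex.exp (((-(‖z‖ ^ 2 / 4) / τ : ℝ) : ℂ) * Complex.I) := by
  have hπ : (Real.pi : ℂ) ≠ 0 := Complex.ofReal_ne_zero.2 Real.pi_ne_zero
  have hτ' : (τ : ℂ) ≠ 0 := Complex.ofReal_ne_zero.2 hτ.ne'
  have e1 : (Real.pi : ℂ) / (((-(4 * Real.pi ^ 2 * τ) : ℝ) : ℂ) * Complex.I) =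
      ((τ⁻¹ : ℝ) : ℂ) * (Complex.I / (4 * Real.pi)) := by
    push_cast
    field_simp
    rw [Complex.I_sq]
  have e2 : -(Real.pi : ℂ) ^ 2 * (‖z‖ : ℂ) ^ 2 / (((-(4 * Real.pi ^ 2 * τ) : ℝ) : ℂ) * Complex.I) =
      ((-(‖z‖ ^ 2 / 4) / τ : ℝ) : ℂ) * Complex.I := by
    push_cast
    field_simp
    rw [Complex.I_sq]; ring
  have hne : Complex.I / (4 * (Real.pi : ℂ)) ≠ 0 :=
    div_ne_zero Complex.I_ne_zero (mul_ne_zero (by norm_num) hπ)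
  have e3 : (((τ⁻¹ : ℝ) : ℂ) * (Complex.I / (4 * Real.pi))) ^ ((d : ℂ) / 2) =
      kernelConst d * ((τ ^ (-((d : ℝ) / 2)) : ℝ) : ℂ) := by
    have hne2 : ((τ⁻¹ : ℝ) : ℂ) ≠ 0 := Complex.ofReal_ne_zero.2 (inv_pos.2 hτ).ne'
    rw [kernelConst, Complex.cpow_def_of_ne_zero (mul_ne_zero hne2 hne),
      Complex.cpow_def_of_ne_zero hne, Complex.log_ofReal_mul (inv_pos.2 hτ) hne,
      Real.rpow_def_of_pos hτ, Complex.ofReal_exp, ← Complex.exp_add, Real.log_inv]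
    congr 1
    push_cast; ring
  rw [gaussianKernel, finrank_euclideanSpace_fin, e1, e2, e3]

/-! ### Functions supported in a bounded time interval and a set of finite measure -/

/-- A jointly measurable function of time and space, bounded by `B`, that vanishes outside
`(0, T] × E`. -/
structure IsSlab {Z : Type*} [MeasurableSpace Z] (T B : ℝ) (E : Set Z) (F : ℝ → Z → ℂ) :
    Prop where
  meas : Measurable (Function.uncurry F)
  bound : ∀ t z, ‖F t z‖ ≤ B
  time : ∀ t z, t ∉ Set.Ioc 0 T → F t z = 0
  space : ∀ t z, z ∉ E → F t z = 0

theorem memLp_of_bounded {X G : Type*} [MeasurableSpace X] [NormedAddCommGroup G]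
    [MeasurableSpace G] [BorelSpace G] [SecondCountableTopology G] {μ : Measure X} {f : X → G}
    (hf : Measurable f) {B : ℝ} (hB : ∀ x, ‖f x‖ ≤ B) {S : Set X} (hSm : MeasurableSet S)
    (hS : μ S < ∞) (h0 : ∀ x, x ∉ S → f x = 0) (p : ℝ≥0∞) : MemLp f p μ := by
  have h1 : MemLp (S.indicator fun _ => B) p μ := memLp_indicator_const p hSm B (Or.inr hS.ne)
  refine h1.mono hf.aestronglyMeasurable (ae_of_all _ fun x => ?_)
  by_cases hx : x ∈ S
  · rw [Set.indicator_of_mem hx]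
    exact (hB x).trans (le_abs_self _)
  · rw [h0 x hx, norm_zero]; exact norm_nonneg _

namespace IsSlab

variable {Z : Type*} [MeasurableSpace Z] {T B : ℝ} {E : Set Z} {F : ℝ → Z → ℂ}

theorem measurable_left (h : IsSlab T B E F) (t : ℝ) : Measurable (F t) :=
  h.meas.comp measurable_prodMk_left

theorem measurable_right (h : IsSlab T B E F) (z : Z) : Measurable fun t => F t z :=
  h.meas.comp measurable_prodMk_right

theorem memLp_time (h : IsSlab T B E F) (z : Z) (p : ℝ≥0∞) : MemLp (fun t => F t z) p volume :=
  memLp_of_bounded (h.measurable_right z) (fun t => h.bound t z) measurableSet_Ioc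
    measure_Ioc_lt_top (fun t ht => h.time t z ht) p

theorem memLp_space (h : IsSlab T B E F) {μ : Measure Z} (hE : MeasurableSet E) (hμ : μ E < ∞)
    (t : ℝ) (p : ℝ≥0∞) : MemLp (F t) p μ :=
  memLp_of_bounded (h.measurable_left t) (fun z => h.bound t z) hE hμ
    (fun z hz => h.space t z hz) p

theorem memLp (h : IsSlab T B E F) {μ : Measure Z} [SFinite μ] (hE : MeasurableSet E)
    (hμ : μ E < ∞) (p : ℝ≥0∞) : MemLp (Function.uncurry F) p (volume.prod μ) := by
  refine memLp_of_bounded (B := B) (S := Set.Ioc 0 T ×ˢ E) h.meas (fun x => h.bound x.1 x.2)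
    (measurableSet_Ioc.prod hE) ?_ (fun x hx => ?_) p
  · rw [Measure.prod_prod]
    exact ENNReal.mul_lt_top measure_Ioc_lt_top hμ
  · rw [Set.mem_prod, not_and_or] at hx
    rcases hx with hx | hx
    · exact h.time _ _ hx
    · exact h.space _ _ hx

theorem mul (h : IsSlab T B E F) {w : Z → ℂ} (hw : Measurable w) {B' : ℝ}
    (hB' : ∀ z ∈ E, ‖w z‖ ≤ B') (hB0 : 0 ≤ B') : IsSlab T (B' * B) E (fun t z => w z * F t z) where
  meas := (hw.comp measurable_snd).mul h.meas
  bound t z := by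
    by_cases hz : z ∈ E
    · rw [norm_mul]
      exact mul_le_mul (hB' z hz) (h.bound t z) (norm_nonneg _) hB0
    · rw [h.space t z hz, mul_zero, norm_zero]
      exact mul_nonneg hB0 ((norm_nonneg _).trans (h.bound t z))
  time t z ht := by rw [h.time t z ht, mul_zero]
  space t z hz := by rw [h.space t z hz, mul_zero]

theorem integrable_norm_sq (h : IsSlab T B E F) {μ : Measure Z} [SFinite μ] (hE : MeasurableSet E)
    (hμ : μ E < ∞) : Integrable (fun x : ℝ × Z => ‖F x.1 x.2‖ ^ 2) (volume.prod μ) := by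
  have := h.memLp hE hμ 2
  exact (memLp_two_iff_integrable_sq_norm this.1).1 this

/-- The spatial Fourier transform of a slab function. -/
theorem fourier {d : ℕ} {E : Set (Rd d)} {F : ℝ → Rd d → ℂ} (h : IsSlab T B E F)
    (hE : MeasurableSet E) (hμ : volume E < ∞) :
    IsSlab T (B * volume.real E) Set.univ (fun t ξ => 𝓕 (F t) ξ) where
  meas := by
    have h1 : StronglyMeasurable fun p : (ℝ × Rd d) × Rd d =>
        Complex.exp (((-2 * Real.pi * inner ℝ p.2 p.1.2 : ℝ) : ℂ) * Complex.I) * F p.1.1 p.2 := by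
      refine StronglyMeasurable.mul ?_ ?_
      · exact (by fun_prop : Continuous fun p : (ℝ × Rd d) × Rd d =>
          Complex.exp (((-2 * Real.pi * inner ℝ p.2 p.1.2 : ℝ) : ℂ) * Complex.I)).stronglyMeasurable
      · exact (h.meas.comp ((measurable_fst.comp measurable_fst).prodMk
          measurable_snd)).stronglyMeasurable
    have h2 := (h1.integral_prod_right' (ν := volume)).measurable
    convert h2 using 1
    ext p
    simp only [Function.uncurry]
    rw [Real.fourier_eq']
    rfl
  bound t ξ := by
    refine (norm_fourier_le _ _).trans ?_
    have : ∫ x, ‖F t x‖ ≤ ∫ x, E.indicator (fun _ => B) x := by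
      refine integral_mono (memLp_one_iff_integrable.1 (h.memLp_space hE hμ t 1)).norm
        (integrableOn_const hμ.ne |>.integrable_indicator hE) fun x => ?_
      simp only
      by_cases hx : x ∈ E
      · rw [Set.indicator_of_mem hx]; exact h.bound t x
      · rw [Set.indicator_of_notMem hx, h.space t x hx, norm_zero]
    rw [integral_indicator hE, setIntegral_const, smul_eq_mul, mul_comm] at this
    exact this
  time t ξ ht := by
    rw [Real.fourier_eq']
    simp [h.time t _ ht]
  space t ξ hξ := absurd (Set.mem_univ ξ) hξ

theorem integral_norm_sq_fourier {d : ℕ} {E : Set (Rd d)} {F : ℝ → Rd d → ℂ} (h : IsSlab T B E F)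
    (hE : MeasurableSet E) (hμ : volume E < ∞) (t : ℝ) :
    ∫ ξ, ‖𝓕 (F t) ξ‖ ^ 2 = ∫ x, ‖F t x‖ ^ 2 :=
  SNLS.integral_norm_sq_fourier (memLp_one_iff_integrable.1 (h.memLp_space hE hμ t 1))
    (h.memLp_space hE hμ t 2)

theorem integrable_norm_sq_fourier {d : ℕ} {E : Set (Rd d)} {F : ℝ → Rd d → ℂ}
    (h : IsSlab T B E F) (hE : MeasurableSet E) (hμ : volume E < ∞) :
    Integrable (fun x : ℝ × Rd d => ‖𝓕 (F x.1) x.2‖ ^ 2) (volume.prod volume) := by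
  have hm := (h.fourier hE hμ).meas
  have hms : AEStronglyMeasurable (fun x : ℝ × Rd d => ‖𝓕 (F x.1) x.2‖ ^ 2)
      (volume.prod volume) := (hm.norm.pow_const 2).aestronglyMeasurable
  rw [integrable_prod_iff hms]
  constructor
  · filter_upwards with t
    have := memLp_fourier (memLp_one_iff_integrable.1 (h.memLp_space hE hμ t 1)) (h.memLp_space hE hμ t 2)
    exact (memLp_two_iff_integrable_sq_norm this.1).1 this
  · have e : ∀ t, ∫ ξ, ‖‖𝓕 (F t) ξ‖ ^ 2‖ = ∫ x, ‖F t x‖ ^ 2 := fun t => by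
      rw [← h.integral_norm_sq_fourier hE hμ t]
      congr 1; ext ξ
      rw [Real.norm_of_nonneg (by positivity)]
    simp_rw [e]
    exact (h.integrable_norm_sq hE hμ).integral_prod_left

end IsSlab

theorem integral_sqrt_mul_sqrt_le {Z : Type*} [MeasurableSpace Z] {μ : Measure Z} {f g : Z → ℝ}
    (hf : Integrable f μ) (hg : Integrable g μ) (hf0 : ∀ z, 0 ≤ f z) (hg0 : ∀ z, 0 ≤ g z) :
    ∫ z, √(f z) * √(g z) ∂μ ≤ √(∫ z, f z ∂μ) * √(∫ z, g z ∂μ) := by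
  have hF : ∀ {f : Z → ℝ}, Integrable f μ → (∀ z, 0 ≤ f z) → MemLp (fun z => ((√(f z) : ℝ) : ℂ)) 2 μ := by
    intro f hf hf0
    have hm : AEStronglyMeasurable (fun z => ((√(f z) : ℝ) : ℂ)) μ :=
      (Complex.continuous_ofReal.comp Real.continuous_sqrt).comp_aestronglyMeasurable
        hf.aestronglyMeasurable
    rw [memLp_two_iff_integrable_sq_norm hm]
    refine hf.congr (ae_of_all _ fun z => ?_)
    simp [Real.sq_sqrt (hf0 z)]
  have key := norm_integral_mul_conj_le (hF hf hf0) (hF hg hg0)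
  simp only [Complex.conj_ofReal, Complex.norm_real, Real.norm_eq_abs, sq_abs] at key
  simp_rw [fun z => Real.sq_sqrt (hf0 z), fun z => Real.sq_sqrt (hg0 z), ← Complex.ofReal_mul] at key
  rw [integral_complex_ofReal, Complex.norm_real] at key
  exact (le_abs_self _).trans key

/-! ### An entire family of integrals -/

/-- An integral of exponentials `e^{ζ a(x)}` with bounded exponents is entire in `ζ`. -/
theorem differentiable_integral_exp_mul {X : Type*} [MeasurableSpace X] {μ : Measure X}
    {a : X → ℝ} {b : X → ℂ} (ha : Measurable a) {A : ℝ} (hA : ∀ x, |a x| ≤ A)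
    (hb : Integrable b μ) :
    Differentiable ℂ fun ζ : ℂ => ∫ x, Complex.exp (ζ * a x) * b x ∂μ := by
  intro ζ₀
  have hexp : ∀ ζ : ℂ, ∀ x, ‖Complex.exp (ζ * a x)‖ ≤ Real.exp (‖ζ‖ * A) := by
    intro ζ x
    rw [Complex.norm_exp]
    apply Real.exp_le_exp.2
    refine (Complex.re_le_norm _).trans ?_
    rw [norm_mul, Complex.norm_real, Real.norm_eq_abs]
    exact mul_le_mul_of_nonneg_left (hA x) (norm_nonneg _)
  have hm : ∀ ζ : ℂ, Measurable fun x => Complex.exp (ζ * a x) := fun ζ =>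
    Complex.measurable_exp.comp ((Complex.measurable_ofReal.comp ha).const_mul ζ)
  have key := hasDerivAt_integral_of_dominated_loc_of_deriv_le (μ := μ) (x₀ := ζ₀)
    (s := Metric.ball ζ₀ 1)
    (F := fun ζ x => Complex.exp (ζ * a x) * b x)
    (F' := fun ζ x => Complex.exp (ζ * a x) * (a x) * b x)
    (bound := fun x => Real.exp ((‖ζ₀‖ + 1) * A) * A * ‖b x‖)
    (Metric.ball_mem_nhds ζ₀ one_pos)
    (Eventually.of_forall fun ζ => (hm ζ).aestronglyMeasurable.mul hb.aestronglyMeasurable)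
    (hb.bdd_mul (hm ζ₀).aestronglyMeasurable (ae_of_all _ (hexp ζ₀)))
    ((((hm ζ₀).mul (Complex.measurable_ofReal.comp ha)).aestronglyMeasurable).mul
      hb.aestronglyMeasurable)
    (ae_of_all _ fun x ζ hζ => ?_) (hb.norm.const_mul _) (ae_of_all _ fun x ζ _ => ?_)
  · exact key.2.differentiableAt
  · have h1 : ‖ζ‖ ≤ ‖ζ₀‖ + 1 := by
      have := norm_sub_norm_le ζ ζ₀
      rw [Metric.mem_ball, dist_eq_norm] at hζ
      linarith
    have hA0 : 0 ≤ A := (abs_nonneg _).trans (hA x)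
    rw [norm_mul, norm_mul, Complex.norm_real, Real.norm_eq_abs]
    refine mul_le_mul_of_nonneg_right ?_ (norm_nonneg _)
    refine mul_le_mul ((hexp ζ x).trans ?_) (hA x) (abs_nonneg _) (Real.exp_pos _).le
    exact Real.exp_le_exp.2 (mul_le_mul_of_nonneg_right h1 hA0)
  · have h1 : HasDerivAt (fun ζ : ℂ => ζ * (a x : ℂ)) (1 * (a x : ℂ)) ζ :=
      (hasDerivAt_id ζ).mul_const _
    rw [one_mul] at h1
    exact h1.cexp.mul_const _

/-- The three lines theorem for a family whose boundary values blow up like `1/|η|` at the corners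
`0` and `1` of the strip. The theorem is applied to `ζ(1-ζ)(ζ+1)^{-3} Φ(ζ)`: the zeros at the
corners absorb the singularities, and the decay absorbs the growth in `|η|`. -/
theorem norm_le_of_three_lines_singular {Φ : ℂ → ℂ} (hd : Differentiable ℂ Φ) {A : ℝ}
    (hA : ∀ ζ : ℂ, 0 ≤ ζ.re → ζ.re ≤ 1 → ‖Φ ζ‖ ≤ A) {M U : ℝ} (hM : 0 ≤ M) (hU : 0 ≤ U)
    (h0 : ∀ η : ℝ, η ≠ 0 → ‖Φ (η * Complex.I)‖ ≤ M * (1 + |η| + 1 / |η|))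
    (h1 : ∀ η : ℝ, η ≠ 0 → ‖Φ (1 + η * Complex.I)‖ ≤ M * U * (1 + |η| + 1 / |η|))
    {θ : ℝ} (hθ0 : 0 < θ) (hθ1 : θ < 1) :
    ‖Φ θ‖ ≤ 8 / (θ * (1 - θ)) * 2 * (M * U ^ θ) := by
  set g : ℂ → ℂ := fun ζ => ζ * (1 - ζ) / (ζ + 1) ^ 3 with hg
  have hne : ∀ ζ : ℂ, 0 ≤ ζ.re → ζ + 1 ≠ 0 := by
    intro ζ hζ h
    have := congrArg Complex.re h
    simp at this; linarith
  have hsq : ∀ x y : ℝ, ‖(x : ℂ) + y * Complex.I‖ ^ 2 = x ^ 2 + y ^ 2 := by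
    intro x y
    rw [← Complex.normSq_eq_norm_sq, Complex.normSq_add_mul_I]
  have hgb : ∀ ζ : ℂ, 0 ≤ ζ.re → ζ.re ≤ 1 → ‖g ζ‖ ≤ 1 := by
    intro ζ h0 h1
    have e0 := hsq ζ.re ζ.im
    have e1 := hsq (1 - ζ.re) (-ζ.im)
    have e2 := hsq (ζ.re + 1) ζ.im
    have f1 : ((1 - ζ.re : ℝ) : ℂ) + ((-ζ.im : ℝ) : ℂ) * Complex.I = 1 - ζ := by
      nth_rewrite 3 [← Complex.re_add_im ζ]; push_cast; ring
    have f2 : ((ζ.re + 1 : ℝ) : ℂ) + (ζ.im : ℂ) * Complex.I = ζ + 1 := by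
      nth_rewrite 3 [← Complex.re_add_im ζ]; push_cast; ring
    rw [Complex.re_add_im] at e0
    rw [f1] at e1
    rw [f2] at e2
    have n1 : 1 ≤ ‖ζ + 1‖ := by
      nlinarith [norm_nonneg (ζ + 1), sq_nonneg ζ.im]
    have n2 : ‖ζ‖ ≤ ‖ζ + 1‖ := by
      apply le_of_sq_le_sq _ (norm_nonneg _)
      rw [e0, e2]; nlinarith
    have n3 : ‖1 - ζ‖ ≤ ‖ζ + 1‖ := by
      apply le_of_sq_le_sq _ (norm_nonneg _)
      rw [e1, e2]; nlinarith
    simp only [hg, norm_div, norm_mul, norm_pow]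
    rw [div_le_one (by positivity)]
    calc ‖ζ‖ * ‖1 - ζ‖ ≤ ‖ζ + 1‖ * ‖ζ + 1‖ := by gcongr
      _ ≤ ‖ζ + 1‖ ^ 3 := by nlinarith [norm_nonneg (ζ + 1)]
  have hedge : ∀ η : ℝ, η ≠ 0 → |η| / (1 + η ^ 2) * (1 + |η| + 1 / |η|) ≤ 2 := by
    intro η hη
    have h : 0 < |η| := abs_pos.2 hη
    have h2 : η ^ 2 = |η| ^ 2 := (sq_abs η).symm
    rw [h2]
    have : |η| / (1 + |η| ^ 2) * (1 + |η| + 1 / |η|) = (|η| + |η| ^ 2 + 1) / (1 + |η| ^ 2) := by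
      field_simp
    rw [this, div_le_iff₀ (by positivity)]
    nlinarith [sq_nonneg (|η| - 1)]
  have hg0 : ∀ η : ℝ, ‖g (η * Complex.I)‖ = |η| / (1 + η ^ 2) := by
    intro η
    have e1 := hsq 1 (-η)
    have e2 := hsq 1 η
    have f1 : ((1 : ℝ) : ℂ) + ((-η : ℝ) : ℂ) * Complex.I = 1 - η * Complex.I := by push_cast; ring
    have f2 : ((1 : ℝ) : ℂ) + (η : ℂ) * Complex.I = η * Complex.I + 1 := by push_cast; ring
    rw [f1] at e1
    rw [f2] at e2
    have e3 : ‖1 - (η : ℂ) * Complex.I‖ = ‖(η : ℂ) * Complex.I + 1‖ := by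
      apply (sq_eq_sq₀ (norm_nonneg _) (norm_nonneg _)).1
      rw [e1, e2]; ring
    have hpos : 0 < ‖(η : ℂ) * Complex.I + 1‖ := by
      rw [norm_pos_iff]; apply hne; simp
    simp only [hg, norm_div, norm_mul, norm_pow, e3, Complex.norm_real, Complex.norm_I, mul_one,
      Real.norm_eq_abs]
    rw [show 1 + η ^ 2 = ‖(η : ℂ) * Complex.I + 1‖ ^ 2 by rw [e2]; ring]
    field_simp
  have hg1 : ∀ η : ℝ, ‖g (1 + η * Complex.I)‖ ≤ |η| / (1 + η ^ 2) := by
    intro η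
    have e1 := hsq 1 η
    have e2 := hsq 2 η
    have f1 : ((1 : ℝ) : ℂ) + (η : ℂ) * Complex.I = 1 + η * Complex.I := by push_cast; ring
    have f2 : ((2 : ℝ) : ℂ) + (η : ℂ) * Complex.I = 1 + η * Complex.I + 1 := by push_cast; ring
    have f3 : (1 : ℂ) - (1 + η * Complex.I) = -(η * Complex.I) := by ring
    rw [f1] at e1
    rw [f2] at e2
    have hle : ‖1 + (η : ℂ) * Complex.I‖ ≤ ‖1 + (η : ℂ) * Complex.I + 1‖ := by
      apply le_of_sq_le_sq _ (norm_nonneg _)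
      rw [e1, e2]; linarith
    have hpos : 0 < ‖1 + (η : ℂ) * Complex.I‖ := by
      have : 0 < ‖1 + (η : ℂ) * Complex.I‖ ^ 2 := by rw [e1]; positivity
      exact lt_of_le_of_ne (norm_nonneg _) fun h => by rw [← h] at this; norm_num at this
    simp only [hg, norm_div, norm_mul, norm_pow, f3, norm_neg, Complex.norm_real, Complex.norm_I,
      mul_one, Real.norm_eq_abs]
    calc ‖1 + (η : ℂ) * Complex.I‖ * |η| / ‖1 + (η : ℂ) * Complex.I + 1‖ ^ 3
        ≤ ‖1 + (η : ℂ) * Complex.I‖ * |η| / ‖1 + (η : ℂ) * Complex.I‖ ^ 3 := by gcongr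
      _ = |η| / (1 + η ^ 2) := by
          rw [show 1 + η ^ 2 = ‖1 + (η : ℂ) * Complex.I‖ ^ 2 by rw [e1]; ring]
          field_simp
  have key := Complex.HadamardThreeLines.norm_le_interp_of_mem_verticalClosedStrip₀₁'
    (fun ζ => g ζ * Φ ζ) (z := (θ : ℂ)) (a := 2 * M) (b := 2 * (M * U))
    ⟨by simpa using hθ0.le, by simpa using hθ1.le⟩ ?_ ?_ ?_ ?_
  · simp only [Complex.ofReal_re, norm_mul] at key
    have hgθ : ‖g θ‖ = θ * (1 - θ) / (θ + 1) ^ 3 := by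
      simp only [hg]
      rw [show (θ : ℂ) * (1 - θ) / (θ + 1) ^ 3 = ((θ * (1 - θ) / (θ + 1) ^ 3 : ℝ) : ℂ) by
        push_cast; rfl, Complex.norm_real, Real.norm_of_nonneg]
      have : 0 < 1 - θ := by linarith
      positivity
    have hlow : θ * (1 - θ) / 8 ≤ ‖g θ‖ := by
      rw [hgθ]
      have : 0 < 1 - θ := by linarith
      gcongr
      calc (θ + 1) ^ 3 ≤ (1 + 1) ^ 3 := by gcongr
        _ = 8 := by norm_num
    have e1 : (2 * M) ^ (1 - θ) * (2 * (M * U)) ^ θ = 2 * (M * U ^ θ) := by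
      rw [← mul_assoc 2 M U, Real.mul_rpow (by positivity) hU, ← mul_assoc]
      rcases hM.eq_or_lt with hM0 | hMpos
      · rw [← hM0]; simp [Real.zero_rpow hθ0.ne']
      · rw [← Real.rpow_add (by positivity)]; simp; ring
    rw [e1] at key
    have hpos : 0 < θ * (1 - θ) / 8 := by
      have : 0 < 1 - θ := by linarith
      positivity
    have : θ * (1 - θ) / 8 * ‖Φ θ‖ ≤ 2 * (M * U ^ θ) :=
      (mul_le_mul_of_nonneg_right hlow (norm_nonneg _)).trans key
    have h1θ : (1 - θ) ≠ 0 := by linarith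
    calc ‖Φ θ‖ = 8 / (θ * (1 - θ)) * (θ * (1 - θ) / 8 * ‖Φ θ‖) := by
          field_simp
      _ ≤ 8 / (θ * (1 - θ)) * (2 * (M * U ^ θ)) := by
          have : 0 < 1 - θ := by linarith
          gcongr
      _ = _ := by ring
  · refine DifferentiableOn.diffContOnCl ?_
    have hcl : ∀ ζ ∈ closure (Complex.HadamardThreeLines.verticalStrip 0 1), 0 ≤ ζ.re := by
      intro ζ hζ
      have hc : IsClosed {z : ℂ | 0 ≤ z.re} := isClosed_le continuous_const Complex.continuous_re
      exact closure_minimal (fun z hz => hz.1.le) hc hζ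
    intro ζ hζ
    refine DifferentiableAt.differentiableWithinAt ?_
    refine DifferentiableAt.mul ?_ (hd ζ)
    exact DifferentiableAt.div (by fun_prop) (by fun_prop) (pow_ne_zero _ (hne ζ (hcl ζ hζ)))
  · refine ⟨A, ?_⟩
    rintro _ ⟨ζ, hζ, rfl⟩
    simp only [Function.comp, norm_mul]
    have := hA ζ hζ.1 hζ.2
    calc ‖g ζ‖ * ‖Φ ζ‖ ≤ 1 * A := by
          gcongr
          exact hgb ζ hζ.1 hζ.2
      _ = A := one_mul A
  · intro ζ hζ
    have hζ' : ζ = ζ.im * Complex.I := by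
      have : ζ.re = 0 := hζ
      nth_rewrite 1 [← Complex.re_add_im ζ]
      rw [this]; simp
    rw [hζ', norm_mul, hg0]
    by_cases h : ζ.im = 0
    · rw [h]; simp; exact hM
    · calc |ζ.im| / (1 + ζ.im ^ 2) * ‖Φ (ζ.im * Complex.I)‖
          ≤ |ζ.im| / (1 + ζ.im ^ 2) * (M * (1 + |ζ.im| + 1 / |ζ.im|)) := by
            gcongr
            exact h0 _ h
        _ = M * (|ζ.im| / (1 + ζ.im ^ 2) * (1 + |ζ.im| + 1 / |ζ.im|)) := by ring
        _ ≤ M * 2 := by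
            gcongr
            exact hedge _ h
        _ = 2 * M := by ring
  · intro ζ hζ
    have hζ' : ζ = 1 + ζ.im * Complex.I := by
      have : ζ.re = 1 := hζ
      nth_rewrite 1 [← Complex.re_add_im ζ]
      rw [this]; simp
    rw [hζ', norm_mul]
    by_cases h : ζ.im = 0
    · rw [h]; simp [hg]; positivity
    · calc ‖g (1 + ζ.im * Complex.I)‖ * ‖Φ (1 + ζ.im * Complex.I)‖
          ≤ |ζ.im| / (1 + ζ.im ^ 2) * (M * U * (1 + |ζ.im| + 1 / |ζ.im|)) := by
            gcongr
            · exact hg1 _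
            · exact h1 _ h
        _ = M * U * (|ζ.im| / (1 + ζ.im ^ 2) * (1 + |ζ.im| + 1 / |ζ.im|)) := by ring
        _ ≤ M * U * 2 := by
            gcongr
            exact hedge _ h
        _ = 2 * (M * U) := by ring

/-! ### Bilinear forms with a kernel in time -/

/-- A bounded measurable kernel `κ` supported in `(ε, T]`. -/
structure IsTimeKernel (ε T B : ℝ) (κ : ℝ → ℂ) : Prop where
  meas : Measurable κ
  bound : ∀ t, ‖κ t‖ ≤ B
  supp : ∀ t, t ∉ Set.Ioc ε T → κ t = 0

namespace IsTimeKernel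

variable {ε T B : ℝ} {κ : ℝ → ℂ}

theorem integrable (h : IsTimeKernel ε T B κ) : Integrable κ :=
  memLp_one_iff_integrable.1 (memLp_of_bounded h.meas h.bound measurableSet_Ioc
    measure_Ioc_lt_top h.supp 1)

theorem mul_phase (h : IsTimeKernel ε T B κ) {φ : ℝ → ℝ} (hφ : Measurable φ) :
    IsTimeKernel ε T B (fun t => κ t * Complex.exp ((φ t : ℂ) * Complex.I)) where
  meas := h.meas.mul (by fun_prop)
  bound t := by
    rw [norm_mul, Complex.norm_exp_ofReal_mul_I, mul_one]; exact h.bound t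
  supp t ht := by rw [h.supp t ht, zero_mul]

/-- The multiplier bound for a time convolution, as an integral over `ℝ × ℝ`. -/
theorem norm_integral_prod_le (h : IsTimeKernel ε T B κ) {M : ℝ} (hM : ∀ σ, ‖𝓕 κ σ‖ ≤ M)
    {a b : ℝ → ℂ} (ha : Integrable a) (ha2 : MemLp a 2 volume) (hb : Integrable b)
    (hb2 : MemLp b 2 volume) :
    ‖∫ q : ℝ × ℝ, κ (q.1 - q.2) * (a q.2 * (starRingEnd ℂ) (b q.1))‖ ≤
      M * (√(∫ s, ‖a s‖ ^ 2) * √(∫ t, ‖b t‖ ^ 2)) := by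
  have hint : Integrable (fun q : ℝ × ℝ => κ (q.1 - q.2) * (a q.2 * (starRingEnd ℂ) (b q.1)))
      (volume.prod volume) := by
    have hb' : Integrable fun t => (starRingEnd ℂ) (b t) :=
      (Complex.conjLIE.toContinuousLinearEquiv.toContinuousLinearMap.integrable_comp hb)
    have h1 := (hb'.mul_prod ha).bdd_mul (c := B)
      (f := fun q : ℝ × ℝ => κ (q.1 - q.2))
      (h.meas.comp (measurable_fst.sub measurable_snd)).aestronglyMeasurable
      (ae_of_all _ fun q => h.bound _)
    refine h1.congr (ae_of_all _ fun q => ?_)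
    simp only; ring
  have e : ∫ q : ℝ × ℝ, κ (q.1 - q.2) * (a q.2 * (starRingEnd ℂ) (b q.1)) =
      ∫ t, (∫ s, a s * κ (t - s)) * (starRingEnd ℂ) (b t) := by
    rw [Measure.volume_eq_prod, integral_prod _ hint]
    congr 1; ext t
    rw [← integral_mul_const]
    congr 1; ext s; ring
  rw [e]
  exact norm_integral_convolution_mul_conj_le h.integrable h.bound hM ha ha2 hb hb2

theorem fourier_mul_phase (κ : ℝ → ℂ) (α σ : ℝ) :
    𝓕 (fun t => κ t * Complex.exp (((α * t : ℝ) : ℂ) * Complex.I)) σ =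
      𝓕 κ (σ - α / (2 * Real.pi)) := by
  rw [Real.fourier_eq', Real.fourier_eq']
  congr 1; ext t
  rw [smul_eq_mul, smul_eq_mul, mul_comm (κ t), ← mul_assoc, ← Complex.exp_add, ← add_mul,
    ← Complex.ofReal_add]
  congr 5
  simp only [RCLike.inner_apply, conj_trivial]
  have := Real.pi_ne_zero
  field_simp
  ring

end IsTimeKernel

namespace IsSlab

variable {Z : Type*} [MeasurableSpace Z] {T B B' : ℝ} {E : Set Z} {F H : ℝ → Z → ℂ}

theorem integrable_kernel_mul (hF : IsSlab T B E F) (hH : IsSlab T B' E H) {μ : Measure Z}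
    [SFinite μ] (hE : MeasurableSet E) (hμ : μ E < ∞) {L : (ℝ × ℝ) × Z × Z → ℂ}
    (hL : Measurable L) {D : ℝ} (hD : ∀ p, ‖L p‖ ≤ D) :
    Integrable (fun p : (ℝ × ℝ) × Z × Z =>
      L p * (F p.1.2 p.2.2 * (starRingEnd ℂ) (H p.1.1 p.2.1)))
      ((volume.prod volume).prod (μ.prod μ)) := by
  have h1 : Measurable fun p : (ℝ × ℝ) × Z × Z => F p.1.2 p.2.2 :=
    hF.meas.comp (by fun_prop : Measurable fun p : (ℝ × ℝ) × Z × Z => (p.1.2, p.2.2))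
  have h2 : Measurable fun p : (ℝ × ℝ) × Z × Z => H p.1.1 p.2.1 :=
    hH.meas.comp (by fun_prop : Measurable fun p : (ℝ × ℝ) × Z × Z => (p.1.1, p.2.1))
  refine Integrable.bdd_mul (c := D) ?_ hL.aestronglyMeasurable (ae_of_all _ hD)
  refine memLp_one_iff_integrable.1 (memLp_of_bounded (B := B * B')
    (f := fun p : (ℝ × ℝ) × Z × Z => F p.1.2 p.2.2 * (starRingEnd ℂ) (H p.1.1 p.2.1))
    (S := (Set.Ioc 0 T ×ˢ Set.Ioc 0 T) ×ˢ (E ×ˢ E)) (h1.mul (Complex.continuous_conj.measurable.comp h2))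
    (fun p => ?_) ((measurableSet_Ioc.prod measurableSet_Ioc).prod (hE.prod hE)) ?_
    (fun p hp => ?_) 1)
  · rw [norm_mul, RCLike.norm_conj]
    exact mul_le_mul (hF.bound _ _) (hH.bound _ _) (norm_nonneg _)
      ((norm_nonneg _).trans (hF.bound p.1.2 p.2.2))
  · simp only [Measure.prod_prod]
    exact ENNReal.mul_lt_top (ENNReal.mul_lt_top measure_Ioc_lt_top measure_Ioc_lt_top)
      (ENNReal.mul_lt_top hμ hμ)
  · simp only [Set.mem_prod, not_and_or] at hp
    rcases hp with (h | h) | (h | h)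
    · rw [hH.time _ _ h, map_zero, mul_zero]
    · rw [hF.time _ _ h, zero_mul]
    · rw [hH.space _ _ h, map_zero, mul_zero]
    · rw [hF.space _ _ h, zero_mul]

theorem measurable_integral_norm_sq (hF : IsSlab T B E F) :
    Measurable fun z => ∫ t, ‖F t z‖ ^ 2 := by
  have : StronglyMeasurable fun p : Z × ℝ => ‖F p.2 p.1‖ ^ 2 :=
    ((hF.meas.comp measurable_swap).norm.pow_const 2).stronglyMeasurable
  exact (this.integral_prod_right' (ν := volume)).measurable

theorem integrable_sqrt_integral_norm_sq (hF : IsSlab T B E F) {μ : Measure Z}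
    (hE : MeasurableSet E) (hμ : μ E < ∞) (hT : 0 ≤ T) :
    Integrable (fun z => √(∫ t, ‖F t z‖ ^ 2)) μ := by
  refine memLp_one_iff_integrable.1 (memLp_of_bounded (B := √(B ^ 2 * T))
    (hF.measurable_integral_norm_sq.sqrt) (fun z => ?_) hE hμ (fun z hz => ?_) 1)
  · rw [Real.norm_of_nonneg (Real.sqrt_nonneg _)]
    apply Real.sqrt_le_sqrt
    have : ∫ t, ‖F t z‖ ^ 2 ≤ ∫ t, (Set.Ioc 0 T).indicator (fun _ => B ^ 2) t := by
      refine integral_mono_of_nonneg (ae_of_all _ fun t => by positivity)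
        ((integrableOn_const measure_Ioc_lt_top.ne).integrable_indicator measurableSet_Ioc)
        (ae_of_all _ fun t => ?_)
      simp only
      by_cases ht : t ∈ Set.Ioc 0 T
      · rw [Set.indicator_of_mem ht]
        exact pow_le_pow_left₀ (norm_nonneg _) (hF.bound t z) 2
      · rw [Set.indicator_of_notMem ht, hF.time t z ht]; simp
    refine this.trans (le_of_eq ?_)
    rw [integral_indicator measurableSet_Ioc, setIntegral_const]
    simp [hT, mul_comm]
  · simp [hF.space _ z hz]

/-- The oscillatory bound on the physical side, for fixed space points. -/
theorem norm_integral_spaceKernel_le {d : ℕ} {E : Set (Rd d)} {F H : ℝ → Rd d → ℂ}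
    (hF : IsSlab T B E F) (hH : IsSlab T B' E H) (hE : MeasurableSet E) (hμ : volume E < ∞)
    (hT : 0 ≤ T) {ε D : ℝ} {κ : ℝ → ℂ} (hκ : IsTimeKernel ε T D κ) {M : ℝ}
    (hM : ∀ γ σ : ℝ, ‖𝓕 (fun t => κ t * Complex.exp (((γ / t : ℝ) : ℂ) * Complex.I)) σ‖ ≤ M) :
    ‖∫ p : (ℝ × ℝ) × Rd d × Rd d, κ (p.1.1 - p.1.2) *
        Complex.exp (((-(‖p.2.1 - p.2.2‖ ^ 2 / 4) / (p.1.1 - p.1.2) : ℝ) : ℂ) * Complex.I) *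
        (F p.1.2 p.2.2 * (starRingEnd ℂ) (H p.1.1 p.2.1))
        ∂((volume.prod volume).prod (volume.prod volume))‖ ≤
      M * ((∫ x, √(∫ t, ‖F t x‖ ^ 2)) * ∫ x, √(∫ t, ‖H t x‖ ^ 2)) := by
  have hM0 : 0 ≤ M := (norm_nonneg _).trans (hM 0 0)
  have hint := hF.integrable_kernel_mul hH (μ := volume) hE hμ (D := D)
    (L := fun p : (ℝ × ℝ) × Rd d × Rd d => κ (p.1.1 - p.1.2) *
        Complex.exp (((-(‖p.2.1 - p.2.2‖ ^ 2 / 4) / (p.1.1 - p.1.2) : ℝ) : ℂ) * Complex.I))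
    ((hκ.meas.comp (by fun_prop)).mul (by fun_prop)) (fun p => by
      rw [norm_mul, Complex.norm_exp_ofReal_mul_I, mul_one]; exact hκ.bound _)
  rw [integral_prod_symm _ hint]
  refine (norm_integral_le_integral_norm _).trans ?_
  have hF' := hF.integrable_sqrt_integral_norm_sq hE hμ hT
  have hH' := hH.integrable_sqrt_integral_norm_sq hE hμ hT
  calc ∫ y : Rd d × Rd d, _ ∂(volume.prod volume)
      ≤ ∫ y : Rd d × Rd d, M * (√(∫ t, ‖H t y.1‖ ^ 2) * √(∫ t, ‖F t y.2‖ ^ 2))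
          ∂(volume.prod volume) := by
        refine integral_mono_of_nonneg (ae_of_all _ fun y => norm_nonneg _)
          ((hH'.mul_prod hF').const_mul M) (ae_of_all _ fun y => ?_)
        simp only
        rw [mul_comm √(∫ t, ‖H t y.1‖ ^ 2)]
        have h1 := (hκ.mul_phase (φ := fun t => -(‖y.1 - y.2‖ ^ 2 / 4) / t)
          (by fun_prop)).norm_integral_prod_le (hM (-(‖y.1 - y.2‖ ^ 2 / 4)))
          (memLp_one_iff_integrable.1 (hF.memLp_time y.2 1)) (hF.memLp_time y.2 2)
          (memLp_one_iff_integrable.1 (hH.memLp_time y.1 1)) (hH.memLp_time y.1 2)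
        rw [Measure.volume_eq_prod] at h1
        exact h1
    _ = _ := by
        rw [integral_const_mul, integral_prod_mul (fun x => √(∫ t, ‖H t x‖ ^ 2))
          (fun x => √(∫ t, ‖F t x‖ ^ 2)), mul_comm (∫ x, √(∫ t, ‖H t x‖ ^ 2))]

end IsSlab

/-- The integral kernel of the propagator `e^{-iτΔ}` on `ℝ^d`. -/
def schrodingerKernel (d : ℕ) (τ : ℝ) (z : Rd d) : ℂ :=
  kernelConst d * ((τ ^ (-((d : ℝ) / 2)) : ℝ) : ℂ) *
    Complex.exp (((-(‖z‖ ^ 2 / 4) / τ : ℝ) : ℂ) * Complex.I)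

/-- The sesquilinear form of the propagator on the frequency side,
`⟨e^{-iτΔ} g, h⟩ = ∫ e^{iτ|2πξ|²} ĝ(ξ) conj ĥ(ξ) dξ`. -/
def propagatorForm (d : ℕ) (τ : ℝ) (g h : Rd d → ℂ) : ℂ :=
  ∫ ξ, Complex.exp (((4 * Real.pi ^ 2 * ‖ξ‖ ^ 2 * τ : ℝ) : ℂ) * Complex.I) *
    (𝓕 g ξ * (starRingEnd ℂ) (𝓕 h ξ))

theorem propagatorForm_eq (d : ℕ) {τ : ℝ} (hτ : 0 < τ) {g h : Rd d → ℂ} (hg : Integrable g)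
    (hg2 : MemLp g 2 volume) (hh : Integrable h) (hh2 : MemLp h 2 volume) :
    propagatorForm d τ g h =
      ∫ y, ∫ x, schrodingerKernel d τ (x - y) * (g y * (starRingEnd ℂ) (h x)) := by
  have hβ : -(4 * Real.pi ^ 2 * τ) ≠ 0 := by
    have := Real.pi_pos; have : 0 < 4 * Real.pi ^ 2 * τ := by positivity
    linarith
  have h1 := integral_symbol_mul_fourier hβ hg hg2 hh hh2
  rw [propagatorForm]
  have e : ∀ ξ : Rd d, Complex.exp (((4 * Real.pi ^ 2 * ‖ξ‖ ^ 2 * τ : ℝ) : ℂ) * Complex.I) =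
      Complex.exp (-(((-(4 * Real.pi ^ 2 * τ) : ℝ) : ℂ) * Complex.I) * ‖ξ‖ ^ 2) := by
    intro ξ; congr 1; push_cast; ring
  simp_rw [e]
  rw [h1]
  congr 1; ext y
  rw [← integral_const_mul]
  congr 1; ext x
  rw [gaussianKernel_imaginary d hτ, schrodingerKernel]
  ring

theorem norm_schrodingerKernel_mul_le {d : ℕ} {ε T D : ℝ} (hε : 0 < ε) {κ : ℝ → ℂ}
    (hκ : IsTimeKernel ε T D κ) (τ : ℝ) (z : Rd d) :
    ‖κ τ * schrodingerKernel d τ z‖ ≤ D * (‖kernelConst d‖ * ε ^ (-((d : ℝ) / 2))) := by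
  have hD : 0 ≤ D := (norm_nonneg _).trans (hκ.bound 0)
  by_cases hτ : τ ∈ Set.Ioc ε T
  · rw [norm_mul, schrodingerKernel, norm_mul, norm_mul, Complex.norm_exp_ofReal_mul_I, mul_one,
      Complex.norm_real, Real.norm_of_nonneg (Real.rpow_nonneg (hε.trans hτ.1).le _)]
    have h2 : τ ^ (-((d : ℝ) / 2)) ≤ ε ^ (-((d : ℝ) / 2)) :=
      Real.rpow_le_rpow_of_nonpos hε hτ.1.le (by
        have : (0 : ℝ) ≤ (d : ℝ) / 2 := by positivity
        linarith)
    exact mul_le_mul (hκ.bound τ) (mul_le_mul_of_nonneg_left h2 (norm_nonneg _))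
      (mul_nonneg (norm_nonneg _) (Real.rpow_nonneg (hε.trans hτ.1).le _)) hD
  · rw [hκ.supp τ hτ, zero_mul, norm_zero]; positivity

theorem measurable_uncurry_comp {X Y Z W : Type*} [MeasurableSpace X] [MeasurableSpace Y]
    [MeasurableSpace Z] [MeasurableSpace W] {G : X → Y → Z} (hG : Measurable (Function.uncurry G))
    {f : W → X} {g : W → Y} (hf : Measurable f) (hg : Measurable g) :
    Measurable fun w => G (f w) (g w) :=
  hG.comp (hf.prodMk hg)

namespace IsSlab

variable {d : ℕ} {T B B' : ℝ} {E : Set (Rd d)} {F H : ℝ → Rd d → ℂ}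

theorem measurable_schrodingerKernel : Measurable fun p : ℝ × Rd d => schrodingerKernel d p.1 p.2 := by
  unfold schrodingerKernel
  fun_prop

/-- The form with the integral kernel of the propagator, on the physical side, equals the form of
the propagator on the frequency side. -/
theorem integral_schrodingerKernel_eq (hF : IsSlab T B E F) (hH : IsSlab T B' E H)
    (hE : MeasurableSet E) (hμ : volume E < ∞) {ε D : ℝ} (hε : 0 < ε) {κ : ℝ → ℂ}
    (hκ : IsTimeKernel ε T D κ) :
    ∫ p : (ℝ × ℝ) × Rd d × Rd d, κ (p.1.1 - p.1.2) *
        schrodingerKernel d (p.1.1 - p.1.2) (p.2.1 - p.2.2) *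
        (F p.1.2 p.2.2 * (starRingEnd ℂ) (H p.1.1 p.2.1))
        ∂((volume.prod volume).prod (volume.prod volume)) =
      ∫ q : ℝ × ℝ, κ (q.1 - q.2) * propagatorForm d (q.1 - q.2) (F q.2) (H q.1) := by
  have hsk : Measurable fun p : (ℝ × ℝ) × Rd d × Rd d =>
      schrodingerKernel d (p.1.1 - p.1.2) (p.2.1 - p.2.2) := by
    have hpair : Measurable fun p : (ℝ × ℝ) × Rd d × Rd d => (p.1.1 - p.1.2, p.2.1 - p.2.2) := by
      fun_prop
    have := measurable_schrodingerKernel.comp hpair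
    exact this
  have hsκ : Measurable fun p : (ℝ × ℝ) × Rd d × Rd d => κ (p.1.1 - p.1.2) :=
    hκ.meas.comp (by fun_prop : Measurable fun p : (ℝ × ℝ) × Rd d × Rd d => p.1.1 - p.1.2)
  have hint := hF.integrable_kernel_mul hH (μ := volume) hE hμ
    (D := D * (‖kernelConst d‖ * ε ^ (-((d : ℝ) / 2))))
    (L := fun p : (ℝ × ℝ) × Rd d × Rd d => κ (p.1.1 - p.1.2) *
        schrodingerKernel d (p.1.1 - p.1.2) (p.2.1 - p.2.2))
    (hsκ.mul hsk) (fun p => norm_schrodingerKernel_mul_le hε hκ _ _)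
  rw [integral_prod _ hint, Measure.volume_eq_prod]
  congr 1; ext q
  by_cases hq : q.1 - q.2 ∈ Set.Ioc ε T
  · rw [propagatorForm_eq d (hε.trans hq.1) (memLp_one_iff_integrable.1 (hF.memLp_space hE hμ _ 1))
      (hF.memLp_space hE hμ _ 2) (memLp_one_iff_integrable.1 (hH.memLp_space hE hμ _ 1))
      (hH.memLp_space hE hμ _ 2)]
    simp_rw [mul_assoc]
    rw [integral_const_mul]
    congr 1
    have hi : Integrable (fun p : Rd d × Rd d => schrodingerKernel d (q.1 - q.2) (p.1 - p.2) *
        (F q.2 p.2 * (starRingEnd ℂ) (H q.1 p.1))) (volume.prod volume) := by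
      have hFi := memLp_one_iff_integrable.1 (hF.memLp_space (μ := volume) hE hμ q.2 1)
      have hHi := memLp_one_iff_integrable.1 (hH.memLp_space (μ := volume) hE hμ q.1 1)
      have hH' : Integrable fun t => (starRingEnd ℂ) (H q.1 t) :=
        (Complex.conjLIE.toContinuousLinearEquiv.toContinuousLinearMap.integrable_comp hHi)
      have h1 := (hH'.mul_prod hFi).bdd_mul
        (c := ‖kernelConst d‖ * (q.1 - q.2) ^ (-((d : ℝ) / 2)))
        (f := fun p : Rd d × Rd d => schrodingerKernel d (q.1 - q.2) (p.1 - p.2))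
        (measurable_schrodingerKernel.comp (by fun_prop :
          Measurable fun p : Rd d × Rd d => (q.1 - q.2, p.1 - p.2))).aestronglyMeasurable
        (ae_of_all _ fun p => by
          rw [schrodingerKernel, norm_mul, norm_mul, Complex.norm_exp_ofReal_mul_I, mul_one,
            Complex.norm_real, Real.norm_of_nonneg (Real.rpow_nonneg (hε.trans hq.1).le _)])
      refine h1.congr (ae_of_all _ fun p => ?_)
      simp only; ring
    rw [integral_prod_symm _ hi]
  · simp [hκ.supp _ hq]

theorem integrable_propagatorForm (hF : IsSlab T B E F) (hH : IsSlab T B' E H)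
    (hE : MeasurableSet E) (hμ : volume E < ∞) :
    Integrable (fun p : (ℝ × ℝ) × Rd d =>
      Complex.exp (((4 * Real.pi ^ 2 * ‖p.2‖ ^ 2 * (p.1.1 - p.1.2) : ℝ) : ℂ) * Complex.I) *
        (𝓕 (F p.1.2) p.2 * (starRingEnd ℂ) (𝓕 (H p.1.1) p.2)))
      ((volume.prod volume).prod volume) := by
  have hF' := hF.fourier hE hμ
  have hH' := hH.fourier hE hμ
  have mF : Measurable fun p : (ℝ × ℝ) × Rd d => 𝓕 (F p.1.2) p.2 :=
    (measurable_uncurry_comp hF'.meas (measurable_snd.comp measurable_fst) measurable_snd)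
  have mH : Measurable fun p : (ℝ × ℝ) × Rd d => 𝓕 (H p.1.1) p.2 :=
    (measurable_uncurry_comp hH'.meas (measurable_fst.comp measurable_fst) measurable_snd)
  have h1 : Integrable (fun t : ℝ => (Set.Ioc 0 T).indicator (fun _ => (1 : ℝ)) t) :=
    (integrableOn_const measure_Ioc_lt_top.ne).integrable_indicator measurableSet_Ioc
  have i1 : Integrable (fun p : (ℝ × ℝ) × Rd d => (Set.Ioc 0 T).indicator (fun _ => (1 : ℝ)) p.1.1 *
      ‖𝓕 (F p.1.2) p.2‖ ^ 2) ((volume.prod volume).prod volume) := by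
    have := h1.mul_prod (hF.integrable_norm_sq_fourier hE hμ)
    exact (measurePreserving_prodAssoc (volume : Measure ℝ) (volume : Measure ℝ)
      (volume : Measure (Rd d))).integrable_comp_of_integrable this
  have i2 : Integrable (fun p : (ℝ × ℝ) × Rd d => (Set.Ioc 0 T).indicator (fun _ => (1 : ℝ)) p.1.2 *
      ‖𝓕 (H p.1.1) p.2‖ ^ 2) ((volume.prod volume).prod volume) := by
    have := h1.mul_prod (hH.integrable_norm_sq_fourier hE hμ)
    have h2 := (measurePreserving_prodAssoc (volume : Measure ℝ) (volume : Measure ℝ)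
      (volume : Measure (Rd d))).integrable_comp_of_integrable this
    have h3 : MeasurePreserving (Prod.map Prod.swap id : (ℝ × ℝ) × Rd d → (ℝ × ℝ) × Rd d)
      ((volume.prod volume).prod volume) ((volume.prod volume).prod volume) :=
      (Measure.measurePreserving_swap).prod (MeasurePreserving.id _)
    exact h3.integrable_comp_of_integrable h2
  refine (i1.add i2).mono' ?_ (ae_of_all _ fun p => ?_)
  · exact ((by fun_prop : Measurable fun p : (ℝ × ℝ) × Rd d =>
      Complex.exp (((4 * Real.pi ^ 2 * ‖p.2‖ ^ 2 * (p.1.1 - p.1.2) : ℝ) : ℂ) * Complex.I)).mul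
      (mF.mul (Complex.continuous_conj.measurable.comp mH))).aestronglyMeasurable
  · rw [norm_mul, Complex.norm_exp_ofReal_mul_I, one_mul, norm_mul, RCLike.norm_conj]
    simp only [Pi.add_apply]
    by_cases ht : p.1.1 ∈ Set.Ioc 0 T
    · by_cases hs : p.1.2 ∈ Set.Ioc 0 T
      · rw [Set.indicator_of_mem ht, Set.indicator_of_mem hs]
        nlinarith [sq_nonneg (‖𝓕 (F p.1.2) p.2‖ - ‖𝓕 (H p.1.1) p.2‖),
          norm_nonneg (𝓕 (F p.1.2) p.2), norm_nonneg (𝓕 (H p.1.1) p.2)]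
      · rw [hF'.time _ _ hs, norm_zero, zero_mul]
        have : 0 ≤ (Set.Ioc 0 T).indicator (fun _ => (1 : ℝ)) p.1.2 :=
          Set.indicator_nonneg (fun _ _ => zero_le_one) _
        have : 0 ≤ (Set.Ioc 0 T).indicator (fun _ => (1 : ℝ)) p.1.1 :=
          Set.indicator_nonneg (fun _ _ => zero_le_one) _
        positivity
    · rw [hH'.time _ _ ht, norm_zero, mul_zero]
      have : 0 ≤ (Set.Ioc 0 T).indicator (fun _ => (1 : ℝ)) p.1.2 :=
        Set.indicator_nonneg (fun _ _ => zero_le_one) _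
      have : 0 ≤ (Set.Ioc 0 T).indicator (fun _ => (1 : ℝ)) p.1.1 :=
        Set.indicator_nonneg (fun _ _ => zero_le_one) _
      positivity

/-- The bound on the frequency side, for fixed frequency. -/
theorem norm_integral_propagatorForm_le (hF : IsSlab T B E F) (hH : IsSlab T B' E H)
    (hE : MeasurableSet E) (hμ : volume E < ∞) {ε D : ℝ} {κ : ℝ → ℂ}
    (hκ : IsTimeKernel ε T D κ) {M : ℝ} (hM : ∀ σ, ‖𝓕 κ σ‖ ≤ M) :
    ‖∫ q : ℝ × ℝ, κ (q.1 - q.2) * propagatorForm d (q.1 - q.2) (F q.2) (H q.1)‖ ≤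
      M * (√(∫ p : ℝ × Rd d, ‖F p.1 p.2‖ ^ 2) * √(∫ p : ℝ × Rd d, ‖H p.1 p.2‖ ^ 2)) := by
  have hM0 : 0 ≤ M := (norm_nonneg _).trans (hM 0)
  have hF' := hF.fourier hE hμ
  have hH' := hH.fourier hE hμ
  have hint := (hF.integrable_propagatorForm hH hE hμ).bdd_mul (c := D)
    (f := fun p => κ (p.1.1 - p.1.2))
    (hκ.meas.comp (by fun_prop)).aestronglyMeasurable (ae_of_all _ fun p => hκ.bound _)
  have e : ∫ q : ℝ × ℝ, κ (q.1 - q.2) * propagatorForm d (q.1 - q.2) (F q.2) (H q.1) =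
      ∫ ξ, ∫ q : ℝ × ℝ, κ (q.1 - q.2) *
        (Complex.exp (((4 * Real.pi ^ 2 * ‖ξ‖ ^ 2 * (q.1 - q.2) : ℝ) : ℂ) * Complex.I) *
        (𝓕 (F q.2) ξ * (starRingEnd ℂ) (𝓕 (H q.1) ξ))) := by
    rw [Measure.volume_eq_prod, ← integral_prod_symm _ hint, integral_prod _ hint]
    congr 1; ext q
    simp only
    rw [integral_const_mul]; rfl
  rw [e]
  have f1 : ∀ {F : ℝ → Rd d → ℂ} {B : ℝ}, IsSlab T B E F →
      Integrable (fun ξ => ∫ t, ‖𝓕 (F t) ξ‖ ^ 2) ∧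
      ∫ ξ, ∫ t, ‖𝓕 (F t) ξ‖ ^ 2 = ∫ p : ℝ × Rd d, ‖F p.1 p.2‖ ^ 2 := by
    intro F B hF
    have h1 := hF.integrable_norm_sq_fourier hE hμ
    refine ⟨h1.integral_prod_right, ?_⟩
    rw [← integral_prod_symm _ h1, integral_prod _ h1, Measure.volume_eq_prod,
      integral_prod _ (hF.integrable_norm_sq hE hμ)]
    congr 1; ext t
    exact hF.integral_norm_sq_fourier hE hμ t
  have f2 : ∀ {F : ℝ → Rd d → ℂ} {B : ℝ}, IsSlab T B E F → ∀ ξ (p : ℝ≥0∞),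
      MemLp (fun t => 𝓕 (F t) ξ) p volume := fun hF ξ p => (hF.fourier hE hμ).memLp_time ξ p
  calc _ ≤ ∫ ξ, ‖∫ q : ℝ × ℝ, κ (q.1 - q.2) *
        (Complex.exp (((4 * Real.pi ^ 2 * ‖ξ‖ ^ 2 * (q.1 - q.2) : ℝ) : ℂ) * Complex.I) *
        (𝓕 (F q.2) ξ * (starRingEnd ℂ) (𝓕 (H q.1) ξ)))‖ := norm_integral_le_integral_norm _
    _ ≤ ∫ ξ, M * (√(∫ t, ‖𝓕 (F t) ξ‖ ^ 2) * √(∫ t, ‖𝓕 (H t) ξ‖ ^ 2)) := by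
        refine integral_mono_of_nonneg (ae_of_all _ fun y => norm_nonneg _) ?_
          (ae_of_all _ fun ξ => ?_)
        · refine Integrable.const_mul ?_ M
          refine ((f1 hF).1.add (f1 hH).1).mono' ?_ (ae_of_all _ fun ξ => ?_)
          · exact ((Real.continuous_sqrt.comp_aestronglyMeasurable (f1 hF).1.1).mul
              (Real.continuous_sqrt.comp_aestronglyMeasurable (f1 hH).1.1))
          · have a1 : 0 ≤ ∫ t, ‖𝓕 (F t) ξ‖ ^ 2 := integral_nonneg fun t => by positivity
            have a2 : 0 ≤ ∫ t, ‖𝓕 (H t) ξ‖ ^ 2 := integral_nonneg fun t => by positivity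
            rw [Real.norm_of_nonneg (by positivity)]
            simp only [Pi.add_apply]
            nlinarith [sq_nonneg (√(∫ t, ‖𝓕 (F t) ξ‖ ^ 2) - √(∫ t, ‖𝓕 (H t) ξ‖ ^ 2)),
              Real.sq_sqrt a1, Real.sq_sqrt a2]
        · simp only
          have h1 := (hκ.mul_phase (φ := fun t => 4 * Real.pi ^ 2 * ‖ξ‖ ^ 2 * t)
            (by fun_prop)).norm_integral_prod_le (M := M) (fun σ => by
              rw [IsTimeKernel.fourier_mul_phase]; exact hM _)
            (memLp_one_iff_integrable.1 (f2 hF ξ 1)) (f2 hF ξ 2)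
            (memLp_one_iff_integrable.1 (f2 hH ξ 1)) (f2 hH ξ 2)
          simp_rw [mul_assoc (κ _)] at h1
          exact h1
    _ ≤ _ := by
        rw [integral_const_mul, ← (f1 hF).2, ← (f1 hH).2]
        gcongr
        exact integral_sqrt_mul_sqrt_le (f1 hF).1 (f1 hH).1
          (fun ξ => integral_nonneg fun t => by positivity)
          (fun ξ => integral_nonneg fun t => by positivity)

end IsSlab

/-! ### Interpolation of the truncated forms -/

/-- The kernel `τ^{-1+δ+ζd/2}` on `(ε, T]`. For `δ = 1 - dθ/2` it equals `1` at `ζ = θ`. -/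
def interpKernel (d : ℕ) (δ ε T : ℝ) (ζ : ℂ) : ℝ → ℂ :=
  (Set.Ioc ε T).indicator fun τ =>
    ((τ ^ (-1 + δ) : ℝ) : ℂ) * Complex.exp (ζ * ((d : ℝ) / 2 * Real.log τ : ℝ))

theorem isTimeKernel_interpKernel (d : ℕ) (δ : ℝ) {ε : ℝ} (hε : 0 < ε) (T : ℝ) (ζ : ℂ) :
    ∃ D, IsTimeKernel ε T D (interpKernel d δ ε T ζ) := by
  have hc : ContinuousOn (fun τ : ℝ =>
      ((τ ^ (-1 + δ) : ℝ) : ℂ) * Complex.exp (ζ * ((d : ℝ) / 2 * Real.log τ : ℝ)))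
      (Set.Icc ε T) := by
    have himg : ∀ t ∈ Set.Icc ε T, t ≠ 0 := fun t ht => (hε.trans_le ht.1).ne'
    refine ContinuousOn.mul ?_ ?_
    · exact Complex.continuous_ofReal.comp_continuousOn
        (continuousOn_id.rpow_const fun t ht => Or.inl (himg t ht))
    · refine Complex.continuous_exp.comp_continuousOn (continuousOn_const.mul ?_)
      exact Complex.continuous_ofReal.comp_continuousOn
        (continuousOn_const.mul (continuousOn_id.log himg))
  obtain ⟨D, hD⟩ := isCompact_Icc.exists_bound_of_continuousOn hc
  refine ⟨max D 0, Measurable.indicator (by fun_prop) measurableSet_Ioc, fun t => ?_,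
    fun t ht => Set.indicator_of_notMem ht _⟩
  by_cases ht : t ∈ Set.Ioc ε T
  · rw [interpKernel, Set.indicator_of_mem ht]
    exact (hD t ⟨ht.1.le, ht.2⟩).trans (le_max_left _ _)
  · rw [interpKernel, Set.indicator_of_notMem ht, norm_zero]; exact le_max_right _ _

theorem fourier_indicator_powFactor (δ η γ : ℝ) {ε T : ℝ} (hT : ε ≤ T) (σ : ℝ) :
    𝓕 (fun t => (Set.Ioc ε T).indicator (powFactor δ η) t *
        Complex.exp (((γ / t : ℝ) : ℂ) * Complex.I)) σ =
      ∫ t in ε..T, powFactor δ η t *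
        Complex.exp (((-2 * Real.pi * σ * t + γ / t : ℝ) : ℂ) * Complex.I) := by
  rw [Real.fourier_eq', intervalIntegral.integral_of_le hT, ← integral_indicator measurableSet_Ioc]
  congr 1; ext t
  by_cases ht : t ∈ Set.Ioc ε T
  · rw [Set.indicator_of_mem ht, Set.indicator_of_mem ht, smul_eq_mul, mul_left_comm,
      ← Complex.exp_add]
    congr 2
    simp only [RCLike.inner_apply, conj_trivial]
    push_cast; ring
  · rw [Set.indicator_of_notMem ht, Set.indicator_of_notMem ht]; simp

theorem interpKernel_mul_I (d : ℕ) (δ ε T η : ℝ) :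
    interpKernel d δ ε T (η * Complex.I) =
      (Set.Ioc ε T).indicator (powFactor δ (η * ((d : ℝ) / 2))) := by
  unfold interpKernel
  congr 1; ext τ
  rw [powFactor]
  congr 2; push_cast; ring

theorem interpKernel_one_add_mul_I {d : ℕ} {δ ε T η : ℝ} (hε : 0 < ε) (τ : ℝ) (z : Rd d) :
    interpKernel d δ ε T (1 + η * Complex.I) τ * schrodingerKernel d τ z =
      kernelConst d * ((Set.Ioc ε T).indicator (powFactor δ (η * ((d : ℝ) / 2))) τ *
        Complex.exp (((-(‖z‖ ^ 2 / 4) / τ : ℝ) : ℂ) * Complex.I)) := by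
  unfold interpKernel
  by_cases hτ : τ ∈ Set.Ioc ε T
  · have hτ0 : 0 < τ := hε.trans hτ.1
    rw [Set.indicator_of_mem hτ, Set.indicator_of_mem hτ, powFactor, schrodingerKernel]
    have e1 : Complex.exp ((1 + η * Complex.I) * ((d : ℝ) / 2 * Real.log τ : ℝ)) =
        ((τ ^ ((d : ℝ) / 2) : ℝ) : ℂ) *
          Complex.exp (((η * ((d : ℝ) / 2) * Real.log τ : ℝ) : ℂ) * Complex.I) := by
      rw [Real.rpow_def_of_pos hτ0, Complex.ofReal_exp, ← Complex.exp_add]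
      congr 1; push_cast; ring
    have e2 : ((τ ^ ((d : ℝ) / 2) : ℝ) : ℂ) * ((τ ^ (-((d : ℝ) / 2)) : ℝ) : ℂ) = 1 := by
      rw [← Complex.ofReal_mul, ← Real.rpow_add hτ0]; simp
    rw [e1]
    linear_combination (((τ ^ (-1 + δ) : ℝ) : ℂ) *
          Complex.exp (((η * ((d : ℝ) / 2) * Real.log τ : ℝ) : ℂ) * Complex.I) *
          kernelConst d * Complex.exp (((-(‖z‖ ^ 2 / 4) / τ : ℝ) : ℂ) * Complex.I)) * e2
  · rw [Set.indicator_of_notMem hτ, Set.indicator_of_notMem hτ]; simp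

/-- A weight `u` on a set `E` of finite measure, between two positive constants there. -/
structure IsWeight {d : ℕ} (E : Set (Rd d)) (c N : ℝ) (u : Rd d → ℝ) : Prop where
  measE : MeasurableSet E
  volE : volume E < ∞
  meas : Measurable u
  pos : 0 < c
  mem : ∀ x ∈ E, c ≤ u x ∧ u x ≤ N
  supp : ∀ x, x ∉ E → u x = 0

namespace IsWeight

variable {d : ℕ} {E : Set (Rd d)} {c N : ℝ} {u : Rd d → ℝ}

theorem nonneg (hu : IsWeight E c N u) (x : Rd d) : 0 ≤ u x := by
  by_cases hx : x ∈ E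
  · exact hu.pos.le.trans (hu.mem x hx).1
  · rw [hu.supp x hx]

theorem abs_log_le (hu : IsWeight E c N u) (x : Rd d) :
    |Real.log (u x)| ≤ max |Real.log c| |Real.log N| := by
  by_cases hx : x ∈ E
  · obtain ⟨h1, h2⟩ := hu.mem x hx
    have h3 := Real.log_le_log hu.pos h1
    have h4 := Real.log_le_log (hu.pos.trans_le h1) h2
    exact abs_le_max_abs_abs h3 h4
  · rw [hu.supp x hx]; simp

theorem integrable (hu : IsWeight E c N u) : Integrable u := by
  refine memLp_one_iff_integrable.1 (memLp_of_bounded (B := max N 0) hu.meas (fun x => ?_)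
    hu.measE hu.volE hu.supp 1)
  rw [Real.norm_of_nonneg (hu.nonneg x)]
  by_cases hx : x ∈ E
  · exact (hu.mem x hx).2.trans (le_max_left _ _)
  · rw [hu.supp x hx]; exact le_max_right _ _

/-- The weighted function `u^{ζ/2} F` is bounded with the same support. The weight is written as an
exponential; `log 0 = 0` does no harm, since `F` vanishes where `u` does. -/
theorem isSlab_weighted (hu : IsWeight E c N u) {T B : ℝ} {F : ℝ → Rd d → ℂ}
    (hF : IsSlab T B E F) (ζ : ℂ) :
    ∃ B', IsSlab T B' E fun t x => Complex.exp (ζ * (Real.log (u x) / 2 : ℝ)) * F t x := by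
  refine ⟨_, hF.mul (B' := Real.exp (‖ζ‖ * (max |Real.log c| |Real.log N| / 2))) ?_ (fun x _ => ?_)
    (Real.exp_pos _).le⟩
  · have := hu.meas
    fun_prop
  · rw [Complex.norm_exp]
    apply Real.exp_le_exp.2
    refine (Complex.re_le_norm _).trans ?_
    rw [norm_mul, Complex.norm_real, Real.norm_eq_abs, abs_div, abs_two]
    gcongr
    exact hu.abs_log_le x

theorem norm_exp_log (x : Rd d) (ζ : ℂ) : ‖Complex.exp (ζ * (Real.log (u x) / 2 : ℝ))‖ =
    Real.exp (ζ.re * (Real.log (u x) / 2)) := by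
  rw [Complex.norm_exp, Complex.re_mul_ofReal]

end IsWeight

/-- The truncated weighted `TT*` form, bounded uniformly in the truncation `ε` by complex
interpolation between `L²` (no weight) and the pointwise kernel bound (weight `u`). It is the
value at `ζ = θ` of an analytic family whose kernel is `τ^{-dθ/2 + ζd/2}`, hence `1` at `ζ = θ`.
-/
theorem exists_norm_integral_truncated_le {d : ℕ} (hd : 1 ≤ d) {θ : ℝ} (hθ0 : 0 < θ) (hθ1 : θ < 1)
    (hθd : d * θ ≤ 2) :
    ∃ C : ℝ, 0 < C ∧ ∀ {E : Set (Rd d)} {c N : ℝ} {u : Rd d → ℝ}, IsWeight E c N u →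
      ∀ {T B : ℝ} {F : ℝ → Rd d → ℂ}, IsSlab T B E F → ∀ {ε : ℝ}, 0 < ε → ε ≤ T →
      ‖∫ q : ℝ × ℝ, (Set.Ioc ε T).indicator (fun _ => (1 : ℂ)) (q.1 - q.2) *
        propagatorForm d (q.1 - q.2)
          (fun x => Complex.exp ((θ : ℂ) * (Real.log (u x) / 2 : ℝ)) * F q.2 x)
          (fun x => Complex.exp ((θ : ℂ) * (Real.log (u x) / 2 : ℝ)) * F q.1 x)‖ ≤
      C * T ^ (1 - d * θ / 2) * (∫ x, u x) ^ θ * ∫ p : ℝ × Rd d, ‖F p.1 p.2‖ ^ 2 := by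
  set δ : ℝ := 1 - d * θ / 2 with hδ
  have hδ0 : 0 ≤ δ := by rw [hδ]; linarith
  obtain ⟨C₀, hC₀, hosc⟩ := exists_norm_integral_powFactor_le hδ0
  have hd0 : (1 : ℝ) ≤ d := by exact_mod_cast hd
  have hθ1' : 0 < 1 - θ := by linarith
  refine ⟨8 / (θ * (1 - θ)) * 2 * (C₀ * (d + 2) * (1 + ‖kernelConst d‖)) *
    (1 + ‖kernelConst d‖) ^ θ, by positivity, ?_⟩
  intro E c N u hu T B F hF ε hε hεT
  have hT0 : 0 < T := hε.trans_le hεT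
  have hTδ : 0 < T ^ δ := Real.rpow_pos_of_pos hT0 _
  set Q := ∫ p : ℝ × Rd d, ‖F p.1 p.2‖ ^ 2 with hQ
  have hQ0 : 0 ≤ Q := integral_nonneg fun p => by positivity
  set U := ∫ x, u x with hU
  have hU0 : 0 ≤ U := integral_nonneg hu.nonneg
  -- the oscillatory bound, with the dependence on `η d / 2` replaced by one on `η`
  have hosc' : ∀ η : ℝ, η ≠ 0 → ∀ γ σ : ℝ,
      ‖𝓕 (fun t => (Set.Ioc ε T).indicator (powFactor δ (η * ((d : ℝ) / 2))) t *
        Complex.exp (((γ / t : ℝ) : ℂ) * Complex.I)) σ‖ ≤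
      C₀ * (d + 2) * T ^ δ * (1 + |η| + 1 / |η|) := by
    intro η hη γ σ
    rw [fourier_indicator_powFactor δ _ γ hεT]
    refine (hosc (η * ((d : ℝ) / 2)) (by positivity) _ γ ε T hε hεT).trans ?_
    have hηp : 0 < |η| := abs_pos.2 hη
    have e1 : |η * ((d : ℝ) / 2)| = |η| * (d / 2) := by
      rw [abs_mul, abs_of_nonneg (by positivity : (0 : ℝ) ≤ (d : ℝ) / 2)]
    have e2 : 1 / (|η| * ((d : ℝ) / 2)) ≤ 2 * (1 / |η|) := by
      rw [mul_one_div, div_le_div_iff₀ (by positivity) hηp]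
      nlinarith
    rw [e1]
    have e3 : 0 < 1 / |η| := by positivity
    calc C₀ * T ^ δ * (1 + |η| * (d / 2) + 1 / (|η| * (d / 2)))
        ≤ C₀ * T ^ δ * ((d + 2) * (1 + |η| + 1 / |η|)) := by
          gcongr
          nlinarith
      _ = _ := by ring
  have hslab := fun ζ : ℂ => hu.isSlab_weighted hF ζ
  choose Bζ hslabζ using hslab
  choose Dζ hkerζ using fun ζ : ℂ => isTimeKernel_interpKernel d δ hε T ζ
  -- on the support of `b`, the exponent `a` is `log (u(x)^{1/2} u(y)^{1/2} τ^{d/2})`, and the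
  -- truncations in `τ` make it bounded everywhere
  set G : ℂ → ℝ → Rd d → ℂ := fun ζ t x =>
    Complex.exp (ζ * (Real.log (u x) / 2 : ℝ)) * F t x with hG
  set a : (ℝ × ℝ) × Rd d × Rd d → ℝ := fun p => Real.log (u p.2.1) / 2 + Real.log (u p.2.2) / 2 +
    d / 2 * Real.log (max ε (min T (p.1.1 - p.1.2))) with ha
  set b : (ℝ × ℝ) × Rd d × Rd d → ℂ := fun p => interpKernel d δ ε T 0 (p.1.1 - p.1.2) *
    schrodingerKernel d (p.1.1 - p.1.2) (p.2.1 - p.2.2) *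
    (F p.1.2 p.2.2 * (starRingEnd ℂ) (F p.1.1 p.2.1)) with hb
  set μ : Measure ((ℝ × ℝ) × Rd d × Rd d) := (volume.prod volume).prod (volume.prod volume) with hμ
  set Φ : ℂ → ℂ := fun ζ => ∫ p, Complex.exp (ζ * a p) * b p ∂μ with hΦ
  have hbint : Integrable b μ := by
    have hsk : Measurable fun p : (ℝ × ℝ) × Rd d × Rd d =>
        schrodingerKernel d (p.1.1 - p.1.2) (p.2.1 - p.2.2) :=
      measurable_uncurry_comp (G := schrodingerKernel d) IsSlab.measurable_schrodingerKernel
        (by fun_prop) (by fun_prop)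
    exact hF.integrable_kernel_mul hF (μ := volume) hu.measE hu.volE
      (D := Dζ 0 * (‖kernelConst d‖ * ε ^ (-((d : ℝ) / 2))))
      (L := fun p : (ℝ × ℝ) × Rd d × Rd d => interpKernel d δ ε T 0 (p.1.1 - p.1.2) *
        schrodingerKernel d (p.1.1 - p.1.2) (p.2.1 - p.2.2))
      (((hkerζ 0).meas.comp (by fun_prop : Measurable fun p : (ℝ × ℝ) × Rd d × Rd d =>
        p.1.1 - p.1.2)).mul hsk) (fun p => norm_schrodingerKernel_mul_le hε (hkerζ 0) _ _)
  have ham : Measurable a := by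
    have := hu.meas
    simp only [ha]
    fun_prop
  obtain ⟨A, hA⟩ : ∃ A, ∀ p, |a p| ≤ A := by
    refine ⟨max |Real.log c| |Real.log N| / 2 + max |Real.log c| |Real.log N| / 2 +
      d / 2 * max |Real.log ε| |Real.log T|, fun p => ?_⟩
    have h1 : |Real.log (max ε (min T (p.1.1 - p.1.2)))| ≤ max |Real.log ε| |Real.log T| := by
      refine abs_le_max_abs_abs (Real.log_le_log hε (le_max_left _ _)) ?_
      exact Real.log_le_log (hε.trans_le (le_max_left _ _)) (max_le hεT (min_le_left _ _))
    refine (abs_add_le _ _).trans (add_le_add ((abs_add_le _ _).trans (add_le_add ?_ ?_)) ?_)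
    · rw [abs_div, abs_two]; gcongr; exact hu.abs_log_le _
    · rw [abs_div, abs_two]; gcongr; exact hu.abs_log_le _
    · rw [abs_mul, abs_of_nonneg (by positivity : (0 : ℝ) ≤ (d : ℝ) / 2)]; gcongr
  have hΦd : Differentiable ℂ Φ := differentiable_integral_exp_mul ham hA hbint
  have hΦA : ∀ ζ : ℂ, 0 ≤ ζ.re → ζ.re ≤ 1 → ‖Φ ζ‖ ≤ ∫ p, Real.exp A * ‖b p‖ ∂μ := by
    intro ζ h0 h1
    refine (norm_integral_le_integral_norm _).trans ?_
    refine integral_mono_of_nonneg (ae_of_all _ fun p => norm_nonneg _) (hbint.norm.const_mul _)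
      (ae_of_all _ fun p => ?_)
    simp only
    rw [norm_mul, Complex.norm_exp, Complex.re_mul_ofReal]
    gcongr
    have := (abs_le.1 (hA p)).2
    have hA0 : 0 ≤ A := (abs_nonneg _).trans (hA p)
    calc ζ.re * a p ≤ ζ.re * A := by gcongr
      _ ≤ 1 * A := by gcongr
      _ = A := one_mul A
  -- the second weight carries `conj ζ`, as it stands under a conjugation
  have hpt : ∀ (ζ : ℂ) p, Complex.exp (ζ * a p) * b p =
      interpKernel d δ ε T ζ (p.1.1 - p.1.2) *
        schrodingerKernel d (p.1.1 - p.1.2) (p.2.1 - p.2.2) *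
        (G ζ p.1.2 p.2.2 * (starRingEnd ℂ) (G ((starRingEnd ℂ) ζ) p.1.1 p.2.1)) := by
    intro ζ p
    by_cases hp : p.1.1 - p.1.2 ∈ Set.Ioc ε T
    · have e1 : max ε (min T (p.1.1 - p.1.2)) = p.1.1 - p.1.2 := by
        rw [min_eq_right hp.2, max_eq_right hp.1.le]
      simp only [ha, hb, hG, interpKernel, Set.indicator_of_mem hp, e1, map_mul, ← Complex.exp_conj,
        Complex.conj_conj, Complex.conj_ofReal, zero_mul, Complex.exp_zero, mul_one]
      have e2 : Complex.exp (ζ * ((Real.log (u p.2.1) / 2 + Real.log (u p.2.2) / 2 +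
          d / 2 * Real.log (p.1.1 - p.1.2) : ℝ) : ℂ)) =
          Complex.exp (ζ * (Real.log (u p.2.1) / 2 : ℝ)) *
          Complex.exp (ζ * (Real.log (u p.2.2) / 2 : ℝ)) *
          Complex.exp (ζ * (d / 2 * Real.log (p.1.1 - p.1.2) : ℝ)) := by
        rw [← Complex.exp_add, ← Complex.exp_add]
        congr 1; push_cast; ring
      rw [e2]; ring
    · simp only [hb, interpKernel, Set.indicator_of_notMem hp, zero_mul, mul_zero]
  have hΦeq : ∀ ζ : ℂ, Φ ζ = ∫ q : ℝ × ℝ, interpKernel d δ ε T ζ (q.1 - q.2) *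
      propagatorForm d (q.1 - q.2) (G ζ q.2) (G ((starRingEnd ℂ) ζ) q.1) := by
    intro ζ
    simp only [hΦ, hpt]
    exact (hslabζ ζ).integral_schrodingerKernel_eq (hslabζ ((starRingEnd ℂ) ζ)) hu.measE hu.volE
      hε (hkerζ ζ)
  have hGnorm : ∀ (ζ : ℂ) t x, ‖G ζ t x‖ ^ 2 =
      Real.exp (ζ.re * Real.log (u x)) * ‖F t x‖ ^ 2 := by
    intro ζ t x
    simp only [hG]
    rw [norm_mul, IsWeight.norm_exp_log, mul_pow, ← Real.exp_nat_mul]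
    congr 2; push_cast; ring
  have key := norm_le_of_three_lines_singular hΦd hΦA (M := C₀ * (d + 2) * T ^ δ *
    (1 + ‖kernelConst d‖) * Q) (U := (1 + ‖kernelConst d‖) * U) (by positivity) (by positivity)
    (fun η hη => ?_) (fun η hη => ?_) hθ0 hθ1
  · rw [hΦeq, Complex.conj_ofReal] at key
    have e1 : interpKernel d δ ε T θ = (Set.Ioc ε T).indicator (fun _ => (1 : ℂ)) := by
      unfold interpKernel
      refine Set.indicator_congr fun τ hτ => ?_
      have hτ0 : 0 < τ := hε.trans hτ.1
      have : Complex.exp ((θ : ℂ) * ((d : ℝ) / 2 * Real.log τ : ℝ)) =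
          ((τ ^ ((d : ℝ) / 2 * θ) : ℝ) : ℂ) := by
        rw [Real.rpow_def_of_pos hτ0, Complex.ofReal_exp]
        congr 1; push_cast; ring
      rw [this, ← Complex.ofReal_mul, ← Real.rpow_add hτ0,
        show -1 + δ + (d : ℝ) / 2 * θ = 0 by rw [hδ]; ring, Real.rpow_zero, Complex.ofReal_one]
    rw [e1] at key
    refine key.trans (le_of_eq ?_)
    rw [Real.mul_rpow (by positivity) hU0]
    ring
  · rw [hΦeq]
    have hconj : (starRingEnd ℂ) ((η : ℂ) * Complex.I) = ((-η : ℝ) : ℂ) * Complex.I := by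
      simp
    rw [hconj]
    have h1 := (hslabζ (η * Complex.I)).norm_integral_propagatorForm_le
      (hslabζ (((-η : ℝ) : ℂ) * Complex.I)) hu.measE hu.volE (hkerζ (η * Complex.I))
      (M := C₀ * (d + 2) * T ^ δ * (1 + |η| + 1 / |η|)) (fun σ => by
        rw [interpKernel_mul_I]
        have := hosc' η hη 0 σ
        simpa using this)
    refine h1.trans ?_
    have e : ∀ η : ℝ, ∫ p : ℝ × Rd d, ‖G (η * Complex.I) p.1 p.2‖ ^ 2 = Q := by
      intro η
      rw [hQ]; congr 1; ext p
      rw [hGnorm]; simp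
    have e1 := e η
    have e2 := e (-η)
    simp only [hG] at e1 e2
    rw [e1, e2, Real.mul_self_sqrt hQ0]
    have hk : (0 : ℝ) ≤ ‖kernelConst d‖ := norm_nonneg _
    have hp : 0 ≤ C₀ * (d + 2) * T ^ δ * Q * (1 + |η| + 1 / |η|) := by positivity
    nlinarith [mul_nonneg hk hp]
  · have e0 : Φ (1 + η * Complex.I) = kernelConst d * ∫ p : (ℝ × ℝ) × Rd d × Rd d,
        (Set.Ioc ε T).indicator (powFactor δ (η * ((d : ℝ) / 2))) (p.1.1 - p.1.2) *
        Complex.exp (((-(‖p.2.1 - p.2.2‖ ^ 2 / 4) / (p.1.1 - p.1.2) : ℝ) : ℂ) * Complex.I) *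
        (G (1 + η * Complex.I) p.1.2 p.2.2 *
          (starRingEnd ℂ) (G ((starRingEnd ℂ) (1 + η * Complex.I)) p.1.1 p.2.1)) ∂μ := by
      simp only [hΦ, hpt]
      rw [← integral_const_mul]
      congr 1; ext p
      rw [interpKernel_one_add_mul_I hε]; ring
    have hker : IsTimeKernel ε T (Dζ (η * Complex.I))
        ((Set.Ioc ε T).indicator (powFactor δ (η * ((d : ℝ) / 2)))) := by
      rw [← interpKernel_mul_I]; exact hkerζ _
    have h1 := (hslabζ (1 + η * Complex.I)).norm_integral_spaceKernel_le
      (hslabζ ((starRingEnd ℂ) (1 + η * Complex.I))) hu.measE hu.volE hT0.le hker (hosc' η hη)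
    rw [e0, norm_mul]
    have hre : ∀ ζ : ℂ, ζ.re = 1 → ∫ x, √(∫ t, ‖G ζ t x‖ ^ 2) ≤ √U * √Q := by
      intro ζ hζ
      have i1 := hF.integrable_norm_sq (μ := volume) hu.measE hu.volE
      have e1 : ∀ x, √(∫ t, ‖G ζ t x‖ ^ 2) = √(u x) * √(∫ t, ‖F t x‖ ^ 2) := by
        intro x
        by_cases hx : x ∈ E
        · have hux : 0 < u x := hu.pos.trans_le (hu.mem x hx).1
          simp_rw [hGnorm, hζ, one_mul, Real.exp_log hux]
          rw [integral_const_mul, Real.sqrt_mul hux.le]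
        · simp_rw [hGnorm, hF.space _ x hx]; simp
      simp_rw [e1]
      refine (integral_sqrt_mul_sqrt_le hu.integrable i1.integral_prod_right hu.nonneg
        (fun x => integral_nonneg fun t => by positivity)).trans (le_of_eq ?_)
      rw [hU, hQ, Measure.volume_eq_prod, integral_prod_symm _ i1]
    have h2 := hre (1 + η * Complex.I) (by simp)
    have h3 := hre ((starRingEnd ℂ) (1 + η * Complex.I)) (by simp)
    have hn2 : 0 ≤ ∫ x, √(∫ t, ‖G (1 + η * Complex.I) t x‖ ^ 2) :=
      integral_nonneg fun x => Real.sqrt_nonneg _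
    have hn3 : 0 ≤ ∫ x, √(∫ t, ‖G ((starRingEnd ℂ) (1 + η * Complex.I)) t x‖ ^ 2) :=
      integral_nonneg fun x => Real.sqrt_nonneg _
    have h4 : (∫ x, √(∫ t, ‖G (1 + η * Complex.I) t x‖ ^ 2)) *
        ∫ x, √(∫ t, ‖G ((starRingEnd ℂ) (1 + η * Complex.I)) t x‖ ^ 2) ≤ U * Q := by
      calc _ ≤ (√U * √Q) * (√U * √Q) := mul_le_mul h2 h3 hn3 (by positivity)
        _ = (√U * √U) * (√Q * √Q) := by ring
        _ = U * Q := by rw [Real.mul_self_sqrt hU0, Real.mul_self_sqrt hQ0]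
    have hk : (0 : ℝ) ≤ ‖kernelConst d‖ := norm_nonneg _
    have hM : 0 ≤ C₀ * (d + 2) * T ^ δ * (1 + |η| + 1 / |η|) := by positivity
    calc _ ≤ ‖kernelConst d‖ * (C₀ * (d + 2) * T ^ δ * (1 + |η| + 1 / |η|) * (U * Q)) := by
          refine mul_le_mul_of_nonneg_left (h1.trans ?_) hk
          exact mul_le_mul_of_nonneg_left h4 hM
      _ ≤ ((1 + ‖kernelConst d‖) * (1 + ‖kernelConst d‖)) *
          (C₀ * (d + 2) * T ^ δ * (1 + |η| + 1 / |η|) * (U * Q)) := by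
          gcongr
          nlinarith
      _ = _ := by ring

/-! ### The weighted Strichartz estimate -/

theorem propagatorForm_conj (d : ℕ) (τ : ℝ) (g h : Rd d → ℂ) :
    (starRingEnd ℂ) (propagatorForm d τ g h) = propagatorForm d (-τ) h g := by
  rw [propagatorForm, propagatorForm, ← integral_conj]
  congr 1; ext ξ
  rw [map_mul, map_mul, Complex.conj_conj, ← Complex.exp_conj, map_mul, Complex.conj_I,
    Complex.conj_ofReal, mul_comm (𝓕 h ξ)]
  congr 2; push_cast; ring

/-- The frequency side of `∫ e^{itΔ} G(t) dt`. -/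
def dualProfile {d : ℕ} (G : ℝ → Rd d → ℂ) (ξ : Rd d) : ℂ :=
  ∫ t, Complex.exp (((-(4 * Real.pi ^ 2 * ‖ξ‖ ^ 2 * t) : ℝ) : ℂ) * Complex.I) * 𝓕 (G t) ξ

theorem volume_diagonal_real : (volume.prod volume) {q : ℝ × ℝ | q.1 = q.2} = 0 := by
  rw [Measure.measure_prod_null (measurableSet_eq_fun measurable_fst measurable_snd)]
  refine ae_of_all _ fun t => ?_
  have : Prod.mk t ⁻¹' {q : ℝ × ℝ | q.1 = q.2} = {t} := by ext s; simp [eq_comm]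
  simp only [this]; simp

namespace IsSlab

variable {d : ℕ} {T B : ℝ} {E : Set (Rd d)} {G : ℝ → Rd d → ℂ}

theorem integral_prod_profile (G : ℝ → Rd d → ℂ) (ξ : Rd d) :
    ∫ q : ℝ × ℝ, Complex.exp (((4 * Real.pi ^ 2 * ‖ξ‖ ^ 2 * (q.1 - q.2) : ℝ) : ℂ) * Complex.I) *
        (𝓕 (G q.2) ξ * (starRingEnd ℂ) (𝓕 (G q.1) ξ)) = ((‖dualProfile G ξ‖ ^ 2 : ℝ) : ℂ) := by
  have h1 : ∀ q : ℝ × ℝ,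
      Complex.exp (((4 * Real.pi ^ 2 * ‖ξ‖ ^ 2 * (q.1 - q.2) : ℝ) : ℂ) * Complex.I) *
        (𝓕 (G q.2) ξ * (starRingEnd ℂ) (𝓕 (G q.1) ξ)) =
      (starRingEnd ℂ) (Complex.exp (((-(4 * Real.pi ^ 2 * ‖ξ‖ ^ 2 * q.1) : ℝ) : ℂ) * Complex.I) *
        𝓕 (G q.1) ξ) *
      (Complex.exp (((-(4 * Real.pi ^ 2 * ‖ξ‖ ^ 2 * q.2) : ℝ) : ℂ) * Complex.I) *
        𝓕 (G q.2) ξ) := by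
    intro q
    rw [map_mul, ← Complex.exp_conj, map_mul, Complex.conj_I, Complex.conj_ofReal]
    have : Complex.exp (((4 * Real.pi ^ 2 * ‖ξ‖ ^ 2 * (q.1 - q.2) : ℝ) : ℂ) * Complex.I) =
        Complex.exp (((-(4 * Real.pi ^ 2 * ‖ξ‖ ^ 2 * q.1) : ℝ) : ℂ) * -Complex.I) *
        Complex.exp (((-(4 * Real.pi ^ 2 * ‖ξ‖ ^ 2 * q.2) : ℝ) : ℂ) * Complex.I) := by
      rw [← Complex.exp_add]; congr 1; push_cast; ring
    rw [this]; ring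
  simp_rw [h1]
  rw [Measure.volume_eq_prod, integral_prod_mul
    (fun t => (starRingEnd ℂ) (Complex.exp (((-(4 * Real.pi ^ 2 * ‖ξ‖ ^ 2 * t) : ℝ) : ℂ) *
      Complex.I) * 𝓕 (G t) ξ))
    (fun t => Complex.exp (((-(4 * Real.pi ^ 2 * ‖ξ‖ ^ 2 * t) : ℝ) : ℂ) *
      Complex.I) * 𝓕 (G t) ξ), integral_conj]
  change (starRingEnd ℂ) (dualProfile G ξ) * dualProfile G ξ = _
  rw [mul_comm, Complex.mul_conj, Complex.normSq_eq_norm_sq]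

theorem measurable_dualProfile (hG : IsSlab T B E G) (hE : MeasurableSet E) (hμ : volume E < ∞) :
    Measurable (dualProfile G) := by
  have h1 : StronglyMeasurable fun p : Rd d × ℝ =>
      Complex.exp (((-(4 * Real.pi ^ 2 * ‖p.1‖ ^ 2 * p.2) : ℝ) : ℂ) * Complex.I) *
        𝓕 (G p.2) p.1 := by
    refine Measurable.stronglyMeasurable (Measurable.mul (by fun_prop) ?_)
    exact measurable_uncurry_comp (hG.fourier hE hμ).meas measurable_snd measurable_fst
  exact (h1.integral_prod_right' (ν := volume)).measurable

/-- The `TT*` identity: the truncated forms control the `L²` norm of the dual profile. -/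
theorem memLp_dualProfile (hG : IsSlab T B E G) (hE : MeasurableSet E) (hμ : volume E < ∞)
    (hT : 0 < T) {M : ℝ} (hM : ∀ ε, 0 < ε → ε ≤ T →
      ‖∫ q : ℝ × ℝ, (Set.Ioc ε T).indicator (fun _ => (1 : ℂ)) (q.1 - q.2) *
        propagatorForm d (q.1 - q.2) (G q.2) (G q.1)‖ ≤ M) :
    MemLp (dualProfile G) 2 volume ∧ ∫ ξ, ‖dualProfile G ξ‖ ^ 2 ≤ 2 * M := by
  have hint := hG.integrable_propagatorForm hG hE hμ
  have hBi : Integrable fun ξ => ‖dualProfile G ξ‖ ^ 2 := by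
    have := hint.integral_prod_right
    have h2 := this.norm
    refine h2.congr (ae_of_all _ fun ξ => ?_)
    have := integral_prod_profile G ξ
    rw [Measure.volume_eq_prod] at this
    simp only
    rw [this, Complex.norm_real, Real.norm_of_nonneg (by positivity)]
  refine ⟨(memLp_two_iff_integrable_sq_norm
    (hG.measurable_dualProfile hE hμ).aestronglyMeasurable).2 hBi, ?_⟩
  set J : ℝ × ℝ → ℂ := fun q => propagatorForm d (q.1 - q.2) (G q.2) (G q.1) with hJ
  have hJi : Integrable J (volume.prod volume) := hint.integral_prod_left
  have hJtot : ∫ q, J q ∂(volume.prod volume) = ((∫ ξ, ‖dualProfile G ξ‖ ^ 2 : ℝ) : ℂ) := by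
    have h1 : ∫ q, J q ∂(volume.prod volume) = ∫ ξ, ∫ q : ℝ × ℝ,
        Complex.exp (((4 * Real.pi ^ 2 * ‖ξ‖ ^ 2 * (q.1 - q.2) : ℝ) : ℂ) * Complex.I) *
        (𝓕 (G q.2) ξ * (starRingEnd ℂ) (𝓕 (G q.1) ξ)) := by
      rw [Measure.volume_eq_prod, ← integral_prod_symm _ hint, integral_prod _ hint]
      rfl
    rw [h1, ← integral_complex_ofReal]
    congr 1; ext ξ
    exact integral_prod_profile G ξ
  have hJconj : ∀ q : ℝ × ℝ, J q.swap = (starRingEnd ℂ) (J q) := by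
    intro q
    simp only [hJ, Prod.fst_swap, Prod.snd_swap]
    rw [propagatorForm_conj, neg_sub]
  set χ : ℝ → ℝ → ℂ := fun ε => (Set.Ioc ε T).indicator (fun _ => (1 : ℂ)) with hχ
  have hχm : ∀ ε, Measurable (χ ε) := fun ε => measurable_const.indicator measurableSet_Ioc
  have hχb : ∀ ε x, ‖χ ε x‖ ≤ 1 := by
    intro ε x
    by_cases hx : x ∈ Set.Ioc ε T
    · simp [hχ, Set.indicator_of_mem hx]
    · simp [hχ, Set.indicator_of_notMem hx]
  have hχi : ∀ ε, Integrable (fun q : ℝ × ℝ => χ ε (q.1 - q.2) * J q) (volume.prod volume) :=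
    fun ε => hJi.bdd_mul (c := 1) ((hχm ε).comp (by fun_prop)).aestronglyMeasurable
      (ae_of_all _ fun q => hχb _ _)
  have hI : ‖∫ q : ℝ × ℝ, χ 0 (q.1 - q.2) * J q ∂(volume.prod volume)‖ ≤ M := by
    have hlim : Tendsto (fun n : ℕ => ∫ q : ℝ × ℝ, χ (T / (n + 1)) (q.1 - q.2) * J q
        ∂(volume.prod volume)) atTop
        (𝓝 (∫ q : ℝ × ℝ, χ 0 (q.1 - q.2) * J q ∂(volume.prod volume))) := by
      refine tendsto_integral_of_dominated_convergence (fun q => ‖J q‖)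
        (fun n => (hχi _).aestronglyMeasurable) hJi.norm (fun n => ae_of_all _ fun q => ?_)
        (ae_of_all _ fun q => ?_)
      · rw [norm_mul]
        exact mul_le_of_le_one_left (norm_nonneg _) (hχb _ _)
      · refine Tendsto.mul_const _ ?_
        have h0 : Tendsto (fun n : ℕ => T / ((n : ℝ) + 1)) atTop (𝓝 0) := by
          have := (tendsto_one_div_add_atTop_nhds_zero_nat (𝕜 := ℝ)).const_mul T
          simpa only [mul_one_div, mul_zero] using this
        refine tendsto_const_nhds.congr' ?_
        by_cases hq : 0 < q.1 - q.2
        · filter_upwards [h0.eventually (gt_mem_nhds hq)] with n hn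
          by_cases hq2 : q.1 - q.2 ≤ T
          · simp only [hχ]
            have m1 : q.1 - q.2 ∈ Set.Ioc 0 T := ⟨hq, hq2⟩
            have m2 : q.1 - q.2 ∈ Set.Ioc (T / (n + 1)) T := ⟨hn, hq2⟩
            rw [Set.indicator_of_mem m1, Set.indicator_of_mem m2]
          · simp only [hχ]
            have m1 : q.1 - q.2 ∉ Set.Ioc 0 T := fun h => hq2 h.2
            have m2 : q.1 - q.2 ∉ Set.Ioc (T / (n + 1)) T := fun h => hq2 h.2
            rw [Set.indicator_of_notMem m1, Set.indicator_of_notMem m2]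
        · refine Eventually.of_forall fun n => ?_
          simp only [hχ]
          have m1 : q.1 - q.2 ∉ Set.Ioc 0 T := fun h => hq h.1
          have m2 : q.1 - q.2 ∉ Set.Ioc (T / (n + 1)) T := fun h =>
            hq (lt_trans (by positivity) h.1)
          rw [Set.indicator_of_notMem m1, Set.indicator_of_notMem m2]
    refine le_of_tendsto hlim.norm (Eventually.of_forall fun n => ?_)
    refine hM _ (by positivity) ?_
    apply div_le_self hT.le
    have : (0 : ℝ) ≤ n := Nat.cast_nonneg n
    linarith
  -- the part `s > t` of the form is the conjugate of the part `s < t`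
  have hsplit : ∀ᵐ q : ℝ × ℝ ∂(volume.prod volume),
      J q = χ 0 (q.1 - q.2) * J q + χ 0 (q.2 - q.1) * J q := by
    have hne : ∀ᵐ q : ℝ × ℝ ∂(volume.prod volume), q.1 ≠ q.2 := by
      rw [ae_iff]
      simpa using volume_diagonal_real
    filter_upwards [hne] with q hq
    by_cases ht : q.1 ∈ Set.Ioc 0 T
    · by_cases hs : q.2 ∈ Set.Ioc 0 T
      · rcases lt_or_gt_of_ne hq with h | h
        · have a1 : q.1 - q.2 ∉ Set.Ioc 0 T := fun h' => by linarith [h'.1]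
          have a2 : q.2 - q.1 ∈ Set.Ioc 0 T := ⟨by linarith, by linarith [ht.1, hs.2]⟩
          simp only [hχ]
          rw [Set.indicator_of_notMem a1, Set.indicator_of_mem a2]; ring
        · have a1 : q.2 - q.1 ∉ Set.Ioc 0 T := fun h' => by linarith [h'.1]
          have a2 : q.1 - q.2 ∈ Set.Ioc 0 T := ⟨by linarith, by linarith [hs.1, ht.2]⟩
          simp only [hχ]
          rw [Set.indicator_of_notMem a1, Set.indicator_of_mem a2]; ring
      · have : J q = 0 := by
          simp [hJ, propagatorForm, (hG.fourier hE hμ).time _ _ hs]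
        rw [this]; simp
    · have : J q = 0 := by
        simp [hJ, propagatorForm, (hG.fourier hE hμ).time _ _ ht]
      rw [this]; simp
  have hswap : ∫ q : ℝ × ℝ, χ 0 (q.2 - q.1) * J q ∂(volume.prod volume) =
      (starRingEnd ℂ) (∫ q : ℝ × ℝ, χ 0 (q.1 - q.2) * J q ∂(volume.prod volume)) := by
    rw [← integral_conj, ← integral_prod_swap (fun q : ℝ × ℝ => χ 0 (q.2 - q.1) * J q)]
    congr 1; ext q
    rw [map_mul, hJconj]
    simp only [Prod.fst_swap, Prod.snd_swap]
    congr 1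
    by_cases hq : q.1 - q.2 ∈ Set.Ioc 0 T
    · simp [hχ, Set.indicator_of_mem hq]
    · simp [hχ, Set.indicator_of_notMem hq]
  have hχi' : Integrable (fun q : ℝ × ℝ => χ 0 (q.2 - q.1) * J q) (volume.prod volume) :=
    hJi.bdd_mul (c := 1) ((hχm 0).comp (by fun_prop)).aestronglyMeasurable
      (ae_of_all _ fun q => hχb _ _)
  have htot := integral_congr_ae hsplit
  rw [integral_add (hχi 0) hχi', hswap, hJtot] at htot
  have h0 : 0 ≤ ∫ ξ, ‖dualProfile G ξ‖ ^ 2 := integral_nonneg fun ξ => by positivity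
  calc ∫ ξ, ‖dualProfile G ξ‖ ^ 2 = ‖((∫ ξ, ‖dualProfile G ξ‖ ^ 2 : ℝ) : ℂ)‖ := by
        rw [Complex.norm_real, Real.norm_of_nonneg h0]
    _ ≤ M + M := by
        rw [htot]
        refine (norm_add_le _ _).trans ?_
        rw [RCLike.norm_conj]
        exact add_le_add hI hI
    _ = 2 * M := by ring

end IsSlab

/-- The free evolution with initial datum `𝓕⁻ a`, for integrable `a`. -/
def freeEvolution {d : ℕ} (a : Rd d → ℂ) (t : ℝ) (x : Rd d) : ℂ :=
  𝓕⁻ (fun ξ => schrodingerSymbol d t ξ * a ξ) x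

section FreeEvolution

variable {d : ℕ} {a : Rd d → ℂ}

theorem measurable_freeEvolution (ha : Measurable a) :
    Measurable (Function.uncurry (freeEvolution a)) := by
  have h1 : StronglyMeasurable fun p : (ℝ × Rd d) × Rd d =>
      Complex.exp (((2 * Real.pi * inner ℝ p.2 p.1.2 : ℝ) : ℂ) * Complex.I) *
        (schrodingerSymbol d p.1.1 p.2 * a p.2) := by
    refine Measurable.stronglyMeasurable (Measurable.mul (by fun_prop) (Measurable.mul ?_
      (ha.comp measurable_snd)))
    unfold schrodingerSymbol
    fun_prop
  have h2 := (h1.integral_prod_right' (ν := volume)).measurable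
  convert h2 using 1
  ext p
  simp only [Function.uncurry, freeEvolution]
  rw [Real.fourierInv_eq']
  rfl

theorem norm_freeEvolution_le (t : ℝ) (x : Rd d) : ‖freeEvolution a t x‖ ≤ ∫ ξ, ‖a ξ‖ := by
  rw [freeEvolution, Real.fourierInv_eq]
  refine (norm_integral_le_integral_norm _).trans (le_of_eq ?_)
  congr 1; ext ξ
  rw [Circle.norm_smul, norm_mul, norm_schrodingerSymbol, one_mul]

theorem integrable_schrodingerSymbol_mul (ha : Integrable a) (t : ℝ) :
    Integrable fun ξ => schrodingerSymbol d t ξ * a ξ := by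
  refine ha.bdd_mul (c := 1) ?_ (ae_of_all _ fun ξ => (norm_schrodingerSymbol d t ξ).le)
  have : Continuous (schrodingerSymbol d t) := by unfold schrodingerSymbol; fun_prop
  exact this.aestronglyMeasurable

theorem integral_mul_conj_freeEvolution (ha : Integrable a) {g : Rd d → ℂ} (hg : Integrable g)
    (t : ℝ) : ∫ x, g x * (starRingEnd ℂ) (freeEvolution a t x) =
      ∫ ξ, 𝓕 g ξ * (starRingEnd ℂ) (schrodingerSymbol d t ξ * a ξ) := by
  have hg' : Integrable fun x => (starRingEnd ℂ) (g x) :=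
    Complex.conjLIE.toContinuousLinearEquiv.toContinuousLinearMap.integrable_comp hg
  have h1 := integral_fourierInv_mul_eq (integrable_schrodingerSymbol_mul ha t) hg'
  have h2 := congrArg (starRingEnd ℂ) h1
  rw [← integral_conj, ← integral_conj] at h2
  refine Eq.trans ?_ (h2.trans ?_)
  · refine integral_congr_ae (ae_of_all _ fun x => ?_)
    simp only
    rw [map_mul, Complex.conj_conj, mul_comm]; rfl
  · refine integral_congr_ae (ae_of_all _ fun ξ => ?_)
    simp only
    rw [← conj_fourier, map_mul _ _ ((starRingEnd ℂ) (𝓕 g ξ)), Complex.conj_conj, mul_comm]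

/-- The dual form of the Strichartz estimate, as a weighted space-time bound for the free
evolution, with the endpoint `d * θ = 2` included for `d ≥ 3`. -/
theorem exists_weighted_strichartz {d : ℕ} (hd : 1 ≤ d) {θ : ℝ} (hθ0 : 0 < θ) (hθ1 : θ < 1)
    (hθd : d * θ ≤ 2) :
    ∃ C : ℝ, 0 < C ∧ ∀ {E : Set (Rd d)} {c N : ℝ} {u : Rd d → ℝ}, IsWeight E c N u →
      ∀ {T : ℝ}, 0 < T → ∀ {a : Rd d → ℂ}, Measurable a → Integrable a → MemLp a 2 volume →
      ∫⁻ t in Set.Ioc 0 T, ∫⁻ x, ENNReal.ofReal (u x ^ θ * ‖freeEvolution a t x‖ ^ 2) ≤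
        ENNReal.ofReal (C * T ^ (1 - d * θ / 2) * (∫ x, u x) ^ θ * ∫ ξ, ‖a ξ‖ ^ 2) := by
  obtain ⟨C, hC, hmain⟩ := exists_norm_integral_truncated_le hd hθ0 hθ1 hθd
  refine ⟨2 * C, by positivity, ?_⟩
  intro E c N u hu T hT a ham hai ha2
  set v := freeEvolution a with hv
  set w : Rd d → ℂ := fun x => Complex.exp ((θ : ℂ) * (Real.log (u x) / 2 : ℝ)) with hw
  have hwm : Measurable w := by have := hu.meas; simp only [hw]; fun_prop
  set F : ℝ → Rd d → ℂ := fun t x =>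
    w x * (Set.Ioc 0 T ×ˢ E).indicator (Function.uncurry v) (t, x) with hF
  have hslab0 : IsSlab T (∫ ξ, ‖a ξ‖) E
      (fun t x => (Set.Ioc 0 T ×ˢ E).indicator (Function.uncurry v) (t, x)) := by
    refine ⟨(measurable_freeEvolution ham).indicator (measurableSet_Ioc.prod hu.measE),
      fun t x => ?_, fun t x ht => ?_, fun t x hx => ?_⟩
    · by_cases h : (t, x) ∈ Set.Ioc 0 T ×ˢ E
      · rw [Set.indicator_of_mem h]; exact norm_freeEvolution_le t x
      · rw [Set.indicator_of_notMem h, norm_zero]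
        exact integral_nonneg fun ξ => norm_nonneg _
    · exact Set.indicator_of_notMem (fun h => ht h.1) _
    · exact Set.indicator_of_notMem (fun h => hx h.2) _
  obtain ⟨B, hFs⟩ := hu.isSlab_weighted hslab0 (θ : ℂ)
  obtain ⟨B', hGs⟩ := hu.isSlab_weighted hFs (θ : ℂ)
  change IsSlab T B E F at hFs
  set G : ℝ → Rd d → ℂ := fun t x => w x * F t x with hG
  change IsSlab T B' E G at hGs
  set Q := ∫ p : ℝ × Rd d, ‖F p.1 p.2‖ ^ 2 with hQ
  have hQ0 : 0 ≤ Q := integral_nonneg fun p => by positivity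
  have hFi := hFs.integrable_norm_sq (μ := volume) hu.measE hu.volE
  set U := ∫ x, u x with hU
  have hU0 : 0 ≤ U := integral_nonneg hu.nonneg
  have hTδ : 0 < T ^ (1 - d * θ / 2) := Real.rpow_pos_of_pos hT _
  obtain ⟨hB2, hBM⟩ := hGs.memLp_dualProfile hu.measE hu.volE hT
    (M := C * T ^ (1 - d * θ / 2) * U ^ θ * Q) (fun ε hε hεT => hmain hu hFs hε hεT)
  have hwsq : ∀ x, w x * w x = ((Real.exp (θ * Real.log (u x)) : ℝ) : ℂ) := by
    intro x
    simp only [hw]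
    rw [← Complex.exp_add, Complex.ofReal_exp]
    congr 1; push_cast; ring
  have hwn : ∀ x, ‖w x‖ ^ 2 = Real.exp (θ * Real.log (u x)) := by
    intro x
    rw [sq, ← norm_mul, hwsq, Complex.norm_real, Real.norm_of_nonneg (Real.exp_pos _).le]
  have hpt : ∀ t ∈ Set.Ioc 0 T, ∀ x, ((‖F t x‖ ^ 2 : ℝ) : ℂ) = G t x * (starRingEnd ℂ) (v t x) := by
    intro t ht x
    simp only [hG, hF]
    by_cases hx : x ∈ E
    · rw [Set.indicator_of_mem (show (t, x) ∈ Set.Ioc 0 T ×ˢ E from ⟨ht, hx⟩)]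
      simp only [Function.uncurry]
      rw [norm_mul, mul_pow, hwn, ← mul_assoc, hwsq, mul_assoc, Complex.mul_conj,
        Complex.normSq_eq_norm_sq]
      push_cast; rfl
    · rw [Set.indicator_of_notMem (fun h => hx h.2)]; simp
  have hpt2 : ∀ t ∈ Set.Ioc 0 T, ∀ x, u x ^ θ * ‖v t x‖ ^ 2 = ‖F t x‖ ^ 2 := by
    intro t ht x
    by_cases hx : x ∈ E
    · simp only [hF]
      rw [Set.indicator_of_mem (show (t, x) ∈ Set.Ioc 0 T ×ˢ E from ⟨ht, hx⟩)]
      simp only [Function.uncurry]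
      rw [norm_mul, mul_pow, hwn, Real.rpow_def_of_pos (hu.pos.trans_le (hu.mem x hx).1),
        mul_comm θ]
    · rw [hFs.space _ x hx, hu.supp x hx, Real.zero_rpow hθ0.ne']; simp
  -- `Q = ⟨F, u^{θ/2} v⟩` is the pairing of `a` with the dual profile of `G = u^{θ/2} F`
  have hdual : (Q : ℂ) = ∫ ξ, dualProfile G ξ * (starRingEnd ℂ) (a ξ) := by
    have hai' : Integrable fun ξ => (starRingEnd ℂ) (a ξ) :=
      Complex.conjLIE.toContinuousLinearEquiv.toContinuousLinearMap.integrable_comp hai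
    have hGf := hGs.fourier hu.measE hu.volE
    have hi : Integrable (fun p : ℝ × Rd d => Complex.exp (((-(4 * Real.pi ^ 2 * ‖p.2‖ ^ 2 * p.1) :
        ℝ) : ℂ) * Complex.I) * 𝓕 (G p.1) p.2 * (starRingEnd ℂ) (a p.2))
        (volume.prod volume) := by
      have h1 : Integrable (fun t : ℝ => (Set.Ioc 0 T).indicator (fun _ => (1 : ℂ)) t) :=
        (integrableOn_const measure_Ioc_lt_top.ne).integrable_indicator measurableSet_Ioc
      have h2 := (h1.mul_prod hai').bdd_mul (c := B' * volume.real E)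
        (f := fun p : ℝ × Rd d => Complex.exp (((-(4 * Real.pi ^ 2 * ‖p.2‖ ^ 2 * p.1) :
          ℝ) : ℂ) * Complex.I) * 𝓕 (G p.1) p.2)
        ((Measurable.mul (by fun_prop) hGf.meas).aestronglyMeasurable)
        (ae_of_all _ fun p => by
          rw [norm_mul, Complex.norm_exp_ofReal_mul_I, one_mul]; exact hGf.bound _ _)
      refine h2.congr (ae_of_all _ fun p => ?_)
      simp only
      by_cases hp : p.1 ∈ Set.Ioc 0 T
      · rw [Set.indicator_of_mem hp]; ring
      · rw [hGf.time _ _ hp]; ring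
    calc (Q : ℂ) = ∫ t, ((∫ x, ‖F t x‖ ^ 2 : ℝ) : ℂ) := by
          rw [integral_complex_ofReal, hQ, Measure.volume_eq_prod, integral_prod _ hFi]
      _ = ∫ t, ∫ ξ, Complex.exp (((-(4 * Real.pi ^ 2 * ‖ξ‖ ^ 2 * t) :
            ℝ) : ℂ) * Complex.I) * 𝓕 (G t) ξ * (starRingEnd ℂ) (a ξ) := by
          congr 1; ext t
          by_cases ht : t ∈ Set.Ioc 0 T
          · rw [← integral_complex_ofReal]
            simp_rw [hpt t ht]
            rw [integral_mul_conj_freeEvolution hai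
              (memLp_one_iff_integrable.1 (hGs.memLp_space hu.measE hu.volE t 1))]
            congr 1; ext ξ
            rw [map_mul, schrodingerSymbol, ← Complex.exp_conj, map_mul, Complex.conj_I,
              Complex.conj_ofReal, norm_smul, Real.norm_of_nonneg (by positivity)]
            have : ((t * (2 * Real.pi * ‖ξ‖) ^ 2 : ℝ) : ℂ) * -Complex.I =
                ((-(4 * Real.pi ^ 2 * ‖ξ‖ ^ 2 * t) : ℝ) : ℂ) * Complex.I := by push_cast; ring
            rw [this]; ring
          · simp_rw [hFs.time _ _ ht, hGf.time _ _ ht]; simp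
      _ = ∫ ξ, ∫ t, Complex.exp (((-(4 * Real.pi ^ 2 * ‖ξ‖ ^ 2 * t) :
            ℝ) : ℂ) * Complex.I) * 𝓕 (G t) ξ * (starRingEnd ℂ) (a ξ) :=
          integral_integral_swap hi
      _ = _ := by
          congr 1; ext ξ
          rw [integral_mul_const]; rfl
  set A := ∫ ξ, ‖a ξ‖ ^ 2 with hA
  have hA0 : 0 ≤ A := integral_nonneg fun p => by positivity
  have hQle : Q ≤ 2 * C * T ^ (1 - d * θ / 2) * U ^ θ * A := by
    have h1 : Q ≤ √(2 * (C * T ^ (1 - d * θ / 2) * U ^ θ * Q)) * √A := by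
      calc Q = ‖(Q : ℂ)‖ := by rw [Complex.norm_real, Real.norm_of_nonneg hQ0]
        _ ≤ √(∫ ξ, ‖dualProfile G ξ‖ ^ 2) * √A := by
            rw [hdual]; exact norm_integral_mul_conj_le hB2 ha2
        _ ≤ _ := by gcongr
    -- `Q² ≤ 2C T^δ U^θ Q A`, and `Q` is finite
    rcases hQ0.eq_or_lt with h0 | hpos
    · rw [← h0]; positivity
    · rw [← Real.sqrt_mul (by positivity)] at h1
      have h2 := Real.le_sqrt' hpos |>.1 h1
      have h3 : Q * Q ≤ (2 * C * T ^ (1 - d * θ / 2) * U ^ θ * A) * Q := by nlinarith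
      exact le_of_mul_le_mul_right h3 hpos
  calc ∫⁻ t in Set.Ioc 0 T, ∫⁻ x, ENNReal.ofReal (u x ^ θ * ‖v t x‖ ^ 2)
      = ∫⁻ t in Set.Ioc 0 T, ∫⁻ x, ENNReal.ofReal (‖F t x‖ ^ 2) := by
        refine setLIntegral_congr_fun measurableSet_Ioc fun t ht => ?_
        simp_rw [hpt2 t ht]
    _ ≤ ∫⁻ t, ∫⁻ x, ENNReal.ofReal (‖F t x‖ ^ 2) := setLIntegral_le_lintegral _ _
    _ = ∫⁻ p : ℝ × Rd d, ENNReal.ofReal (‖F p.1 p.2‖ ^ 2) ∂(volume.prod volume) := by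
        rw [lintegral_prod _ (hFi.1.aemeasurable.ennreal_ofReal)]
    _ = ENNReal.ofReal Q := by
        rw [hQ, Measure.volume_eq_prod,
          ofReal_integral_eq_lintegral_ofReal hFi (ae_of_all _ fun p => by positivity)]
    _ ≤ _ := ENNReal.ofReal_le_ofReal hQle

end FreeEvolution

/-! ### Gaussian moments and covariances of a Brownian family -/

/-- The `L^σ` norm of a standard real Gaussian variable. -/
def gaussianMoment (σ : ℝ≥0∞) : ℝ≥0∞ := eLpNorm id σ (gaussianReal 0 1)

theorem gaussianMoment_lt_top {σ : ℝ≥0∞} (hσ : σ ≠ ∞) : gaussianMoment σ < ∞ :=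
  (memLp_id_gaussianReal' σ hσ).2

theorem gaussianMoment_two : gaussianMoment 2 = 1 := by
  have h := variance_id_gaussianReal (μ := 0) (v := 1)
  rw [variance_of_integral_eq_zero aemeasurable_id (by simp)] at h
  have hi : Integrable (fun x : ℝ => x ^ 2) (gaussianReal 0 1) := by
    have := memLp_id_gaussianReal (μ := 0) (v := 1) 2
    exact this.integrable_sq
  rw [gaussianMoment, eLpNorm_eq_lintegral_rpow_enorm_toReal (by norm_num) (by norm_num)]
  have : ∫⁻ x, ‖id x‖ₑ ^ (2 : ℝ≥0∞).toReal ∂(gaussianReal 0 1) = 1 := by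
    have e : ∀ x : ℝ, ‖id x‖ₑ ^ (2 : ℝ≥0∞).toReal = ENNReal.ofReal (x ^ 2) := by
      intro x
      rw [ENNReal.toReal_ofNat, ENNReal.rpow_ofNat, id, ← ofReal_norm,
        ← ENNReal.ofReal_pow (norm_nonneg _), Real.norm_eq_abs, sq_abs]
    simp_rw [e]
    rw [← ofReal_integral_eq_lintegral_ofReal hi (ae_of_all _ fun x => sq_nonneg x)]
    simp only [id] at h
    rw [h]; simp
  rw [this]; simp

variable {Ω : Type*} [MeasurableSpace Ω] {P : Measure Ω}

theorem eLpNorm_eq_of_hasGaussianLaw {g : Ω → ℝ} (hg : HasGaussianLaw g P) (h0 : P[g] = 0)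
    (σ : ℝ≥0∞) : eLpNorm g σ P = eLpNorm g 2 P * gaussianMoment σ := by
  have key : ∀ σ, eLpNorm g σ P = ‖√(Var[g; P])‖ₑ * gaussianMoment σ := by
    intro σ
    have h1 := hg.map_eq_gaussianReal
    rw [h0] at h1
    have h2 := gaussianReal_map_const_mul (μ := 0) (v := 1) (√(Var[g; P]))
    have h3 : (NNReal.mk (√(Var[g; P]) ^ 2) (sq_nonneg _) * 1 : ℝ≥0) = (Var[g; P]).toNNReal := by
      rw [mul_one]
      ext
      rw [Real.coe_toNNReal _ (variance_nonneg g P), NNReal.coe_mk, Real.sq_sqrt (variance_nonneg g P)]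
    rw [h3, mul_zero] at h2
    have e1 : eLpNorm g σ P = eLpNorm id σ (P.map g) := by
      rw [eLpNorm_map_measure aestronglyMeasurable_id hg.aemeasurable]; rfl
    rw [e1, h1, ← h2, eLpNorm_map_measure aestronglyMeasurable_id (by fun_prop)]
    have e2 : id ∘ (fun x : ℝ => √(Var[g; P]) * x) = √(Var[g; P]) • (id : ℝ → ℝ) := by
      ext x; simp
    rw [e2, eLpNorm_const_smul]
    rfl
  rw [key σ, key 2, gaussianMoment_two, mul_one]

/-- The real and imaginary parts of the Brownian motions of a family. -/
def brownianCoord (β : ℕ → ℝ≥0 → Ω → ℂ) (k : ℕ × ℝ≥0 × Bool) (ω : Ω) : ℝ :=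
  if k.2.2 then (β k.1 k.2.1 ω).re else (β k.1 k.2.1 ω).im

/-- The first-chaos variables with finitely many terms: the real linear combinations of the real
and imaginary parts of the Brownian motions. -/
def brownianSpan (β : ℕ → ℝ≥0 → Ω → ℂ) : Submodule ℝ (Ω → ℝ) :=
  Submodule.span ℝ (Set.range (brownianCoord β))

theorem IsComplexBrownian.isGaussianProcess_re {b : ℝ≥0 → Ω → ℂ} (hb : IsComplexBrownian P b) :
    IsGaussianProcess (fun t ω => (b t ω).re) P := by
  have h := hb.re.toIsPreBrownianReal.isGaussianProcess.smul (fun _ => (√2)⁻¹)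
  simpa [smul_eq_mul, ← mul_assoc] using h

theorem IsComplexBrownian.isGaussianProcess_im {b : ℝ≥0 → Ω → ℂ} (hb : IsComplexBrownian P b) :
    IsGaussianProcess (fun t ω => (b t ω).im) P := by
  have h := hb.im.toIsPreBrownianReal.isGaussianProcess.smul (fun _ => (√2)⁻¹)
  simpa [smul_eq_mul, ← mul_assoc] using h

theorem IsComplexBrownian.memLp {b : ℝ≥0 → Ω → ℂ} (hb : IsComplexBrownian P b) (t : ℝ≥0) :
    MemLp (b t) 2 P := by
  have h1 : MemLp (fun ω => ((b t ω).re : ℂ)) 2 P :=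
    (hb.isGaussianProcess_re.hasGaussianLaw_eval t).memLp_two.ofReal
  have h2 : MemLp (fun ω => ((b t ω).im : ℂ)) 2 P :=
    (hb.isGaussianProcess_im.hasGaussianLaw_eval t).memLp_two.ofReal
  refine (h1.add (h2.mul_const Complex.I)).ae_eq (ae_of_all _ fun ω => ?_)
  exact Complex.re_add_im _

theorem integral_of_brownian {B : ℝ≥0 → Ω → ℝ}
    (hB : IsBrownianReal (fun t ω => √2 * B t ω) P) (t : ℝ≥0) : ∫ ω, B t ω ∂P = 0 := by
  have h := hB.toIsPreBrownianReal.integral_eval t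
  rw [integral_const_mul] at h
  have : √2 ≠ 0 := by positivity
  exact (mul_eq_zero.1 h).resolve_left this

/-- A linear combination is a sum, over the modes, of independent Gaussian variables, and each of
these is a sum of two independent ones. -/
theorem IsBrownianFamily.hasGaussianLaw_of_mem_brownianSpan {β : ℕ → ℝ≥0 → Ω → ℂ}
    (hβ : IsBrownianFamily P β) {g : Ω → ℝ}
    (hg : g ∈ brownianSpan β) : HasGaussianLaw g P ∧ P[g] = 0 := by
  rw [brownianSpan, Finsupp.mem_span_range_iff_exists_finsupp] at hg
  obtain ⟨c, rfl⟩ := hg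
  have hre := fun n t => (hβ.brownian n).isGaussianProcess_re.hasGaussianLaw_eval t
  have him := fun n t => (hβ.brownian n).isGaussianProcess_im.hasGaussianLaw_eval t
  classical
  set A := c.support.image Prod.fst with hA
  set J := c.support.image (fun k => k.2.1) with hJ
  have hrep : (c.sum fun i a => a • brownianCoord β i) = fun ω => ∑ n : A,
      ((∑ t ∈ J, c (n, t, true) • (β n t ω).re) + ∑ t ∈ J, c (n, t, false) • (β n t ω).im) := by
    ext ω
    have h1 : c.support ⊆ A ×ˢ (J ×ˢ (Finset.univ : Finset Bool)) := by
      intro k hk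
      simp only [Finset.mem_product, Finset.mem_univ, and_true]
      exact ⟨Finset.mem_image_of_mem _ hk, Finset.mem_image_of_mem (fun k => k.2.1) hk⟩
    rw [Finsupp.sum_of_support_subset c h1 _ (by simp), Finset.sum_product, Finset.sum_apply,
      Finset.sum_coe_sort A fun n =>
      ((∑ t ∈ J, c (n, t, true) • (β n t ω).re) + ∑ t ∈ J, c (n, t, false) • (β n t ω).im)]
    refine Finset.sum_congr rfl fun n _ => ?_
    rw [Finset.sum_product, Finset.sum_apply, ← Finset.sum_add_distrib]
    refine Finset.sum_congr rfl fun t _ => ?_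
    rw [Finset.sum_apply]
    simp [brownianCoord]
  rw [hrep]
  have hn : ∀ n, HasGaussianLaw (fun ω => (∑ t ∈ J, c (n, t, true) • (β n t ω).re) +
      ∑ t ∈ J, c (n, t, false) • (β n t ω).im) P := by
    intro n
    have g1 := ((hβ.brownian n).isGaussianProcess_re.smul
      (fun t => c (n, t, true))).hasGaussianLaw_fun_sum (I := J)
    have g2 := ((hβ.brownian n).isGaussianProcess_im.smul
      (fun t => c (n, t, false))).hasGaussianLaw_fun_sum (I := J)
    refine iIndepFun.hasGaussianLaw_fun_add g1 g2 ?_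
    exact (hβ.brownian n).indep.comp
      (φ := fun x : ℝ≥0 → ℝ => ∑ t ∈ J, c (n, t, true) • x t)
      (ψ := fun x : ℝ≥0 → ℝ => ∑ t ∈ J, c (n, t, false) • x t) (by fun_prop) (by fun_prop)
  constructor
  · refine iIndepFun.hasGaussianLaw_fun_sum (fun n => hn n) ?_
    have h1 := hβ.indep.precomp (g := fun n : A => (n : ℕ)) Subtype.val_injective
    exact h1.comp (fun n (x : ℝ≥0 → ℂ) => (∑ t ∈ J, c ((n : ℕ), t, true) • (x t).re) +
      ∑ t ∈ J, c ((n : ℕ), t, false) • (x t).im) (fun n => by fun_prop)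
  · beta_reduce
    rw [integral_finsetSum _ fun (n : A) _ => (hn n).integrable]
    refine Finset.sum_eq_zero fun n _ => ?_
    rw [integral_add, integral_finsetSum, integral_finsetSum, Finset.sum_eq_zero,
      Finset.sum_eq_zero, add_zero]
    · intro t _; exact (integral_const_mul _ _).trans (by
        rw [integral_of_brownian (hβ.brownian n).im, mul_zero])
    · intro t _; exact (integral_const_mul _ _).trans (by
        rw [integral_of_brownian (hβ.brownian n).re, mul_zero])
    · intro t _; exact (him n t).integrable.const_mul _
    · intro t _; exact (hre n t).integrable.const_mul _
    · exact integrable_finsetSum _ fun t _ => (hre n t).integrable.const_mul _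
    · exact integrable_finsetSum _ fun t _ => (him n t).integrable.const_mul _

/-- Equivalence of moments in the complexified first chaos. The real and imaginary parts need not
be independent, whence the factor `2`. -/
theorem IsBrownianFamily.eLpNorm_le_of_mem_brownianSpan {β : ℕ → ℝ≥0 → Ω → ℂ}
    (hβ : IsBrownianFamily P β) {g₁ g₂ : Ω → ℝ}
    (h₁ : g₁ ∈ brownianSpan β) (h₂ : g₂ ∈ brownianSpan β) {Y : Ω → ℂ}
    (hY : Y =ᵐ[P] fun ω => (g₁ ω : ℂ) + Complex.I * g₂ ω) {σ : ℝ≥0∞} (hσ : 1 ≤ σ) :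
    eLpNorm Y σ P ≤ 2 * gaussianMoment σ * eLpNorm Y 2 P := by
  obtain ⟨l1, m1⟩ := hβ.hasGaussianLaw_of_mem_brownianSpan h₁
  obtain ⟨l2, m2⟩ := hβ.hasGaussianLaw_of_mem_brownianSpan h₂
  rw [eLpNorm_congr_ae hY, eLpNorm_congr_ae hY]
  set W : Ω → ℂ := fun ω => (g₁ ω : ℂ) + Complex.I * g₂ ω with hW
  have b1 : eLpNorm g₁ 2 P ≤ eLpNorm W 2 P := by
    refine eLpNorm_mono fun ω => ?_
    have := Complex.abs_re_le_norm (W ω)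
    simpa [hW] using this
  have b2 : eLpNorm g₂ 2 P ≤ eLpNorm W 2 P := by
    refine eLpNorm_mono fun ω => ?_
    have := Complex.abs_im_le_norm (W ω)
    simpa [hW] using this
  have n1 : eLpNorm (fun ω => (g₁ ω : ℂ)) σ P = eLpNorm g₁ σ P :=
    eLpNorm_congr_norm_ae (ae_of_all _ fun ω => by simp)
  have n2 : eLpNorm (fun ω => Complex.I * (g₂ ω : ℂ)) σ P = eLpNorm g₂ σ P :=
    eLpNorm_congr_norm_ae (ae_of_all _ fun ω => by simp)
  have a1 : AEStronglyMeasurable (fun ω => (g₁ ω : ℂ)) P :=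
    (Complex.measurable_ofReal.comp_aemeasurable l1.aemeasurable).aestronglyMeasurable
  have a2 : AEStronglyMeasurable (fun ω => Complex.I * (g₂ ω : ℂ)) P :=
    ((Complex.measurable_ofReal.comp_aemeasurable l2.aemeasurable).const_mul _).aestronglyMeasurable
  calc eLpNorm W σ P ≤ eLpNorm g₁ σ P + eLpNorm g₂ σ P := by
        rw [← n1, ← n2]; exact eLpNorm_add_le a1 a2 hσ
    _ = (eLpNorm g₁ 2 P + eLpNorm g₂ 2 P) * gaussianMoment σ := by
        rw [eLpNorm_eq_of_hasGaussianLaw l1 m1 σ, eLpNorm_eq_of_hasGaussianLaw l2 m2 σ, add_mul]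
    _ ≤ (eLpNorm W 2 P + eLpNorm W 2 P) * gaussianMoment σ := by gcongr
    _ = _ := by ring

section

variable [IsProbabilityMeasure P]

theorem integral_mul_of_brownian {B : ℝ≥0 → Ω → ℝ}
    (hB : IsBrownianReal (fun t ω => √2 * B t ω) P) (s t : ℝ≥0) :
    ∫ ω, B s ω * B t ω ∂P = (min s t : ℝ) / 2 := by
  have h := hB.toIsPreBrownianReal.covariance_fun_eval s t
  have hm := fun t => (hB.toIsPreBrownianReal.isGaussianProcess.hasGaussianLaw_eval t).memLp_two
  rw [covariance_eq_sub (hm s) (hm t), hB.toIsPreBrownianReal.integral_eval s] at h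
  have e : ∀ ω, ((fun ω => √2 * B s ω) * fun ω => √2 * B t ω) ω = 2 * (B s ω * B t ω) := by
    intro ω
    simp only [Pi.mul_apply]
    have : √2 * √2 = 2 := Real.mul_self_sqrt (by norm_num)
    linear_combination (B s ω * B t ω) * this
  simp_rw [e] at h
  rw [integral_const_mul] at h
  push_cast at h
  linarith

theorem IsComplexBrownian.integral_conj_mul {b : ℝ≥0 → Ω → ℂ} (hb : IsComplexBrownian P b)
    (s t : ℝ≥0) : ∫ ω, (starRingEnd ℂ) (b s ω) * b t ω ∂P = ((min s t : ℝ≥0) : ℂ) := by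
  have hre := fun t => (hb.isGaussianProcess_re.hasGaussianLaw_eval t).memLp_two
  have him := fun t => (hb.isGaussianProcess_im.hasGaussianLaw_eval t).memLp_two
  have hcross : ∀ s t, ∫ ω, (b s ω).re * (b t ω).im ∂P = 0 := by
    intro s t
    have h1 : IndepFun (fun ω => (b s ω).re) (fun ω => (b t ω).im) P :=
      hb.indep.comp (measurable_pi_apply s) (measurable_pi_apply t)
    rw [h1.integral_fun_mul_eq_mul_integral (hre s).1 (him t).1, integral_of_brownian hb.re,
      zero_mul]
  have e : ∀ ω, (starRingEnd ℂ) (b s ω) * b t ω =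
      (((b s ω).re * (b t ω).re + (b s ω).im * (b t ω).im : ℝ) : ℂ) +
        Complex.I * (((b s ω).re * (b t ω).im - (b t ω).re * (b s ω).im : ℝ) : ℂ) := by
    intro ω
    apply Complex.ext
    · simp
    · simp; ring
  simp_rw [e]
  have i1 : Integrable (fun ω => (b s ω).re * (b t ω).re) P := (hre s).integrable_mul (hre t)
  have i2 : Integrable (fun ω => (b s ω).im * (b t ω).im) P := (him s).integrable_mul (him t)
  have i3 : Integrable (fun ω => (b s ω).re * (b t ω).im) P := (hre s).integrable_mul (him t)
  have i4 : Integrable (fun ω => (b t ω).re * (b s ω).im) P := (hre t).integrable_mul (him s)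
  rw [integral_add (i1.add i2).ofReal ((i3.sub i4).ofReal.const_mul _), integral_const_mul,
    integral_complex_ofReal, integral_complex_ofReal]
  rw [integral_add i1 i2, integral_sub i3 i4, hcross, hcross, integral_mul_of_brownian hb.re,
    integral_mul_of_brownian hb.im]
  simp

theorem IsComplexBrownian.integral_eq_zero {b : ℝ≥0 → Ω → ℂ} (hb : IsComplexBrownian P b)
    (t : ℝ≥0) : ∫ ω, b t ω ∂P = 0 := by
  have h := integral_re_add_im (𝕜 := ℂ) ((hb.memLp t).integrable (by norm_num))
  simp only [RCLike.re_to_complex, RCLike.im_to_complex] at h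
  rw [integral_of_brownian hb.re, integral_of_brownian hb.im] at h
  rw [← h]; simp

namespace IsBrownianFamily

variable {β : ℕ → ℝ≥0 → Ω → ℂ}

theorem integral_conj_mul (hβ : IsBrownianFamily P β) (m n : ℕ) (s t : ℝ≥0) :
    ∫ ω, (starRingEnd ℂ) (β m s ω) * β n t ω ∂P = if m = n then ((min s t : ℝ≥0) : ℂ) else 0 := by
  split_ifs with h
  · subst h; exact (hβ.brownian m).integral_conj_mul s t
  · have h1 : IndepFun (fun ω => (starRingEnd ℂ) (β m s ω)) (fun ω => β n t ω) P :=
      (hβ.indep.indepFun h).comp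
        (Complex.continuous_conj.measurable.comp (measurable_pi_apply s)) (measurable_pi_apply t)
    have hm : AEStronglyMeasurable (fun ω => (starRingEnd ℂ) (β m s ω)) P :=
      Complex.continuous_conj.comp_aestronglyMeasurable ((hβ.brownian m).memLp s).1
    rw [h1.integral_fun_mul_eq_mul_integral hm ((hβ.brownian n).memLp t).1,
      (hβ.brownian n).integral_eq_zero, mul_zero]

end IsBrownianFamily

end

/-! ### The Itô isometry as a closed graph -/

/-- Lebesgue measure on `ℝ_+`. -/
def nnVol : Measure ℝ≥0 := Measure.comap ((↑) : ℝ≥0 → ℝ) volume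

theorem measurableEmbedding_coe_nnreal : MeasurableEmbedding ((↑) : ℝ≥0 → ℝ) :=
  MeasurableEmbedding.subtype_coe measurableSet_Ici

theorem range_coe_nnreal : Set.range ((↑) : ℝ≥0 → ℝ) = Set.Ici 0 := by
  ext x; exact ⟨fun ⟨y, hy⟩ => hy ▸ y.2, fun h => ⟨⟨x, h⟩, rfl⟩⟩

theorem map_coe_nnVol : nnVol.map ((↑) : ℝ≥0 → ℝ) = volume.restrict (Set.Ici 0) := by
  rw [nnVol, measurableEmbedding_coe_nnreal.map_comap, range_coe_nnreal]

theorem nnVol_Icc (a b : ℝ≥0) : nnVol (Set.Icc a b) = ENNReal.ofReal (b - a) := by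
  rw [nnVol, measurableEmbedding_coe_nnreal.comap_apply, ← Real.volume_Icc]
  congr 1
  ext x
  constructor
  · rintro ⟨y, hy, rfl⟩; exact ⟨by exact_mod_cast hy.1, by exact_mod_cast hy.2⟩
  · intro hx; exact ⟨⟨x, a.2.trans hx.1⟩, ⟨by exact_mod_cast hx.1, by exact_mod_cast hx.2⟩, rfl⟩

theorem nnVol_Ioc (a b : ℝ≥0) : nnVol (Set.Ioc a b) = ENNReal.ofReal (b - a) := by
  rw [nnVol, measurableEmbedding_coe_nnreal.comap_apply, ← Real.volume_Ioc]
  congr 1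
  ext x
  constructor
  · rintro ⟨y, hy, rfl⟩; exact ⟨by exact_mod_cast hy.1, by exact_mod_cast hy.2⟩
  · intro hx
    exact ⟨⟨x, a.2.trans hx.1.le⟩, ⟨by exact_mod_cast hx.1, by exact_mod_cast hx.2⟩, rfl⟩

instance : SigmaFinite nnVol :=
  ⟨⟨{ set := fun n => Set.Icc 0 n
      set_mem := fun _ => trivial
      finite := fun n => by rw [nnVol_Icc]; exact ENNReal.ofReal_lt_top
      spanning := by
        refine Set.eq_univ_of_forall fun x => Set.mem_iUnion.2 ?_
        obtain ⟨n, hn⟩ := exists_nat_ge x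
        exact ⟨n, zero_le, hn⟩ }⟩⟩

theorem leb_eq (T : ℝ≥0) : leb T = nnVol.restrict (Set.Icc 0 T) := rfl

/-- The product of counting measure on the modes with Lebesgue measure in time. -/
def modeVol : Measure (ℕ × ℝ≥0) := Measure.count.prod nnVol

instance : SigmaFinite modeVol := inferInstanceAs (SigmaFinite (Measure.count.prod nnVol))

theorem lintegral_modeVol {f : ℕ × ℝ≥0 → ℝ≥0∞} (hf : AEMeasurable f modeVol) :
    ∫⁻ z, f z ∂modeVol = ∑' n, ∫⁻ t, f (n, t) ∂nnVol := by
  rw [modeVol, lintegral_prod _ hf, lintegral_count]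

theorem modeVol_singleton_prod_Ioc (n : ℕ) (b : ℝ≥0) :
    modeVol ({n} ×ˢ Set.Ioc 0 b) = b := by
  rw [modeVol, Measure.prod_prod, Measure.count_singleton, nnVol_Ioc]
  simp

theorem measurableSet_mode (n : ℕ) (b : ℝ≥0) :
    MeasurableSet (({n} : Set ℕ) ×ˢ Set.Ioc (0 : ℝ≥0) b) :=
  (measurableSet_singleton n).prod measurableSet_Ioc

theorem modeVol_ne_top (n : ℕ) (b : ℝ≥0) : modeVol (({n} : Set ℕ) ×ˢ Set.Ioc 0 b) ≠ ∞ := by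
  rw [modeVol_singleton_prod_Ioc]; exact ENNReal.coe_ne_top

section Graph

variable {Ω : Type*} [MeasurableSpace Ω] (P : Measure Ω) (β : ℕ → ℝ≥0 → Ω → ℂ)
  (H : Type*) [NormedAddCommGroup H] [InnerProductSpace ℂ H]

/-- The pairs `(1_{{n} × (0,b]} h, βₙ(b) h)` of an integrand and its Wiener integral. -/
def itoGenerators : Set (Lp H 2 modeVol × Lp H 2 P) :=
  {p | ∃ (n : ℕ) (b : ℝ≥0) (h : H),
    p.1 = indicatorConstLp 2 (measurableSet_mode n b)
      (modeVol_ne_top n b) h ∧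
    p.2 =ᵐ[P] fun ω => β n b ω • h}

/-- The closed linear graph generated by the elementary integrands and their Wiener integrals. -/
def itoGraph : Submodule ℂ (Lp H 2 modeVol × Lp H 2 P) :=
  (Submodule.span ℂ (itoGenerators P β H)).topologicalClosure

variable {P β H}

/-- On generators, the isometry is `E[conj (βₘ(b)) βₙ(b')] = δₘₙ min(b, b')`. -/
theorem itoGenerators_inner [CompleteSpace H] [IsProbabilityMeasure P] (hβ : IsBrownianFamily P β)
    {p q : Lp H 2 modeVol × Lp H 2 P} (hp : p ∈ itoGenerators P β H)
    (hq : q ∈ itoGenerators P β H) : inner ℂ p.1 q.1 = inner ℂ p.2 q.2 := by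
  obtain ⟨n, b, h, hp1, hp2⟩ := hp
  obtain ⟨m, b', h', hq1, hq2⟩ := hq
  have e1 : inner ℂ p.2 q.2 =
      (∫ ω, (starRingEnd ℂ) (β n b ω) * β m b' ω ∂P) * inner ℂ h h' := by
    rw [L2.inner_def, ← integral_mul_const]
    refine integral_congr_ae ?_
    filter_upwards [hp2, hq2] with ω h1 h2
    rw [h1, h2, inner_smul_left, inner_smul_right]; ring
  rw [e1, hβ.integral_conj_mul, hp1, hq1]
  rw [L2.inner_indicatorConstLp_indicatorConstLp (hμs := modeVol_ne_top n b)
    (hμt := modeVol_ne_top m b')]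
  have e2 : (({n} : Set ℕ) ×ˢ Set.Ioc (0 : ℝ≥0) b) ∩ ({m} ×ˢ Set.Ioc 0 b') =
      if n = m then {n} ×ˢ Set.Ioc 0 (min b b') else ∅ := by
    rw [Set.prod_inter_prod]
    split_ifs with hnm
    · subst hnm
      rw [Set.inter_self, Set.Ioc_inter_Ioc]; simp
    · have : ({n} : Set ℕ) ∩ {m} = ∅ := by
        ext k; simp; intro h1 h2; exact hnm (h1 ▸ h2)
      rw [this, Set.empty_prod]
  rw [e2]
  split_ifs with hnm
  · rw [Measure.real, modeVol_singleton_prod_Ioc, ENNReal.coe_toReal, RCLike.real_smul_eq_coe_mul]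
    rfl
  · simp

theorem itoSpan_inner [CompleteSpace H] [IsProbabilityMeasure P] (hβ : IsBrownianFamily P β)
    {p q : Lp H 2 modeVol × Lp H 2 P} (hp : p ∈ Submodule.span ℂ (itoGenerators P β H))
    (hq : q ∈ Submodule.span ℂ (itoGenerators P β H)) : inner ℂ p.1 q.1 = inner ℂ p.2 q.2 := by
  induction hp using Submodule.span_induction with
  | mem p hp =>
    induction hq using Submodule.span_induction with
    | mem q hq => exact itoGenerators_inner hβ hp hq
    | zero => simp
    | add x y _ _ hx hy => simp [inner_add_right, hx, hy]
    | smul c x _ hx => simp [inner_smul_right, hx]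
  | zero => simp
  | add x y _ _ hx hy => simp [inner_add_left, hx, hy]
  | smul c x _ hx => simp [inner_smul_left, hx]

theorem itoGraph_norm_eq [CompleteSpace H] [IsProbabilityMeasure P] (hβ : IsBrownianFamily P β)
    {p : Lp H 2 modeVol × Lp H 2 P} (hp : p ∈ itoGraph P β H) : ‖p.1‖ = ‖p.2‖ := by
  have hc : IsClosed {p : Lp H 2 modeVol × Lp H 2 P | ‖p.1‖ = ‖p.2‖} :=
    isClosed_eq (continuous_norm.comp continuous_fst) (continuous_norm.comp continuous_snd)
  refine closure_minimal (fun q hq => ?_) hc hp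
  have := itoSpan_inner hβ hq hq
  rw [inner_self_eq_norm_sq_to_K, inner_self_eq_norm_sq_to_K] at this
  have h2 : ‖q.1‖ ^ 2 = ‖q.2‖ ^ 2 := by exact_mod_cast this
  exact (sq_eq_sq₀ (norm_nonneg _) (norm_nonneg _)).1 h2

variable {K : Type*} [NormedAddCommGroup K] [InnerProductSpace ℂ K]

theorem itoGraph_map (L : H →L[ℂ] K) {p : Lp H 2 modeVol × Lp H 2 P} (hp : p ∈ itoGraph P β H) :
    (L.compLpL 2 modeVol p.1, L.compLpL 2 P p.2) ∈ itoGraph P β K := by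
  set A : (Lp H 2 modeVol × Lp H 2 P) →L[ℂ] (Lp K 2 modeVol × Lp K 2 P) :=
    (L.compLpL 2 modeVol).prodMap (L.compLpL 2 P) with hA
  change p ∈ (itoGraph P β K).comap (A : _ →ₗ[ℂ] _)
  refine (Submodule.topologicalClosure_minimal _ ?_ ?_ : itoGraph P β H ≤ _) hp
  · rw [Submodule.span_le]
    rintro p ⟨n, b, h, h1, h2⟩
    refine Submodule.le_topologicalClosure _ (Submodule.subset_span ⟨n, b, L h, ?_, ?_⟩)
    · change L.compLpL 2 modeVol p.1 = _
      rw [h1]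
      ext1
      filter_upwards [L.coeFn_compLpL (p := 2) (μ := modeVol) (indicatorConstLp 2
        (measurableSet_mode n b)
        (modeVol_ne_top n b) h),
        indicatorConstLp_coeFn (p := 2) (hs := measurableSet_mode n b)
          (hμs := modeVol_ne_top n b) (c := h),
        indicatorConstLp_coeFn (p := 2) (hs := measurableSet_mode n b)
          (hμs := modeVol_ne_top n b) (c := L h)]
        with z h3 h4 h5
      rw [h3, h4, h5]
      by_cases hz : z ∈ ({n} : Set ℕ) ×ˢ Set.Ioc (0 : ℝ≥0) b
      · rw [Set.indicator_of_mem hz, Set.indicator_of_mem hz]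
      · rw [Set.indicator_of_notMem hz, Set.indicator_of_notMem hz, map_zero]
    · change L.compLpL 2 P p.2 =ᵐ[P] _
      filter_upwards [L.coeFn_compLpL (p := 2) (μ := P) p.2, h2] with ω h3 h4
      rw [h3, h4, map_smul]
  · exact (Submodule.isClosed_topologicalClosure _).preimage A.continuous

/-- Equivalence of moments on the graph of the scalar Wiener integral. -/
theorem eLpNorm_le_of_mem_itoGraph [IsProbabilityMeasure P] (hβ : IsBrownianFamily P β)
    {p : Lp ℂ 2 modeVol × Lp ℂ 2 P} (hp : p ∈ itoGraph P β ℂ) {σ : ℝ≥0∞} (hσ : 1 ≤ σ)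
    (hσ' : σ ≠ ∞) : eLpNorm p.2 σ P ≤ 2 * gaussianMoment σ * ‖p.1‖ₑ := by
  have hspan : ∀ q ∈ Submodule.span ℂ (itoGenerators P β ℂ),
      ∃ g₁ ∈ brownianSpan β, ∃ g₂ ∈ brownianSpan β,
        q.2 =ᵐ[P] fun ω => (g₁ ω : ℂ) + Complex.I * g₂ ω := by
    intro q hq
    have hsm : ∀ (c : ℂ) (Y : Ω → ℂ), (∃ g₁ ∈ brownianSpan β, ∃ g₂ ∈ brownianSpan β,
        Y =ᵐ[P] fun ω => (g₁ ω : ℂ) + Complex.I * g₂ ω) → ∃ g₁ ∈ brownianSpan β,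
        ∃ g₂ ∈ brownianSpan β, (fun ω => c * Y ω) =ᵐ[P] fun ω => (g₁ ω : ℂ) + Complex.I * g₂ ω := by
      rintro c Y ⟨g₁, m₁, g₂, m₂, h⟩
      refine ⟨c.re • g₁ - c.im • g₂, sub_mem (Submodule.smul_mem _ _ m₁) (Submodule.smul_mem _ _ m₂),
        c.im • g₁ + c.re • g₂, add_mem (Submodule.smul_mem _ _ m₁) (Submodule.smul_mem _ _ m₂), ?_⟩
      filter_upwards [h] with ω hω
      rw [hω]
      apply Complex.ext
      · simp
      · simp; ring
    induction hq using Submodule.span_induction with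
    | mem q hq =>
      obtain ⟨n, b, h, -, h2⟩ := hq
      have := hsm h (β n b) ⟨brownianCoord β (n, b, true), Submodule.subset_span ⟨_, rfl⟩,
        brownianCoord β (n, b, false), Submodule.subset_span ⟨_, rfl⟩,
        ae_of_all _ fun ω => by
          simp only [brownianCoord, if_true, Bool.false_eq_true, if_false]
          rw [mul_comm, Complex.re_add_im]⟩
      obtain ⟨g₁, m₁, g₂, m₂, h'⟩ := this
      refine ⟨g₁, m₁, g₂, m₂, ?_⟩
      filter_upwards [h2, h'] with ω h3 h4
      rw [h3, ← h4, smul_eq_mul, mul_comm]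
    | zero =>
      refine ⟨0, zero_mem _, 0, zero_mem _, ?_⟩
      filter_upwards [Lp.coeFn_zero (E := ℂ) 2 P] with ω hω
      simp only [Prod.snd_zero]
      rw [hω]; simp
    | add x y _ _ hx hy =>
      obtain ⟨g₁, m₁, g₂, m₂, h⟩ := hx
      obtain ⟨k₁, n₁, k₂, n₂, h'⟩ := hy
      refine ⟨g₁ + k₁, add_mem m₁ n₁, g₂ + k₂, add_mem m₂ n₂, ?_⟩
      filter_upwards [h, h', Lp.coeFn_add x.2 y.2] with ω h1 h2 h3
      rw [Prod.snd_add, h3, Pi.add_apply, h1, h2]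
      simp only [Pi.add_apply]
      push_cast; ring
    | smul c x _ hx =>
      obtain ⟨g₁, m₁, g₂, m₂, h⟩ := hsm c _ hx
      refine ⟨g₁, m₁, g₂, m₂, ?_⟩
      filter_upwards [h, Lp.coeFn_smul c x.2] with ω h1 h2
      rw [Prod.smul_snd, h2, ← h1]; rfl
  have hc : 2 * gaussianMoment σ ≠ ∞ :=
    ENNReal.mul_ne_top (by norm_num) (gaussianMoment_lt_top hσ').ne
  have hbound : ∀ q ∈ Submodule.span ℂ (itoGenerators P β ℂ),
      eLpNorm q.2 σ P ≤ 2 * gaussianMoment σ * ‖q.1‖ₑ := by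
    intro q hq
    obtain ⟨g₁, m₁, g₂, m₂, h⟩ := hspan q hq
    refine (hβ.eLpNorm_le_of_mem_brownianSpan m₁ m₂ h hσ).trans (le_of_eq ?_)
    congr 1
    have h1 := itoGraph_norm_eq hβ (Submodule.le_topologicalClosure _ hq)
    rw [← Lp.enorm_def, ← ofReal_norm, ← ofReal_norm, h1]
  obtain ⟨q, hq, hlim⟩ := mem_closure_iff_seq_limit.1 hp
  have h1 : Tendsto (fun k => (q k).1) atTop (𝓝 p.1) := (continuous_fst.tendsto p).comp hlim
  have h2 : Tendsto (fun k => (q k).2) atTop (𝓝 p.2) := (continuous_snd.tendsto p).comp hlim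
  have hmeas := tendstoInMeasure_of_tendsto_Lp h2
  have hall : ∀ n : ℕ, eLpNorm p.2 σ P ≤
      2 * gaussianMoment σ * ENNReal.ofReal (‖p.1‖ + 1 / ((n : ℝ) + 1)) := by
    intro n
    have hlt : ‖p.1‖ < ‖p.1‖ + 1 / ((n : ℝ) + 1) := by
      have : (0 : ℝ) < 1 / ((n : ℝ) + 1) := by positivity
      linarith
    refine eLpNorm_le_of_tendstoInMeasure ?_ hmeas fun k => Lp.aestronglyMeasurable _
    filter_upwards [h1.norm.eventually (gt_mem_nhds hlt)] with k hk
    refine (hbound _ (hq k)).trans ?_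
    gcongr
    rw [← ofReal_norm]
    exact ENNReal.ofReal_le_ofReal hk.le
  have hlim2 : Tendsto (fun n : ℕ => 2 * gaussianMoment σ *
      ENNReal.ofReal (‖p.1‖ + 1 / ((n : ℝ) + 1))) atTop (𝓝 (2 * gaussianMoment σ * ‖p.1‖ₑ)) := by
    refine ENNReal.Tendsto.const_mul ?_ (Or.inr hc)
    rw [← ofReal_norm]
    refine ENNReal.tendsto_ofReal ?_
    have := (tendsto_one_div_add_atTop_nhds_zero_nat (𝕜 := ℝ)).const_add ‖p.1‖
    simpa using this
  exact ge_of_tendsto hlim2 (Eventually.of_forall hall)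

end Graph

/-- `Y` is the Wiener integral `∑ₙ ∫ F(n, t) dβₙ(t)`: the classes of `F` and `Y` form a pair in
the closed graph of the integral. Functions rather than classes are used, since `F` and `Y` are
given up to null sets. -/
def IsItoPair {Ω H : Type*} [MeasurableSpace Ω] [NormedAddCommGroup H] [InnerProductSpace ℂ H]
    (P : Measure Ω) (β : ℕ → ℝ≥0 → Ω → ℂ) (F : ℕ × ℝ≥0 → H) (Y : Ω → H) : Prop :=
  ∃ (hF : MemLp F 2 modeVol) (hY : MemLp Y 2 P), (hF.toLp F, hY.toLp Y) ∈ itoGraph P β H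

namespace IsItoPair

variable {Ω H : Type*} [MeasurableSpace Ω] [NormedAddCommGroup H] [InnerProductSpace ℂ H]
  {P : Measure Ω} {β : ℕ → ℝ≥0 → Ω → ℂ} {F F' : ℕ × ℝ≥0 → H} {Y Y' : Ω → H}

theorem memLp_left (h : IsItoPair P β F Y) : MemLp F 2 modeVol := h.1

theorem memLp_right (h : IsItoPair P β F Y) : MemLp Y 2 P := h.2.1

theorem congr (h : IsItoPair P β F Y) (hF : F =ᵐ[modeVol] F') (hY : Y =ᵐ[P] Y') :
    IsItoPair P β F' Y' := by
  obtain ⟨h1, h2, h3⟩ := h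
  refine ⟨h1.ae_eq hF, h2.ae_eq hY, ?_⟩
  convert h3 using 2
  · exact (MemLp.toLp_eq_toLp_iff _ _).2 hF.symm
  · exact (MemLp.toLp_eq_toLp_iff _ _).2 hY.symm

theorem add (h : IsItoPair P β F Y) (h' : IsItoPair P β F' Y') :
    IsItoPair P β (fun z => F z + F' z) (fun ω => Y ω + Y' ω) := by
  obtain ⟨h1, h2, h3⟩ := h
  obtain ⟨h1', h2', h3'⟩ := h'
  exact ⟨h1.add h1', h2.add h2', add_mem h3 h3'⟩

theorem smul (c : ℂ) (h : IsItoPair P β F Y) :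
    IsItoPair P β (fun z => c • F z) (fun ω => c • Y ω) := by
  obtain ⟨h1, h2, h3⟩ := h
  exact ⟨h1.const_smul c, h2.const_smul c, Submodule.smul_mem _ c h3⟩

theorem sub (h : IsItoPair P β F Y) (h' : IsItoPair P β F' Y') :
    IsItoPair P β (fun z => F z - F' z) (fun ω => Y ω - Y' ω) := by
  have := h.add (h'.smul (-1))
  refine this.congr (ae_of_all _ fun z => ?_) (ae_of_all _ fun ω => ?_) <;>
    simp [sub_eq_add_neg]

theorem zero : IsItoPair P β (fun _ => (0 : H)) (fun _ => 0) :=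
  ⟨MemLp.zero, MemLp.zero, zero_mem _⟩

theorem sum {ι : Type*} (s : Finset ι) {F : ι → ℕ × ℝ≥0 → H} {Y : ι → Ω → H}
    (h : ∀ i ∈ s, IsItoPair P β (F i) (Y i)) :
    IsItoPair P β (fun z => ∑ i ∈ s, F i z) (fun ω => ∑ i ∈ s, Y i ω) := by
  classical
  induction s using Finset.induction_on with
  | empty => simpa using zero
  | insert i s hi ih =>
    simp only [Finset.sum_insert hi]
    exact (h i (Finset.mem_insert_self i s)).add
      (ih fun j hj => h j (Finset.mem_insert_of_mem hj))

theorem elementary [IsProbabilityMeasure P] (hβ : IsBrownianFamily P β) (n : ℕ) (b : ℝ≥0) (h : H) :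
    IsItoPair P β ((({n} : Set ℕ) ×ˢ Set.Ioc (0 : ℝ≥0) b).indicator fun _ => h)
      (fun ω => β n b ω • h) := by
  have h1 : MemLp ((({n} : Set ℕ) ×ˢ Set.Ioc (0 : ℝ≥0) b).indicator fun _ => h) 2 modeVol :=
    memLp_indicator_const 2 (measurableSet_mode n b) h
      (Or.inr (modeVol_ne_top n b))
  have h2 : MemLp (fun ω => β n b ω • h) 2 P := by
    have := (hβ.brownian n).memLp b
    exact (ContinuousLinearMap.toSpanSingleton ℂ h).comp_memLp' this
  refine ⟨h1, h2, Submodule.le_topologicalClosure _ (Submodule.subset_span ⟨n, b, h, rfl, ?_⟩)⟩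
  exact h2.coeFn_toLp

theorem norm_eq [CompleteSpace H] [IsProbabilityMeasure P] (hβ : IsBrownianFamily P β)
    (h : IsItoPair P β F Y) :
    eLpNorm F 2 modeVol = eLpNorm Y 2 P := by
  obtain ⟨h1, h2, h3⟩ := h
  have := itoGraph_norm_eq hβ h3
  simp only [Lp.norm_toLp] at this
  exact (ENNReal.toReal_eq_toReal_iff' h1.2.ne h2.2.ne).1 this

theorem map {K : Type*} [NormedAddCommGroup K] [InnerProductSpace ℂ K] (L : H →L[ℂ] K)
    (h : IsItoPair P β F Y) : IsItoPair P β (fun z => L (F z)) (fun ω => L (Y ω)) := by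
  obtain ⟨h1, h2, h3⟩ := h
  refine ⟨L.comp_memLp' h1, L.comp_memLp' h2, ?_⟩
  convert itoGraph_map L h3 using 2
  · ext1
    filter_upwards [(L.comp_memLp' h1).coeFn_toLp, L.coeFn_compLpL (h1.toLp F), h1.coeFn_toLp]
      with z a b c
    exact a.trans (by rw [b, c]; rfl)
  · ext1
    filter_upwards [(L.comp_memLp' h2).coeFn_toLp, L.coeFn_compLpL (h2.toLp Y), h2.coeFn_toLp]
      with z a b c
    exact a.trans (by rw [b, c]; rfl)

theorem limit {Fk : ℕ → ℕ × ℝ≥0 → H} {Yk : ℕ → Ω → H} (h : ∀ k, IsItoPair P β (Fk k) (Yk k))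
    (hF : MemLp F 2 modeVol) (hY : MemLp Y 2 P)
    (h1 : Tendsto (fun k => eLpNorm (fun z => Fk k z - F z) 2 modeVol) atTop (𝓝 0))
    (h2 : Tendsto (fun k => eLpNorm (fun ω => Yk k ω - Y ω) 2 P) atTop (𝓝 0)) :
    IsItoPair P β F Y := by
  refine ⟨hF, hY, ?_⟩
  have hc : IsClosed (itoGraph P β H : Set (Lp H 2 modeVol × Lp H 2 P)) :=
    Submodule.isClosed_topologicalClosure _
  have t1 := (Lp.tendsto_Lp_iff_tendsto_eLpNorm'' Fk (fun k => (h k).memLp_left) F hF).2 h1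
  have t2 := (Lp.tendsto_Lp_iff_tendsto_eLpNorm'' Yk (fun k => (h k).memLp_right) Y hY).2 h2
  refine hc.mem_of_tendsto (t1.prodMk_nhds t2) (Eventually.of_forall fun k => ?_)
  obtain ⟨_, _, h3⟩ := h k
  exact h3

/-- Integrands that converge have convergent Wiener integrals. -/
theorem exists_limit [CompleteSpace H] [IsProbabilityMeasure P] (hβ : IsBrownianFamily P β)
    {Fk : ℕ → ℕ × ℝ≥0 → H}
    {Yk : ℕ → Ω → H} (h : ∀ k, IsItoPair P β (Fk k) (Yk k)) (hF : MemLp F 2 modeVol)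
    (h1 : Tendsto (fun k => eLpNorm (fun z => Fk k z - F z) 2 modeVol) atTop (𝓝 0)) :
    ∃ Y, IsItoPair P β F Y ∧
      Tendsto (fun k => eLpNorm (fun ω => Yk k ω - Y ω) 2 P) atTop (𝓝 0) := by
  have t1 := (Lp.tendsto_Lp_iff_tendsto_eLpNorm'' Fk (fun k => (h k).memLp_left) F hF).2 h1
  have hdist : ∀ k l, dist ((h k).memLp_right.toLp (Yk k)) ((h l).memLp_right.toLp (Yk l)) =
      dist ((h k).memLp_left.toLp (Fk k)) ((h l).memLp_left.toLp (Fk l)) := by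
    intro k l
    have := ((h k).sub (h l)).norm_eq hβ
    rw [dist_eq_norm, dist_eq_norm, ← MemLp.toLp_sub, ← MemLp.toLp_sub, Lp.norm_toLp, Lp.norm_toLp]
    exact congrArg ENNReal.toReal this.symm
  have hcau : CauchySeq fun k => (h k).memLp_right.toLp (Yk k) := by
    have := t1.cauchySeq
    rw [Metric.cauchySeq_iff] at this ⊢
    intro ε hε
    obtain ⟨N, hN⟩ := this ε hε
    exact ⟨N, fun m hm n hn => by rw [hdist]; exact hN m hm n hn⟩
  obtain ⟨y, hy⟩ := cauchySeq_tendsto_of_complete hcau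
  have hy' := (Lp.tendsto_Lp_iff_tendsto_eLpNorm' _ _).1 hy
  have hlim : Tendsto (fun k => eLpNorm (fun ω => Yk k ω - y ω) 2 P) atTop (𝓝 0) := by
    refine hy'.congr fun k => eLpNorm_congr_ae ?_
    filter_upwards [(h k).memLp_right.coeFn_toLp] with ω hω
    simp only [Pi.sub_apply]
    rw [hω]
  exact ⟨y, limit h hF (Lp.memLp y) h1 hlim, hlim⟩

theorem eLpNorm_le [IsProbabilityMeasure P] (hβ : IsBrownianFamily P β) {F : ℕ × ℝ≥0 → ℂ}
    {Y : Ω → ℂ} (h : IsItoPair P β F Y) {σ : ℝ≥0∞} (hσ : 1 ≤ σ) (hσ' : σ ≠ ∞) :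
    eLpNorm Y σ P ≤ 2 * gaussianMoment σ * eLpNorm F 2 modeVol := by
  obtain ⟨h1, h2, h3⟩ := h
  have := eLpNorm_le_of_mem_itoGraph hβ h3 hσ hσ'
  rw [eLpNorm_congr_ae h2.coeFn_toLp, Lp.enorm_toLp] at this
  exact this

end IsItoPair

/-! ### Wiener integrals and the stochastic convolution of a unitary group -/

section ModeLift

variable {H : Type*} [NormedAddCommGroup H]

theorem leb_univ (t : ℝ≥0) : leb t Set.univ = t := by
  rw [leb_eq, Measure.restrict_apply_univ, nnVol_Icc]; simp

instance (t : ℝ≥0) : IsFiniteMeasure (leb t) := ⟨by rw [leb_univ]; exact ENNReal.coe_lt_top⟩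

theorem measurableEmbedding_mode (n : ℕ) :
    MeasurableEmbedding (Prod.mk n : ℝ≥0 → ℕ × ℝ≥0) :=
  MeasurableEmbedding.prodMk_left n MeasurableEmbedding.id

/-- The integrand on all modes that is `f` on `[0, t]` in the mode `n`, and `0` otherwise. -/
def modeLift (n : ℕ) (t : ℝ≥0) (f : ℝ≥0 → H) : ℕ × ℝ≥0 → H :=
  (({n} : Set ℕ) ×ˢ Set.Icc 0 t).indicator fun z => f z.2

theorem restrict_modeVol (n : ℕ) (t : ℝ≥0) :
    modeVol.restrict (({n} : Set ℕ) ×ˢ Set.Icc 0 t) = (leb t).map (Prod.mk n) := by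
  rw [modeVol, ← Measure.prod_restrict, Measure.restrict_singleton, Measure.count_singleton,
    one_smul, ← leb_eq, Measure.dirac_prod]

theorem eLpNorm_modeLift (n : ℕ) (t : ℝ≥0) (f : ℝ≥0 → H) :
    eLpNorm (modeLift n t f) 2 modeVol = eLpNorm f 2 (leb t) := by
  rw [modeLift, eLpNorm_indicator_eq_eLpNorm_restrict
    ((measurableSet_singleton n).prod measurableSet_Icc), restrict_modeVol,
    (measurableEmbedding_mode n).eLpNorm_map_measure]
  rfl

theorem memLp_modeLift {n : ℕ} {t : ℝ≥0} {f : ℝ≥0 → H} (hf : MemLp f 2 (leb t)) :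
    MemLp (modeLift n t f) 2 modeVol := by
  rw [modeLift, memLp_indicator_iff_restrict
    ((measurableSet_singleton n).prod measurableSet_Icc), restrict_modeVol,
    (measurableEmbedding_mode n).memLp_map_measure_iff]
  exact hf

theorem modeLift_sub (n : ℕ) (t : ℝ≥0) (f g : ℝ≥0 → H) (z : ℕ × ℝ≥0) :
    modeLift n t f z - modeLift n t g z = modeLift n t (fun x => f x - g x) z := by
  simp only [modeLift, Set.indicator]
  split_ifs <;> simp

theorem modeLift_stepFun {m : ℕ} {τ : ℕ → ℝ≥0} (hτ : Monotone τ) {t : ℝ≥0} (ht : ∀ j, τ j ≤ t)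
    (h : ℕ → H) (n : ℕ) (z : ℕ × ℝ≥0) : modeLift n t (stepFun m τ h) z =
      ∑ j ∈ Finset.range m, ((({n} : Set ℕ) ×ˢ Set.Ioc 0 (τ (j + 1))).indicator (fun _ => h j) z -
        (({n} : Set ℕ) ×ˢ Set.Ioc 0 (τ j)).indicator (fun _ => h j) z) := by
  obtain ⟨k, x⟩ := z
  by_cases hk : k = n
  · subst hk
    have e1 : modeLift k t (stepFun m τ h) (k, x) = stepFun m τ h x := by
      simp only [modeLift, Set.indicator, Set.mem_prod, Set.mem_singleton_iff, Set.mem_Icc,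
        zero_le, true_and]
      split_ifs with hx
      · rfl
      · symm
        refine Finset.sum_eq_zero fun j _ => Set.indicator_of_notMem ?_ _
        exact fun hj => hx (hj.2.trans (ht _))
    rw [e1, stepFun]
    refine Finset.sum_congr rfl fun j _ => ?_
    have hj : τ j ≤ τ (j + 1) := hτ (Nat.le_succ j)
    simp only [Set.indicator, Set.mem_prod, Set.mem_singleton_iff, Set.mem_Ioc, true_and]
    by_cases h1 : τ j < x
    · have h2 : ¬ x ≤ τ j := not_le.2 h1
      have h3 : 0 < x := lt_of_le_of_lt zero_le h1
      simp [h1, h2, h3]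
    · have h2 : x ≤ τ j := not_lt.1 h1
      simp [h1, h2, h2.trans hj]
  · simp [modeLift, Set.indicator, hk]

end ModeLift

section Wiener

variable {Ω H : Type*} [MeasurableSpace Ω] [NormedAddCommGroup H] {P : Measure Ω}

theorem isItoPair_step [InnerProductSpace ℂ H] [IsProbabilityMeasure P]
    {β : ℕ → ℝ≥0 → Ω → ℂ} (hβ : IsBrownianFamily P β) (n : ℕ) {m : ℕ} {τ : ℕ → ℝ≥0}
    (hτ : Monotone τ) {t : ℝ≥0} (ht : ∀ j, τ j ≤ t) (h : ℕ → H) :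
    IsItoPair P β (modeLift n t (stepFun m τ h)) (stepIntegral (β n) m τ h) := by
  have := IsItoPair.sum (P := P) (β := β) (Finset.range m)
    (fun j _ => (IsItoPair.elementary hβ n (τ (j + 1)) (h j)).sub
      (IsItoPair.elementary hβ n (τ j) (h j)))
  refine this.congr (ae_of_all _ fun z => (modeLift_stepFun hτ ht h n z).symm)
    (ae_of_all _ fun ω => ?_)
  simp only [stepIntegral, sub_smul]

theorem eLpNorm_fun_sub_comm {α : Type*} {m : MeasurableSpace α} (μ : Measure α) (f g : α → H)
    (p : ℝ≥0∞) : eLpNorm (fun x => f x - g x) p μ = eLpNorm (fun x => g x - f x) p μ :=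
  eLpNorm_sub_comm f g p μ

theorem IsWienerIntegral.isItoPair [InnerProductSpace ℂ H] [IsProbabilityMeasure P]
    {β : ℕ → ℝ≥0 → Ω → ℂ} (hβ : IsBrownianFamily P β) {n : ℕ} {f : ℝ≥0 → H} {t : ℝ≥0} {I : Ω → H}
    (h : IsWienerIntegral P (β n) f t I) : IsItoPair P β (modeLift n t f) I := by
  obtain ⟨hf, hI, m, τ, h, hτ, ht, h1, h2⟩ := h
  refine IsItoPair.limit (fun k => isItoPair_step hβ n (m := m k) (hτ k) (ht k) (h k))
    (memLp_modeLift hf) hI ?_ ?_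
  · simp only [modeLift_sub]
    refine h1.congr fun k => ?_
    have := eLpNorm_modeLift n t (fun x => stepFun (m k) (τ k) (h k) x - f x)
    rw [eLpNorm_fun_sub_comm]
    exact this.symm
  · exact h2.congr fun k => eLpNorm_fun_sub_comm _ _ _ _

theorem tendsto_eLpNorm_map [NormedSpace ℂ H] {K : Type*} [NormedAddCommGroup K]
    [NormedSpace ℂ K] {α : Type*} [MeasurableSpace α] (μ : Measure α) (L : H →L[ℂ] K)
    {u : ℕ → α → H} (hu : Tendsto (fun k => eLpNorm (u k) 2 μ) atTop (𝓝 0)) :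
    Tendsto (fun k => eLpNorm (fun x => L (u k x)) 2 μ) atTop (𝓝 0) := by
  have hb : Tendsto (fun k => ‖L‖ₑ * eLpNorm (u k) 2 μ) atTop (𝓝 0) := by
    have := ENNReal.Tendsto.const_mul (a := ‖L‖ₑ) hu (Or.inr enorm_ne_top)
    rwa [mul_zero] at this
  refine tendsto_of_tendsto_of_tendsto_of_le_of_le tendsto_const_nhds hb (fun _ => zero_le)
    fun k => ?_
  exact eLpNorm_le_nnreal_smul_eLpNorm_of_ae_le_mul (f := fun x => L (u k x)) (g := u k)
    (c := ‖L‖₊) (μ := μ) (ae_of_all _ fun x => L.le_opNNNorm (u k x)) 2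

theorem IsWienerIntegral.map [NormedSpace ℂ H] {K : Type*} [NormedAddCommGroup K] [NormedSpace ℂ K]
    {β : ℝ≥0 → Ω → ℂ} (L : H →L[ℂ] K) {f : ℝ≥0 → H} {t : ℝ≥0} {I : Ω → H}
    (h : IsWienerIntegral P β f t I) :
    IsWienerIntegral P β (fun x => L (f x)) t (fun ω => L (I ω)) := by
  obtain ⟨hf, hI, m, τ, h, hτ, ht, h1, h2⟩ := h
  refine ⟨L.comp_memLp' hf, L.comp_memLp' hI, m, τ, fun k j => L (h k j), hτ, ht, ?_, ?_⟩
  · refine (tendsto_eLpNorm_map _ L h1).congr fun k => ?_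
    congr 1; ext x
    simp only [map_sub, stepFun, map_sum]
    congr 1
    refine Finset.sum_congr rfl fun j _ => ?_
    simp only [Set.indicator]; split_ifs <;> simp
  · refine (tendsto_eLpNorm_map _ L h2).congr fun k => ?_
    congr 1; ext x
    simp only [map_sub, stepIntegral, map_sum, map_smul]

theorem stepFun_eq {m : ℕ} {τ : ℕ → ℝ≥0} (hτ : Monotone τ) (h : ℕ → H) {x : ℝ≥0}
    (h0 : τ 0 < x) (hm : x ≤ τ m) :
    ∃ j < m, x ∈ Set.Ioc (τ j) (τ (j + 1)) ∧ stepFun m τ h x = h j := by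
  have hex : ∃ k, x ≤ τ k := ⟨m, hm⟩
  classical
  obtain ⟨j, hj⟩ : ∃ j, Nat.find hex = j + 1 := by
    refine Nat.exists_eq_succ_of_ne_zero fun h => ?_
    have := Nat.find_spec hex
    rw [h] at this
    exact absurd h0 (not_lt.2 this)
  have hjm : j < m := by
    have := Nat.find_min' hex hm
    omega
  have h1 : τ j < x := not_le.1 (Nat.find_min hex (by omega))
  have h2 : x ≤ τ (j + 1) := hj ▸ Nat.find_spec hex
  refine ⟨j, hjm, ⟨h1, h2⟩, ?_⟩
  rw [stepFun, Finset.sum_eq_single_of_mem j (Finset.mem_range.2 hjm)]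
  · exact Set.indicator_of_mem (show x ∈ Set.Ioc (τ j) (τ (j + 1)) from ⟨h1, h2⟩) _
  · intro i _ hij
    refine Set.indicator_of_notMem (fun hx => ?_) _
    have := hτ.pairwise_disjoint_on_Ioc_succ hij
    exact Set.disjoint_left.1 this hx ⟨h1, h2⟩

theorem ae_leb_mem (t : ℝ≥0) : ∀ᵐ x ∂(leb t), x ∈ Set.Ioc 0 t := by
  have h0 : leb t {0} = 0 := by
    have := nnVol_Icc 0 0
    rw [Set.Icc_self, sub_self, ENNReal.ofReal_zero] at this
    exact le_antisymm ((Measure.restrict_apply_le _ _).trans this.le) zero_le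
  have h1 : ∀ᵐ x ∂(leb t), x ∉ ({0} : Set ℝ≥0) := measure_eq_zero_iff_ae_notMem.1 h0
  have h2 : ∀ᵐ x ∂(leb t), x ∈ Set.Icc 0 t := ae_restrict_mem measurableSet_Icc
  filter_upwards [h1, h2] with x hx hx2
  exact ⟨pos_iff_ne_zero.2 hx, hx2.2⟩

/-- The Riemann sums of a continuous integrand converge in `L²`. -/
theorem exists_stepFun_tendsto {f : ℝ≥0 → H} (hf : Continuous f) (t : ℝ≥0) :
    ∃ (m : ℕ → ℕ) (τ : ℕ → ℕ → ℝ≥0) (h : ℕ → ℕ → H),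
    (∀ k, Monotone (τ k)) ∧ (∀ k j, τ k j ≤ t) ∧
    Tendsto (fun k => eLpNorm (fun x => f x - stepFun (m k) (τ k) (h k) x) 2 (leb t))
      atTop (𝓝 0) := by
  set τ : ℕ → ℕ → ℝ≥0 := fun k j => min t (t * j / (k + 1)) with hτdef
  have hτ : ∀ k, Monotone (τ k) := by
    intro k i j hij
    refine min_le_min_left t ?_
    gcongr
  refine ⟨fun k => k + 1, τ, fun k j => f (τ k j), hτ, fun k j => min_le_left _ _, ?_⟩
  have hunif : UniformContinuousOn f (Set.Icc 0 t) :=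
    isCompact_Icc.uniformContinuousOn_of_continuous hf.continuousOn
  rw [ENNReal.tendsto_nhds_zero]
  intro ε hε
  obtain ⟨η, hη0, hη⟩ : ∃ η : ℝ≥0, 0 < η ∧ (t : ℝ≥0∞) ^ (1 / 2 : ℝ) * η ≤ ε := by
    by_cases ht : (t : ℝ≥0∞) ^ (1 / 2 : ℝ) = 0
    · exact ⟨1, one_pos, by rw [ht, zero_mul]; exact zero_le⟩
    · have htt : (t : ℝ≥0∞) ^ (1 / 2 : ℝ) ≠ ∞ :=
        ENNReal.rpow_ne_top_of_nonneg (by norm_num) ENNReal.coe_ne_top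
      have : 0 < ε / (t : ℝ≥0∞) ^ (1 / 2 : ℝ) := ENNReal.div_pos hε.ne' htt
      obtain ⟨η, h1, h2⟩ := ENNReal.lt_iff_exists_nnreal_btwn.1 this
      refine ⟨η, by exact_mod_cast h1, ?_⟩
      rw [mul_comm]
      exact (ENNReal.le_div_iff_mul_le (Or.inl ht) (Or.inl htt)).1 h2.le
  obtain ⟨δ, hδ, hu⟩ := Metric.uniformContinuousOn_iff_le.1 hunif η (by exact_mod_cast hη0)
  have hlim : Tendsto (fun k : ℕ => (t : ℝ) * (1 / ((k : ℝ) + 1))) atTop (𝓝 0) := by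
    have := (tendsto_one_div_add_atTop_nhds_zero_nat (𝕜 := ℝ)).const_mul (t : ℝ)
    rwa [mul_zero] at this
  filter_upwards [hlim.eventually (gt_mem_nhds hδ)] with k hk
  have hae : ∀ᵐ x ∂(leb t), ‖f x - stepFun (k + 1) (τ k) (fun j => f (τ k j)) x‖ ≤ η := by
    filter_upwards [ae_leb_mem t] with x hx
    have h0 : τ k 0 < x := by simpa [hτdef] using hx.1
    have hm : x ≤ τ k (k + 1) := by
      have : (t * ((k + 1 : ℕ) : ℝ≥0)) / ((k : ℝ≥0) + 1) = t := by
        push_cast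
        exact mul_div_cancel_right₀ _ (by positivity)
      simp only [hτdef, this, min_self]
      exact hx.2
    obtain ⟨j, hj, hx2, he⟩ := stepFun_eq (hτ k) (fun j => f (τ k j)) h0 hm
    rw [he, ← dist_eq_norm]
    refine hu x ⟨zero_le, hx.2⟩ (τ k j) ⟨zero_le, min_le_left _ _⟩ ?_
    refine le_trans ?_ hk.le
    have hlt : (t * j / (k + 1) : ℝ≥0) < x := by
      rcases min_lt_iff.1 hx2.1 with h | h
      · exact absurd hx.2 (not_le.2 h)
      · exact h
    have hle : τ k j = t * j / (k + 1) := min_eq_right (hlt.le.trans hx.2)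
    have h3 : x ≤ t * (j + 1 : ℕ) / (k + 1) := hx2.2.trans (min_le_right _ _)
    have h3' : (x : ℝ) ≤ t * (j + 1) / (k + 1) := by
      have : (x : ℝ) ≤ ((t * (j + 1 : ℕ) / (k + 1) : ℝ≥0) : ℝ) := by exact_mod_cast h3
      push_cast at this; exact this
    have h4 : ((τ k j : ℝ≥0) : ℝ) = t * j / (k + 1) := by rw [hle]; push_cast; rfl
    have h5 : (τ k j : ℝ) ≤ x := by exact_mod_cast hx2.1.le
    rw [NNReal.dist_eq, abs_of_nonneg (by linarith), h4]
    have : (t : ℝ) * (j + 1) / (k + 1) = t * j / (k + 1) + t * (1 / (k + 1)) := by ring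
    linarith
  have := eLpNorm_le_of_ae_bound (p := 2) hae
  refine this.trans (le_trans (le_of_eq ?_) hη)
  rw [leb_univ]
  simp

theorem exists_isWienerIntegral [InnerProductSpace ℂ H] [CompleteSpace H] [IsProbabilityMeasure P]
    {β : ℕ → ℝ≥0 → Ω → ℂ} (hβ : IsBrownianFamily P β) (n : ℕ) {f : ℝ≥0 → H} (hf : Continuous f)
    (t : ℝ≥0) : ∃ I, IsWienerIntegral P (β n) f t I := by
  obtain ⟨m, τ, h, hτ, ht, hlim⟩ := exists_stepFun_tendsto hf t
  have hfL : MemLp f 2 (leb t) := by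
    obtain ⟨C, hC⟩ := isCompact_Icc.exists_bound_of_continuousOn (hf.continuousOn (s := Set.Icc 0 t))
    refine MemLp.of_bound hf.aestronglyMeasurable C ?_
    filter_upwards [ae_leb_mem t] with x hx
    exact hC x ⟨zero_le, hx.2⟩
  have hlim' : Tendsto (fun k => eLpNorm (fun z => modeLift n t (stepFun (m k) (τ k) (h k)) z -
      modeLift n t f z) 2 modeVol) atTop (𝓝 0) := by
    simp only [modeLift_sub]
    refine hlim.congr fun k => ?_
    have := eLpNorm_modeLift n t (fun x => stepFun (m k) (τ k) (h k) x - f x)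
    rw [eLpNorm_fun_sub_comm]
    exact this.symm
  obtain ⟨Y, hY, hYlim⟩ := IsItoPair.exists_limit hβ
    (fun k => isItoPair_step hβ n (m := m k) (hτ k) (ht k) (h k)) (memLp_modeLift hfL) hlim'
  exact ⟨Y, hfL, hY.memLp_right, m, τ, h, hτ, ht, hlim,
    hYlim.congr fun k => eLpNorm_fun_sub_comm _ _ _ _⟩

end Wiener

/-- A strongly continuous unitary group, as an isometric one-parameter group of bounded operators.
-/
structure IsUnitaryGroup {H : Type*} [NormedAddCommGroup H] [NormedSpace ℂ H]
    (S : ℝ → H →L[ℂ] H) : Prop where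
  norm_map : ∀ t h, ‖S t h‖ = ‖h‖
  map_add : ∀ a b h, S a (S b h) = S (a + b) h
  map_zero : ∀ h, S 0 h = h
  continuous : ∀ h, Continuous fun t => S t h

theorem eLpNorm_two_modeVol {H : Type*} [NormedAddCommGroup H] {G : ℕ × ℝ≥0 → H}
    (hG : AEStronglyMeasurable G modeVol) {A : Set ℝ≥0} (hA : MeasurableSet A) {c : ℕ → ℝ≥0∞}
    (h : ∀ z, ‖G z‖ₑ = A.indicator (fun _ => c z.1) z.2) :
    eLpNorm G 2 modeVol = (nnVol A * ∑' n, c n ^ 2) ^ (1 / 2 : ℝ) := by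
  rw [eLpNorm_eq_lintegral_rpow_enorm_toReal (by norm_num) (by norm_num),
    lintegral_modeVol (hG.enorm.pow_const _)]
  congr 1
  rw [← ENNReal.tsum_mul_left]
  refine tsum_congr fun n => ?_
  have : ∀ t, ‖G (n, t)‖ₑ ^ (2 : ℝ≥0∞).toReal = A.indicator (fun _ => c n ^ 2) t := by
    intro t
    rw [h, ENNReal.toReal_ofNat, ENNReal.rpow_ofNat]
    simp only [Set.indicator]; split_ifs <;> simp
  simp_rw [this]
  rw [lintegral_indicator_const hA, mul_comm]

theorem tsum_ite_lt_tendsto {g : ℕ → ℝ≥0∞} (hg : ∑' n, g n ≠ ∞) :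
    Tendsto (fun N => ∑' n, if n < N then 0 else g n) atTop (𝓝 0) := by
  refine (ENNReal.tendsto_sum_nat_add g hg).congr fun N => ?_
  rw [← ENNReal.summable.sum_add_tsum_nat_add' (f := fun n => if n < N then 0 else g n) (k := N),
    Finset.sum_eq_zero, zero_add]
  · refine tsum_congr fun k => ?_
    rw [if_neg (by omega)]
  · intro i hi
    rw [if_pos (Finset.mem_range.1 hi)]

section Convolution

variable {H : Type*} [NormedAddCommGroup H] [InnerProductSpace ℂ H]

/-- The integrand `-i 1_{t' ≤ t} S(t - t') fₙ` of the stochastic convolution at time `t`. -/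
def convIntegrand (S : ℝ → H →L[ℂ] H) (f : ℕ → H) (t : ℝ≥0) : ℕ × ℝ≥0 → H :=
  {z | z.2 ∈ Set.Icc 0 t}.indicator fun z => (-Complex.I) • S ((t : ℝ) - z.2) (f z.1)

variable {S : ℝ → H →L[ℂ] H} {f : ℕ → H}

theorem IsUnitaryGroup.continuous_mode (hS : IsUnitaryGroup S) (f : ℕ → H) (t : ℝ) :
    Continuous fun z : ℕ × ℝ≥0 => S (t - z.2) (f z.1) := by
  refine continuous_prod_of_discrete_left.2 fun n => ?_
  exact (hS.continuous (f n)).comp (by fun_prop)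

theorem aestronglyMeasurable_convIntegrand (hS : IsUnitaryGroup S) (f : ℕ → H) (t : ℝ≥0) :
    AEStronglyMeasurable (convIntegrand S f t) modeVol := by
  refine AEStronglyMeasurable.indicator ?_ (measurableSet_Icc.preimage measurable_snd)
  exact ((hS.continuous_mode f t).const_smul _).aestronglyMeasurable

theorem enorm_convIntegrand (hS : IsUnitaryGroup S) (f : ℕ → H) (t : ℝ≥0) (z : ℕ × ℝ≥0) :
    ‖convIntegrand S f t z‖ₑ = (Set.Icc 0 t).indicator (fun _ => ‖f z.1‖ₑ) z.2 := by
  simp only [convIntegrand, Set.indicator, Set.mem_ofPred_eq]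
  split_ifs with h
  · rw [← ofReal_norm, norm_smul, hS.norm_map]; simp
  · simp

theorem memLp_convIntegrand (hS : IsUnitaryGroup S) (hf : ∑' n, ‖f n‖ₑ ^ 2 ≠ ∞) (t : ℝ≥0) :
    MemLp (convIntegrand S f t) 2 modeVol := by
  refine ⟨aestronglyMeasurable_convIntegrand hS f t, ?_⟩
  rw [eLpNorm_two_modeVol (aestronglyMeasurable_convIntegrand hS f t) measurableSet_Icc
    (c := fun n => ‖f n‖ₑ) (enorm_convIntegrand hS f t), nnVol_Icc]
  exact ENNReal.rpow_lt_top_of_nonneg (by norm_num) (ENNReal.mul_ne_top ENNReal.ofReal_ne_top hf)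

/-- The integrand of a partial sum of the stochastic convolution, as a truncation. -/
theorem sum_modeLift_eq (S : ℝ → H →L[ℂ] H) (f : ℕ → H) (t : ℝ≥0) (N : ℕ) (z : ℕ × ℝ≥0) :
    ∑ n ∈ Finset.range N, (-Complex.I) • modeLift n t (fun t' => S ((t : ℝ) - t') (f n)) z =
      if z.1 < N then convIntegrand S f t z else 0 := by
  obtain ⟨k, x⟩ := z
  simp only [modeLift, convIntegrand, Set.indicator, Set.mem_prod, Set.mem_singleton_iff,
    Set.mem_ofPred_eq]
  split_ifs with h1 h2
  · rw [Finset.sum_eq_single_of_mem k (Finset.mem_range.2 h1)]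
    · rw [if_pos ⟨rfl, h2⟩]
    · intro i _ hik
      rw [if_neg (fun h => hik h.1.symm), smul_zero]
  · exact Finset.sum_eq_zero fun i _ => by rw [if_neg (fun h => h2 h.2), smul_zero]
  · refine Finset.sum_eq_zero fun i hi => ?_
    rw [if_neg, smul_zero]
    rintro ⟨h, -⟩
    exact h1 (h ▸ Finset.mem_range.1 hi)

theorem tendsto_sum_modeLift (hS : IsUnitaryGroup S) (hf : ∑' n, ‖f n‖ₑ ^ 2 ≠ ∞) (t : ℝ≥0) :
    Tendsto (fun N => eLpNorm (fun z => ∑ n ∈ Finset.range N,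
      (-Complex.I) • modeLift n t (fun t' => S ((t : ℝ) - t') (f n)) z - convIntegrand S f t z) 2
      modeVol) atTop (𝓝 0) := by
  have key : ∀ N, eLpNorm (fun z => ∑ n ∈ Finset.range N,
      (-Complex.I) • modeLift n t (fun t' => S ((t : ℝ) - t') (f n)) z - convIntegrand S f t z) 2
      modeVol = (nnVol (Set.Icc 0 t) * ∑' n, if n < N then 0 else ‖f n‖ₑ ^ 2) ^ (1 / 2 : ℝ) := by
    intro N
    have e : (fun z => ∑ n ∈ Finset.range N,
        (-Complex.I) • modeLift n t (fun t' => S ((t : ℝ) - t') (f n)) z - convIntegrand S f t z) =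
        fun z => -({z : ℕ × ℝ≥0 | N ≤ z.1}.indicator (convIntegrand S f t) z) := by
      ext z
      rw [sum_modeLift_eq]
      simp only [Set.indicator, Set.mem_ofPred_eq]
      by_cases h : z.1 < N
      · simp [h, not_le.2 h]
      · simp [h, not_lt.1 h]
    rw [e, eLpNorm_two_modeVol (A := Set.Icc 0 t) (c := fun n => if n < N then 0 else ‖f n‖ₑ) _
      measurableSet_Icc]
    · congr 2
      refine tsum_congr fun n => ?_
      split_ifs <;> simp
    · intro z
      rw [enorm_neg]
      simp only [Set.indicator, Set.mem_ofPred_eq]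
      by_cases h : z.1 < N
      · simp [h, not_le.2 h]
      · have := enorm_convIntegrand hS f t z
        simp only [Set.indicator] at this
        rw [if_pos (not_lt.1 h), this, if_neg h]
    · exact ((aestronglyMeasurable_convIntegrand hS f t).indicator
        (measurableSet_le measurable_const measurable_fst)).neg
  simp_rw [key]
  have h1 := ENNReal.Tendsto.const_mul (a := nnVol (Set.Icc 0 t)) (tsum_ite_lt_tendsto hf)
    (Or.inr (by rw [nnVol_Icc]; exact ENNReal.ofReal_ne_top))
  rw [mul_zero] at h1
  have h2 := h1.ennrpow_const (1 / 2 : ℝ)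
  rwa [ENNReal.zero_rpow_of_pos (by norm_num)] at h2

variable {Ω : Type*} [MeasurableSpace Ω] {P : Measure Ω} [IsProbabilityMeasure P]
  {β : ℕ → ℝ≥0 → Ω → ℂ}

theorem isItoPair_convolution (hβ : IsBrownianFamily P β) (hS : IsUnitaryGroup S)
    (hf : ∑' n, ‖f n‖ₑ ^ 2 ≠ ∞) {t : ℝ≥0} {I : ℕ → Ω → H} {Ψ : Ω → H}
    (hI : ∀ n, IsWienerIntegral P (β n) (fun t' => S ((t : ℝ) - t') (f n)) t (I n))
    (hΨ : MemLp Ψ 2 P)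
    (hlim : Tendsto (fun N => eLpNorm
      (fun ω => Ψ ω - ∑ n ∈ Finset.range N, (-Complex.I) • I n ω) 2 P) atTop (𝓝 0)) :
    IsItoPair P β (convIntegrand S f t) Ψ := by
  refine IsItoPair.limit (fun N => IsItoPair.sum (Finset.range N) fun n _ =>
    ((hI n).isItoPair hβ).smul (-Complex.I)) (memLp_convIntegrand hS hf t) hΨ
    (tendsto_sum_modeLift hS hf t) ?_
  exact hlim.congr fun N => eLpNorm_fun_sub_comm _ _ _ _

theorem exists_convolution [CompleteSpace H] (hβ : IsBrownianFamily P β) (hS : IsUnitaryGroup S)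
    (hf : ∑' n, ‖f n‖ₑ ^ 2 ≠ ∞) (t : ℝ≥0) : ∃ (I : ℕ → Ω → H) (Ψ : Ω → H),
    (∀ n, IsWienerIntegral P (β n) (fun t' => S ((t : ℝ) - t') (f n)) t (I n)) ∧ MemLp Ψ 2 P ∧
    Tendsto (fun N => eLpNorm
      (fun ω => Ψ ω - ∑ n ∈ Finset.range N, (-Complex.I) • I n ω) 2 P) atTop (𝓝 0) := by
  have hc : ∀ n, Continuous fun t' : ℝ≥0 => S ((t : ℝ) - t') (f n) := fun n =>
    (hS.continuous (f n)).comp (by fun_prop)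
  choose I hI using fun n => exists_isWienerIntegral hβ n (hc n) t
  obtain ⟨Ψ, h1, h2⟩ := IsItoPair.exists_limit hβ (fun N => IsItoPair.sum (Finset.range N)
    fun n _ => ((hI n).isItoPair hβ).smul (-Complex.I)) (memLp_convIntegrand hS hf t)
    (tendsto_sum_modeLift hS hf t)
  exact ⟨I, Ψ, hI, h1.memLp_right, h2.congr fun N => eLpNorm_fun_sub_comm _ _ _ _⟩

/-- The process `S(-t) Ψ(t) = -i ∑ₙ ∫_0^t S(-t') fₙ dβₙ(t')` has increments of size
`|t - s|^{1/2}`. -/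
theorem eLpNorm_sub_convIntegrand (hS : IsUnitaryGroup S) (f : ℕ → H) {s t : ℝ≥0} (hst : s ≤ t) :
    eLpNorm (fun z => S (-t) (convIntegrand S f t z) - S (-s) (convIntegrand S f s z)) 2 modeVol =
      (ENNReal.ofReal (t - s) * ∑' n, ‖f n‖ₑ ^ 2) ^ (1 / 2 : ℝ) := by
  rw [eLpNorm_two_modeVol (A := Set.Ioc s t) (c := fun n => ‖f n‖ₑ) _ measurableSet_Ioc,
    nnVol_Ioc]
  · intro z
    have e : ∀ t : ℝ≥0, S (-t) (convIntegrand S f t z) =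
        if z.2 ≤ t then (-Complex.I) • S (-z.2) (f z.1) else 0 := by
      intro t
      simp only [convIntegrand, Set.indicator, Set.mem_ofPred_eq, Set.mem_Icc, zero_le, true_and]
      split_ifs
      · rw [map_smul, hS.map_add]; congr 3; ring
      · simp
    rw [e, e]
    simp only [Set.indicator, Set.mem_Ioc]
    have e2 : ‖(-Complex.I) • S (-z.2) (f z.1)‖ₑ = ‖f z.1‖ₑ := by
      rw [← ofReal_norm, norm_smul, hS.norm_map]; simp
    by_cases h1 : z.2 ≤ s
    · simp [h1, h1.trans hst, not_lt.2 h1]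
    · by_cases h2 : z.2 ≤ t
      · rw [if_pos h2, if_neg h1, if_pos ⟨not_le.1 h1, h2⟩, sub_zero, e2]
      · simp [h1, h2]
  · exact ((S (-t)).continuous.comp_aestronglyMeasurable
      (aestronglyMeasurable_convIntegrand hS f t)).sub ((S (-s)).continuous.comp_aestronglyMeasurable
      (aestronglyMeasurable_convIntegrand hS f s))

end Convolution

/-! ### Minkowski's integral inequality and lower semicontinuity of `L^r` norms -/

section Minkowski

variable {Ω X : Type*} [MeasurableSpace Ω] [MeasurableSpace X]

/-- The absorption `A ≤ B A^{1-1/p} ⟹ A ≤ B^p` of a finite quantity. -/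
theorem le_rpow_of_le_mul_rpow {A B : ℝ≥0∞} {p : ℝ} (hp0 : 0 < p) (hA : A ≠ ∞)
    (h : A ≤ B * A ^ (1 - 1 / p)) : A ≤ B ^ p := by
  by_cases hA0 : A = 0
  · rw [hA0]; exact zero_le
  have h5 : A ^ (1 / p) ≤ B := by
    have hne : A ^ (1 - 1 / p) ≠ 0 := by
      rw [Ne, ENNReal.rpow_eq_zero_iff]; rintro (⟨h, -⟩ | ⟨h, -⟩)
      exacts [hA0 h, hA h]
    have hnt : A ^ (1 - 1 / p) ≠ ∞ := by
      rw [Ne, ENNReal.rpow_eq_top_iff]; rintro (⟨h, -⟩ | ⟨h, -⟩)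
      exacts [hA0 h, hA h]
    refine (ENNReal.mul_le_mul_iff_left hne hnt).1 ?_
    rw [← ENNReal.rpow_add _ _ hA0 hA]
    simpa using h
  calc A = (A ^ (1 / p)) ^ p := by
        rw [← ENNReal.rpow_mul, one_div, inv_mul_cancel₀ hp0.ne', ENNReal.rpow_one]
    _ ≤ B ^ p := by gcongr

/-- Minkowski's integral inequality, by Hölder's inequality against `G^{p-1}` and absorption. -/
theorem lintegral_rpow_lintegral_le {P : Measure Ω} [IsFiniteMeasure P] {μ : Measure X} [SFinite μ]
    {g : Ω → X → ℝ≥0∞} (hg : Measurable (Function.uncurry g)) {p : ℝ} (hp : 1 ≤ p) :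
    (∫⁻ ω, (∫⁻ x, g ω x ∂μ) ^ p ∂P) ^ (1 / p) ≤ ∫⁻ x, (∫⁻ ω, g ω x ^ p ∂P) ^ (1 / p) ∂μ := by
  have hp0 : 0 < p := by linarith
  have hgx : ∀ x, Measurable fun ω => g ω x := fun x => hg.comp measurable_prodMk_right
  have hG : Measurable fun ω => ∫⁻ x, g ω x ∂μ := hg.lintegral_prod_right'
  set G := fun ω => ∫⁻ x, g ω x ∂μ with hGdef
  set B := ∫⁻ x, (∫⁻ ω, g ω x ^ p ∂P) ^ (1 / p) ∂μ with hB
  rcases hp.eq_or_lt with rfl | hp1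
  · simp only [ENNReal.rpow_one, div_one, hB]
    rw [lintegral_lintegral_swap hg.aemeasurable]
  -- truncating at height `N` makes the quantity to be absorbed finite
  have key : ∀ N : ℕ, (∫⁻ ω, (min (G ω) N) ^ p ∂P) ≤ B ^ p := by
    intro N
    set A := ∫⁻ ω, (min (G ω) N) ^ p ∂P with hA
    have hAfin : A ≠ ∞ := by
      refine ((lintegral_mono fun ω => ENNReal.rpow_le_rpow (min_le_right (G ω) (N : ℝ≥0∞))
        hp0.le).trans_lt ?_).ne
      rw [lintegral_const]
      exact ENNReal.mul_lt_top (ENNReal.rpow_lt_top_of_nonneg hp0.le (ENNReal.natCast_ne_top N))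
        (measure_lt_top _ _)
    have hconj : p.HolderConjugate (p / (p - 1)) := Real.HolderConjugate.conjExponent hp1
    set φ := fun ω => (min (G ω) N) ^ (p - 1) with hφ
    have hφm : Measurable φ := (hG.min measurable_const).pow_const _
    have h1 : A ≤ ∫⁻ ω, G ω * φ ω ∂P := by
      refine lintegral_mono fun ω => ?_
      have : (min (G ω) (N : ℝ≥0∞)) ^ p = min (G ω) N * φ ω := by
        simp only [hφ]
        by_cases h0 : min (G ω) (N : ℝ≥0∞) = 0
        · rw [h0, zero_mul, ENNReal.zero_rpow_of_pos hp0]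
        · have ht : min (G ω) (N : ℝ≥0∞) ≠ ∞ :=
            ((min_le_right _ _).trans_lt (ENNReal.natCast_lt_top N)).ne
          conv_rhs => rw [← ENNReal.rpow_one (min (G ω) (N : ℝ≥0∞))]
          rw [← ENNReal.rpow_mul, ← ENNReal.rpow_add _ _ h0 ht]
          congr 1; ring
      change (min (G ω) (N : ℝ≥0∞)) ^ p ≤ _
      rw [this]
      gcongr
      exact min_le_left _ _
    have h2 : ∫⁻ ω, G ω * φ ω ∂P = ∫⁻ x, ∫⁻ ω, g ω x * φ ω ∂P ∂μ := by
      rw [lintegral_lintegral_swap]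
      · refine lintegral_congr fun ω => ?_
        exact (lintegral_mul_const _ (show Measurable fun x => g ω x from
          hg.comp measurable_prodMk_left)).symm
      · exact ((hg.comp measurable_swap).mul (hφm.comp measurable_snd)).aemeasurable
    have h3 : ∀ x, ∫⁻ ω, g ω x * φ ω ∂P ≤
        (∫⁻ ω, g ω x ^ p ∂P) ^ (1 / p) * A ^ (1 / (p / (p - 1))) := by
      intro x
      have := ENNReal.lintegral_mul_le_Lp_mul_Lq P hconj (hgx x).aemeasurable hφm.aemeasurable
      refine this.trans (le_of_eq ?_)
      congr 2
      refine lintegral_congr fun ω => ?_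
      simp only [hφ]
      rw [← ENNReal.rpow_mul]
      congr 1
      have : p - 1 ≠ 0 := by linarith
      field_simp
    have h4 : A ≤ B * A ^ (1 / (p / (p - 1))) := by
      refine h1.trans (h2.le.trans ((lintegral_mono h3).trans (le_of_eq ?_)))
      rw [lintegral_mul_const]
      have : Measurable (Function.uncurry fun x ω => g ω x ^ p) :=
        (hg.comp measurable_swap).pow_const _
      exact (Measurable.lintegral_prod_right' this).pow_const _
    have e : 1 / (p / (p - 1)) = 1 - 1 / p := by field_simp
    rw [e] at h4
    exact le_rpow_of_le_mul_rpow hp0 hAfin h4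
  have hlim : ∫⁻ ω, G ω ^ p ∂P ≤ B ^ p := by
    have e : ∀ ω, G ω ^ p = ⨆ N : ℕ, (min (G ω) (N : ℝ≥0∞)) ^ p := by
      intro ω
      have : Tendsto (fun N : ℕ => (min (G ω) (N : ℝ≥0∞)) ^ p) atTop (𝓝 (G ω ^ p)) := by
        refine (ENNReal.continuous_rpow_const.tendsto _).comp ?_
        have := (tendsto_const_nhds (x := G ω) (f := atTop)).min ENNReal.tendsto_nat_nhds_top
        rwa [min_eq_left le_top] at this
      refine (tendsto_nhds_unique this (tendsto_atTop_iSup fun a b hab => ?_))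
      gcongr
    simp_rw [e]
    rw [lintegral_iSup (fun N => (hG.min measurable_const).pow_const _) (fun a b hab ω => by
      dsimp only; gcongr)]
    exact iSup_le key
  calc (∫⁻ ω, G ω ^ p ∂P) ^ (1 / p) ≤ (B ^ p) ^ (1 / p) := by gcongr
    _ = B := by rw [← ENNReal.rpow_mul, mul_one_div_cancel hp0.ne', ENNReal.rpow_one]

/-- `L^r` norms are lower semicontinuous on `L²`. -/
theorem lowerSemicontinuous_eLpNorm (μ : Measure X) (r : ℝ≥0∞) :
    LowerSemicontinuous fun h : Lp ℂ 2 μ => eLpNorm h r μ := by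
  rw [lowerSemicontinuous_iff_isClosed_preimage]
  intro C
  refine IsSeqClosed.isClosed fun u h hu hlim => ?_
  exact eLpNorm_le_of_tendstoInMeasure (Eventually.of_forall hu) (tendstoInMeasure_of_tendsto_Lp hlim)
    fun n => Lp.aestronglyMeasurable _

end Minkowski

/-! ### Fourier multipliers on `L²` -/

section Multiplier

variable {X : Type*} [MeasurableSpace X] {μ : Measure X}

theorem memLp_mul_of_norm_le_one {m : X → ℂ} (hm : Measurable m) (hb : ∀ x, ‖m x‖ ≤ 1)
    (f : Lp ℂ 2 μ) : MemLp (fun x => m x * f x) 2 μ := by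
  refine (Lp.memLp f).of_le (hm.aestronglyMeasurable.mul (Lp.aestronglyMeasurable f))
    (ae_of_all _ fun x => ?_)
  rw [norm_mul]
  exact mul_le_of_le_one_left (norm_nonneg _) (hb x)

/-- Multiplication by a measurable function bounded by `1`, as an operator on `L²`. -/
def mulOp (μ : Measure X) (m : X → ℂ) (hm : Measurable m) (hb : ∀ x, ‖m x‖ ≤ 1) :
    Lp ℂ 2 μ →L[ℂ] Lp ℂ 2 μ :=
  LinearMap.mkContinuous
    { toFun := fun f => (memLp_mul_of_norm_le_one hm hb f).toLp _
      map_add' := fun f g => by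
        rw [← MemLp.toLp_add, MemLp.toLp_eq_toLp_iff]
        filter_upwards [Lp.coeFn_add f g] with x hx
        rw [hx]; simp [mul_add]
      map_smul' := fun c f => by
        rw [RingHom.id_apply, ← MemLp.toLp_const_smul, MemLp.toLp_eq_toLp_iff]
        filter_upwards [Lp.coeFn_smul c f] with x hx
        rw [hx]; simp [mul_left_comm] } 1 fun f => by
    rw [one_mul]
    refine Lp.norm_le_norm_of_ae_le ?_
    filter_upwards [(memLp_mul_of_norm_le_one hm hb f).coeFn_toLp] with x hx
    change ‖(memLp_mul_of_norm_le_one hm hb f).toLp _ x‖ ≤ _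
    rw [hx, norm_mul]
    exact mul_le_of_le_one_left (norm_nonneg _) (hb x)

theorem coeFn_mulOp {m : X → ℂ} (hm : Measurable m) (hb : ∀ x, ‖m x‖ ≤ 1) (f : Lp ℂ 2 μ) :
    mulOp μ m hm hb f =ᵐ[μ] fun x => m x * f x :=
  (memLp_mul_of_norm_le_one hm hb f).coeFn_toLp

theorem tendsto_mulOp {ι : Type*} {l : Filter ι} [l.IsCountablyGenerated] {m : ι → X → ℂ}
    (hm : ∀ i, Measurable (m i)) (hb : ∀ i x, ‖m i x‖ ≤ 1) {m₀ : X → ℂ} (hm₀ : Measurable m₀)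
    (hb₀ : ∀ x, ‖m₀ x‖ ≤ 1) (hlim : ∀ x, Tendsto (fun i => m i x) l (𝓝 (m₀ x))) (f : Lp ℂ 2 μ) :
    Tendsto (fun i => mulOp μ (m i) (hm i) (hb i) f) l (𝓝 (mulOp μ m₀ hm₀ hb₀ f)) := by
  rw [Lp.tendsto_Lp_iff_tendsto_eLpNorm']
  have e : ∀ i, eLpNorm (⇑(mulOp μ (m i) (hm i) (hb i) f) - ⇑(mulOp μ m₀ hm₀ hb₀ f)) 2 μ =
      (∫⁻ x, ‖m i x - m₀ x‖ₑ ^ 2 * ‖f x‖ₑ ^ 2 ∂μ) ^ (1 / 2 : ℝ) := by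
    intro i
    rw [eLpNorm_eq_lintegral_rpow_enorm_toReal (by norm_num) (by norm_num)]
    congr 1
    refine lintegral_congr_ae ?_
    filter_upwards [coeFn_mulOp (hm i) (hb i) f, coeFn_mulOp hm₀ hb₀ f] with x h1 h2
    rw [Pi.sub_apply, h1, h2, ← sub_mul, enorm_mul, ENNReal.toReal_ofNat, ENNReal.rpow_ofNat,
      mul_pow]
  simp_rw [e]
  have hfin : ∫⁻ x, (2 : ℝ≥0∞) ^ 2 * ‖f x‖ₑ ^ 2 ∂μ ≠ ∞ := by
    rw [lintegral_const_mul' _ _ (by norm_num)]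
    refine ENNReal.mul_ne_top (by norm_num) ?_
    have := (Lp.memLp f).2
    rw [eLpNorm_eq_lintegral_rpow_enorm_toReal (by norm_num) (by norm_num)] at this
    have h2 := (ENNReal.rpow_lt_top_iff_of_pos (by norm_num)).1 this
    simpa using h2.ne
  have h0 : Tendsto (fun i => ∫⁻ x, ‖m i x - m₀ x‖ₑ ^ 2 * ‖f x‖ₑ ^ 2 ∂μ) l (𝓝 0) := by
    have := tendsto_lintegral_filter_of_dominated_convergence (μ := μ) (l := l)
      (F := fun i x => ‖m i x - m₀ x‖ₑ ^ 2 * ‖f x‖ₑ ^ 2) (f := fun _ => 0)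
      (fun x => (2 : ℝ≥0∞) ^ 2 * ‖f x‖ₑ ^ 2)
      (Eventually.of_forall fun i => (((hm i).sub hm₀).enorm.pow_const 2).mul
        ((Lp.stronglyMeasurable f).measurable.enorm.pow_const 2))
      (Eventually.of_forall fun i => ae_of_all _ fun x => by
        gcongr
        refine (enorm_sub_le).trans ?_
        have h1 : ‖m i x‖ₑ ≤ 1 := by rw [← ofReal_norm]; exact ENNReal.ofReal_le_one.2 (hb i x)
        have h2 : ‖m₀ x‖ₑ ≤ 1 := by rw [← ofReal_norm]; exact ENNReal.ofReal_le_one.2 (hb₀ x)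
        exact (add_le_add h1 h2).trans (by norm_num)) hfin
      (ae_of_all _ fun x => by
        have h1 : Tendsto (fun i => ‖m i x - m₀ x‖ₑ) l (𝓝 0) := by
          have := ((hlim x).sub_const (m₀ x)).enorm
          rwa [sub_self, enorm_zero] at this
        have h2 := ENNReal.Tendsto.mul_const (b := ‖f x‖ₑ ^ 2)
          (((ENNReal.continuous_pow 2).tendsto 0).comp h1) (Or.inr (by finiteness))
        simpa using h2)
    simpa using this
  have := h0.ennrpow_const (1 / 2 : ℝ)
  rwa [ENNReal.zero_rpow_of_pos (by norm_num)] at this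

end Multiplier

section FourierSide

variable {d : ℕ}

theorem measurable_schrodingerSymbol (d : ℕ) (t : ℝ) : Measurable (schrodingerSymbol d t) :=
  (schrodingerSymbol_hasTemperateGrowth d t).1.continuous.measurable

/-- The Fourier multiplier on `L²` with a symbol bounded by `1`. -/
def l2Multiplier (m : Rd d → ℂ) (hm : Measurable m) (hb : ∀ x, ‖m x‖ ≤ 1) :
    LpRd d 2 →L[ℂ] LpRd d 2 :=
  ((Lp.fourierTransformₗᵢ (Rd d) ℂ).symm.toContinuousLinearEquiv : LpRd d 2 →L[ℂ] LpRd d 2) ∘L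
    (mulOp volume m hm hb) ∘L
    ((Lp.fourierTransformₗᵢ (Rd d) ℂ).toContinuousLinearEquiv : LpRd d 2 →L[ℂ] LpRd d 2)

theorem l2Multiplier_apply {m : Rd d → ℂ} (hm : Measurable m) (hb : ∀ x, ‖m x‖ ≤ 1)
    (h : LpRd d 2) : l2Multiplier m hm hb h = 𝓕⁻ (mulOp volume m hm hb (𝓕 h)) := rfl

theorem fourier_l2Multiplier {m : Rd d → ℂ} (hm : Measurable m) (hb : ∀ x, ‖m x‖ ≤ 1)
    (h : LpRd d 2) : 𝓕 (l2Multiplier m hm hb h) = mulOp volume m hm hb (𝓕 h) :=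
  (Lp.fourierTransformₗᵢ (Rd d) ℂ).apply_symm_apply _

/-- The Schrödinger group on `L²`. -/
def l2Schrodinger (d : ℕ) (t : ℝ) : LpRd d 2 →L[ℂ] LpRd d 2 :=
  l2Multiplier (schrodingerSymbol d t) (measurable_schrodingerSymbol d t)
    fun ξ => (norm_schrodingerSymbol d t ξ).le

theorem coeFn_fourier_l2Schrodinger (t : ℝ) (h : LpRd d 2) :
    ((𝓕 (l2Schrodinger d t h) : LpRd d 2) : Rd d → ℂ) =ᵐ[volume]
      fun ξ => schrodingerSymbol d t ξ * (𝓕 h : LpRd d 2) ξ := by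
  rw [l2Schrodinger, fourier_l2Multiplier]
  exact coeFn_mulOp _ _ _

theorem fourier_l2_injective : Function.Injective (fun h : LpRd d 2 => 𝓕 h) :=
  (Lp.fourierTransformₗᵢ (Rd d) ℂ).injective

theorem isUnitaryGroup_l2Schrodinger (d : ℕ) : IsUnitaryGroup (l2Schrodinger d) where
  norm_map t h := by
    rw [← Lp.norm_fourier_eq, ← Lp.norm_fourier_eq h, Lp.norm_def, Lp.norm_def]
    congr 1
    refine eLpNorm_congr_norm_ae ?_
    filter_upwards [coeFn_fourier_l2Schrodinger t h] with ξ hξ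
    rw [hξ, norm_mul, norm_schrodingerSymbol, one_mul]
  map_add a b h := by
    apply fourier_l2_injective
    refine Lp.ext ?_
    filter_upwards [coeFn_fourier_l2Schrodinger a (l2Schrodinger d b h),
      coeFn_fourier_l2Schrodinger b h, coeFn_fourier_l2Schrodinger (a + b) h] with ξ h1 h2 h3
    rw [h1, h2, h3, ← mul_assoc]
    congr 1
    simp only [schrodingerSymbol]
    rw [← Complex.exp_add]
    push_cast; congr 1; ring
  map_zero h := by
    apply fourier_l2_injective
    refine Lp.ext ?_
    filter_upwards [coeFn_fourier_l2Schrodinger 0 h] with ξ h1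
    rw [h1]; simp [schrodingerSymbol]
  continuous h := by
    rw [continuous_iff_continuousAt]
    intro t
    refine ((Lp.fourierTransformₗᵢ (Rd d) ℂ).symm.continuous.tendsto _).comp ?_
    refine tendsto_mulOp (m := fun t => schrodingerSymbol d t) (fun t => measurable_schrodingerSymbol d t)
      (fun t ξ => (norm_schrodingerSymbol d t ξ).le) (measurable_schrodingerSymbol d t)
      (fun ξ => (norm_schrodingerSymbol d t ξ).le) (fun ξ => ?_) (𝓕 h)
    have : Continuous fun t => schrodingerSymbol d t ξ := by
      unfold schrodingerSymbol; fun_prop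
    exact this.tendsto t

/-! ### Frequency cutoffs -/

/-- The Fourier transform of `h`, restricted to frequencies of size at most `R`. -/
def cutoffProfile (R : ℕ) (h : LpRd d 2) : Rd d → ℂ :=
  (Metric.closedBall 0 (R : ℝ)).indicator (𝓕 h : LpRd d 2)

theorem measurable_cutoffProfile (R : ℕ) (h : LpRd d 2) : Measurable (cutoffProfile R h) :=
  (Lp.stronglyMeasurable _).measurable.indicator Metric.isClosed_closedBall.measurableSet

theorem memLp_cutoffProfile (R : ℕ) (h : LpRd d 2) : MemLp (cutoffProfile R h) 2 volume :=
  (Lp.memLp _).indicator Metric.isClosed_closedBall.measurableSet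

theorem integrable_cutoffProfile (R : ℕ) (h : LpRd d 2) : Integrable (cutoffProfile R h) := by
  rw [cutoffProfile, integrable_indicator_iff Metric.isClosed_closedBall.measurableSet]
  have : IsFiniteMeasure ((volume : Measure (Rd d)).restrict (Metric.closedBall 0 (R : ℝ))) :=
    ⟨by rw [Measure.restrict_apply_univ]; exact measure_closedBall_lt_top⟩
  exact ((Lp.memLp (𝓕 h : LpRd d 2)).restrict _).integrable (by norm_num)

theorem integral_norm_sq_cutoffProfile_le (R : ℕ) (h : LpRd d 2) :
    ∫ ξ, ‖cutoffProfile R h ξ‖ ^ 2 ≤ ‖h‖ ^ 2 := by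
  rw [integral_norm_sq_toLp (memLp_cutoffProfile R h), ← Lp.norm_fourier_eq h]
  gcongr
  refine Lp.norm_le_norm_of_ae_le ?_
  filter_upwards [(memLp_cutoffProfile R h).coeFn_toLp] with ξ hξ
  rw [hξ, cutoffProfile]
  exact norm_indicator_le_norm_self _ _

theorem memLp_cutoffChar (R : ℕ) (x : Rd d) : MemLp ((Metric.closedBall (0 : Rd d) (R : ℝ)).indicator
    fun ξ => (starRingEnd ℂ) (Real.fourierChar (inner ℝ ξ x) : ℂ)) 2 volume := by
  refine memLp_of_bounded (B := 1) (S := Metric.closedBall (0 : Rd d) (R : ℝ)) ?_ ?_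
    Metric.isClosed_closedBall.measurableSet measure_closedBall_lt_top ?_ 2
  · refine Measurable.indicator ?_ Metric.isClosed_closedBall.measurableSet
    refine Continuous.measurable ?_
    refine Complex.continuous_conj.comp ?_
    have := Real.continuous_fourierChar
    fun_prop
  · intro ξ
    refine (norm_indicator_le_norm_self _ _).trans ?_
    rw [RCLike.norm_conj]
    exact (Circle.norm_coe _).le
  · intro ξ hξ; exact Set.indicator_of_notMem hξ _

/-- The value at `x` of the restriction of `h` to frequencies of size at most `R`, as a bounded
functional on `L²`: the pairing of `𝓕 h` with a truncated character. -/
def cutoffEval (R : ℕ) (x : Rd d) : LpRd d 2 →L[ℂ] ℂ :=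
  (innerSL ℂ ((memLp_cutoffChar R x).toLp _)) ∘L
    ((Lp.fourierTransformₗᵢ (Rd d) ℂ).toContinuousLinearEquiv : LpRd d 2 →L[ℂ] LpRd d 2)

theorem cutoffEval_l2Schrodinger (R : ℕ) (x : Rd d) (t : ℝ) (h : LpRd d 2) :
    cutoffEval R x (l2Schrodinger d t h) = freeEvolution (cutoffProfile R h) t x := by
  change inner ℂ ((memLp_cutoffChar R x).toLp _) (𝓕 (l2Schrodinger d t h)) = _
  rw [L2.inner_def, freeEvolution, Real.fourierInv_eq]
  refine integral_congr_ae ?_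
  filter_upwards [(memLp_cutoffChar R x).coeFn_toLp, coeFn_fourier_l2Schrodinger t h] with ξ h1 h2
  rw [h1, h2, cutoffProfile]
  by_cases hξ : ξ ∈ Metric.closedBall (0 : Rd d) (R : ℝ)
  · simp only [Set.indicator_of_mem hξ, RCLike.inner_apply, Circle.smul_def, smul_eq_mul,
      Complex.conj_conj]
    ring
  · simp [Set.indicator_of_notMem hξ]

theorem cutoffEval_eq (R : ℕ) (x : Rd d) (h : LpRd d 2) :
    cutoffEval R x h = freeEvolution (cutoffProfile R h) 0 x := by
  rw [← cutoffEval_l2Schrodinger, (isUnitaryGroup_l2Schrodinger d).map_zero]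

theorem cutoffEval_eq_fourierInv (R : ℕ) (x : Rd d) (h : LpRd d 2) :
    cutoffEval R x h = 𝓕⁻ (cutoffProfile R h) x := by
  have : (fun ξ => schrodingerSymbol d 0 ξ * cutoffProfile R h ξ) = cutoffProfile R h := by
    funext ξ; simp [schrodingerSymbol]
  rw [cutoffEval_eq, freeEvolution, this]

/-- The restriction to frequencies of size at most `R`. -/
def cutoffProj (R : ℕ) : LpRd d 2 →L[ℂ] LpRd d 2 :=
  l2Multiplier ((Metric.closedBall 0 (R : ℝ)).indicator fun _ => 1)
    (measurable_const.indicator Metric.isClosed_closedBall.measurableSet)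
    fun ξ => (norm_indicator_le_norm_self _ _).trans (by simp)

theorem mulOp_cutoff_coeFn (R : ℕ) (h : LpRd d 2) :
    mulOp volume ((Metric.closedBall 0 (R : ℝ)).indicator fun _ => 1)
      (measurable_const.indicator Metric.isClosed_closedBall.measurableSet)
      (fun ξ => (norm_indicator_le_norm_self _ _).trans (by simp)) (𝓕 h) =ᵐ[volume]
      cutoffProfile R h := by
  filter_upwards [coeFn_mulOp (μ := volume)
    (m := (Metric.closedBall (0 : Rd d) (R : ℝ)).indicator fun _ => 1)
    (measurable_const.indicator Metric.isClosed_closedBall.measurableSet)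
    (fun ξ => (norm_indicator_le_norm_self _ _).trans (by simp)) (𝓕 h)] with ξ hξ
  rw [hξ, cutoffProfile]
  simp only [Set.indicator]
  split_ifs <;> simp

theorem coeFn_cutoffProj (R : ℕ) (h : LpRd d 2) :
    cutoffProj R h =ᵐ[volume] fun x => cutoffEval R x h := by
  have hc := mulOp_cutoff_coeFn R h
  have h1 := coeFn_fourierInv_of_integrable _ ((integrable_cutoffProfile R h).congr hc.symm)
  rw [cutoffProj, l2Multiplier_apply]
  refine h1.trans (ae_of_all _ fun x => ?_)
  simp only [cutoffEval_eq_fourierInv]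
  rw [Real.fourierInv_eq, Real.fourierInv_eq]
  refine integral_congr_ae ?_
  filter_upwards [hc] with ξ hξ
  rw [hξ]

theorem norm_cutoffProj_le (R : ℕ) (h : LpRd d 2) : ‖cutoffProj R h‖ ≤ ‖h‖ := by
  rw [← Lp.norm_fourier_eq, cutoffProj, fourier_l2Multiplier, ← Lp.norm_fourier_eq h]
  refine Lp.norm_le_norm_of_ae_le ?_
  filter_upwards [mulOp_cutoff_coeFn R h] with ξ hξ
  rw [hξ, cutoffProfile]
  exact norm_indicator_le_norm_self _ _

theorem tendsto_cutoffProj (h : LpRd d 2) :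
    Tendsto (fun R => cutoffProj R h) atTop (𝓝 h) := by
  have h1 : mulOp volume (fun _ => (1 : ℂ)) measurable_const (by simp) (𝓕 h : LpRd d 2) = 𝓕 h := by
    refine Lp.ext ?_
    filter_upwards [coeFn_mulOp (μ := volume) (m := fun _ : Rd d => (1 : ℂ)) measurable_const
      (by simp) (𝓕 h : LpRd d 2)] with ξ hξ
    rw [hξ, one_mul]
  have h2 : (Lp.fourierTransformₗᵢ (Rd d) ℂ).symm (𝓕 h : LpRd d 2) = h :=
    (Lp.fourierTransformₗᵢ (Rd d) ℂ).symm_apply_apply h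
  have key := ((Lp.fourierTransformₗᵢ (Rd d) ℂ).symm.continuous.tendsto (𝓕 h : LpRd d 2))
  rw [h2] at key
  refine key.comp ?_
  conv_rhs => rw [← h1]
  refine tendsto_mulOp (m := fun R : ℕ => (Metric.closedBall (0 : Rd d) (R : ℝ)).indicator fun _ => 1)
    (fun R => measurable_const.indicator Metric.isClosed_closedBall.measurableSet)
    (fun R ξ => (norm_indicator_le_norm_self _ _).trans (by simp)) measurable_const (by simp)
    (fun ξ => ?_) (𝓕 h)
  obtain ⟨n, hn⟩ := exists_nat_ge ‖ξ‖
  refine tendsto_const_nhds.congr' ?_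
  filter_upwards [eventually_ge_atTop n] with R hR
  rw [Set.indicator_of_mem]
  rw [mem_closedBall_zero_iff]
  exact hn.trans (by exact_mod_cast hR)

theorem nnnorm_cutoffEval_le (R : ℕ) (x : Rd d) : ‖cutoffEval R x‖₊ ≤ Real.toNNReal
    ((volume (Metric.closedBall (0 : Rd d) R)).toReal ^ (1 / 2 : ℝ)) := by
  rw [← NNReal.coe_le_coe, coe_nnnorm, Real.coe_toNNReal _ (by positivity)]
  refine ContinuousLinearMap.opNorm_le_bound _ (by positivity) fun h => ?_
  change ‖inner ℂ ((memLp_cutoffChar R x).toLp _) (𝓕 h)‖ ≤ _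
  refine (norm_inner_le_norm _ _).trans ?_
  rw [Lp.norm_fourier_eq]
  gcongr
  rw [Lp.norm_toLp]
  have hle : eLpNorm ((Metric.closedBall (0 : Rd d) (R : ℝ)).indicator
      fun ξ => (starRingEnd ℂ) (Real.fourierChar (inner ℝ ξ x) : ℂ)) 2 volume ≤
      volume (Metric.closedBall (0 : Rd d) R) ^ (1 / 2 : ℝ) := by
    rw [eLpNorm_indicator_eq_eLpNorm_restrict Metric.isClosed_closedBall.measurableSet]
    refine (eLpNorm_le_of_ae_bound (C := 1) (ae_of_all _ fun ξ => by
      rw [RCLike.norm_conj]; exact (Circle.norm_coe _).le)).trans ?_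
    simp
  refine (ENNReal.toReal_mono ?_ hle).trans ?_
  · exact ENNReal.rpow_ne_top_of_nonneg (by norm_num) measure_closedBall_lt_top.ne
  · rw [ENNReal.toReal_rpow]

theorem continuous_cutoffEval (R : ℕ) :
    Continuous fun p : LpRd d 2 × Rd d => cutoffEval R p.2 p.1 := by
  refine continuous_prod_of_continuous_lipschitzWith (fun p : LpRd d 2 × Rd d =>
    cutoffEval R p.2 p.1) (Real.toNNReal
    ((volume (Metric.closedBall (0 : Rd d) R)).toReal ^ (1 / 2 : ℝ))) (fun h => ?_) fun x => ?_
  · simp only [cutoffEval_eq_fourierInv]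
    exact VectorFourier.fourierIntegral_continuous (L := -innerₗ (Rd d)) Real.continuous_fourierChar
      (by exact continuous_inner.neg) (integrable_cutoffProfile R h)
  · exact (cutoffEval R x).lipschitz.weaken (nnnorm_cutoffEval_le R x)

end FourierSide

/-! ### Spatial integrability of the stochastic convolution at a fixed time -/

section Moments

variable {d : ℕ} {Ω : Type*} [MeasurableSpace Ω] {P : Measure Ω} [IsProbabilityMeasure P]
  {β : ℕ → ℝ≥0 → Ω → ℂ}

theorem stronglyMeasurable_cutoffEval {X : Type*} [MeasurableSpace X] (R : ℕ) {Y : X → LpRd d 2}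
    (hY : StronglyMeasurable Y) :
    StronglyMeasurable fun p : X × Rd d => cutoffEval R p.2 (Y p.1) := by
  have h1 : StronglyMeasurable fun p : X × Rd d => Y p.1 := hY.comp_measurable measurable_fst
  have h2 : StronglyMeasurable fun p : X × Rd d => p.2 := measurable_snd.stronglyMeasurable
  exact Continuous.comp_stronglyMeasurable (g := fun q : LpRd d 2 × Rd d => cutoffEval R q.2 q.1)
    (f := fun p : X × Rd d => (Y p.1, p.2)) (continuous_cutoffEval R) (h1.prodMk h2)

theorem eLpNorm_two_rpow {X E : Type*} [MeasurableSpace X] [NormedAddCommGroup E] (μ : Measure X)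
    (f : X → E) : (eLpNorm f 2 μ) ^ (2 : ℝ) = ∫⁻ x, ‖f x‖ₑ ^ (2 : ℝ) ∂μ := by
  rw [eLpNorm_eq_lintegral_rpow_enorm_toReal (by norm_num) (by norm_num), ← ENNReal.rpow_mul]
  simp

/-- Moments of the `L^r` norm of a Wiener integral, from the integrability in `x` of the variances
of its frequency cutoffs. -/
theorem IsItoPair.eLpNorm_eLpNorm_le (hβ : IsBrownianFamily P β) {F : ℕ × ℝ≥0 → LpRd d 2}
    {Y : Ω → LpRd d 2} (h : IsItoPair P β F Y) {r σ : ℝ≥0} (hr : 1 ≤ r) (hσ : r ≤ σ) {B : ℝ≥0∞}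
    (hB : ∀ R : ℕ, ∫⁻ x : Rd d, (eLpNorm (fun z => cutoffEval R x (F z)) 2 modeVol) ^ (r : ℝ) ≤
      B ^ (r : ℝ)) :
    eLpNorm (fun ω => eLpNorm (Y ω) r (volume : Measure (Rd d))) σ P ≤
      2 * gaussianMoment σ * B := by
  wlog hYm : StronglyMeasurable Y generalizing Y
  · have hae := h.memLp_right.1.ae_eq_mk
    refine (eLpNorm_congr_ae ?_).le.trans (this (h.congr (EventuallyEq.refl _ _) hae)
      h.memLp_right.1.stronglyMeasurable_mk)
    filter_upwards [hae] with ω hω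
    rw [hω]
  have hr0 : (0 : ℝ) < r := by exact_mod_cast (zero_lt_one.trans_le hr)
  have hσ0 : (0 : ℝ) < σ := by exact_mod_cast (zero_lt_one.trans_le (hr.trans hσ))
  have hrσ : (1 : ℝ) ≤ σ / r := by rw [one_le_div hr0]; exact_mod_cast hσ
  have hrne : (r : ℝ≥0∞) ≠ 0 := by exact_mod_cast (zero_lt_one.trans_le hr).ne'
  have hσne : (σ : ℝ≥0∞) ≠ 0 := by exact_mod_cast (zero_lt_one.trans_le (hr.trans hσ)).ne'
  set g : ℕ → Ω → Rd d → ℝ≥0∞ := fun R ω x => ‖cutoffEval R x (Y ω)‖ₑ ^ (r : ℝ) with hg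
  have hgm : ∀ R, Measurable (Function.uncurry (g R)) := fun R =>
    (stronglyMeasurable_cutoffEval R hYm).measurable.enorm.pow_const _
  have hGm : ∀ R, Measurable fun ω => ∫⁻ x, g R ω x := fun R => (hgm R).lintegral_prod_right'
  have e1 : ∀ R ω, eLpNorm (cutoffProj R (Y ω)) r volume = (∫⁻ x, g R ω x) ^ (1 / (r : ℝ)) := by
    intro R ω
    rw [eLpNorm_congr_ae (coeFn_cutoffProj R (Y ω)),
      eLpNorm_eq_lintegral_rpow_enorm_toReal hrne ENNReal.coe_ne_top]
    rfl
  have key : ∀ R, ∫⁻ ω, (eLpNorm (cutoffProj R (Y ω)) r volume) ^ (σ : ℝ) ∂P ≤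
      (2 * gaussianMoment σ * B) ^ (σ : ℝ) := by
    intro R
    have h1 := lintegral_rpow_lintegral_le (P := P) (μ := (volume : Measure (Rd d))) (hgm R) hrσ
    have h2 : ∀ x, (∫⁻ ω, g R ω x ^ ((σ : ℝ) / r) ∂P) ^ (1 / ((σ : ℝ) / r)) ≤
        (2 * gaussianMoment σ) ^ (r : ℝ) *
          (eLpNorm (fun z => cutoffEval R x (F z)) 2 modeVol) ^ (r : ℝ) := by
      intro x
      have h3 := (h.map (cutoffEval R x)).eLpNorm_le hβ (σ := σ)
        (by exact_mod_cast hr.trans hσ) ENNReal.coe_ne_top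
      rw [eLpNorm_eq_lintegral_rpow_enorm_toReal hσne ENNReal.coe_ne_top,
        ENNReal.coe_toReal] at h3
      rw [← ENNReal.mul_rpow_of_nonneg _ _ hr0.le]
      refine le_trans (le_of_eq ?_) (ENNReal.rpow_le_rpow h3 hr0.le)
      rw [← ENNReal.rpow_mul]
      congr 1
      · refine lintegral_congr fun ω => ?_
        simp only [hg]
        rw [← ENNReal.rpow_mul]
        congr 1; field_simp
      · field_simp
    have h4 : (∫⁻ ω, (∫⁻ x, g R ω x) ^ ((σ : ℝ) / r) ∂P) ^ (1 / ((σ : ℝ) / r)) ≤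
        (2 * gaussianMoment σ * B) ^ (r : ℝ) := by
      refine h1.trans ((lintegral_mono h2).trans ?_)
      have hc : (2 * gaussianMoment σ) ^ (r : ℝ) ≠ ∞ :=
        ENNReal.rpow_ne_top_of_nonneg hr0.le
          (ENNReal.mul_ne_top (by norm_num) (gaussianMoment_lt_top ENNReal.coe_ne_top).ne)
      rw [lintegral_const_mul' _ _ hc, ENNReal.mul_rpow_of_nonneg (2 * gaussianMoment σ) B hr0.le]
      gcongr
      exact hB R
    have h5 := ENNReal.rpow_le_rpow h4 (show (0 : ℝ) ≤ (σ : ℝ) / r by positivity)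
    rw [← ENNReal.rpow_mul, ← ENNReal.rpow_mul, one_div_mul_cancel (by positivity),
      ENNReal.rpow_one, mul_div_cancel₀ _ hr0.ne'] at h5
    refine le_trans (le_of_eq (lintegral_congr fun ω => ?_)) h5
    rw [e1, ← ENNReal.rpow_mul]
    congr 1; ring
  have hlsc : LowerSemicontinuous ((fun a : ℝ≥0∞ => a ^ (σ : ℝ)) ∘
      fun h : LpRd d 2 => eLpNorm h r volume) :=
    ENNReal.continuous_rpow_const.comp_lowerSemicontinuous (lowerSemicontinuous_eLpNorm volume r)
      (ENNReal.monotone_rpow_of_nonneg hσ0.le)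
  have hlim : ∀ ω, (eLpNorm (Y ω) r volume) ^ (σ : ℝ) ≤
      liminf (fun R => (eLpNorm (cutoffProj R (Y ω)) r volume) ^ (σ : ℝ)) atTop := fun ω =>
    (lowerSemicontinuousAt_iff_le_liminf.1 (hlsc (Y ω))).trans
      (liminf_le_liminf_of_le (tendsto_cutoffProj (Y ω)))
  rw [eLpNorm_eq_lintegral_rpow_enorm_toReal hσne ENNReal.coe_ne_top, ENNReal.coe_toReal]
  simp only [enorm_eq_self]
  have hfat : ∫⁻ ω, (eLpNorm (Y ω) r volume) ^ (σ : ℝ) ∂P ≤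
      (2 * gaussianMoment σ * B) ^ (σ : ℝ) := by
    refine (lintegral_mono hlim).trans ((lintegral_liminf_le fun R => ?_).trans ?_)
    · simp only [e1]
      exact ((hGm R).pow_const _).pow_const _
    · refine liminf_le_of_le (by isBoundedDefault) fun b hb => ?_
      obtain ⟨R, hR⟩ := hb.exists
      exact hR.trans (key R)
  calc _ ≤ ((2 * gaussianMoment σ * B) ^ (σ : ℝ)) ^ (1 / (σ : ℝ)) := by gcongr
    _ = _ := by rw [← ENNReal.rpow_mul, mul_one_div_cancel hσ0.ne', ENNReal.rpow_one]

/-- The case `r = 2`, where Plancherel's theorem suffices. -/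
theorem lintegral_eLpNorm_cutoffEval_le {F : ℕ × ℝ≥0 → LpRd d 2} (hF : MemLp F 2 modeVol) (R : ℕ) :
    ∫⁻ x : Rd d, (eLpNorm (fun z => cutoffEval R x (F z)) 2 modeVol) ^ (2 : ℝ) ≤
      (eLpNorm F 2 modeVol) ^ (2 : ℝ) := by
  wlog hFm : StronglyMeasurable F generalizing F
  · have hae := hF.1.ae_eq_mk
    have := this (hF.ae_eq hae) hF.1.stronglyMeasurable_mk
    rw [← eLpNorm_congr_ae hae] at this
    refine le_trans (le_of_eq (lintegral_congr fun x => ?_)) this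
    congr 1
    refine eLpNorm_congr_ae ?_
    filter_upwards [hae] with z hz
    rw [hz]
  simp only [eLpNorm_two_rpow]
  rw [lintegral_lintegral_swap]
  · refine lintegral_mono fun z => ?_
    rw [← eLpNorm_two_rpow volume, ← eLpNorm_congr_ae (coeFn_cutoffProj R (F z))]
    rw [← Lp.enorm_def]
    gcongr
    rw [← ofReal_norm, ← ofReal_norm]
    exact ENNReal.ofReal_le_ofReal (norm_cutoffProj_le R (F z))
  · exact (((stronglyMeasurable_cutoffEval R hFm).measurable.enorm.pow_const _).comp
      measurable_swap).aemeasurable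

/-- A bounded function whose weighted integrals obey `∫ u^{1-1/p} D ≤ K (∫ u)^{1-1/p}` has
`‖D‖_{L^p} ≤ K`: the weight is `D^p`. -/
theorem lintegral_rpow_le_of_weighted {D : Rd d → ℝ≥0∞} (hD : Measurable D) {M : ℝ≥0∞}
    (hM : M ≠ ∞) (hDM : ∀ x, D x ≤ M) {K : ℝ≥0∞} {p : ℝ} (hp : 1 < p)
    (hw : ∀ {E : Set (Rd d)} {c N : ℝ} {u : Rd d → ℝ}, IsWeight E c N u →
      ∫⁻ x, ENNReal.ofReal (u x ^ (1 - 1 / p)) * D x ≤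
        K * ENNReal.ofReal (∫ x, u x) ^ (1 - 1 / p)) :
    ∫⁻ x, D x ^ p ≤ K ^ p := by
  have hp0 : 0 < p := by linarith
  have hθ : 0 < 1 - 1 / p := by
    have : 1 / p < 1 := by rw [div_lt_one hp0]; exact hp
    linarith
  have hDt : ∀ x, D x ≠ ∞ := fun x => ((hDM x).trans_lt hM.lt_top).ne
  set E : ℕ → Set (Rd d) := fun n =>
    Metric.closedBall 0 (n : ℝ) ∩ {x | 1 / ((n : ℝ) + 1) ≤ (D x).toReal} with hE
  have hEm : ∀ n, MeasurableSet (E n) := fun n => Metric.isClosed_closedBall.measurableSet.inter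
    (measurableSet_le measurable_const hD.ennreal_toReal)
  have hEfin : ∀ n, volume (E n) < ∞ := fun n =>
    (measure_mono Set.inter_subset_left).trans_lt measure_closedBall_lt_top
  have key : ∀ n, ∫⁻ x in E n, D x ^ p ≤ K ^ p := by
    intro n
    set u : Rd d → ℝ := (E n).indicator fun x => (D x).toReal ^ p with hu
    have hum : Measurable u := (hD.ennreal_toReal.pow_const p).indicator (hEm n)
    have hweight : IsWeight (E n) ((1 / ((n : ℝ) + 1)) ^ p) (M.toReal ^ p) u := by
      refine ⟨hEm n, hEfin n, hum, by positivity, fun x hx => ?_, fun x hx =>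
        Set.indicator_of_notMem hx _⟩
      rw [hu, Set.indicator_of_mem hx]
      exact ⟨Real.rpow_le_rpow (by positivity) hx.2 hp0.le,
        Real.rpow_le_rpow ENNReal.toReal_nonneg (ENNReal.toReal_mono hM (hDM x)) hp0.le⟩
    have hui : Integrable u := by
      rw [hu, integrable_indicator_iff (hEm n)]
      have : IsFiniteMeasure ((volume : Measure (Rd d)).restrict (E n)) :=
        ⟨by rw [Measure.restrict_apply_univ]; exact hEfin n⟩
      refine Integrable.of_bound (hD.ennreal_toReal.pow_const p).aestronglyMeasurable
        (M.toReal ^ p) (ae_of_all _ fun x => ?_)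
      rw [Real.norm_of_nonneg (by positivity)]
      exact Real.rpow_le_rpow ENNReal.toReal_nonneg (ENNReal.toReal_mono hM (hDM x)) hp0.le
    have hU : ENNReal.ofReal (∫ x, u x) = ∫⁻ x in E n, D x ^ p := by
      rw [ofReal_integral_eq_lintegral_ofReal hui (ae_of_all _ hweight.nonneg),
        ← lintegral_indicator (hEm n)]
      refine lintegral_congr fun x => ?_
      by_cases hx : x ∈ E n
      · rw [hu, Set.indicator_of_mem hx, Set.indicator_of_mem hx,
          ← ENNReal.ofReal_rpow_of_nonneg ENNReal.toReal_nonneg hp0.le,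
          ENNReal.ofReal_toReal (hDt x)]
      · rw [hu, Set.indicator_of_notMem hx, Set.indicator_of_notMem hx, ENNReal.ofReal_zero]
    have hL : ∫⁻ x, ENNReal.ofReal (u x ^ (1 - 1 / p)) * D x = ∫⁻ x in E n, D x ^ p := by
      rw [← lintegral_indicator (hEm n)]
      refine lintegral_congr fun x => ?_
      by_cases hx : x ∈ E n
      · have hx0 : D x ≠ 0 := by
          intro h0
          have := hx.2
          simp only [Set.mem_ofPred_eq, h0, ENNReal.toReal_zero] at this
          have h1 : (0 : ℝ) < 1 / ((n : ℝ) + 1) := by positivity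
          linarith
        rw [hu, Set.indicator_of_mem hx, Set.indicator_of_mem hx,
          ← ENNReal.ofReal_rpow_of_nonneg (by positivity) hθ.le,
          ← ENNReal.ofReal_rpow_of_nonneg ENNReal.toReal_nonneg hp0.le,
          ENNReal.ofReal_toReal (hDt x), ← ENNReal.rpow_mul]
        conv_lhs => rw [← ENNReal.rpow_one (D x), ← ENNReal.rpow_mul, one_mul]
        rw [← ENNReal.rpow_add _ _ hx0 (hDt x)]
        congr 1; field_simp; ring
      · rw [hu, Set.indicator_of_notMem hx, Set.indicator_of_notMem hx, Real.zero_rpow hθ.ne',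
          ENNReal.ofReal_zero, zero_mul]
    have h1 := hw hweight
    rw [hL, hU] at h1
    exact le_rpow_of_le_mul_rpow hp0 (hU ▸ ENNReal.ofReal_ne_top) h1
  have hmono : Monotone E := by
    intro a b hab x hx
    refine ⟨Metric.closedBall_subset_closedBall (by exact_mod_cast hab) hx.1,
      (le_trans ?_ hx.2 : 1 / ((b : ℝ) + 1) ≤ (D x).toReal)⟩
    have : (a : ℝ) ≤ b := by exact_mod_cast hab
    exact one_div_le_one_div_of_le (by positivity) (by linarith)
  have hUn : ∀ x, x ∉ ⋃ n, E n → D x ^ p = 0 := by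
    intro x hx
    by_contra h0
    have hx0 : D x ≠ 0 := fun h => h0 (by rw [h, ENNReal.zero_rpow_of_pos hp0])
    have hpos : 0 < (D x).toReal := ENNReal.toReal_pos hx0 (hDt x)
    obtain ⟨n, hn⟩ := exists_nat_ge ‖x‖
    obtain ⟨m, hm⟩ := exists_nat_one_div_lt hpos
    refine hx (Set.mem_iUnion.2 ⟨max n m, ⟨?_, ?_⟩⟩)
    · rw [mem_closedBall_zero_iff]
      exact hn.trans (by exact_mod_cast le_max_left n m)
    · refine le_trans ?_ hm.le
      have : (m : ℝ) ≤ (max n m : ℕ) := by exact_mod_cast le_max_right n m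
      exact one_div_le_one_div_of_le (by positivity) (by linarith)
  have e : ∫⁻ x, D x ^ p = ∫⁻ x in ⋃ n, E n, D x ^ p := by
    rw [← lintegral_indicator (MeasurableSet.iUnion hEm)]
    refine lintegral_congr fun x => ?_
    by_cases hx : x ∈ ⋃ n, E n
    · rw [Set.indicator_of_mem hx]
    · rw [Set.indicator_of_notMem hx, hUn x hx]
  rw [e, setLIntegral_iUnion_of_directed _ hmono.directed_le]
  exact iSup_le key

/-- The substitution `t' ↦ t - t'`. -/
theorem lintegral_nnVol_reflect (t : ℝ≥0) (h : ℝ → ℝ≥0∞) :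
    ∫⁻ t', (Set.Icc 0 t).indicator (fun t' : ℝ≥0 => h ((t : ℝ) - t')) t' ∂nnVol =
      ∫⁻ τ in Set.Ioc 0 (t : ℝ), h τ := by
  set K : ℝ → ℝ≥0∞ := (Set.Icc 0 (t : ℝ)).indicator h with hK
  have e1 : ∀ t' : ℝ≥0, (Set.Icc 0 t).indicator (fun t' : ℝ≥0 => h ((t : ℝ) - t')) t' =
      K ((t : ℝ) - t') := by
    intro t'
    simp only [hK, Set.indicator, Set.mem_Icc, zero_le, true_and, sub_nonneg, NNReal.coe_le_coe,
      sub_le_self_iff, NNReal.coe_nonneg, and_true]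
  simp_rw [e1]
  have e2 := measurableEmbedding_coe_nnreal.lintegral_map (μ := nnVol) (fun y => K ((t : ℝ) - y))
  rw [← e2, map_coe_nnVol, ← lintegral_indicator measurableSet_Ici]
  have e3 : (Set.Ici (0 : ℝ)).indicator (fun y => K ((t : ℝ) - y)) = fun y => K ((t : ℝ) - y) := by
    ext y
    by_cases hy : y ∈ Set.Ici (0 : ℝ)
    · rw [Set.indicator_of_mem hy]
    · rw [Set.indicator_of_notMem hy, hK, Set.indicator_of_notMem]
      intro h'
      exact hy (by have := h'.2; simp only [Set.mem_Ici]; linarith)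
  rw [e3, lintegral_sub_left_eq_self K (t : ℝ), hK, lintegral_indicator measurableSet_Icc,
    Measure.restrict_congr_set Ioc_ae_eq_Icc]

theorem cutoffEval_convIntegrand_sq (R : ℕ) (x : Rd d) (f : ℕ → LpRd d 2) (t : ℝ≥0) :
    (eLpNorm (fun z => cutoffEval R x (convIntegrand (l2Schrodinger d) f t z)) 2 modeVol) ^ (2 : ℝ) =
      ∑' n, ∫⁻ τ in Set.Ioc 0 (t : ℝ), ‖freeEvolution (cutoffProfile R (f n)) τ x‖ₑ ^ 2 := by
  have hm : AEStronglyMeasurable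
      (fun z => cutoffEval R x (convIntegrand (l2Schrodinger d) f t z)) modeVol :=
    (cutoffEval R x).continuous.comp_aestronglyMeasurable
      (aestronglyMeasurable_convIntegrand (isUnitaryGroup_l2Schrodinger d) f t)
  rw [eLpNorm_eq_lintegral_rpow_enorm_toReal (by norm_num) (by norm_num), ← ENNReal.rpow_mul,
    lintegral_modeVol (hm.enorm.pow_const _)]
  norm_num
  refine tsum_congr fun n => ?_
  rw [← lintegral_nnVol_reflect]
  refine lintegral_congr fun t' => ?_
  simp only [convIntegrand, Set.indicator, Set.mem_ofPred_eq]
  split_ifs with h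
  · rw [map_smul, cutoffEval_l2Schrodinger, enorm_smul]
    simp [← ofReal_norm]
  · simp

/-- The dispersive gain: the variances of the frequency cutoffs of the stochastic convolution at
time `t` are bounded in `L^{r/2}`, uniformly in the cutoff, with a nonnegative power of `t`. -/
theorem exists_lintegral_cutoffEval_convIntegrand_le (hd : 1 ≤ d) {r : ℝ≥0}
    (hr : AdmissibleExponent d r) : ∃ (C : ℝ≥0) (δ : ℝ), 0 ≤ δ ∧
    ∀ (f : ℕ → LpRd d 2), ∑' n, ‖f n‖ₑ ^ 2 ≠ ∞ → ∀ (t : ℝ≥0), 0 < t → ∀ R : ℕ,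
      ∫⁻ x : Rd d, (eLpNorm (fun z => cutoffEval R x (convIntegrand (l2Schrodinger d) f t z)) 2
        modeVol) ^ (r : ℝ) ≤
      (C * (t : ℝ≥0∞) ^ δ * (∑' n, ‖f n‖ₑ ^ 2) ^ (1 / 2 : ℝ)) ^ (r : ℝ) := by
  obtain ⟨hr2, hr3⟩ := hr
  have hS := isUnitaryGroup_l2Schrodinger d
  -- for `r = 2` the dual exponent `θ` is `0`, and the weighted estimate is not needed
  rcases hr2.eq_or_lt with rfl | hr2
  · refine ⟨1, 1 / 2, by norm_num, fun f hf t ht R => ?_⟩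
    refine (lintegral_eLpNorm_cutoffEval_le (memLp_convIntegrand hS hf t) R).trans (le_of_eq ?_)
    rw [eLpNorm_two_modeVol (aestronglyMeasurable_convIntegrand hS f t) measurableSet_Icc
      (c := fun n => ‖f n‖ₑ) (enorm_convIntegrand hS f t), nnVol_Icc,
      ENNReal.mul_rpow_of_nonneg _ _ (by norm_num : (0 : ℝ) ≤ 1 / 2)]
    simp
  set p : ℝ := r / 2 with hp
  have hp1 : 1 < p := by
    have : (2 : ℝ) < r := by exact_mod_cast hr2
    rw [hp]; linarith
  have hp0 : 0 < p := by linarith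
  have hinv : 1 / p < 1 := by rw [div_lt_one hp0]; exact hp1
  have hinv0 : 0 < 1 / p := by positivity
  -- `r ≤ 2d/(d-2)` means `dθ ≤ 2` for `θ = 1 - 1/p`
  have hθd : (d : ℝ) * (1 - 1 / p) ≤ 2 := by
    have hd0 : (0 : ℝ) ≤ d := by positivity
    by_cases h3 : 3 ≤ d
    · have h4 := hr3 h3
      have h5 : (0 : ℝ) < (d : ℝ) - 2 := by
        have : (3 : ℝ) ≤ d := by exact_mod_cast h3
        linarith
      rw [le_div_iff₀ h5] at h4
      have h6 : 1 / p * p = 1 := one_div_mul_cancel hp0.ne'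
      have h7 : p * ((d : ℝ) - 2) ≤ d := by rw [hp]; linarith
      have h8 : ((d : ℝ) - 2) ≤ (1 / p) * d := by
        calc ((d : ℝ) - 2) = (1 / p * p) * (d - 2) := by rw [h6, one_mul]
          _ = (1 / p) * (p * (d - 2)) := by ring
          _ ≤ _ := by gcongr
      linarith
    · have h2 : (d : ℝ) ≤ 2 := by exact_mod_cast (by omega : d ≤ 2)
      nlinarith
  obtain ⟨C, hC, hst⟩ := exists_weighted_strichartz hd (θ := 1 - 1 / p) (by linarith) (by linarith) hθd
  set δ : ℝ := 1 - d * (1 - 1 / p) / 2 with hδ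
  refine ⟨(C ^ (1 / 2 : ℝ)).toNNReal, δ / 2, by rw [hδ]; linarith, fun f hf t ht R => ?_⟩
  set D : Rd d → ℝ≥0∞ := fun x => (eLpNorm (fun z =>
    cutoffEval R x (convIntegrand (l2Schrodinger d) f t z)) 2 modeVol) ^ (2 : ℝ) with hD
  have hDeq : ∀ x, D x = ∑' n, ∫⁻ τ in Set.Ioc 0 (t : ℝ),
      ‖freeEvolution (cutoffProfile R (f n)) τ x‖ₑ ^ 2 :=
    fun x => cutoffEval_convIntegrand_sq R x f t
  have hvm : ∀ n, Measurable fun q : Rd d × ℝ =>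
      ‖freeEvolution (cutoffProfile R (f n)) q.2 q.1‖ₑ ^ 2 := fun n =>
    (((measurable_freeEvolution (measurable_cutoffProfile R (f n))).comp
      measurable_swap).enorm).pow_const 2
  have hDm : Measurable D := by
    have : D = _ := funext hDeq
    rw [this]
    exact Measurable.tsum fun n => (hvm n).lintegral_prod_right'
  set κ : ℝ≥0 := Real.toNNReal ((volume (Metric.closedBall (0 : Rd d) R)).toReal ^ (1 / 2 : ℝ))
  have hDM : ∀ x, D x ≤ (κ * eLpNorm (convIntegrand (l2Schrodinger d) f t) 2 modeVol) ^ (2 : ℝ) := by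
    intro x
    refine ENNReal.rpow_le_rpow ?_ (by norm_num)
    exact eLpNorm_le_nnreal_smul_eLpNorm_of_ae_le_mul (ae_of_all _ fun z =>
      ((cutoffEval R x).le_opNNNorm _).trans (by gcongr; exact nnnorm_cutoffEval_le R x)) 2
  have hMfin : (κ * eLpNorm (convIntegrand (l2Schrodinger d) f t) 2 modeVol) ^ (2 : ℝ) ≠ ∞ :=
    ENNReal.rpow_ne_top_of_nonneg (by norm_num)
      (ENNReal.mul_ne_top ENNReal.coe_ne_top (memLp_convIntegrand hS hf t).2.ne)
  have ht' : (0 : ℝ) < t := by exact_mod_cast ht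
  have hmain := lintegral_rpow_le_of_weighted hDm hMfin hDM
    (K := ENNReal.ofReal (C * (t : ℝ) ^ δ) * ∑' n, ‖f n‖ₑ ^ 2) hp1 (by
    intro E c N u hu
    simp_rw [hDeq, ← ENNReal.tsum_mul_left]
    rw [lintegral_tsum (f := fun n x => ENNReal.ofReal (u x ^ (1 - 1 / p)) *
      ∫⁻ τ in Set.Ioc 0 (t : ℝ), ‖freeEvolution (cutoffProfile R (f n)) τ x‖ₑ ^ 2)
      fun n => (((hu.meas.pow_const _).ennreal_ofReal).mul
        ((hvm n).lintegral_prod_right')).aemeasurable,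
      ← ENNReal.tsum_mul_right]
    refine ENNReal.tsum_le_tsum fun n => ?_
    have e1 : ∫⁻ x, ENNReal.ofReal (u x ^ (1 - 1 / p)) * ∫⁻ τ in Set.Ioc 0 (t : ℝ),
        ‖freeEvolution (cutoffProfile R (f n)) τ x‖ₑ ^ 2 =
        ∫⁻ τ in Set.Ioc 0 (t : ℝ), ∫⁻ x, ENNReal.ofReal (u x ^ (1 - 1 / p) *
          ‖freeEvolution (cutoffProfile R (f n)) τ x‖ ^ 2) := by
      rw [lintegral_lintegral_swap]
      · refine lintegral_congr fun x => ?_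
        rw [← lintegral_const_mul' _ _ ENNReal.ofReal_ne_top]
        refine lintegral_congr fun τ => ?_
        rw [ENNReal.ofReal_mul (Real.rpow_nonneg (hu.nonneg x) _),
          ENNReal.ofReal_pow (norm_nonneg _), ofReal_norm]
      · refine Measurable.aemeasurable ?_
        have h1 := (measurable_freeEvolution (measurable_cutoffProfile R (f n))).norm.pow_const 2
        have h2 : Measurable fun q : ℝ × Rd d => u q.2 ^ (1 - 1 / p) :=
          (hu.meas.comp measurable_snd).pow_const _
        exact (h2.mul h1).ennreal_ofReal
    rw [e1]
    refine (hst hu ht' (measurable_cutoffProfile R (f n)) (integrable_cutoffProfile R (f n))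
      (memLp_cutoffProfile R (f n))).trans ?_
    have hU0 : 0 ≤ ∫ x, u x := integral_nonneg hu.nonneg
    rw [ENNReal.ofReal_mul (by positivity), ENNReal.ofReal_mul (by positivity),
      ENNReal.ofReal_rpow_of_nonneg hU0 (by linarith), mul_right_comm]
    gcongr
    rw [← ofReal_norm, ← ENNReal.ofReal_pow (norm_nonneg _)]
    exact ENNReal.ofReal_le_ofReal (integral_norm_sq_cutoffProfile_le R (f n)))
  have e2 : ∀ x, (eLpNorm (fun z => cutoffEval R x (convIntegrand (l2Schrodinger d) f t z)) 2
      modeVol) ^ (r : ℝ) = D x ^ p := by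
    intro x
    rw [hD, ← ENNReal.rpow_mul]
    congr 1; rw [hp]; ring
  simp_rw [e2]
  refine hmain.trans (le_of_eq ?_)
  have e3 : (r : ℝ) = 1 / 2 * r * 2 := by ring
  have e4 : ((C ^ (1 / 2 : ℝ)).toNNReal : ℝ≥0∞) = ENNReal.ofReal C ^ (1 / 2 : ℝ) := by
    rw [ENNReal.ofReal_rpow_of_nonneg hC.le (by norm_num)]; rfl
  have e5 : (t : ℝ≥0∞) ^ (δ / 2) = ENNReal.ofReal ((t : ℝ) ^ δ) ^ (1 / 2 : ℝ) := by
    rw [← ENNReal.ofReal_rpow_of_pos ht', ← ENNReal.rpow_mul, ENNReal.ofReal_coe_nnreal]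
    congr 1; ring
  rw [e4, e5, ← ENNReal.mul_rpow_of_nonneg _ _ (by norm_num : (0 : ℝ) ≤ 1 / 2),
    ← ENNReal.mul_rpow_of_nonneg _ _ (by norm_num : (0 : ℝ) ≤ 1 / 2), ← ENNReal.rpow_mul,
    ENNReal.ofReal_mul hC.le]
  congr 1; rw [hp]; ring

end Moments

/-! ### Continuous modifications and joint measurability -/

section Dyadic

variable {H : Type*} [NormedAddCommGroup H]

/-- The largest dyadic number of level `k` below `t`. -/
def dyadicFloor (k : ℕ) (t : ℝ≥0) : ℝ≥0 := (⌊2 ^ k * t⌋₊ : ℝ≥0) / 2 ^ k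

theorem dyadicFloor_le (k : ℕ) (t : ℝ≥0) : dyadicFloor k t ≤ t := by
  rw [dyadicFloor, div_le_iff₀ (by positivity), mul_comm]
  exact Nat.floor_le zero_le

theorem lt_dyadicFloor_add (k : ℕ) (t : ℝ≥0) : (t : ℝ) - dyadicFloor k t < (1 / 2) ^ k := by
  have h := Nat.lt_floor_add_one (2 ^ k * t)
  have h2 : (2 ^ k * t : ℝ) < (⌊2 ^ k * t⌋₊ : ℝ) + 1 := by exact_mod_cast h
  have h3 : ((dyadicFloor k t : ℝ≥0) : ℝ) = (⌊2 ^ k * t⌋₊ : ℝ) / 2 ^ k := by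
    rw [dyadicFloor]; push_cast; rfl
  have h4 : (0 : ℝ) < 2 ^ k := by positivity
  have h5 : (t : ℝ) < ((⌊2 ^ k * t⌋₊ : ℝ) + 1) / 2 ^ k := by
    rw [lt_div_iff₀ h4, mul_comm]; exact h2
  rw [h3, one_div, inv_pow, ← one_div]
  rw [add_div] at h5
  linarith

theorem tendsto_dyadicFloor (t : ℝ≥0) : Tendsto (fun k => dyadicFloor k t) atTop (𝓝 t) := by
  rw [tendsto_iff_dist_tendsto_zero]
  refine squeeze_zero (fun _ => dist_nonneg) (fun k => ?_)
    (tendsto_pow_atTop_nhds_zero_of_lt_one (r := (1 / 2 : ℝ)) (by norm_num) (by norm_num))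
  rw [dist_comm, NNReal.dist_eq, abs_of_nonneg]
  · exact (lt_dyadicFloor_add k t).le
  · exact sub_nonneg.2 (by exact_mod_cast dyadicFloor_le k t)

/-- If the dyadic increments of `x` decay geometrically, locally uniformly, then `x` has a
continuous limit along dyadic approximations of the time. -/
theorem exists_continuous_of_dyadic [CompleteSpace H] {x : ℝ≥0 → H} {ρ : ℝ} (hρ0 : 0 ≤ ρ)
    (hρ : ρ < 1) (hx : ∀ K : ℕ, ∃ A : ℝ, ∀ k j : ℕ, j < K * 2 ^ k →
      ‖x ((j + 1 : ℕ) / 2 ^ k) - x ((j : ℕ) / 2 ^ k)‖ ≤ A * ρ ^ k) :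
    ∃ z : ℝ≥0 → H, Continuous z ∧
      ∀ t, Tendsto (fun k => x (dyadicFloor k t)) atTop (𝓝 (z t)) := by
  have hfl : ∀ (K : ℕ) (k : ℕ) (t : ℝ≥0), t < K → ⌊2 ^ k * t⌋₊ < K * 2 ^ k := by
    intro K k t ht
    rw [Nat.floor_lt zero_le]
    push_cast
    rw [mul_comm]
    gcongr
  have hstep : ∀ (K : ℕ) (A : ℝ), (∀ k j : ℕ, j < K * 2 ^ k →
      ‖x ((j + 1 : ℕ) / 2 ^ k) - x ((j : ℕ) / 2 ^ k)‖ ≤ A * ρ ^ k) → ∀ t : ℝ≥0, t < K → ∀ k,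
      dist (x (dyadicFloor k t)) (x (dyadicFloor (k + 1) t)) ≤ (|A| * ρ) * ρ ^ k := by
    intro K A hA t ht k
    set j := ⌊2 ^ k * t⌋₊ with hj
    have h1 : (j : ℝ≥0) ≤ 2 ^ k * t := Nat.floor_le zero_le
    have h2 : 2 ^ k * t < (j : ℝ≥0) + 1 := Nat.lt_floor_add_one _
    have e0 : dyadicFloor k t = ((2 * j : ℕ) : ℝ≥0) / 2 ^ (k + 1) := by
      rw [dyadicFloor, ← hj, pow_succ]; push_cast
      rw [mul_comm ((2 : ℝ≥0) ^ k) 2]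
      exact (mul_div_mul_left _ _ two_ne_zero).symm
    have h3 : 2 * j ≤ ⌊2 ^ (k + 1) * t⌋₊ := by
      refine Nat.le_floor ?_
      push_cast
      calc (2 : ℝ≥0) * j ≤ 2 * (2 ^ k * t) := by gcongr
        _ = _ := by ring
    have h4 : ⌊2 ^ (k + 1) * t⌋₊ < 2 * j + 2 := by
      rw [Nat.floor_lt zero_le]
      push_cast
      calc (2 : ℝ≥0) ^ (k + 1) * t = 2 * (2 ^ k * t) := by ring
        _ < 2 * (j + 1) := by gcongr
        _ = _ := by ring
    have h5 : ⌊2 ^ (k + 1) * t⌋₊ < K * 2 ^ (k + 1) := hfl K (k + 1) t ht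
    rcases (by omega : ⌊2 ^ (k + 1) * t⌋₊ = 2 * j ∨ ⌊2 ^ (k + 1) * t⌋₊ = 2 * j + 1) with h | h
    · rw [e0, dyadicFloor, h, dist_self]; positivity
    · rw [e0, dyadicFloor, h, dist_comm, dist_eq_norm]
      refine (hA (k + 1) (2 * j) (by omega)).trans ?_
      rw [pow_succ, mul_comm (ρ ^ k), ← mul_assoc]
      gcongr
      exact le_abs_self A
  have hex : ∀ t : ℝ≥0, ∃ z, Tendsto (fun k => x (dyadicFloor k t)) atTop (𝓝 z) := by
    intro t
    obtain ⟨K, hK⟩ := exists_nat_gt t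
    obtain ⟨A, hA⟩ := hx K
    exact cauchySeq_tendsto_of_complete
      (cauchySeq_of_le_geometric ρ (|A| * ρ) hρ (hstep K A hA t hK))
  choose z hz using hex
  refine ⟨z, ?_, hz⟩
  rw [Metric.continuous_iff]
  intro t ε hε
  obtain ⟨K, hK⟩ := exists_nat_gt (t + 1)
  obtain ⟨A, hA⟩ := hx K
  have hclose : ∀ s : ℝ≥0, s < K → ∀ k, dist (x (dyadicFloor k s)) (z s) ≤
      |A| * ρ * ρ ^ k / (1 - ρ) := fun s hs k =>
    dist_le_of_le_geometric_of_tendsto ρ _ hρ (hstep K A hA s hs) (hz s) k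
  have hadj : ∀ s u : ℝ≥0, s ≤ u → u < K → ∀ k, (u : ℝ) - s < (1 / 2) ^ k →
      dist (x (dyadicFloor k u)) (x (dyadicFloor k s)) ≤ |A| * ρ ^ k := by
    intro s u hsu hu k hk
    set i := ⌊2 ^ k * s⌋₊ with hi
    set j := ⌊2 ^ k * u⌋₊ with hj
    have h1 : i ≤ j := Nat.floor_le_floor (by gcongr)
    have h2 : j < i + 2 := by
      rw [Nat.floor_lt zero_le]
      have h3 : 2 ^ k * s < (i : ℝ≥0) + 1 := Nat.lt_floor_add_one _
      have h3' : (2 : ℝ) ^ k * s < (i : ℝ) + 1 := by exact_mod_cast h3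
      have h4 : (2 : ℝ) ^ k * (u - s) < 1 := by
        calc (2 : ℝ) ^ k * (u - s) < 2 ^ k * (1 / 2) ^ k := by gcongr
          _ = 1 := by rw [← mul_pow]; norm_num
      have : (2 : ℝ) ^ k * u < ((i + 2 : ℕ) : ℝ) := by push_cast; linarith
      exact_mod_cast this
    have h5 : i < K * 2 ^ k := hfl K k s (hsu.trans_lt hu)
    rcases (by omega : j = i ∨ j = i + 1) with h | h
    · rw [dyadicFloor, dyadicFloor, ← hi, ← hj, h, dist_self]; positivity
    · rw [dyadicFloor, dyadicFloor, ← hi, ← hj, h, dist_eq_norm]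
      refine (hA k i h5).trans ?_
      gcongr
      exact le_abs_self A
  have hlim : Tendsto (fun k : ℕ => (2 * (|A| * ρ / (1 - ρ)) + |A|) * ρ ^ k) atTop (𝓝 0) := by
    have := (tendsto_pow_atTop_nhds_zero_of_lt_one hρ0 hρ).const_mul (2 * (|A| * ρ / (1 - ρ)) + |A|)
    rwa [mul_zero] at this
  obtain ⟨k, hk⟩ := (hlim.eventually (gt_mem_nhds hε)).exists
  refine ⟨min 1 ((1 / 2) ^ k), by positivity, fun s hs => ?_⟩
  have hsd : |(s : ℝ) - t| < min 1 ((1 / 2) ^ k) := by rwa [NNReal.dist_eq] at hs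
  have hs1 : |(s : ℝ) - t| < 1 := hsd.trans_le (min_le_left _ _)
  have hs2 : |(s : ℝ) - t| < (1 / 2) ^ k := hsd.trans_le (min_le_right _ _)
  have hK' : (t : ℝ) + 1 < K := by exact_mod_cast hK
  have htK : t < K := by
    have : (t : ℝ) < K := by linarith
    exact_mod_cast this
  have hsK : s < K := by
    have : (s : ℝ) < K := by linarith [(abs_lt.1 hs1).2]
    exact_mod_cast this
  have hmid : dist (x (dyadicFloor k s)) (x (dyadicFloor k t)) ≤ |A| * ρ ^ k := by
    rcases le_total s t with h | h
    · rw [dist_comm]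
      exact hadj s t h htK k (by linarith [(abs_lt.1 hs2).1])
    · exact hadj t s h hsK k (by linarith [(abs_lt.1 hs2).2])
  calc dist (z s) (z t) ≤ dist (z s) (x (dyadicFloor k s)) +
        dist (x (dyadicFloor k s)) (x (dyadicFloor k t)) + dist (x (dyadicFloor k t)) (z t) :=
        dist_triangle4 _ _ _ _
    _ ≤ |A| * ρ * ρ ^ k / (1 - ρ) + |A| * ρ ^ k + |A| * ρ * ρ ^ k / (1 - ρ) := by
        rw [dist_comm (z s)]
        gcongr
        · exact hclose s hsK k
        · exact hclose t htK k
    _ = (2 * (|A| * ρ / (1 - ρ)) + |A|) * ρ ^ k := by ring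
    _ < ε := hk

variable {Ω : Type*} [MeasurableSpace Ω] {P : Measure Ω}

/-- A Kolmogorov continuity criterion, with fourth moments. -/
theorem exists_continuous_modification [CompleteSpace H] [IsFiniteMeasure P] {M : ℝ≥0 → Ω → H}
    (hM : ∀ t, AEStronglyMeasurable (M t) P) {C : ℝ≥0∞} (hC : C ≠ ∞)
    (hinc : ∀ s t : ℝ≥0, s ≤ t →
      ∫⁻ ω, ‖M t ω - M s ω‖ₑ ^ 4 ∂P ≤ C * ENNReal.ofReal (t - s) ^ 2) :
    ∃ Z : ℝ≥0 → Ω → H, (∀ t, Z t =ᵐ[P] M t) ∧ ∀ ω, Continuous fun t => Z t ω := by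
  -- with `1.1^4 * 2 / 4 < 1`, the weighted sum of all dyadic increments on `[0, K]` is integrable,
  -- and its finiteness gives increments of order `(10 / 11)^k`
  set Q : ℕ → Ω → ℝ≥0∞ := fun K ω => ∑' k : ℕ, ∑ j ∈ Finset.range (K * 2 ^ k),
    (ENNReal.ofReal ((11 / 10) ^ k) * ‖M ((j + 1 : ℕ) / 2 ^ k) ω - M ((j : ℕ) / 2 ^ k) ω‖ₑ) ^ 4
    with hQ
  have hterm : ∀ k j : ℕ, AEMeasurable (fun ω => (ENNReal.ofReal ((11 / 10) ^ k) *
      ‖M ((j + 1 : ℕ) / 2 ^ k) ω - M ((j : ℕ) / 2 ^ k) ω‖ₑ) ^ 4) P := fun k j =>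
    (((hM _).sub (hM _)).enorm.const_mul _).pow_const _
  have hQint : ∀ K, ∫⁻ ω, Q K ω ∂P ≠ ∞ := by
    intro K
    rw [lintegral_tsum fun k => Finset.aemeasurable_fun_sum _ fun j _ => hterm k j]
    have hk : ∀ k : ℕ, ∫⁻ ω, ∑ j ∈ Finset.range (K * 2 ^ k), (ENNReal.ofReal ((11 / 10) ^ k) *
        ‖M ((j + 1 : ℕ) / 2 ^ k) ω - M ((j : ℕ) / 2 ^ k) ω‖ₑ) ^ 4 ∂P ≤
        K * C * ENNReal.ofReal ((14641 / 20000) ^ k) := by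
      intro k
      rw [lintegral_finsetSum' _ fun j _ => hterm k j]
      have hj : ∀ j ∈ Finset.range (K * 2 ^ k), ∫⁻ ω, (ENNReal.ofReal ((11 / 10) ^ k) *
          ‖M ((j + 1 : ℕ) / 2 ^ k) ω - M ((j : ℕ) / 2 ^ k) ω‖ₑ) ^ 4 ∂P ≤
          ENNReal.ofReal ((11 / 10) ^ k) ^ 4 * (C * ENNReal.ofReal ((1 / 2) ^ k) ^ 2) := by
        intro j _
        simp_rw [mul_pow]
        rw [lintegral_const_mul' _ _ (by finiteness)]
        gcongr
        refine (hinc _ _ (by gcongr; omega)).trans (le_of_eq ?_)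
        congr 3
        push_cast
        rw [one_div, inv_pow]
        ring
      refine (Finset.sum_le_sum hj).trans (le_of_eq ?_)
      rw [Finset.sum_const, Finset.card_range, nsmul_eq_mul]
      have e : (14641 / 20000 : ℝ) ^ k = 2 ^ k * (((11 / 10) ^ k) ^ 4 * ((1 / 2) ^ k) ^ 2) := by
        rw [← pow_mul, ← pow_mul, mul_comm k 4, mul_comm k 2, pow_mul, pow_mul, ← mul_pow,
          ← mul_pow]
        norm_num
      rw [e, ENNReal.ofReal_mul (by positivity), ENNReal.ofReal_mul (by positivity),
        ENNReal.ofReal_pow (n := 4) (by positivity), ENNReal.ofReal_pow (n := 2) (by positivity)]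
      have e2 : ENNReal.ofReal (2 ^ k) = 2 ^ k := by
        rw [ENNReal.ofReal_pow (by norm_num)]; norm_num
      rw [e2]
      push_cast
      ring
    refine ne_top_of_le_ne_top ?_ (ENNReal.tsum_le_tsum hk)
    rw [ENNReal.tsum_mul_left]
    refine ENNReal.mul_ne_top (ENNReal.mul_ne_top (ENNReal.natCast_ne_top K) hC) ?_
    rw [← ENNReal.ofReal_tsum_of_nonneg (fun k => by positivity)
      (summable_geometric_of_lt_one (by norm_num) (by norm_num))]
    exact ENNReal.ofReal_ne_top
  have hae : ∀ᵐ ω ∂P, ∀ K, Q K ω < ∞ := ae_all_iff.2 fun K =>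
    ae_lt_top' (AEMeasurable.tsum fun k => Finset.aemeasurable_fun_sum _ fun j _ =>
      hterm k j) (hQint K)
  have hpath : ∀ ω, (∀ K, Q K ω < ∞) → ∃ z : ℝ≥0 → H, Continuous z ∧
      ∀ t, Tendsto (fun k => M (dyadicFloor k t) ω) atTop (𝓝 (z t)) := by
    intro ω hω
    refine exists_continuous_of_dyadic (x := fun t => M t ω) (ρ := 10 / 11) (by norm_num)
      (by norm_num) fun K => ⟨((Q K ω) ^ (1 / 4 : ℝ)).toReal, fun k j hj => ?_⟩
    have h1 : (ENNReal.ofReal ((11 / 10) ^ k) *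
        ‖M ((j + 1 : ℕ) / 2 ^ k) ω - M ((j : ℕ) / 2 ^ k) ω‖ₑ) ^ 4 ≤ Q K ω :=
      (Finset.single_le_sum (f := fun j : ℕ => (ENNReal.ofReal ((11 / 10) ^ k) *
        ‖M ((j + 1 : ℕ) / 2 ^ k) ω - M ((j : ℕ) / 2 ^ k) ω‖ₑ) ^ 4) (fun _ _ => zero_le)
        (Finset.mem_range.2 hj)).trans (ENNReal.le_tsum k)
    have h2 := ENNReal.rpow_le_rpow h1 (show (0 : ℝ) ≤ 1 / 4 by norm_num)
    rw [← ENNReal.rpow_natCast, ← ENNReal.rpow_mul] at h2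
    norm_num at h2
    have hfin : Q K ω ^ (1 / 4 : ℝ) ≠ ∞ := ENNReal.rpow_ne_top_of_nonneg (by norm_num) (hω K).ne
    have h3 := ENNReal.toReal_mono hfin h2
    rw [ENNReal.toReal_mul, ENNReal.toReal_pow, ENNReal.toReal_ofReal (by norm_num),
      toReal_enorm] at h3
    have h4 : (11 / 10 : ℝ) ^ k * (10 / 11) ^ k = 1 := by rw [← mul_pow]; norm_num
    push_cast
    calc ‖M ((j + 1) / 2 ^ k) ω - M (j / 2 ^ k) ω‖ =
        ((11 / 10) ^ k * ‖M ((j + 1) / 2 ^ k) ω - M (j / 2 ^ k) ω‖) * (10 / 11) ^ k := by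
          linear_combination (-‖M ((j + 1) / 2 ^ k) ω - M (j / 2 ^ k) ω‖) * h4
      _ ≤ _ := by gcongr
  classical
  refine ⟨fun t ω => if h : ∀ K, Q K ω < ∞ then (hpath ω h).choose t else 0, fun t => ?_,
    fun ω => ?_⟩
  · have h1 : ∀ᵐ ω ∂P, Tendsto (fun k => M (dyadicFloor k t) ω) atTop
        (𝓝 (if h : ∀ K, Q K ω < ∞ then (hpath ω h).choose t else 0)) := by
      filter_upwards [hae] with ω hω
      rw [dif_pos hω]
      exact (hpath ω hω).choose_spec.2 t
    have h2 : Tendsto (fun k => eLpNorm (M (dyadicFloor k t) - M t) 4 P) atTop (𝓝 0) := by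
      have hb : Tendsto (fun k : ℕ => (C * ENNReal.ofReal ((1 / 2) ^ k) ^ 2) ^ (1 / 4 : ℝ)) atTop
          (𝓝 0) := by
        have h3 : Tendsto (fun k : ℕ => ENNReal.ofReal ((1 / 2 : ℝ) ^ k)) atTop (𝓝 0) := by
          have := ENNReal.tendsto_ofReal (tendsto_pow_atTop_nhds_zero_of_lt_one
            (r := (1 / 2 : ℝ)) (by norm_num) (by norm_num))
          rwa [ENNReal.ofReal_zero] at this
        have h4 := ENNReal.Tendsto.const_mul (a := C)
          (((ENNReal.continuous_pow 2).tendsto 0).comp h3) (Or.inr hC)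
        have h5 := h4.ennrpow_const (1 / 4 : ℝ)
        simpa using h5
      refine tendsto_of_tendsto_of_tendsto_of_le_of_le tendsto_const_nhds hb (fun _ => zero_le)
        fun k => ?_
      rw [eLpNorm_sub_comm, eLpNorm_eq_lintegral_rpow_enorm_toReal (by norm_num) (by norm_num)]
      norm_num
      refine ENNReal.rpow_le_rpow ((hinc _ _ (dyadicFloor_le k t)).trans ?_) (by norm_num)
      have h6 : ENNReal.ofReal ((t : ℝ) - dyadicFloor k t) ≤ ENNReal.ofReal (1 / 2) ^ k := by
        rw [← ENNReal.ofReal_pow (by norm_num)]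
        exact ENNReal.ofReal_le_ofReal (lt_dyadicFloor_add k t).le
      gcongr
    have h3 := tendstoInMeasure_of_tendsto_eLpNorm (by norm_num) (fun k => hM _) (hM t) h2
    have h4 := tendstoInMeasure_of_tendsto_ae (fun k => hM (dyadicFloor k t)) h1
    exact tendstoInMeasure_ae_unique h4 h3
  · by_cases h : ∀ K, Q K ω < ∞
    · simp only [dif_pos h]
      exact (hpath ω h).choose_spec.1
    · simp only [dif_neg h]
      exact continuous_const

/-- A process with almost surely continuous paths agrees, almost surely and at all times, with a
jointly measurable one. -/
theorem exists_jointly_measurable [SecondCountableTopology H] {X : ℝ≥0 → Ω → H}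
    (hX : ∀ t, AEStronglyMeasurable (X t) P) (hc : ∀ᵐ ω ∂P, Continuous fun t => X t ω) :
    ∃ Z : ℝ≥0 → Ω → H, StronglyMeasurable (Function.uncurry Z) ∧ ∀ᵐ ω ∂P, ∀ t, Z t ω = X t ω := by
  borelize H
  set Y : ℕ → ℕ → Ω → H := fun k j => (hX ((j : ℝ≥0) / 2 ^ k)).mk with hY
  have hgood : ∀ᵐ ω ∂P, (Continuous fun t => X t ω) ∧ ∀ k j : ℕ,
      X ((j : ℝ≥0) / 2 ^ k) ω = Y k j ω := by
    filter_upwards [hc, ae_all_iff.2 fun k : ℕ => ae_all_iff.2 fun j : ℕ =>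
      (hX ((j : ℝ≥0) / 2 ^ k)).ae_eq_mk] with ω h1 h2
    exact ⟨h1, h2⟩
  -- outside a measurable null set, `X` is the limit of its measurable dyadic approximations
  set N : Set Ω := toMeasurable P {ω | ¬((Continuous fun t => X t ω) ∧ ∀ k j : ℕ,
      X ((j : ℝ≥0) / 2 ^ k) ω = Y k j ω)} with hN
  have hN0 : P N = 0 := by rw [hN, measure_toMeasurable]; exact hgood
  have hNm : MeasurableSet N := measurableSet_toMeasurable _ _
  have hNc : ∀ ω, ω ∉ N → (Continuous fun t => X t ω) ∧ ∀ k j : ℕ,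
      X ((j : ℝ≥0) / 2 ^ k) ω = Y k j ω := by
    intro ω hω
    by_contra h
    exact hω (subset_toMeasurable _ _ h)
  classical
  set Zk : ℕ → ℝ≥0 × Ω → H := fun k => {p : ℝ≥0 × Ω | p.2 ∈ Nᶜ}.indicator
    fun p => Y k ⌊2 ^ k * p.1⌋₊ p.2 with hZk
  refine ⟨fun t ω => (Nᶜ : Set Ω).indicator (X t) ω, ?_, ?_⟩
  · refine stronglyMeasurable_of_tendsto atTop (f := Zk) (fun k => ?_) ?_
    · refine StronglyMeasurable.indicator ?_ (hNm.compl.preimage measurable_snd)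
      have h1 : Measurable fun q : ℕ × Ω => Y k q.1 q.2 :=
        measurable_from_prod_countable_right fun j =>
          (hX ((j : ℝ≥0) / 2 ^ k)).stronglyMeasurable_mk.measurable
      have h2 : Measurable fun p : ℝ≥0 × Ω => (⌊2 ^ k * p.1⌋₊, p.2) :=
        (Nat.measurable_floor.comp (measurable_fst.const_mul _)).prodMk measurable_snd
      exact (h1.comp h2).stronglyMeasurable
    · rw [tendsto_pi_nhds]
      rintro ⟨t, ω⟩
      by_cases hω : ω ∈ N
      · have e1 : ∀ k, Zk k (t, ω) = 0 := fun k =>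
          Set.indicator_of_notMem (show ¬ (ω ∈ Nᶜ) from fun h => h hω) _
        have e2 : Function.uncurry (fun t ω => (Nᶜ : Set Ω).indicator (X t) ω) (t, ω) = 0 :=
          Set.indicator_of_notMem (fun h : ω ∈ Nᶜ => h hω) _
        simp only [e1, e2]
        exact tendsto_const_nhds
      · obtain ⟨h1, h2⟩ := hNc ω hω
        have e1 : ∀ k, Zk k (t, ω) = X (dyadicFloor k t) ω := fun k => by
          rw [hZk]
          simp only
          rw [Set.indicator_of_mem (show (t, ω) ∈ {p : ℝ≥0 × Ω | p.2 ∈ Nᶜ} from hω), ← h2]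
          rfl
        have e2 : Function.uncurry (fun t ω => (Nᶜ : Set Ω).indicator (X t) ω) (t, ω) = X t ω :=
          Set.indicator_of_mem hω _
        simp only [e1, e2]
        exact (h1.tendsto t).comp (tendsto_dyadicFloor t)
  · have : ∀ᵐ ω ∂P, ω ∉ N := measure_eq_zero_iff_ae_notMem.1 hN0
    filter_upwards [this] with ω hω t
    exact Set.indicator_of_mem hω _

end Dyadic

section Convolution

variable {d : ℕ} {Ω : Type*} [MeasurableSpace Ω] {P : Measure Ω} [IsProbabilityMeasure P]
  {β : ℕ → ℝ≥0 → Ω → ℂ}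

/-- Fourth moments in `L²`: the case `r = 2`, `σ = 4` of the moments of `L^r` norms. -/
theorem IsItoPair.eLpNorm_four_le (hβ : IsBrownianFamily P β) {F : ℕ × ℝ≥0 → LpRd d 2}
    {Y : Ω → LpRd d 2} (h : IsItoPair P β F Y) :
    eLpNorm Y 4 P ≤ 2 * gaussianMoment 4 * eLpNorm F 2 modeVol := by
  have h1 := h.eLpNorm_eLpNorm_le hβ (r := 2) (σ := 4) (by norm_num) (by norm_num)
    (lintegral_eLpNorm_cutoffEval_le h.memLp_left)
  refine le_trans (le_of_eq ?_) h1
  have e : (fun ω => eLpNorm (Y ω) ((2 : ℝ≥0) : ℝ≥0∞) (volume : Measure (Rd d))) =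
      fun ω => ‖Y ω‖ₑ := by
    ext ω; rw [Lp.enorm_def]; rfl
  rw [e]
  exact (eLpNorm_enorm Y).symm

/-- The stochastic convolution of the Schrödinger group has a continuous modification. -/
theorem exists_continuous_convolution (hβ : IsBrownianFamily P β) {f : ℕ → LpRd d 2}
    (hf : ∑' n, ‖f n‖ₑ ^ 2 ≠ ∞) {Ψ : ℝ≥0 → Ω → LpRd d 2}
    (hΨ : ∀ t, IsItoPair P β (convIntegrand (l2Schrodinger d) f t) (Ψ t)) :
    ∃ Z : ℝ≥0 → Ω → LpRd d 2, (∀ t, Z t =ᵐ[P] Ψ t) ∧ ∀ ω, Continuous fun t => Z t ω := by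
  have hS := isUnitaryGroup_l2Schrodinger d
  have hg : gaussianMoment 4 ≠ ∞ := (gaussianMoment_lt_top (by norm_num)).ne
  obtain ⟨Z, hZ, hZc⟩ := exists_continuous_modification (P := P)
    (M := fun t ω => l2Schrodinger d (-t) (Ψ t ω))
    (fun t => (l2Schrodinger d (-t)).continuous.comp_aestronglyMeasurable (hΨ t).memLp_right.1)
    (C := (2 * gaussianMoment 4) ^ 4 * (∑' n, ‖f n‖ₑ ^ 2) ^ 2) (by finiteness) (by
      intro s t hst
      have h1 := (((hΨ t).map (l2Schrodinger d (-t))).sub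
        ((hΨ s).map (l2Schrodinger d (-s)))).eLpNorm_four_le hβ
      rw [eLpNorm_sub_convIntegrand hS f hst,
        eLpNorm_eq_lintegral_rpow_enorm_toReal (by norm_num) (by norm_num)] at h1
      have h2 := ENNReal.rpow_le_rpow h1 (show (0 : ℝ) ≤ 4 by norm_num)
      rw [← ENNReal.rpow_mul, ENNReal.mul_rpow_of_nonneg _ _ (show (0 : ℝ) ≤ 4 by norm_num),
        ← ENNReal.rpow_mul] at h2
      norm_num at h2
      refine h2.trans (le_of_eq ?_)
      ring)
  refine ⟨fun t ω => l2Schrodinger d t (Z t ω), fun t => ?_, fun ω => ?_⟩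
  · filter_upwards [hZ t] with ω hω
    rw [hω, hS.map_add, add_neg_cancel, hS.map_zero]
  · have hj : Continuous fun q : LpRd d 2 × ℝ => l2Schrodinger d q.2 q.1 := by
      refine continuous_prod_of_continuous_lipschitzWith (fun q : LpRd d 2 × ℝ =>
        l2Schrodinger d q.2 q.1) 1 (fun h => hS.continuous h) fun t => ?_
      exact LipschitzWith.of_dist_le_mul fun a b => by
        rw [dist_eq_norm, dist_eq_norm, ← map_sub, hS.norm_map]; simp
    have h2 : Continuous fun t : ℝ≥0 => (Z t ω, (t : ℝ)) := (hZc ω).prodMk NNReal.continuous_coe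
    exact Continuous.comp (g := fun q : LpRd d 2 × ℝ => l2Schrodinger d q.2 q.1)
      (f := fun t : ℝ≥0 => (Z t ω, (t : ℝ))) hj h2

end Convolution

/-! ### Sobolev norms as Lebesgue norms -/

section Sobolev

variable {d : ℕ}

theorem ae_eq_of_toTemperedDistribution_eq {p p' : ℝ≥0∞} [hp : Fact (1 ≤ p)] [hp' : Fact (1 ≤ p')]
    {f : LpRd d p} {g : LpRd d p'} (h : (f : 𝓢'(Rd d, ℂ)) = (g : 𝓢'(Rd d, ℂ))) :
    (f : Rd d → ℂ) =ᵐ[volume] g := by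
  apply ae_eq_of_integral_contDiff_smul_eq
  · exact (Lp.memLp f).locallyIntegrable hp.out
  · exact (Lp.memLp g).locallyIntegrable hp'.out
  intro φ φ_smooth φ_cpt
  have hg₁ : HasCompactSupport (Complex.ofRealCLM ∘ φ) := φ_cpt.comp_left rfl
  have hg₂ : ContDiff ℝ (⊤ : ℕ∞) (Complex.ofRealCLM ∘ φ) := by fun_prop
  set G : 𝓢(Rd d, ℂ) := hg₁.toSchwartzMap hg₂
  have h1 : ∫ x, φ x • f x = (f : 𝓢'(Rd d, ℂ)) G := by
    rw [Lp.toTemperedDistribution_apply]; simp [G]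
  have h2 : ∫ x, φ x • g x = (g : 𝓢'(Rd d, ℂ)) G := by
    rw [Lp.toTemperedDistribution_apply]; simp [G]
  rw [h1, h2, h]

theorem toTemperedDistribution_eq_of_ae_eq {p p' : ℝ≥0∞} [Fact (1 ≤ p)] [Fact (1 ≤ p')]
    {f : LpRd d p} {g : LpRd d p'} (h : (f : Rd d → ℂ) =ᵐ[volume] g) :
    (f : 𝓢'(Rd d, ℂ)) = (g : 𝓢'(Rd d, ℂ)) := by
  ext u
  rw [Lp.toTemperedDistribution_apply, Lp.toTemperedDistribution_apply]
  refine integral_congr_ae ?_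
  filter_upwards [h] with x hx
  rw [hx]

namespace WSob

variable {s : ℝ} {p : ℝ≥0∞} [Fact (1 ≤ p)]

theorem toLp_surjective : Function.Surjective (toLp : WSob d s p → LpRd d p) := by
  intro f
  have hb : bessel d s (bessel d (-s) (f : 𝓢'(Rd d, ℂ))) = (f : 𝓢'(Rd d, ℂ)) := by
    rw [bessel_bessel, neg_add_cancel, bessel_zero]
  have hmem : bessel d (-s) (f : 𝓢'(Rd d, ℂ)) ∈ sobolevSubmodule d s p := ⟨f, hb⟩
  set u : WSob d s p := (⟨_, hmem⟩ : sobolevSubmodule d s p)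
  refine ⟨u, ?_⟩
  apply coe_Lp_injective
  exact (toLp_spec u).symm.trans hb

/-- The isometry `⟨∇⟩^s : W^{s,p} → L^p`. -/
def toLpIso (d : ℕ) (s : ℝ) (p : ℝ≥0∞) [Fact (1 ≤ p)] : WSob d s p ≃ₗᵢ[ℂ] LpRd d p :=
  LinearIsometryEquiv.ofSurjective ⟨toLp, fun _ => rfl⟩ toLp_surjective

theorem toLpIso_apply (u : WSob d s p) : toLpIso d s p u = toLp u := rfl

end WSob

theorem schrodingerDist_toTemperedDistribution (t : ℝ) (f : LpRd d 2) :
    schrodingerDist d t (f : 𝓢'(Rd d, ℂ)) = (l2Schrodinger d t f : 𝓢'(Rd d, ℂ)) := by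
  rw [schrodingerDist, TemperedDistribution.fourierMultiplierCLM_apply,
    Lp.fourier_toTemperedDistribution_eq]
  have h : TemperedDistribution.smulLeftCLM ℂ (schrodingerSymbol d t)
      ((𝓕 f : LpRd d 2) : 𝓢'(Rd d, ℂ)) =
      ((𝓕 (l2Schrodinger d t f) : LpRd d 2) : 𝓢'(Rd d, ℂ)) := by
    ext u
    rw [TemperedDistribution.smulLeftCLM_apply_apply, Lp.toTemperedDistribution_apply,
      Lp.toTemperedDistribution_apply]
    refine integral_congr_ae ?_
    filter_upwards [coeFn_fourier_l2Schrodinger t f] with x hx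
    rw [hx, SchwartzMap.smulLeftCLM_apply_apply (schrodingerSymbol_hasTemperateGrowth d t)]
    simp only [smul_eq_mul]
    ring
  rw [h, ← Lp.fourier_toTemperedDistribution_eq, FourierTransform.fourierInv_fourier_eq]

theorem toLp_schrodinger (s t : ℝ) (u : HSob d s) :
    WSob.toLp (schrodinger d s t u) = l2Schrodinger d t (WSob.toLp u) := by
  apply WSob.coe_Lp_injective
  dsimp only
  rw [← schrodingerDist_toTemperedDistribution, ← WSob.toLp_spec, ← WSob.toLp_spec,
    toDist_schrodinger, bessel_schrodingerDist]

/-- An element of `H^s` with `⟨∇⟩^s w ∈ L^r` is, as a distribution, an element of `W^{s,r}`. -/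
theorem exists_wsob_of_memLp {s : ℝ} {r : ℝ≥0∞} [Fact (1 ≤ r)] (w : HSob d s)
    (h : MemLp (WSob.toLp w) r volume) :
    WSob.toDist ((WSob.toLpIso d s r).symm (h.toLp _)) = WSob.toDist w := by
  apply bessel_injective d s
  rw [WSob.toLp_spec, WSob.toLp_spec, ← WSob.toLpIso_apply, LinearIsometryEquiv.apply_symm_apply]
  exact toTemperedDistribution_eq_of_ae_eq h.coeFn_toLp

/-- Also when both sides are infinite. -/
theorem sobolevENorm_toDist {s : ℝ} {r : ℝ≥0∞} [Fact (1 ≤ r)] (w : HSob d s) :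
    sobolevENorm s r (WSob.toDist w) = eLpNorm (WSob.toLp w) r volume := by
  have hnorm : ∀ v : WSob d s r, WSob.toDist v = WSob.toDist w →
      ‖v‖ₑ = eLpNorm (WSob.toLp w) r volume := by
    intro v hv
    have h1 : (WSob.toLp v : Rd d → ℂ) =ᵐ[volume] WSob.toLp w := by
      apply ae_eq_of_toTemperedDistribution_eq
      rw [← WSob.toLp_spec, ← WSob.toLp_spec, hv]
    rw [← eLpNorm_congr_ae h1, ← Lp.enorm_def]
    rfl
  rw [sobolevENorm]
  refine le_antisymm ?_ (le_iInf₂ fun v hv => (hnorm v hv).ge)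
  by_cases h : MemLp (WSob.toLp w) r volume
  · have hv := exists_wsob_of_memLp w h
    exact (iInf₂_le ((WSob.toLpIso d s r).symm (h.toLp _)) hv).trans (hnorm _ hv).le
  · have : eLpNorm (WSob.toLp w) r volume = ∞ := by
      by_contra h'
      exact h ⟨Lp.aestronglyMeasurable _, lt_top_iff_ne_top.2 h'⟩
    rw [this]; exact le_top

/-- In a separable space, measurability is tested on balls. -/
theorem measurable_of_edist_lt {X E : Type*} [MeasurableSpace X] [PseudoEMetricSpace E]
    [SecondCountableTopology E] [MeasurableSpace E] [BorelSpace E] {g : X → E}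
    (h : ∀ y (c : ℝ≥0∞), MeasurableSet {x | edist (g x) y < c}) : Measurable g := by
  have hb : TopologicalSpace.IsTopologicalBasis
      {s : Set E | ∃ (y : E) (c : ℝ≥0∞), s = Metric.eball y c} := by
    refine TopologicalSpace.isTopologicalBasis_of_isOpen_of_nhds ?_ ?_
    · rintro s ⟨y, c, rfl⟩; exact Metric.isOpen_eball
    · intro a u ha hu
      obtain ⟨c, hc, hcu⟩ := EMetric.isOpen_iff.1 hu a ha
      exact ⟨_, ⟨a, c, rfl⟩, Metric.mem_eball_self hc, hcu⟩
  rw [BorelSpace.measurable_eq (α := E), hb.borel_eq_generateFrom]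
  refine measurable_generateFrom ?_
  rintro s ⟨y, c, rfl⟩
  exact h y c

open Classical in
/-- The element of `L^r` given by an element of `L²`, or `0` if there is none. -/
def toLr (r : ℝ≥0∞) (f : LpRd d 2) : LpRd d r :=
  if h : MemLp f r volume then h.toLp f else 0

theorem lowerSemicontinuous_eLpNorm_sub (r : ℝ≥0∞) {h : Rd d → ℂ}
    (hh : AEStronglyMeasurable h volume) :
    LowerSemicontinuous fun f : LpRd d 2 => eLpNorm (fun x => f x - h x) r volume := by
  rw [lowerSemicontinuous_iff_isClosed_preimage]
  intro C
  refine IsSeqClosed.isClosed fun u f hu hlim => ?_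
  refine eLpNorm_le_of_tendstoInMeasure (u := atTop) (f := fun n x => u n x - h x)
    (Eventually.of_forall hu) ?_ fun n => (Lp.aestronglyMeasurable _).sub hh
  have := tendstoInMeasure_of_tendsto_Lp (l := atTop) (f := u) hlim
  intro ε hε
  refine (this ε hε).congr fun n => ?_
  congr 1; ext x
  simp only [Set.mem_ofPred_eq, edist_sub_right]

/-- The preimages of balls of `L^r` are measurable, because the `L^r` distance to a point is lower
semicontinuous on `L²`. -/
theorem measurable_toLr [MeasurableSpace (LpRd d 2)] [BorelSpace (LpRd d 2)] {r : ℝ≥0∞}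
    [hr1 : Fact (1 ≤ r)] [hr : Fact (r ≠ ∞)] [MeasurableSpace (LpRd d r)] [BorelSpace (LpRd d r)] :
    Measurable (toLr r : LpRd d 2 → LpRd d r) := by
  refine measurable_of_edist_lt fun y c => ?_
  have hA : MeasurableSet {f : LpRd d 2 | eLpNorm f r volume < ∞} :=
    measurableSet_lt (lowerSemicontinuous_eLpNorm volume r).measurable measurable_const
  have hB : MeasurableSet {f : LpRd d 2 | eLpNorm (fun x => f x - y x) r volume < c} :=
    measurableSet_lt (lowerSemicontinuous_eLpNorm_sub r (Lp.aestronglyMeasurable y)).measurable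
      measurable_const
  have e : {f : LpRd d 2 | edist (toLr r f) y < c} =
      ({f : LpRd d 2 | eLpNorm f r volume < ∞} ∩
        {f : LpRd d 2 | eLpNorm (fun x => f x - y x) r volume < c}) ∪
      ({f : LpRd d 2 | eLpNorm f r volume < ∞}ᶜ ∩ {_f : LpRd d 2 | edist 0 y < c}) := by
    ext f
    by_cases h : eLpNorm f r volume < ∞
    · have hm : MemLp f r volume := ⟨Lp.aestronglyMeasurable f, h⟩
      have : edist (toLr r f) y = eLpNorm (fun x => f x - y x) r volume := by
        rw [toLr, dif_pos hm, Lp.edist_def]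
        refine eLpNorm_congr_ae ?_
        filter_upwards [hm.coeFn_toLp] with x hx
        rw [Pi.sub_apply, hx]
      simp [h, this]
    · have hm : ¬ MemLp f r volume := fun h' => h h'.2
      simp [h, toLr, hm]
  rw [e]
  exact (hA.inter hB).union (hA.compl.inter (MeasurableSet.const _))

theorem enorm_toLr {r : ℝ≥0∞} {f : LpRd d 2} (h : MemLp f r volume) :
    ‖toLr r f‖ₑ = eLpNorm f r volume := by
  rw [toLr, dif_pos h, Lp.enorm_toLp]

/-- Interpolation between `L²` and `L^p`, with a constant: `|f|^r` is at most
`M^{r-2}|f|²` where `|f| ≤ M`, and at most `M^{r-p}|f|^p` elsewhere. -/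
theorem eLpNorm_le_of_two_le {X : Type*} [MeasurableSpace X] {μ : Measure X} {f : X → ℂ}
    (hf : AEStronglyMeasurable f μ) {r p : ℝ≥0} (hr : 2 ≤ r) (hrp : r ≤ p) :
    eLpNorm f r μ ≤ 2 * (eLpNorm f 2 μ + eLpNorm f p μ) := by
  set M := eLpNorm f 2 μ + eLpNorm f p μ with hM
  have hr' : (2 : ℝ) ≤ r := by exact_mod_cast hr
  have hrp' : (r : ℝ) ≤ p := by exact_mod_cast hrp
  have hr0 : (r : ℝ≥0∞) ≠ 0 := by
    have : (0 : ℝ≥0) < r := lt_of_lt_of_le (by norm_num) hr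
    exact_mod_cast this.ne'
  have hp0 : (p : ℝ≥0∞) ≠ 0 := by
    have : (0 : ℝ≥0) < p := lt_of_lt_of_le (by norm_num) (hr.trans hrp)
    exact_mod_cast this.ne'
  by_cases hMt : M = ∞
  · rw [hMt, ENNReal.mul_top (by norm_num)]; exact le_top
  by_cases hM0 : M = 0
  · have h2 : eLpNorm f 2 μ = 0 := (add_eq_zero.1 hM0).1
    have h3 : f =ᵐ[μ] 0 := (eLpNorm_eq_zero_iff hf (by norm_num)).1 h2
    rw [eLpNorm_congr_ae h3]; simp
  have hint : ∀ q : ℝ≥0, (q : ℝ≥0∞) ≠ 0 → eLpNorm f q μ ≤ M →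
      ∫⁻ x, ‖f x‖ₑ ^ (q : ℝ) ∂μ ≤ M ^ (q : ℝ) := by
    intro q hq h
    rw [eLpNorm_eq_lintegral_rpow_enorm_toReal hq ENNReal.coe_ne_top, ENNReal.coe_toReal] at h
    have hq0 : (0 : ℝ) < q := by
      have : 0 < q := pos_iff_ne_zero.2 (by exact_mod_cast hq)
      exact_mod_cast this
    have := ENNReal.rpow_le_rpow h hq0.le
    rwa [← ENNReal.rpow_mul, one_div_mul_cancel hq0.ne', ENNReal.rpow_one] at this
  have hA := hint 2 (by norm_num) (le_self_add : eLpNorm f 2 μ ≤ M)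
  have hB := hint p hp0 (le_add_self : eLpNorm f p μ ≤ M)
  have hpt : ∀ x, ‖f x‖ₑ ^ (r : ℝ) ≤ M ^ ((r : ℝ) - 2) * ‖f x‖ₑ ^ ((2 : ℝ≥0) : ℝ) +
      M ^ ((r : ℝ) - p) * ‖f x‖ₑ ^ (p : ℝ) := by
    intro x
    by_cases hx0 : ‖f x‖ₑ = 0
    · rw [hx0, ENNReal.zero_rpow_of_pos (by linarith)]; exact zero_le
    rcases le_total ‖f x‖ₑ M with h | h
    · refine le_trans ?_ le_self_add
      calc ‖f x‖ₑ ^ (r : ℝ) = ‖f x‖ₑ ^ ((r : ℝ) - 2) * ‖f x‖ₑ ^ (2 : ℝ) := by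
            rw [← ENNReal.rpow_add _ _ hx0 enorm_ne_top]; congr 1; ring
        _ ≤ M ^ ((r : ℝ) - 2) * ‖f x‖ₑ ^ (2 : ℝ) := by gcongr
    · refine le_trans ?_ le_add_self
      calc ‖f x‖ₑ ^ (r : ℝ) = ‖f x‖ₑ ^ ((r : ℝ) - p) * ‖f x‖ₑ ^ (p : ℝ) := by
            rw [← ENNReal.rpow_add _ _ hx0 enorm_ne_top]; congr 1; ring
        _ ≤ M ^ ((r : ℝ) - p) * ‖f x‖ₑ ^ (p : ℝ) := by
            gcongr ?_ * _
            rw [← neg_sub (p : ℝ), ENNReal.rpow_neg, ENNReal.rpow_neg, ENNReal.inv_le_inv]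
            exact ENNReal.rpow_le_rpow h (by linarith)
  have hsum : ∫⁻ x, ‖f x‖ₑ ^ (r : ℝ) ∂μ ≤ 2 * M ^ (r : ℝ) := by
    refine (lintegral_mono hpt).trans ?_
    have hm : ∀ c : ℝ, AEMeasurable (fun x => ‖f x‖ₑ ^ c) μ := fun c => hf.enorm.pow_const c
    rw [lintegral_add_left' ((hm _).const_mul _), lintegral_const_mul'' _ (hm _),
      lintegral_const_mul'' _ (hm _), two_mul]
    refine add_le_add ?_ ?_
    · calc _ ≤ M ^ ((r : ℝ) - 2) * M ^ ((2 : ℝ≥0) : ℝ) := by gcongr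
        _ = _ := by rw [← ENNReal.rpow_add _ _ hM0 hMt]; congr 1; push_cast; ring
    · calc _ ≤ M ^ ((r : ℝ) - p) * M ^ (p : ℝ) := by gcongr
        _ = _ := by rw [← ENNReal.rpow_add _ _ hM0 hMt]; congr 1; ring
  rw [eLpNorm_eq_lintegral_rpow_enorm_toReal hr0 ENNReal.coe_ne_top, ENNReal.coe_toReal]
  calc _ ≤ (2 * M ^ (r : ℝ)) ^ (1 / (r : ℝ)) := by gcongr
    _ = 2 ^ (1 / (r : ℝ)) * M := by
        rw [ENNReal.mul_rpow_of_nonneg _ _ (by positivity), ← ENNReal.rpow_mul,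
          mul_one_div_cancel (by linarith), ENNReal.rpow_one]
    _ ≤ 2 * M := by
        gcongr
        calc (2 : ℝ≥0∞) ^ (1 / (r : ℝ)) ≤ 2 ^ (1 : ℝ) := by
              refine ENNReal.rpow_le_rpow_of_exponent_le (by norm_num) ?_
              rw [div_le_one (by linarith)]; linarith
          _ = 2 := ENNReal.rpow_one _

end Sobolev

/-! ### Space-time integrability -/

section SpaceTime

variable {d : ℕ}

theorem eLpNorm_coe_eq {X E : Type*} [MeasurableSpace X] {μ : Measure X} [TopologicalSpace E]
    [ContinuousENorm E] (g : X → E) {p : ℝ≥0} (hp : 1 ≤ p) :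
    eLpNorm g p μ = (∫⁻ x, ‖g x‖ₑ ^ (p : ℝ) ∂μ) ^ (1 / (p : ℝ)) := by
  have h0 : (p : ℝ≥0∞) ≠ 0 := by exact_mod_cast (zero_lt_one.trans_le hp).ne'
  rw [eLpNorm_eq_lintegral_rpow_enorm_toReal h0 ENNReal.coe_ne_top, ENNReal.coe_toReal]

theorem measurable_eLpNorm_leb {Ω : Type*} [MeasurableSpace Ω] {N : ℝ≥0 → Ω → ℝ≥0∞}
    (hN : Measurable (Function.uncurry N)) {q : ℝ≥0} (hq : 1 ≤ q) (T : ℝ≥0) :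
    Measurable fun ω => eLpNorm (fun t => N t ω) q (leb T) := by
  simp only [eLpNorm_coe_eq _ hq, enorm_eq_self]
  exact (Measurable.lintegral_prod_left' (f := fun p : ℝ≥0 × Ω => N p.1 p.2 ^ (q : ℝ))
    (hN.pow_const _)).pow_const _

/-- Hölder's inequality in time followed by Fubini: a bound on the moments at almost every fixed
time gives a bound on the moments of the time norm. -/
theorem eLpNorm_eLpNorm_leb_le {Ω : Type*} [MeasurableSpace Ω] {P : Measure Ω} [SFinite P]
    {N : ℝ≥0 → Ω → ℝ≥0∞} (hN : Measurable (Function.uncurry N)) {q σ : ℝ≥0} (hq : 1 ≤ q)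
    (hσ : q ≤ σ) {T : ℝ≥0} (hT : 0 < T) {B : ℝ≥0∞}
    (hB : ∀ᵐ t ∂(leb T), eLpNorm (N t) σ P ≤ B) :
    eLpNorm (fun ω => eLpNorm (fun t => N t ω) q (leb T)) σ P ≤
      (T : ℝ≥0∞) ^ (1 / (q : ℝ)) * B := by
  have hσ1 : 1 ≤ σ := hq.trans hσ
  have hσ0 : (0 : ℝ) < σ := by exact_mod_cast (zero_lt_one.trans_le hσ1)
  have hT0 : (T : ℝ≥0∞) ≠ 0 := by exact_mod_cast hT.ne'
  have hNt : ∀ ω, Measurable fun t => N t ω := fun ω => hN.comp measurable_prodMk_right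
  have hfix : ∀ᵐ t ∂(leb T), ∫⁻ ω, N t ω ^ (σ : ℝ) ∂P ≤ B ^ (σ : ℝ) := by
    filter_upwards [hB] with t h1
    rw [eLpNorm_coe_eq _ hσ1] at h1
    have h3 := ENNReal.rpow_le_rpow h1 hσ0.le
    rwa [← ENNReal.rpow_mul, one_div_mul_cancel hσ0.ne', ENNReal.rpow_one] at h3
  have hGle : ∀ ω, eLpNorm (fun t => N t ω) q (leb T) ^ (σ : ℝ) ≤
      ((T : ℝ≥0∞) ^ (1 / (q : ℝ) - 1 / (σ : ℝ))) ^ (σ : ℝ) * ∫⁻ t, N t ω ^ (σ : ℝ) ∂(leb T) := by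
    intro ω
    have h1 := eLpNorm_le_eLpNorm_mul_rpow_measure_univ (μ := leb T) (p := (q : ℝ≥0∞))
      (q := (σ : ℝ≥0∞)) (by exact_mod_cast hσ) (hNt ω).aestronglyMeasurable
    rw [leb_univ, ENNReal.coe_toReal, ENNReal.coe_toReal, eLpNorm_coe_eq _ hσ1] at h1
    simp only [enorm_eq_self] at h1
    have h2 := ENNReal.rpow_le_rpow h1 hσ0.le
    rw [ENNReal.mul_rpow_of_nonneg _ _ hσ0.le, ← ENNReal.rpow_mul, one_div_mul_cancel hσ0.ne',
      ENNReal.rpow_one, mul_comm] at h2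
    exact h2
  have hswap : ∫⁻ ω, ∫⁻ t, N t ω ^ (σ : ℝ) ∂(leb T) ∂P ≤ T * B ^ (σ : ℝ) := by
    rw [lintegral_lintegral_swap ((hN.comp measurable_swap).pow_const _).aemeasurable]
    refine (lintegral_mono_ae hfix).trans (le_of_eq ?_)
    rw [lintegral_const, leb_univ, mul_comm]
  have h1 : ∫⁻ ω, eLpNorm (fun t => N t ω) q (leb T) ^ (σ : ℝ) ∂P ≤
      ((T : ℝ≥0∞) ^ (1 / (q : ℝ) - 1 / (σ : ℝ))) ^ (σ : ℝ) * (T * B ^ (σ : ℝ)) := by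
    refine (lintegral_mono hGle).trans ?_
    rw [lintegral_const_mul _ (Measurable.lintegral_prod_left'
      (f := fun p : ℝ≥0 × Ω => N p.1 p.2 ^ (σ : ℝ)) (hN.pow_const _))]
    gcongr
  rw [eLpNorm_coe_eq _ hσ1]
  simp only [enorm_eq_self]
  refine (ENNReal.rpow_le_rpow h1 (by positivity)).trans (le_of_eq ?_)
  rw [ENNReal.mul_rpow_of_nonneg _ _ (by positivity), ENNReal.mul_rpow_of_nonneg _ _ (by positivity),
    ← ENNReal.rpow_mul, ← ENNReal.rpow_mul, ← ENNReal.rpow_mul,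
    mul_one_div_cancel hσ0.ne', ENNReal.rpow_one, mul_one, ← mul_assoc,
    ← ENNReal.rpow_add _ _ hT0 ENNReal.coe_ne_top, sub_add_cancel]

/-- The moment bound for the space-time norms of the stochastic convolution in `L²`. -/
theorem exists_moment_bound (hd : 1 ≤ d) {q r : ℝ≥0} (hq : 1 ≤ q) (hr : AdmissibleExponent d r) :
    ∃ θ : ℝ, 0 < θ ∧ ∀ ρ : ℝ≥0, 1 ≤ ρ → ∃ C : ℝ≥0,
      ∀ {Ω : Type*} [MeasurableSpace Ω] {P : Measure Ω} [IsProbabilityMeasure P]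
        {β : ℕ → ℝ≥0 → Ω → ℂ} (_ : IsBrownianFamily P β) {f : ℕ → LpRd d 2}
        (_ : ∑' n, ‖f n‖ₑ ^ 2 ≠ ∞) {X : ℝ≥0 → Ω → LpRd d 2}
        (_ : ∀ t, IsItoPair P β (convIntegrand (l2Schrodinger d) f t) (X t))
        (_ : ∀ᵐ ω ∂P, Continuous fun t => X t ω) {T : ℝ≥0} (_ : 0 < T),
        AEMeasurable (fun ω => eLpNorm (fun t => eLpNorm (X t ω) r volume) q (leb T)) P ∧
        eLpNorm (fun ω => eLpNorm (fun t => eLpNorm (X t ω) r volume) q (leb T)) ρ P ≤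
          C * (T : ℝ≥0∞) ^ θ * (∑' n, ‖f n‖ₑ ^ 2) ^ (1 / 2 : ℝ) := by
  obtain ⟨C, δ, hδ, hbound⟩ := exists_lintegral_cutoffEval_convIntegrand_le hd hr
  have hr1 : 1 ≤ r := le_trans (by norm_num) hr.1
  have hq0 : (0 : ℝ) < q := by exact_mod_cast (zero_lt_one.trans_le hq)
  -- Hölder's inequality in time gives `T^{1/q}`, so that `θ > 0` even if `δ = 0`
  refine ⟨1 / q + δ, by positivity, fun ρ hρ => ?_⟩
  obtain ⟨σ, hσq, hσr, hσρ⟩ : ∃ σ : ℝ≥0, q ≤ σ ∧ r ≤ σ ∧ ρ ≤ σ :=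
    ⟨max q (max r ρ), le_max_left _ _, (le_max_left _ _).trans (le_max_right _ _),
      (le_max_right _ _).trans (le_max_right _ _)⟩
  have hγ : gaussianMoment σ ≠ ∞ := (gaussianMoment_lt_top ENNReal.coe_ne_top).ne
  refine ⟨2 * (gaussianMoment σ).toNNReal * C, ?_⟩
  intro Ω _ P _ β hβ f hf X hX hc T hT
  have : Fact ((2 : ℝ≥0∞) ≠ ∞) := ⟨by norm_num⟩
  obtain ⟨Z, hZm, hZ⟩ := exists_jointly_measurable (fun t => (hX t).memLp_right.1) hc
  have hNm : Measurable (Function.uncurry fun t ω => eLpNorm (Z t ω) r volume) := by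
    borelize (LpRd d 2)
    exact (lowerSemicontinuous_eLpNorm volume r).measurable.comp hZm.measurable
  have hae : (fun ω => eLpNorm (fun t => eLpNorm (X t ω) r volume) q (leb T)) =ᵐ[P]
      fun ω => eLpNorm (fun t => eLpNorm (Z t ω) r volume) q (leb T) := by
    filter_upwards [hZ] with ω hω
    simp only [hω]
  have hGm := measurable_eLpNorm_leb hNm hq T
  refine ⟨⟨_, hGm, hae⟩, ?_⟩
  rw [eLpNorm_congr_ae hae]
  have hfix : ∀ᵐ t ∂(leb T), eLpNorm (fun ω => eLpNorm (Z t ω) r volume) σ P ≤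
      2 * gaussianMoment σ * (C * (T : ℝ≥0∞) ^ δ * (∑' n, ‖f n‖ₑ ^ 2) ^ (1 / 2 : ℝ)) := by
    filter_upwards [ae_leb_mem T] with t ht
    have h1 := (hX t).eLpNorm_eLpNorm_le hβ hr1 hσr (hbound f hf t ht.1)
    have h2 : (fun ω => eLpNorm (X t ω) r volume) =ᵐ[P] fun ω => eLpNorm (Z t ω) r volume := by
      filter_upwards [hZ] with ω hω
      rw [hω]
    rw [eLpNorm_congr_ae h2] at h1
    refine h1.trans ?_
    gcongr
    exact ht.2
  refine (eLpNorm_le_eLpNorm_of_exponent_le (by exact_mod_cast hσρ)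
    hGm.aestronglyMeasurable).trans ((eLpNorm_eLpNorm_leb_le hNm hq hσq hT hfix).trans
      (le_of_eq ?_))
  have hT0 : (T : ℝ≥0∞) ≠ 0 := by exact_mod_cast hT.ne'
  rw [ENNReal.rpow_add _ _ hT0 ENNReal.coe_ne_top, ENNReal.coe_mul, ENNReal.coe_mul,
    ENNReal.coe_toNNReal hγ, ENNReal.coe_ofNat]
  ring

/-- A countable family of admissible exponents that dominates all admissible exponents. -/
def admissibleSeq (d k : ℕ) : ℝ≥0 :=
  if k = 0 then 2 else if 3 ≤ d then Real.toNNReal (2 * d / ((d : ℝ) - 2)) else k + 2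

theorem admissibleSeq_spec (d k : ℕ) : AdmissibleExponent d (admissibleSeq d k) := by
  have h3 : 3 ≤ d → (2 : ℝ) ≤ 2 * d / ((d : ℝ) - 2) := by
    intro h
    have h' : (3 : ℝ) ≤ d := by exact_mod_cast h
    rw [le_div_iff₀ (by linarith)]; linarith
  unfold admissibleSeq
  split_ifs with h0 h
  · exact ⟨le_rfl, fun h => by simpa using h3 h⟩
  · refine ⟨?_, fun _ => ?_⟩
    · rw [Real.le_toNNReal_iff_coe_le (by linarith [h3 h])]
      exact h3 h
    · rw [Real.coe_toNNReal _ (by linarith [h3 h])]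
  · exact ⟨le_add_self, fun h' => absurd h' h⟩

theorem exists_le_admissibleSeq {d : ℕ} {r : ℝ≥0} (hr : AdmissibleExponent d r) :
    ∃ k, r ≤ admissibleSeq d k := by
  by_cases h : 3 ≤ d
  · refine ⟨1, ?_⟩
    rw [admissibleSeq, if_neg one_ne_zero, if_pos h]
    exact NNReal.le_toNNReal_of_coe_le (hr.2 h)
  · obtain ⟨k, hk⟩ := exists_nat_ge r
    refine ⟨k + 1, ?_⟩
    rw [admissibleSeq, if_neg (Nat.succ_ne_zero k), if_neg h]
    refine hk.trans ?_
    push_cast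
    rw [add_assoc]
    exact le_self_add

theorem measurable_eLpNorm_of_continuous {x : ℝ≥0 → LpRd d 2} (hx : Continuous x) (r : ℝ≥0∞) :
    Measurable fun t => eLpNorm (x t) r volume :=
  ((lowerSemicontinuous_eLpNorm volume r).comp hx).measurable

/-- A continuous path in `L²` whose `L^r` norms have all moments in time, for `r` in the countable
family of exponents, has finite `L^q([0,T]; L^r)` norms for all admissible `r`. -/
theorem lintegral_rpow_eLpNorm_lt_top {x : ℝ≥0 → LpRd d 2} (hx : Continuous x)
    (h : ∀ n m k : ℕ, ∫⁻ t, (eLpNorm (x t) (admissibleSeq d k) volume) ^ ((n : ℝ) + 1)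
      ∂(leb (m + 1)) < ∞) (q : ℝ≥0) {r : ℝ≥0} (hr : AdmissibleExponent d r) (T : ℝ≥0) :
    ∫⁻ t, (eLpNorm (x t) r volume) ^ (q : ℝ) ∂(leb T) < ∞ := by
  obtain ⟨k, hk⟩ := exists_le_admissibleSeq hr
  obtain ⟨n, hn⟩ := exists_nat_ge q
  obtain ⟨m, hm⟩ := exists_nat_ge T
  have hle : leb T ≤ leb (m + 1) := by
    rw [leb_eq, leb_eq]
    exact Measure.restrict_mono (Set.Icc_subset_Icc_right (hm.trans le_self_add)) le_rfl
  refine (lintegral_mono' hle le_rfl).trans_lt ?_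
  have hn1 : (q : ℝ) ≤ (n : ℝ) + 1 := by
    have : (q : ℝ) ≤ n := by exact_mod_cast hn
    linarith
  have hpt : ∀ t, (eLpNorm (x t) r volume) ^ (q : ℝ) ≤ 1 + 2 ^ ((n : ℝ) + 1) * (2 ^ (n : ℝ) *
      ((eLpNorm (x t) (admissibleSeq d 0) volume) ^ ((n : ℝ) + 1) +
        (eLpNorm (x t) (admissibleSeq d k) volume) ^ ((n : ℝ) + 1))) := by
    intro t
    have h1 := eLpNorm_le_of_two_le (Lp.aestronglyMeasurable (x t)) hr.1 hk
    have e2 : ((admissibleSeq d 0 : ℝ≥0) : ℝ≥0∞) = 2 := by simp [admissibleSeq]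
    rcases le_total (eLpNorm (x t) r volume) 1 with h2 | h2
    · refine le_trans ?_ le_self_add
      exact ENNReal.rpow_le_one h2 q.2
    · refine le_trans ?_ le_add_self
      calc (eLpNorm (x t) r volume) ^ (q : ℝ) ≤ (eLpNorm (x t) r volume) ^ ((n : ℝ) + 1) :=
            ENNReal.rpow_le_rpow_of_exponent_le h2 hn1
        _ ≤ (2 * (eLpNorm (x t) 2 volume + eLpNorm (x t) (admissibleSeq d k) volume)) ^
            ((n : ℝ) + 1) := by gcongr
        _ = 2 ^ ((n : ℝ) + 1) * (eLpNorm (x t) 2 volume +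
            eLpNorm (x t) (admissibleSeq d k) volume) ^ ((n : ℝ) + 1) :=
            ENNReal.mul_rpow_of_nonneg _ _ (by positivity)
        _ ≤ _ := by
            rw [e2]
            gcongr
            have := ENNReal.rpow_add_le_mul_rpow_add_rpow (eLpNorm (x t) 2 volume)
              (eLpNorm (x t) (admissibleSeq d k) volume) (p := (n : ℝ) + 1) (by simp)
            rwa [add_sub_cancel_right] at this
  have hmeas := fun r => measurable_eLpNorm_of_continuous hx r
  refine (lintegral_mono hpt).trans_lt ?_
  rw [lintegral_add_left measurable_const, lintegral_const_mul' _ _ (by finiteness),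
    lintegral_const_mul' _ _ (by finiteness), lintegral_add_left ((hmeas _).pow_const _),
    lintegral_const, leb_univ, one_mul]
  exact ENNReal.add_lt_top.2 ⟨ENNReal.coe_lt_top, ENNReal.mul_lt_top (by finiteness)
    (ENNReal.mul_lt_top (by finiteness) (ENNReal.add_lt_top.2 ⟨h n m 0, h n m k⟩))⟩

/-- A continuous path in `H^s` with finite `L^q([0,T]; W^{s,r})` norm is strongly measurable into
`W^{s,r}`. -/
theorem memLqW_of_continuous {s : ℝ} {q r : ℝ≥0} [Fact (1 ≤ (r : ℝ≥0∞))] (hq : 1 ≤ q) {T : ℝ≥0}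
    {w : ℝ≥0 → HSob d s} (hw : Continuous w)
    (h : ∫⁻ t, (eLpNorm (WSob.toLp (w t)) r volume) ^ (q : ℝ) ∂(leb T) < ∞) :
    MemLqW s q r T fun t => WSob.toDist (w t) := by
  have hr : Fact ((r : ℝ≥0∞) ≠ ∞) := ⟨ENNReal.coe_ne_top⟩
  have hq0 : (0 : ℝ) < q := by exact_mod_cast (zero_lt_one.trans_le hq)
  have hc : Continuous fun t => WSob.toLp (w t) := (WSob.toLpIso d s 2).continuous.comp hw
  borelize (LpRd d 2)
  borelize (LpRd d r)
  have hm : Measurable fun t => toLr r (WSob.toLp (w t)) := measurable_toLr.comp hc.measurable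
  have hfin : ∀ᵐ t ∂(leb T), MemLp (WSob.toLp (w t)) r volume := by
    filter_upwards [ae_lt_top ((measurable_eLpNorm_of_continuous hc r).pow_const _) h.ne] with t ht
    exact ⟨Lp.aestronglyMeasurable _, (ENNReal.rpow_lt_top_iff_of_pos hq0).1 ht⟩
  refine ⟨fun t => (WSob.toLpIso d s r).symm (toLr r (WSob.toLp (w t))), ⟨?_, ?_⟩, ?_⟩
  · exact ((WSob.toLpIso d s r).symm.continuous.comp_stronglyMeasurable
      hm.stronglyMeasurable).aestronglyMeasurable
  · rw [eLpNorm_coe_eq _ hq]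
    refine ENNReal.rpow_lt_top_of_nonneg (by positivity) (ne_of_lt (lt_of_le_of_lt ?_ h))
    refine lintegral_mono_ae ?_
    filter_upwards [hfin] with t ht
    rw [LinearIsometryEquiv.enorm_map, enorm_toLr ht]
  · filter_upwards [hfin] with t ht
    rw [toLr, dif_pos ht]
    exact exists_wsob_of_memLp (w t) ht

end SpaceTime

/-! ### Transfer to `H^s` -/

section Transfer

variable {d : ℕ} {s : ℝ} {Ω : Type*} [MeasurableSpace Ω] {P : Measure Ω} [IsProbabilityMeasure P]
  {e : HilbertBasis ℕ ℂ (LpRd d 2)} {β : ℕ → ℝ≥0 → Ω → ℂ} {φ : LpRd d 2 →L[ℂ] HSob d s}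

/-- The functions `⟨∇⟩^s φ(eₙ)`. -/
def modeFun (e : HilbertBasis ℕ ℂ (LpRd d 2)) (φ : LpRd d 2 →L[ℂ] HSob d s) (n : ℕ) : LpRd d 2 :=
  WSob.toLp (φ (e n))

theorem hsNorm_eq_modeFun (e : HilbertBasis ℕ ℂ (LpRd d 2)) (φ : LpRd d 2 →L[ℂ] HSob d s) :
    hsNorm e φ = (∑' n, ‖modeFun e φ n‖ₑ ^ 2) ^ (1 / 2 : ℝ) := rfl

theorem tsum_modeFun_ne_top (h : hsNorm e φ < ∞) : ∑' n, ‖modeFun e φ n‖ₑ ^ 2 ≠ ∞ := by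
  rw [hsNorm_eq_modeFun] at h
  exact ((ENNReal.rpow_lt_top_iff_of_pos (by norm_num)).1 h).ne

theorem IsStochasticConvolution.isItoPair (hβ : IsBrownianFamily P β) (hφ : hsNorm e φ < ∞)
    {Ψ : ℝ≥0 → Ω → HSob d s} (h : IsStochasticConvolution P e β φ Ψ) (t : ℝ≥0) :
    IsItoPair P β (convIntegrand (l2Schrodinger d) (modeFun e φ) t)
      (fun ω => WSob.toLp (Ψ t ω)) := by
  obtain ⟨I, hI, hΨ⟩ := h
  set J : HSob d s →L[ℂ] LpRd d 2 :=
    (WSob.toLpIso d s 2).toContinuousLinearEquiv.toContinuousLinearMap with hJ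
  have hJa : ∀ u, J u = WSob.toLp u := fun u => rfl
  refine isItoPair_convolution hβ (isUnitaryGroup_l2Schrodinger d) (tsum_modeFun_ne_top hφ)
    (I := fun n ω => J (I n t ω)) (fun n => ?_) (J.comp_memLp' (hΨ t).1) ?_
  · have := (hI n t).map J
    simp only [hJa, toLp_schrodinger] at this
    exact this
  · refine (tendsto_eLpNorm_map P J (hΨ t).2).congr fun N => ?_
    congr 1; ext1 ω
    rw [map_sub, map_sum]
    simp only [map_smul]
    rfl

theorem exists_isStochasticConvolution (hβ : IsBrownianFamily P β) (hφ : hsNorm e φ < ∞) :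
    ∃ Ψ : ℝ≥0 → Ω → HSob d s, IsStochasticConvolution P e β φ Ψ := by
  choose I Ψ hI hΨ hlim using fun t => exists_convolution hβ (isUnitaryGroup_l2Schrodinger d)
    (tsum_modeFun_ne_top hφ) t
  set J : LpRd d 2 →L[ℂ] HSob d s :=
    (WSob.toLpIso d s 2).symm.toContinuousLinearEquiv.toContinuousLinearMap with hJ
  refine ⟨fun t ω => J (Ψ t ω), fun n t ω => J (I t n ω), fun n t => ?_, fun t =>
    ⟨J.comp_memLp' (hΨ t), ?_⟩⟩
  · have h1 := (hI t n).map J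
    have h2 : ∀ x : ℝ≥0, J (l2Schrodinger d ((t : ℝ) - x) (modeFun e φ n)) =
        schrodinger d s ((t : ℝ) - x) (φ (e n)) := by
      intro x
      rw [modeFun, ← toLp_schrodinger]
      exact (WSob.toLpIso d s 2).symm_apply_apply _
    simp only [h2] at h1
    exact h1
  · refine (tendsto_eLpNorm_map P J (hlim t)).congr fun N => ?_
    congr 1; ext1 ω
    rw [map_sub, map_sum]
    simp only [map_smul]

theorem IsStochasticConvolution.exists_continuous (hβ : IsBrownianFamily P β)
    (hφ : hsNorm e φ < ∞) {Ψ₀ : ℝ≥0 → Ω → HSob d s} (h : IsStochasticConvolution P e β φ Ψ₀) :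
    ∃ Ψ : ℝ≥0 → Ω → HSob d s, (∀ t, Ψ t =ᵐ[P] Ψ₀ t) ∧
      ∀ᵐ ω ∂P, Continuous (fun t => Ψ t ω) := by
  obtain ⟨Z, hZ, hZc⟩ := exists_continuous_convolution hβ (tsum_modeFun_ne_top hφ)
    fun t => h.isItoPair hβ hφ t
  refine ⟨fun t ω => (WSob.toLpIso d s 2).symm (Z t ω), fun t => ?_, ae_of_all _ fun ω =>
    (WSob.toLpIso d s 2).symm.continuous.comp (hZc ω)⟩
  filter_upwards [hZ t] with ω hω
  rw [hω]
  exact (WSob.toLpIso d s 2).symm_apply_apply _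

/-- The null set has to be independent of the exponents and of the time, so the moment bound is used
for countably many of them, which dominate all others. -/
theorem IsStochasticConvolution.ae_memLqW (hd : 1 ≤ d) (hβ : IsBrownianFamily P β)
    (hφ : hsNorm e φ < ∞) {Ψ : ℝ≥0 → Ω → HSob d s} (h : IsStochasticConvolution P e β φ Ψ)
    (hc : ∀ᵐ ω ∂P, Continuous fun t => Ψ t ω) :
    ∀ᵐ ω ∂P, ∀ (q r : ℝ≥0) [Fact (1 ≤ (r : ℝ≥0∞))], 1 ≤ q → AdmissibleExponent d r →
      ∀ T : ℝ≥0, 0 < T → MemLqW s q r T (fun t => WSob.toDist (Ψ t ω)) := by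
  have hcL : ∀ᵐ ω ∂P, Continuous fun t => WSob.toLp (Ψ t ω) := by
    filter_upwards [hc] with ω hω
    exact (WSob.toLpIso d s 2).continuous.comp hω
  have hfin : ∀ n m k : ℕ, ∀ᵐ ω ∂P, ∫⁻ t, (eLpNorm (WSob.toLp (Ψ t ω)) (admissibleSeq d k)
      volume) ^ ((n : ℝ) + 1) ∂(leb (m + 1)) < ∞ := by
    intro n m k
    obtain ⟨θ, -, hθ⟩ := exists_moment_bound hd (q := n + 1) le_add_self (admissibleSeq_spec d k)
    obtain ⟨C, hC⟩ := hθ 1 le_rfl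
    obtain ⟨h1, h2⟩ := hC hβ (tsum_modeFun_ne_top hφ) (fun t => h.isItoPair hβ hφ t) hcL
      (T := m + 1) (by positivity)
    rw [← hsNorm_eq_modeFun, ENNReal.coe_one, eLpNorm_one_eq_lintegral_enorm] at h2
    simp only [enorm_eq_self] at h2
    have hT : (((m : ℝ≥0) + 1 : ℝ≥0) : ℝ≥0∞) ≠ 0 := by
      have : (0 : ℝ≥0) < (m : ℝ≥0) + 1 := by positivity
      exact_mod_cast this.ne'
    have h3 := ae_lt_top' h1 (ne_of_lt (h2.trans_lt (ENNReal.mul_lt_top (ENNReal.mul_lt_top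
      ENNReal.coe_lt_top (lt_top_iff_ne_top.2 (ENNReal.rpow_ne_top_of_ne_zero hT
        ENNReal.coe_ne_top))) hφ)))
    filter_upwards [h3] with ω hω
    rw [eLpNorm_coe_eq _ le_add_self] at hω
    simp only [enorm_eq_self] at hω
    have h4 := (ENNReal.rpow_lt_top_iff_of_pos (by positivity)).1 hω
    push_cast at h4
    exact h4
  filter_upwards [hc, hcL, ae_all_iff.2 fun n => ae_all_iff.2 fun m => ae_all_iff.2 fun k =>
    hfin n m k] with ω h1 h2 h3 q r _ hq hr T _
  exact memLqW_of_continuous hq h1 (lintegral_rpow_eLpNorm_lt_top h2 h3 q hr T)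

theorem LqWNorm_toDist {q r : ℝ≥0} [Fact (1 ≤ (r : ℝ≥0∞))] (T : ℝ≥0) (w : ℝ≥0 → HSob d s) :
    LqWNorm s q r T (fun t => WSob.toDist (w t)) =
      eLpNorm (fun t => eLpNorm (WSob.toLp (w t)) r volume) q (leb T) := by
  simp only [LqWNorm, sobolevENorm_toDist]

end Transfer

end

end SNLS

open SNLS in
theorem lemma2p1 (d : ℕ) (hd : 1 ≤ d) :
    (∀ {Ω : Type*} [MeasurableSpace Ω] (P : Measure Ω) [IsProbabilityMeasure P]
      (e : HilbertBasis ℕ ℂ (LpRd d 2)) (β : ℕ → ℝ≥0 → Ω → ℂ) (_ : IsBrownianFamily P β)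
      (s : ℝ) (φ : LpRd d 2 →L[ℂ] HSob d s) (_ : hsNorm e φ < ∞),
      (∃ Ψ : ℝ≥0 → Ω → HSob d s, IsStochasticConvolution P e β φ Ψ) ∧
      ∀ Ψ₀ : ℝ≥0 → Ω → HSob d s, IsStochasticConvolution P e β φ Ψ₀ →
        (∃ Ψ : ℝ≥0 → Ω → HSob d s, (∀ t, Ψ t =ᵐ[P] Ψ₀ t) ∧
          ∀ᵐ ω ∂P, Continuous (fun t => Ψ t ω)) ∧
        ((∀ᵐ ω ∂P, Continuous (fun t => Ψ₀ t ω)) →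
          ∀ᵐ ω ∂P, ∀ (q r : ℝ≥0) [Fact (1 ≤ (r : ℝ≥0∞))], 1 ≤ q → AdmissibleExponent d r →
            ∀ T : ℝ≥0, 0 < T → MemLqW s q r T (fun t => WSob.toDist (Ψ₀ t ω)))) ∧
    (∀ (q r : ℝ≥0) [Fact (1 ≤ (r : ℝ≥0∞))], 1 ≤ q → AdmissibleExponent d r →
      ∃ θ : ℝ, 0 < θ ∧ ∀ ρ : ℝ≥0, 1 ≤ ρ → ∃ C : ℝ≥0,
        ∀ {Ω : Type*} [MeasurableSpace Ω] (P : Measure Ω) [IsProbabilityMeasure P]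
          (e : HilbertBasis ℕ ℂ (LpRd d 2)) (β : ℕ → ℝ≥0 → Ω → ℂ) (_ : IsBrownianFamily P β)
          (s : ℝ) (φ : LpRd d 2 →L[ℂ] HSob d s) (_ : hsNorm e φ < ∞)
          (Ψ : ℝ≥0 → Ω → HSob d s) (_ : IsStochasticConvolution P e β φ Ψ)
          (_ : ∀ᵐ ω ∂P, Continuous (fun t => Ψ t ω)) (T : ℝ≥0) (_ : 0 < T),
          AEMeasurable (fun ω => LqWNorm s q r T (fun t => WSob.toDist (Ψ t ω))) P ∧
          eLpNorm (fun ω => LqWNorm s q r T (fun t => WSob.toDist (Ψ t ω))) ρ P ≤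
            C * (T : ℝ≥0∞) ^ θ * hsNorm e φ) := by
  refine ⟨?_, ?_⟩
  · intro Ω _ P _ e β hβ s φ hφ
    refine ⟨exists_isStochasticConvolution hβ hφ, fun Ψ₀ hΨ => ?_⟩
    exact ⟨hΨ.exists_continuous hβ hφ, fun hc => hΨ.ae_memLqW hd hβ hφ hc⟩
  · intro q r _ hq hr
    obtain ⟨θ, hθ, hmain⟩ := exists_moment_bound hd hq hr
    refine ⟨θ, hθ, fun ρ hρ => ?_⟩
    obtain ⟨C, hC⟩ := hmain ρ hρ
    refine ⟨C, ?_⟩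
    intro Ω _ P _ e β hβ s φ hφ Ψ hΨ hc T hT
    simp only [LqWNorm_toDist]
    refine hC hβ (tsum_modeFun_ne_top hφ) (fun t => hΨ.isItoPair hβ hφ t) ?_ hT
    filter_upwards [hc] with ω hω
    exact (WSob.toLpIso d s 2).continuous.comp hω
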